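/- **Setting.** Let $\Omega\subset\mathbb R^2$ be bounded, open, with Lipschitz boundary; let $\Omega_B\subseteq\Omega$ be open (the brittle part), $\partial_S\Omega\subseteq\partial_N\Omega\subseteq\partial\Omega$ closed with $\overline\Omega_B\cap\partial_S\Omega=\emptyset$, $\partial_D\Omega:=\partial\Omega\setminus\partial_N\Omega$, and let $\Omega_S\subseteq\Omega\setminus\overline\Omega_B$ be open with Lipschitz boundary and $\partial_S\Omega\subseteq\partial\Omega_S$. Let $T>0$, $p,q>1$, $1\le\dot q<q$, and $r\ge p$ with $r\le p/(2-p)$ if $p<2$; primes denote conjugate exponents. *Surface density.* $k:\overline\Omega_B\times\mathbb R^2\to\mathbb R$ is continuous, $k(x,\cdot)$ is a norm, and $K_1|\nu|\le k(x,\nu)\le K_2|\nu|$ with $K_1,K_2>0$. For a rectifiable $\Gamma$ with unit normal $\nu$, $\mathcal E^s(\Gamma):=\int_\Gamma k(x,\nu)\,d\mathcal H^1$, with $k:=+\infty$ off $\overline\Omega_B$. *Bulk density.* $W:\Omega\times M^{2\times2}\to[0,\infty)$ is a Carathéodory function, $W(x,\cdot)$ is $C^1$ and quasiconvex, i.e.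 $|\Omega|\,W(x,\xi)\le\int_\Omega W(x,\xi+\nabla\varphi(y))\,dy$ for all $x\in\Omega$, $\xi$, $\varphi\in C_c^\infty(\Omega;\mathbb R^2)$, and $a_0|\xi|^p-b_0(x)\le W(x,\xi)\le a_1|\xi|^p+b_1(x)$ with $a_0,a_1>0$ and $0\le b_0,b_1\in L^1(\Omega)$. *Body forces.* $F,\dot F:[0,T]\times\Omega\times\mathbb R^2\to\mathbb R$ are measurable in $(t,x)$ for each $z$ and $C^1$ in $z$; for all $(t,z)$ and a.e. $x$, $F(t,x,z)=F(0,x,z)+\int_0^t\dot F(s,x,z)\,ds$ and $\partial_zF(t,x,z)=\partial_zF(0,x,z)+\int_0^t\partial_z\dot F(s,x,z)\,ds$. For all $(t,x,z)$: $a_0|z|^q-b_0(t,x)\le-F\le a_1|z|^q+b_1(t,x)$, $|\partial_zF|\le a_2|z|^{q-1}+b_2(t,x)$, $|\dot F|\le a_3(t)|z|^{\dot q}+b_3(t,x)$, $|\partial_z\dot F|\le a_4(t)|z|^{\dot q-1}+b_4(t,x)$, with constants $a_0,a_1,a_2>0$ and nonnegative $b_0,b_1\in C^0([0,T];L^1(\Omega))$,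 $b_2\in C^0([0,T];L^{q'}(\Omega))$, $a_3,a_4\in L^1(0,T)$, $b_3\in L^1(0,T;L^1(\Omega))$, $b_4\in L^1(0,T;L^{\dot q'}(\Omega))$. *Surface forces.* $G,\dot G:[0,T]\times\partial_S\Omega\times\mathbb R^2\to\mathbb R$ satisfy the same measurability, smoothness and integral identities with respect to $\mathcal H^1$ on $\partial_S\Omega$, and for all $(t,x,z)$: $-a_0(t,x)|z|-b_0(t,x)\le-G\le a_1|z|^r+b_1(t,x)$, $|\partial_zG|\le a_2|z|^{r-1}+b_2(t,x)$, $|\dot G|\le a_3(t)|z|^r+b_3(t,x)$, $|\partial_z\dot G|\le a_4(t)|z|^{r-1}+b_4(t,x)$, with constants $a_1,a_2\ge0$ and nonnegative $a_0\in L^\infty(0,T;L^{r'}(\partial_S\Omega))$, $b_0,b_1\in C^0([0,T];L^1(\partial_S\Omega))$, $b_2\in C^0([0,T];L^{r'}(\partial_S\Omega))$, $a_3,a_4\in L^1(0,T)$, $b_3\in L^1(0,T;L^1(\partial_S\Omega))$, $b_4\in L^1(0,T;L^{r'}(\partial_S\Omega))$. *Energies.* Put $\mathcal W(\nabla u)=\int_\Omega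 W(x,\nabla u)\,dx$, $\mathcal F(t)(u)=\int_\Omega F(t,x,u)\,dx$, $\dot{\mathcal F}(t)(u)=\int_\Omega\dot F(t,x,u)\,dx$, $\mathcal G(t)(u)=\int_{\partial_S\Omega}G(t,x,u)\,d\mathcal H^1$, $\dot{\mathcal G}(t)(u)=\int_{\partial_S\Omega}\dot G(t,x,u)\,d\mathcal H^1$ (with the trace of $u$ on $\partial_S\Omega$), $\langle\partial\mathcal W(\nabla u),\nabla v\rangle=\int_\Omega\partial_\xi W(x,\nabla u)\nabla v\,dx$, $\langle\partial\mathcal F(t)(u),v\rangle=\int_\Omega\partial_zF(t,x,u)v\,dx$, $\langle\partial\mathcal G(t)(u),v\rangle=\int_{\partial_S\Omega}\partial_zG(t,x,u)v\,d\mathcal H^1$, $\mathcal E^{el}(t)(u)=\mathcal W(\nabla u)-\mathcal F(t)(u)-\mathcal G(t)(u)$ and $\mathcal E(t)(u,\Gamma)=\mathcal E^{el}(t)(u)+\mathcal E^s(\Gamma)$. *Finite elements.* Fix $0<c_1<c_2$ and a set $M\subseteq(0,\infty)$ of mesh sizes. For each $\varepsilon\in M$ let $\mathbf R_\varepsilon$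 be a finite family of closed nondegenerate triangles with union $\overline\Omega$, any two distinct ones meeting in the empty set, a common vertex or a common edge, each containing a ball of diameter $c_1\varepsilon$ and contained in a ball of diameter $c_2\varepsilon$; suppose that $\overline\Omega_B,\overline\Omega_S$ are unions of triangles of $\mathbf R_\varepsilon$, and $\partial_D\Omega,\partial_S\Omega$ are unions of edges of $\mathbf R_\varepsilon$ up to finitely many points. For $a\in(0,\frac12)$, choosing on every edge $[x,y]$ of $\mathbf R_\varepsilon$ a point $tx+(1-t)y$, $t\in[a,1-a]$, and joining these points divides every triangle into four; $\mathcal A^B_{\varepsilon,a}$ is the set of $u:\Omega\to\mathbb R^2$ that are affine on each (open) triangle of such a division and whose set $S(u)$ of points of $\Omega$ without approximate limit is contained in $\overline\Omega_B$. For $g$ continuous on $\overline\Omega$, $S^g(u):=S(u)\cup\{x\in\partial_D\Omega:u(x)\ne g(x)\}$ in the sense of traces. *Data.* For $\varepsilon\in M$ let $g_\varepsilon\in W^{1,1}([0,T];W^{1,p}(\Omega;\mathbb R^2)\cap L^q(\Omega;\mathbb R^2))$ be such that $g_\varepsilon(t)$ is, for every $t$, continuous on $\overline\Omega$ and affine on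 each triangle of $\mathbf R_\varepsilon$. For $\varepsilon\in M$, $a\in(0,\frac12)$ let $\Gamma^0_{\varepsilon,a}$ be a preexisting crack: up to an $\mathcal H^1$-null set it is contained in $\overline\Omega_B$ and equal to $S^0(z)$ for some $z\in\mathcal A^B_{\varepsilon,a}$, and $\mathcal H^1(\Gamma^0_{\varepsilon,a})<\infty$. *Discrete evolutions.* For $\delta>0$ let $N_\delta$ be the largest integer with $\delta(N_\delta-1)<T$, $t^\delta_i:=i\delta$ for $i<N_\delta$, $t^\delta_{N_\delta}:=T$, $g^{\delta,i}_\varepsilon:=g_\varepsilon(t^\delta_i)$. For all $\delta>0$, $\varepsilon\in M$, $a\in(0,\frac12)$ let $u^{\delta,i}_{\varepsilon,a}\in\mathcal A^B_{\varepsilon,a}$, $0\le i\le N_\delta$, be such that, with $\Gamma^{\delta,i}_{\varepsilon,a}:=\Gamma^0_{\varepsilon,a}\cup\bigcup_{l\le i}S^{g^{\delta,l}_\varepsilon}(u^{\delta,l}_{\varepsilon,a})$ and $\Gamma^{\delta,-1}_{\varepsilon,a}:=\Gamma^0_{\varepsilon,a}$, the function $u^{\delta,i}_{\varepsilon,a}$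 minimizes $v\mapsto\mathcal E^{el}(t^\delta_i)(v)+\mathcal E^s(S^{g^{\delta,i}_\varepsilon}(v)\setminus\Gamma^{\delta,i-1}_{\varepsilon,a})$ over $\mathcal A^B_{\varepsilon,a}$ for each $0\le i\le N_\delta$. Put $u^\delta_{\varepsilon,a}(t):=u^{\delta,i}_{\varepsilon,a}$ for $t^\delta_i\le t<t^\delta_{i+1}$, $0\le i<N_\delta$, and $u^\delta_{\varepsilon,a}(T):=u^{\delta,N_\delta}_{\varepsilon,a}$. **Proposition.** All the surface energies $\mathcal E^s(\Gamma^{\delta,i}_{\varepsilon,a})$ are finite, and there are numbers $e^\delta_{\varepsilon,a}$ such that for all $\delta>0$, $\varepsilon\in M$, $a\in(0,\frac12)$ and $0\le j\le i\le N_\delta$ $$ \begin{aligned} \mathcal E(t^\delta_i)(u^{\delta,i}_{\varepsilon,a},\Gamma^{\delta,i}_{\varepsilon,a})\le{}&\mathcal E(t^\delta_j)(u^{\delta,j}_{\varepsilon,a},\Gamma^{\delta,j}_{\varepsilon,a})+\int_{t^\delta_j}^{t^\delta_i}\langle\partial\mathcal W(\nabla u^\delta_{\varepsilon,a}(\tau)),\nabla\dot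 g_\varepsilon(\tau)\rangle\,d\tau\\ &-\int_{t^\delta_j}^{t^\delta_i}\dot{\mathcal F}(\tau)(u^\delta_{\varepsilon,a}(\tau))\,d\tau-\int_{t^\delta_j}^{t^\delta_i}\langle\partial\mathcal F(\tau)(u^\delta_{\varepsilon,a}(\tau)),\dot g_\varepsilon(\tau)\rangle\,d\tau\\ &-\int_{t^\delta_j}^{t^\delta_i}\dot{\mathcal G}(\tau)(u^\delta_{\varepsilon,a}(\tau))\,d\tau-\int_{t^\delta_j}^{t^\delta_i}\langle\partial\mathcal G(\tau)(u^\delta_{\varepsilon,a}(\tau)),\dot g_\varepsilon(\tau)\rangle\,d\tau+e^\delta_{\varepsilon,a}, \end{aligned} $$ and $e^\delta_{\varepsilon,a}\to0$ as $\delta\to0$ uniformly in $\varepsilon$ and $a$, in the following sense. 1. If $E\subseteq M$ and $\{g_\varepsilon:\varepsilon\in E\}$ is relatively compact in $W^{1,1}([0,T];W^{1,p}(\Omega;\mathbb R^2)\cap L^q(\Omega;\mathbb R^2))$ (for instance if $E$ is a single mesh size, or a sequence $\varepsilon_n\to0$ along which $g_{\varepsilon_n}$ converges strongly in this space), then $\sup_{\varepsilon\in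 E,\,a\in(0,1/2)}|e^\delta_{\varepsilon,a}|\to0$ as $\delta\to0$. 2. If $g_\varepsilon\to g$ strongly in $W^{1,1}([0,T];W^{1,p}(\Omega;\mathbb R^2)\cap L^q(\Omega;\mathbb R^2))$ as $\varepsilon\to0$ in $M$, then for every $\eta>0$ there are $\delta_0,\varepsilon_0>0$ with $|e^\delta_{\varepsilon,a}|\le\eta$ for all $0<\delta<\delta_0$, $\varepsilon\in M$ with $\varepsilon<\varepsilon_0$, and $a\in(0,\frac12)$. -/

import Mathlib

open MeasureTheory Set Filter Topology
open scoped ENNReal NNReal ContDiff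

namespace CrackGrowth

/-- The plane with its Euclidean norm. -/
abbrev Plane : Type := EuclideanSpace ℝ (Fin 2)

/-- `2 × 2` matrices, as linear maps of the plane. -/
abbrev Mat : Type := Plane →L[ℝ] Plane

/-- One-dimensional Hausdorff measure on the plane. -/
noncomputable abbrev H1 : Measure Plane := Measure.hausdorffMeasure 1

/-! ### Domains -/

/-- Near each boundary point, up to a rotation or reflection, `A` is the strict epigraph of a
Lipschitz function. -/
def HasLipschitzBoundary (A : Set Plane) : Prop :=
  ∀ x ∈ frontier A, ∃ U ∈ 𝓝 x, ∃ (φ : Plane ≃ₗᵢ[ℝ] Plane) (K : ℝ≥0) (γ : ℝ → ℝ),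
    LipschitzWith K γ ∧ A ∩ U = {y | γ (φ y 0) < φ y 1} ∩ U

/-! ### Approximate limits, jump sets, traces -/

/-- `z` is the approximate limit of `u` at `x` from within `A`. -/
def HasApproxLimWithin (A : Set Plane) (u : Plane → Plane) (x z : Plane) : Prop :=
  ∀ η : ℝ, 0 < η →
    Tendsto (fun ρ : ℝ =>
        volume {y | y ∈ Metric.ball x ρ ∧ y ∈ A ∧ η < ‖u y - z‖} / ENNReal.ofReal (ρ ^ 2))
      (𝓝[>] 0) (𝓝 0)

/-- `S(u)`: the points of `A` at which `u` has no approximate limit. -/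
def jumpSet (A : Set Plane) (u : Plane → Plane) : Set Plane :=
  {x | x ∈ A ∧ ¬ ∃ z, HasApproxLimWithin A u x z}

/-- The trace of `u` on the boundary of `A`: at a boundary point, the approximate limit from within
`A`. -/
noncomputable def trace (A : Set Plane) (u : Plane → Plane) (x : Plane) : Plane :=
  Classical.epsilon fun z => HasApproxLimWithin A u x z

/-! ### `C¹` curves, normal fields -/

/-- On the open set `U`, a neighbourhood of `x`, the set `C` is the zero set of the `C¹` function
`f`, whose differential vanishes nowhere on `U`. -/
def IsLocalEquation (C : Set Plane) (x : Plane) (U : Set Plane) (f : Plane → ℝ) : Prop :=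
  IsOpen U ∧ x ∈ U ∧ ContDiffOn ℝ 1 f U ∧ (∀ y ∈ U, fderiv ℝ f y ≠ 0) ∧
    C ∩ U = {y | y ∈ U ∧ f y = 0}

/-- `C` is a one-dimensional `C¹` submanifold of the plane. -/
def IsC1Curve (C : Set Plane) : Prop :=
  ∀ x ∈ C, ∃ U f, IsLocalEquation C x U f

/-- `n` is a unit normal vector to the `C¹` curve `C` at its point `x`. -/
def IsUnitNormalAt (C : Set Plane) (x n : Plane) : Prop :=
  ‖n‖ = 1 ∧ x ∈ C ∧ ∃ U f, IsLocalEquation C x U f ∧ ∀ w, fderiv ℝ f x w = 0 → inner ℝ n w = 0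

/-- `Γ` is rectifiable and `ν` is a unit normal field on it: `Γ` is covered, up to an `H1`-null set,
by countably many `C¹` curves, and at `H1`-almost every point of `Γ` the vector `ν` is normal to one
of the curves through the point. -/
def IsNormalField (Γ : Set Plane) (ν : Plane → Plane) : Prop :=
  ∃ C : ℕ → Set Plane, (∀ n, IsC1Curve (C n)) ∧
    H1 {x | x ∈ Γ ∧ ¬ ∃ n, IsUnitNormalAt (C n) x (ν x)} = 0

/-! ### Triangulations; a triangle is given by its set of vertices -/

/-- `R` is a regular triangulation of `A` of size `ε` with constants `c₁`, `c₂`. Two triangles meet in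
the convex hull of their common vertices, that is in nothing, a common vertex or a common edge. -/
structure IsRegularTriangulation (c₁ c₂ ε : ℝ) (A : Set Plane) (R : Set (Set Plane)) : Prop where
  finite : R.Finite
  card : ∀ s ∈ R, s.ncard = 3
  indep : ∀ s ∈ R, AffineIndependent ℝ ((↑) : s → Plane)
  cover : ⋃ s ∈ R, convexHull ℝ s = closure A
  inter : ∀ s ∈ R, ∀ t ∈ R, convexHull ℝ s ∩ convexHull ℝ t = convexHull ℝ (s ∩ t)
  inner_ball : ∀ s ∈ R, ∃ x, Metric.ball x (c₁ * ε / 2) ⊆ convexHull ℝ s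
  outer_ball : ∀ s ∈ R, ∃ x, convexHull ℝ s ⊆ Metric.closedBall x (c₂ * ε / 2)

/-- The edges of a triangulation, as pairs of vertices. -/
def edges (R : Set (Set Plane)) : Set (Set Plane) :=
  {e | e.ncard = 2 ∧ ∃ s ∈ R, e ⊆ s}

/-- `B` is composed of edges of `R` up to a finite number of points. -/
def IsComposedOfEdges (R : Set (Set Plane)) (B : Set Plane) : Prop :=
  ∃ L ⊆ edges R, (symmDiff B (⋃ e ∈ L, convexHull ℝ e)).Finite

/-- The region `A` is composed of triangles of `R`. -/
def IsComposedOfTriangles (R : Set (Set Plane)) (A : Set Plane) : Prop :=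
  ∃ L ⊆ R, closure A = ⋃ s ∈ L, convexHull ℝ s

/-- `κ` chooses on each edge `[x, y]` of `R` an adaptive vertex `t x + (1 - t) y` with
`t ∈ [a, 1 - a]`. -/
def IsAdaptiveVertexChoice (R : Set (Set Plane)) (a : ℝ) (κ : Sym2 Plane → Plane) : Prop :=
  ∀ s ∈ R, ∀ x ∈ s, ∀ y ∈ s, x ≠ y → ∃ t ∈ Icc a (1 - a), κ s(x, y) = t • x + (1 - t) • y

/-- The triangulation obtained by dividing each triangle of `R` into four by means of the adaptive
vertices `κ`: three triangles at the corners and one in the middle. -/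
def adaptiveTriangulation (R : Set (Set Plane)) (κ : Sym2 Plane → Plane) : Set (Set Plane) :=
  {t | ∃ x y z : Plane, x ≠ y ∧ y ≠ z ∧ z ≠ x ∧ ({x, y, z} : Set Plane) ∈ R ∧
    (t = {x, κ s(x, y), κ s(x, z)} ∨ t = {κ s(x, y), κ s(y, z), κ s(z, x)})}

/-- `u` is affine on each triangle of some adaptive triangulation with parameter `a` nested in `R`.
As `u` may jump across edges, only the interiors of the triangles count; the values on the edges are
immaterial. -/
def IsAdaptiveAffine (R : Set (Set Plane)) (a : ℝ) (u : Plane → Plane) : Prop :=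
  ∃ κ, IsAdaptiveVertexChoice R a κ ∧ ∀ t ∈ adaptiveTriangulation R κ,
    ∃ L : Plane →ᵃ[ℝ] Plane, EqOn u L (interior (convexHull ℝ t))

/-- `g` is continuous on the closure of `A` and affine on each triangle of `R`. -/
def IsContinuousAffine (A : Set Plane) (R : Set (Set Plane)) (g : Plane → Plane) : Prop :=
  ContinuousOn g (closure A) ∧
    ∀ s ∈ R, ∃ L : Plane →ᵃ[ℝ] Plane, EqOn g L (convexHull ℝ s)

/-! ### Function classes in time and space -/

/-- `b ∈ C⁰([0,T]; L^s(μ))`. -/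
def IsContinuousInLp (T : ℝ) (μ : Measure Plane) (s : ℝ≥0∞) (b : ℝ → Plane → ℝ) : Prop :=
  ∀ t ∈ Icc 0 T, MemLp (b t) s μ ∧
    Tendsto (fun τ => eLpNorm (b τ - b t) s μ) (𝓝[Icc 0 T] t) (𝓝 0)

/-- `b ∈ L¹([0,T]; L^s(μ))`. -/
def IsIntegrableInLp (T : ℝ) (μ : Measure Plane) (s : ℝ≥0∞) (b : ℝ → Plane → ℝ) : Prop :=
  AEStronglyMeasurable (Function.uncurry b) ((volume.restrict (Icc 0 T)).prod μ) ∧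
    ∫⁻ t in Icc 0 T, eLpNorm (b t) s μ < ⊤

/-- `b ∈ L^∞([0,T]; L^s(μ))`. -/
def IsBoundedInLp (T : ℝ) (μ : Measure Plane) (s : ℝ≥0∞) (b : ℝ → Plane → ℝ) : Prop :=
  AEStronglyMeasurable (Function.uncurry b) ((volume.restrict (Icc 0 T)).prod μ) ∧
    ∃ C : ℝ≥0, ∀ᵐ t ∂volume.restrict (Icc 0 T), eLpNorm (b t) s μ ≤ C

/-- `b` is nonnegative on `[0,T] × A`. -/
def IsNonnegOn (T : ℝ) (A : Set Plane) (b : ℝ → Plane → ℝ) : Prop :=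
  ∀ t ∈ Icc 0 T, ∀ x ∈ A, 0 ≤ b t x

/-- Measurability of a function of `(t, x)`, jointly (up to null sets) and at each fixed time; both
follow from measurability for the product of the Lebesgue and the `μ`-measurable sets. -/
def IsTimeMeasurable (T : ℝ) (μ : Measure Plane) (f : ℝ → Plane → ℝ) : Prop :=
  AEStronglyMeasurable (Function.uncurry f) ((volume.restrict (Icc 0 T)).prod μ) ∧
    ∀ t ∈ Icc 0 T, AEStronglyMeasurable (f t) μ

/-- The part common to body and surface potentials: on `[0,T] × A`, with the measure `μ` on `A`,
`Φ` and `Φdot` are measurable in `(t, x)`, of class `C¹` in `z`, and `Φdot` is the time derivative of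
`Φ` in the integrated sense, also after differentiation in `z`. -/
structure IsTimePotential (T : ℝ) (A : Set Plane) (μ : Measure Plane)
    (Φ Φdot : ℝ → Plane → Plane → ℝ) : Prop where
  meas : ∀ z, IsTimeMeasurable T μ fun t x => Φ t x z
  smooth : ∀ t ∈ Icc 0 T, ∀ x ∈ A, ContDiff ℝ 1 (Φ t x)
  meas_dot : ∀ z, IsTimeMeasurable T μ fun t x => Φdot t x z
  smooth_dot : ∀ t ∈ Icc 0 T, ∀ x ∈ A, ContDiff ℝ 1 (Φdot t x)
  eq_integral : ∀ t ∈ Icc 0 T, ∀ z, ∀ᵐ x ∂μ, Φ t x z = Φ 0 x z + ∫ s in 0..t, Φdot s x z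
  fderiv_eq_integral : ∀ t ∈ Icc 0 T, ∀ z, ∀ᵐ x ∂μ,
    fderiv ℝ (Φ t x) z = fderiv ℝ (Φ 0 x) z + ∫ s in 0..t, fderiv ℝ (Φdot s x) z

/-- `D` is the weak gradient of `v` on the open set `A`. -/
def HasWeakGradient (A : Set Plane) (v : Plane → Plane) (D : Plane → Mat) : Prop :=
  ∀ φ : Plane → ℝ, ContDiff ℝ ∞ φ → HasCompactSupport φ → tsupport φ ⊆ A →
    ∀ w : Plane, ∫ x in A, (fderiv ℝ φ x w) • v x = - ∫ x in A, φ x • D x w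

/-- The space gradient of a path of (piecewise affine) functions. -/
noncomputable def pathGrad (g : ℝ → Plane → Plane) : ℝ → Plane → Mat :=
  fun t => fderiv ℝ (g t)

/-! ### The data of the model -/

/-- The data: the reference configuration `Ω`, its brittle part `ΩB`, the region `ΩS` next to the
loaded part of the boundary, the Neumann part `bdN` of the boundary and its loaded part `bdS`, the
time horizon `T`, the exponents, the bulk density `W`, the potentials `F` and `G` of body and surface
forces with their time derivatives, and the surface density `k`. -/
structure Data where
  Ω : Set Plane
  ΩB : Set Plane
  ΩS : Set Plane
  bdN : Set Plane
  bdS : Set Plane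
  T : ℝ
  p : ℝ
  q : ℝ
  qdot : ℝ
  r : ℝ
  W : Plane → Mat → ℝ
  F : ℝ → Plane → Plane → ℝ
  Fdot : ℝ → Plane → Plane → ℝ
  G : ℝ → Plane → Plane → ℝ
  Gdot : ℝ → Plane → Plane → ℝ
  k : Plane → Plane → ℝ

namespace Data

variable (m : Data)

/-- The Dirichlet part of the boundary. -/
def bdD : Set Plane := frontier m.Ω \ m.bdN

/-- Lebesgue measure on `Ω`. -/
noncomputable def μΩ : Measure Plane := volume.restrict m.Ω

/-- Arc length on the loaded part of the boundary. -/
noncomputable def μS : Measure Plane := H1.restrict m.bdS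

/-- Assumptions on the domains. -/
structure GeometryOK : Prop where
  open_Ω : IsOpen m.Ω
  bounded_Ω : Bornology.IsBounded m.Ω
  lipschitz_Ω : HasLipschitzBoundary m.Ω
  open_ΩB : IsOpen m.ΩB
  ΩB_sub : m.ΩB ⊆ m.Ω
  closed_bdN : IsClosed m.bdN
  bdN_sub : m.bdN ⊆ frontier m.Ω
  closed_bdS : IsClosed m.bdS
  bdS_sub : m.bdS ⊆ m.bdN
  disjoint_ΩB_bdS : closure m.ΩB ∩ m.bdS = ∅
  open_ΩS : IsOpen m.ΩS
  ΩS_sub : m.ΩS ⊆ m.Ω \ closure m.ΩB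
  lipschitz_ΩS : HasLipschitzBoundary m.ΩS
  bdS_sub_ΩS : m.bdS ⊆ frontier m.ΩS

/-- Assumptions on the exponents and the time horizon. -/
structure ExponentsOK : Prop where
  T_pos : 0 < m.T
  one_lt_p : 1 < m.p
  one_lt_q : 1 < m.q
  one_le_qdot : 1 ≤ m.qdot
  qdot_lt : m.qdot < m.q
  p_le_r : m.p ≤ m.r
  r_le : m.p < 2 → m.r ≤ m.p / (2 - m.p)

/-- Assumptions on the surface density: continuous on `closure ΩB × ℝ²`, a norm in the second
variable, and comparable with the Euclidean norm. -/
structure SurfaceDensityOK : Prop where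
  cont : ContinuousOn (Function.uncurry m.k) (closure m.ΩB ×ˢ univ)
  add_le : ∀ x ∈ closure m.ΩB, ∀ ν ν', m.k x (ν + ν') ≤ m.k x ν + m.k x ν'
  smul : ∀ x ∈ closure m.ΩB, ∀ (c : ℝ) (ν), m.k x (c • ν) = |c| * m.k x ν
  bounds : ∃ K₁ K₂ : ℝ, 0 < K₁ ∧ 0 < K₂ ∧
    ∀ x ∈ closure m.ΩB, ∀ ν, K₁ * ‖ν‖ ≤ m.k x ν ∧ m.k x ν ≤ K₂ * ‖ν‖

/-- Assumptions on the bulk density: a nonnegative Carathéodory function, quasiconvex and `C¹` in the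
gradient variable, with growth of order `p`. -/
structure BulkDensityOK : Prop where
  nonneg : ∀ x ∈ m.Ω, ∀ ξ, 0 ≤ m.W x ξ
  meas : ∀ ξ, AEStronglyMeasurable (fun x => m.W x ξ) m.μΩ
  smooth : ∀ x ∈ m.Ω, ContDiff ℝ 1 (m.W x)
  quasiconvex : ∀ x ∈ m.Ω, ∀ ξ, ∀ φ : Plane → Plane, ContDiff ℝ ∞ φ → HasCompactSupport φ →
    tsupport φ ⊆ m.Ω →
      volume.real m.Ω * m.W x ξ ≤ ∫ y in m.Ω, m.W x (ξ + fderiv ℝ φ y)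
  growth : ∃ (a₀ a₁ : ℝ) (b₀ b₁ : Plane → ℝ), 0 < a₀ ∧ 0 < a₁ ∧
    Integrable b₀ m.μΩ ∧ Integrable b₁ m.μΩ ∧ (∀ x ∈ m.Ω, 0 ≤ b₀ x) ∧ (∀ x ∈ m.Ω, 0 ≤ b₁ x) ∧
    ∀ x ∈ m.Ω, ∀ ξ, a₀ * ‖ξ‖ ^ m.p - b₀ x ≤ m.W x ξ ∧ m.W x ξ ≤ a₁ * ‖ξ‖ ^ m.p + b₁ x

/-- Assumptions on the potential of the body forces. -/
structure BodyForcesOK : Prop where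
  potential : IsTimePotential m.T m.Ω m.μΩ m.F m.Fdot
  growth : ∃ (a₀ a₁ : ℝ) (b₀ b₁ : ℝ → Plane → ℝ), 0 < a₀ ∧ 0 < a₁ ∧
    IsNonnegOn m.T m.Ω b₀ ∧ IsNonnegOn m.T m.Ω b₁ ∧
    IsContinuousInLp m.T m.μΩ 1 b₀ ∧ IsContinuousInLp m.T m.μΩ 1 b₁ ∧
    ∀ t ∈ Icc 0 m.T, ∀ x ∈ m.Ω, ∀ z,
      a₀ * ‖z‖ ^ m.q - b₀ t x ≤ - m.F t x z ∧ - m.F t x z ≤ a₁ * ‖z‖ ^ m.q + b₁ t x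
  growth_fderiv : ∃ (a₂ : ℝ) (b₂ : ℝ → Plane → ℝ), 0 < a₂ ∧ IsNonnegOn m.T m.Ω b₂ ∧
    IsContinuousInLp m.T m.μΩ (ENNReal.conjExponent (ENNReal.ofReal m.q)) b₂ ∧
    ∀ t ∈ Icc 0 m.T, ∀ x ∈ m.Ω, ∀ z, ‖fderiv ℝ (m.F t x) z‖ ≤ a₂ * ‖z‖ ^ (m.q - 1) + b₂ t x
  growth_dot : ∃ (a₃ : ℝ → ℝ) (b₃ : ℝ → Plane → ℝ), (∀ t ∈ Icc 0 m.T, 0 ≤ a₃ t) ∧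
    IntegrableOn a₃ (Icc 0 m.T) ∧ IsNonnegOn m.T m.Ω b₃ ∧ IsIntegrableInLp m.T m.μΩ 1 b₃ ∧
    ∀ t ∈ Icc 0 m.T, ∀ x ∈ m.Ω, ∀ z, |m.Fdot t x z| ≤ a₃ t * ‖z‖ ^ m.qdot + b₃ t x
  growth_fderiv_dot : ∃ (a₄ : ℝ → ℝ) (b₄ : ℝ → Plane → ℝ), (∀ t ∈ Icc 0 m.T, 0 ≤ a₄ t) ∧
    IntegrableOn a₄ (Icc 0 m.T) ∧ IsNonnegOn m.T m.Ω b₄ ∧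
    IsIntegrableInLp m.T m.μΩ (ENNReal.conjExponent (ENNReal.ofReal m.qdot)) b₄ ∧
    ∀ t ∈ Icc 0 m.T, ∀ x ∈ m.Ω, ∀ z,
      ‖fderiv ℝ (m.Fdot t x) z‖ ≤ a₄ t * ‖z‖ ^ (m.qdot - 1) + b₄ t x

/-- Assumptions on the potential of the surface forces. -/
structure SurfaceForcesOK : Prop where
  potential : IsTimePotential m.T m.bdS m.μS m.G m.Gdot
  growth : ∃ (a₀ : ℝ → Plane → ℝ) (a₁ : ℝ) (b₀ b₁ : ℝ → Plane → ℝ), 0 ≤ a₁ ∧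
    IsNonnegOn m.T m.bdS a₀ ∧ IsNonnegOn m.T m.bdS b₀ ∧ IsNonnegOn m.T m.bdS b₁ ∧
    IsBoundedInLp m.T m.μS (ENNReal.conjExponent (ENNReal.ofReal m.r)) a₀ ∧
    IsContinuousInLp m.T m.μS 1 b₀ ∧ IsContinuousInLp m.T m.μS 1 b₁ ∧
    ∀ t ∈ Icc 0 m.T, ∀ x ∈ m.bdS, ∀ z,
      - a₀ t x * ‖z‖ - b₀ t x ≤ - m.G t x z ∧ - m.G t x z ≤ a₁ * ‖z‖ ^ m.r + b₁ t x
  growth_fderiv : ∃ (a₂ : ℝ) (b₂ : ℝ → Plane → ℝ), 0 ≤ a₂ ∧ IsNonnegOn m.T m.bdS b₂ ∧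
    IsContinuousInLp m.T m.μS (ENNReal.conjExponent (ENNReal.ofReal m.r)) b₂ ∧
    ∀ t ∈ Icc 0 m.T, ∀ x ∈ m.bdS, ∀ z, ‖fderiv ℝ (m.G t x) z‖ ≤ a₂ * ‖z‖ ^ (m.r - 1) + b₂ t x
  growth_dot : ∃ (a₃ : ℝ → ℝ) (b₃ : ℝ → Plane → ℝ), (∀ t ∈ Icc 0 m.T, 0 ≤ a₃ t) ∧
    IntegrableOn a₃ (Icc 0 m.T) ∧ IsNonnegOn m.T m.bdS b₃ ∧ IsIntegrableInLp m.T m.μS 1 b₃ ∧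
    ∀ t ∈ Icc 0 m.T, ∀ x ∈ m.bdS, ∀ z, |m.Gdot t x z| ≤ a₃ t * ‖z‖ ^ m.r + b₃ t x
  growth_fderiv_dot : ∃ (a₄ : ℝ → ℝ) (b₄ : ℝ → Plane → ℝ), (∀ t ∈ Icc 0 m.T, 0 ≤ a₄ t) ∧
    IntegrableOn a₄ (Icc 0 m.T) ∧ IsNonnegOn m.T m.bdS b₄ ∧
    IsIntegrableInLp m.T m.μS (ENNReal.conjExponent (ENNReal.ofReal m.r)) b₄ ∧
    ∀ t ∈ Icc 0 m.T, ∀ x ∈ m.bdS, ∀ z,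
      ‖fderiv ℝ (m.Gdot t x) z‖ ≤ a₄ t * ‖z‖ ^ (m.r - 1) + b₄ t x

/-- The standing assumptions on the data. -/
structure Admissible : Prop where
  geometry : m.GeometryOK
  exponents : m.ExponentsOK
  surfaceDensity : m.SurfaceDensityOK
  bulkDensity : m.BulkDensityOK
  bodyForces : m.BodyForcesOK
  surfaceForces : m.SurfaceForcesOK

/-! ### Energies and powers -/

/-- `𝓦(∇u)`. -/
noncomputable def bulkEnergy (u : Plane → Plane) : ℝ := ∫ x in m.Ω, m.W x (fderiv ℝ u x)

/-- `𝓕(t)(u)`. -/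
noncomputable def bodyWork (t : ℝ) (u : Plane → Plane) : ℝ := ∫ x in m.Ω, m.F t x (u x)

/-- `𝓖(t)(u)`. -/
noncomputable def surfaceWork (t : ℝ) (u : Plane → Plane) : ℝ :=
  ∫ x in m.bdS, m.G t x (trace m.Ω u x) ∂H1

/-- The elastic energy `𝓔^el(t)(u) = 𝓦(∇u) - 𝓕(t)(u) - 𝓖(t)(u)`. -/
noncomputable def elasticEnergy (t : ℝ) (u : Plane → Plane) : ℝ :=
  m.bulkEnergy u - m.bodyWork t u - m.surfaceWork t u

open Classical in
/-- The surface energy `𝓔^s(Γ) = ∫_Γ k(x, ν(x)) dH¹(x)`, where `ν` is a unit normal field on `Γ` and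
`k = +∞` off the closure of the brittle part, where cracks are not admissible. All unit normal fields
on a rectifiable set agree up to sign almost everywhere, so that the infimum is over equal numbers;
it is `+∞` if `Γ` is not rectifiable. -/
noncomputable def surfaceEnergy (Γ : Set Plane) : ℝ≥0∞ :=
  ⨅ (ν : Plane → Plane) (_ : IsNormalField Γ ν),
    ∫⁻ x in Γ, (if x ∈ closure m.ΩB then ENNReal.ofReal (m.k x (ν x)) else ⊤) ∂H1

/-- The total energy `𝓔(t)(u, Γ)` (of configurations with finite surface energy). -/
noncomputable def totalEnergy (t : ℝ) (u : Plane → Plane) (Γ : Set Plane) : ℝ :=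
  m.elasticEnergy t u + (m.surfaceEnergy Γ).toReal

/-- `⟨∂𝓦(∇u), ∇v⟩`. -/
noncomputable def bulkPairing (u v : Plane → Plane) : ℝ :=
  ∫ x in m.Ω, fderiv ℝ (m.W x) (fderiv ℝ u x) (fderiv ℝ v x)

/-- The functional `𝓕̇(t)(u)`. -/
noncomputable def bodyWorkDot (t : ℝ) (u : Plane → Plane) : ℝ := ∫ x in m.Ω, m.Fdot t x (u x)

/-- `⟨∂𝓕(t)(u), v⟩`. -/
noncomputable def bodyPairing (t : ℝ) (u v : Plane → Plane) : ℝ :=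
  ∫ x in m.Ω, fderiv ℝ (m.F t x) (u x) (v x)

/-- The functional `𝓖̇(t)(u)`. -/
noncomputable def surfaceWorkDot (t : ℝ) (u : Plane → Plane) : ℝ :=
  ∫ x in m.bdS, m.Gdot t x (trace m.Ω u x) ∂H1

/-- `⟨∂𝓖(t)(u), v⟩`. -/
noncomputable def surfacePairing (t : ℝ) (u v : Plane → Plane) : ℝ :=
  ∫ x in m.bdS, fderiv ℝ (m.G t x) (trace m.Ω u x) (trace m.Ω v x) ∂H1

/-! ### The finite element setting -/

/-- `R` is a regular triangulation of `Ω` of size `ε`, adapted to `ΩB`, `ΩS` and to the Dirichlet and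
the loaded part of the boundary. -/
structure IsMesh (c₁ c₂ ε : ℝ) (R : Set (Set Plane)) : Prop where
  regular : IsRegularTriangulation c₁ c₂ ε m.Ω R
  brittle : IsComposedOfTriangles R m.ΩB
  loaded : IsComposedOfTriangles R m.ΩS
  dirichlet : IsComposedOfEdges R m.bdD
  surface : IsComposedOfEdges R m.bdS

/-- The finite element space: adaptive piecewise affine functions that jump only in the closure of the
brittle part. -/
def feSpace (R : Set (Set Plane)) (a : ℝ) : Set (Plane → Plane) :=
  {u | IsAdaptiveAffine R a u ∧ jumpSet m.Ω u ⊆ closure m.ΩB}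

/-- `S^g(u)`: the jump set of `u` together with the points of the Dirichlet boundary at which the
trace of `u` is not `g`. -/
def fullJump (g u : Plane → Plane) : Set Plane :=
  jumpSet m.Ω u ∪ {x | x ∈ m.bdD ∧ ¬ HasApproxLimWithin m.Ω u x (g x)}

/-- The discrete preexisting cracks, with equality of sets up to `H1`-null sets. -/
def IsInitialCrack (R : Set (Set Plane)) (a : ℝ) (Γ : Set Plane) : Prop :=
  H1 (Γ \ closure m.ΩB) = 0 ∧ H1 Γ < ⊤ ∧
    ∃ z ∈ m.feSpace R a, Γ =ᵐ[H1] m.fullJump 0 z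

/-- The norm of `W^{1,p} ∩ L^q` of a function `v` with gradient `D`. -/
noncomputable def sobolevNorm (v : Plane → Plane) (D : Plane → Mat) : ℝ≥0∞ :=
  eLpNorm v (ENNReal.ofReal m.p) m.μΩ + eLpNorm D (ENNReal.ofReal m.p) m.μΩ +
    eLpNorm v (ENNReal.ofReal m.q) m.μΩ

/-- The distance in `W^{1,1}([0,T]; W^{1,p} ∩ L^q)` of two paths, given with their space gradients,
their time derivatives and the space gradients of these. -/
noncomputable def pathDist (g gdot : ℝ → Plane → Plane) (D Ddot : ℝ → Plane → Mat)
    (h hdot : ℝ → Plane → Plane) (E Edot : ℝ → Plane → Mat) : ℝ≥0∞ :=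
  (∫⁻ t in Icc 0 m.T, m.sobolevNorm (g t - h t) (D t - E t)) +
    ∫⁻ t in Icc 0 m.T, m.sobolevNorm (gdot t - hdot t) (Ddot t - Edot t)

/-- `g ∈ W^{1,1}([0,T]; W^{1,p} ∩ L^q)` with time derivative `gdot`, where `g(t)` is continuous and
affine on each triangle of `R` for all `t`. These functions form a finite-dimensional space, in which
`gdot(t)` lies as well for almost all `t` and on which evaluation at a point of the closure of `Ω` is
continuous; measurability and the integral of a path can therefore be taken pointwise in `x`. -/
structure IsBoundaryDatum (R : Set (Set Plane)) (g gdot : ℝ → Plane → Plane) : Prop where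
  affine : ∀ t ∈ Icc 0 m.T, IsContinuousAffine m.Ω R (g t)
  affine_dot : ∀ᵐ t ∂volume.restrict (Icc 0 m.T), IsContinuousAffine m.Ω R (gdot t)
  meas : ∀ x ∈ closure m.Ω,
    AEStronglyMeasurable (fun t => gdot t x) (volume.restrict (Icc 0 m.T))
  integrable : ∫⁻ t in Icc 0 m.T, m.sobolevNorm (gdot t) (fderiv ℝ (gdot t)) < ⊤
  eq_integral : ∀ t ∈ Icc 0 m.T, ∀ x ∈ closure m.Ω, g t x = g 0 x + ∫ s in 0..t, gdot s x

/-- `v ∈ W^{1,p}(Ω; ℝ²) ∩ L^q(Ω; ℝ²)` with weak gradient `D`. -/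
def IsSobolev (v : Plane → Plane) (D : Plane → Mat) : Prop :=
  MemLp v (ENNReal.ofReal m.p) m.μΩ ∧ MemLp D (ENNReal.ofReal m.p) m.μΩ ∧
    MemLp v (ENNReal.ofReal m.q) m.μΩ ∧ HasWeakGradient m.Ω v D

/-- A general `g ∈ W^{1,1}([0,T]; W^{1,p} ∩ L^q)`, with space gradient `D`, time derivative `gdot` and
the space gradient `Ddot` of the latter. -/
structure IsSobolevPath (g gdot : ℝ → Plane → Plane) (D Ddot : ℝ → Plane → Mat) : Prop where
  sobolev : ∀ t ∈ Icc 0 m.T, m.IsSobolev (g t) (D t)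
  sobolev_dot : ∀ᵐ t ∂volume.restrict (Icc 0 m.T), m.IsSobolev (gdot t) (Ddot t)
  meas : AEStronglyMeasurable (Function.uncurry g) ((volume.restrict (Icc 0 m.T)).prod m.μΩ)
  meas_grad : AEStronglyMeasurable (Function.uncurry D) ((volume.restrict (Icc 0 m.T)).prod m.μΩ)
  meas_dot : AEStronglyMeasurable (Function.uncurry gdot)
    ((volume.restrict (Icc 0 m.T)).prod m.μΩ)
  meas_grad_dot : AEStronglyMeasurable (Function.uncurry Ddot)
    ((volume.restrict (Icc 0 m.T)).prod m.μΩ)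
  integrable : ∫⁻ t in Icc 0 m.T, m.sobolevNorm (gdot t) (Ddot t) < ⊤
  eq_integral : ∀ t ∈ Icc 0 m.T, ∀ᵐ x ∂m.μΩ, g t x = g 0 x + ∫ s in 0..t, gdot s x

/-! ### The discrete evolution -/

/-- `N_δ`, the largest integer `N` with `δ (N - 1) < T`. -/
noncomputable def numSteps (δ : ℝ) : ℕ := ⌈m.T / δ⌉₊

/-- The times `t_i = i δ` for `i < N_δ` and `t_i = T` for `i = N_δ`. -/
noncomputable def time (δ : ℝ) (i : ℕ) : ℝ := if i < m.numSteps δ then i * δ else m.T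

/-- `Γ^i`, the union of the preexisting crack and of the jumps of `u_0, …, u_i`. -/
def crack (δ : ℝ) (g : ℝ → Plane → Plane) (Γ₀ : Set Plane) (u : ℕ → Plane → Plane) (i : ℕ) :
    Set Plane :=
  Γ₀ ∪ ⋃ l ≤ i, m.fullJump (g (m.time δ l)) (u l)

/-- `u` minimizes `𝓔^el(t)(v) + 𝓔^s(S^g(v) \ Γ)` over the finite element space. -/
def IsMinimizer (R : Set (Set Plane)) (a t : ℝ) (g : Plane → Plane) (Γ : Set Plane)
    (u : Plane → Plane) : Prop :=
  u ∈ m.feSpace R a ∧ ∀ v ∈ m.feSpace R a,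
    (m.elasticEnergy t u : EReal) + (m.surfaceEnergy (m.fullJump g u \ Γ) : EReal) ≤
      (m.elasticEnergy t v : EReal) + (m.surfaceEnergy (m.fullJump g v \ Γ) : EReal)

/-- `u_0, …, u_{N_δ}` is a discrete evolution with time step `δ`, boundary datum `g` and preexisting
crack `Γ₀`. -/
structure IsDiscreteEvolution (R : Set (Set Plane)) (a δ : ℝ) (g : ℝ → Plane → Plane)
    (Γ₀ : Set Plane) (u : ℕ → Plane → Plane) : Prop where
  initial : m.IsMinimizer R a 0 (g 0) Γ₀ (u 0)
  step : ∀ i < m.numSteps δ,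
    m.IsMinimizer R a (m.time δ (i + 1)) (g (m.time δ (i + 1))) (m.crack δ g Γ₀ u i) (u (i + 1))

/-- The piecewise constant interpolation: `u_i` on `[t_i, t_{i+1})`, and `u_{N_δ}` at `T`. -/
noncomputable def interpolation (δ : ℝ) (u : ℕ → Plane → Plane) (t : ℝ) : Plane → Plane :=
  if t < m.T then u ⌊t / δ⌋₊ else u (m.numSteps δ)

end Data

end CrackGrowth

namespace CrackGrowth

section Tools

variable {α β E F : Type*} [MeasurableSpace α] [MeasurableSpace β]

theorem eLpNorm_ofReal_eq [NormedAddCommGroup E] {μ : Measure α} {ρ : ℝ} (hρ : 0 < ρ) (f : α → E) :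
    eLpNorm f (ENNReal.ofReal ρ) μ = (∫⁻ x, ‖f x‖ₑ ^ ρ ∂μ) ^ (1 / ρ) := by
  rw [eLpNorm_eq_lintegral_rpow_enorm_toReal (by simpa using hρ) ENNReal.ofReal_ne_top,
    ENNReal.toReal_ofReal hρ.le]

theorem lintegral_rpow_enorm_eq [NormedAddCommGroup E] {μ : Measure α} {ρ : ℝ} (hρ : 0 < ρ)
    (f : α → E) : ∫⁻ x, ‖f x‖ₑ ^ ρ ∂μ = eLpNorm f (ENNReal.ofReal ρ) μ ^ ρ := by
  rw [eLpNorm_ofReal_eq hρ, ← ENNReal.rpow_mul, one_div, inv_mul_cancel₀ hρ.ne', ENNReal.rpow_one]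

theorem conjExponent_ofReal {ρ : ℝ} (hρ : 1 < ρ) :
    ENNReal.conjExponent (ENNReal.ofReal ρ) = ENNReal.ofReal (ρ / (ρ - 1)) := by
  have h1 : 0 < ρ - 1 := by linarith
  have h2 : ENNReal.HolderConjugate (ENNReal.ofReal ρ) (ENNReal.ofReal (ρ / (ρ - 1))) := by
    have := (Real.HolderConjugate.conjExponent hρ)
    exact Real.HolderConjugate.ennrealOfReal this
  exact h2.conjExponent_eq

/-- Hölder's inequality for `U ^ (ρ - 1) * V`. -/
theorem lintegral_rpow_sub_one_mul_le {μ : Measure α} {ρ : ℝ} (hρ : 1 < ρ) {U V : α → ℝ≥0∞}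
    (hU : AEMeasurable U μ) (hV : AEMeasurable V μ) :
    ∫⁻ x, U x ^ (ρ - 1) * V x ∂μ ≤
      (∫⁻ x, U x ^ ρ ∂μ) ^ ((ρ - 1) / ρ) * (∫⁻ x, V x ^ ρ ∂μ) ^ (1 / ρ) := by
  have hc := (Real.HolderConjugate.conjExponent hρ).symm
  have h1 : 0 < ρ - 1 := by linarith
  refine (ENNReal.lintegral_mul_le_Lp_mul_Lq μ hc (hU.pow_const (ρ - 1)) hV).trans (le_of_eq ?_)
  simp only [← ENNReal.rpow_mul, Real.conjExponent]
  congr 2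
  · congr 1; ext x; congr 1; field_simp
  · field_simp

/-- **Minkowski's integral inequality**. -/
theorem lintegral_rpow_lintegral_le {ν : Measure α} {μ : Measure β} [SFinite ν] [SFinite μ]
    {f : α × β → ℝ≥0∞} (hf : AEMeasurable f (ν.prod μ)) {ρ : ℝ} (hρ : 1 < ρ)
    (hfin : ∫⁻ y, (∫⁻ x, f (x, y) ∂ν) ^ ρ ∂μ ≠ ⊤) :
    (∫⁻ y, (∫⁻ x, f (x, y) ∂ν) ^ ρ ∂μ) ^ (1 / ρ) ≤
      ∫⁻ x, (∫⁻ y, f (x, y) ^ ρ ∂μ) ^ (1 / ρ) ∂ν := by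
  have h0 : 0 < ρ := by linarith
  have h1 : 0 < ρ - 1 := by linarith
  set H : β → ℝ≥0∞ := fun y => ∫⁻ x, f (x, y) ∂ν with hHdef
  set A := ∫⁻ y, H y ^ ρ ∂μ with hA
  have hH : AEMeasurable H μ := hf.prod_swap.lintegral_prod_right'
  have hkey : A ≤ A ^ ((ρ - 1) / ρ) * ∫⁻ x, (∫⁻ y, f (x, y) ^ ρ ∂μ) ^ (1 / ρ) ∂ν := by
    have e1 : A = ∫⁻ y, ∫⁻ x, H y ^ (ρ - 1) * f (x, y) ∂ν ∂μ := by
      rw [hA]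
      have hm : ∀ᵐ y ∂μ, AEMeasurable (fun x => f (x, y)) ν := by
        filter_upwards [hf.prod_swap.aestronglyMeasurable.prodMk_left] with y hy using hy.aemeasurable
      refine lintegral_congr_ae ?_
      filter_upwards [hm] with y hy
      rw [lintegral_const_mul'' _ hy]
      change H y ^ ρ = H y ^ (ρ - 1) * H y
      conv_rhs => rw [← ENNReal.rpow_one (H y), ← ENNReal.rpow_mul, one_mul,
        ← ENNReal.rpow_add_of_nonneg _ _ h1.le zero_le_one]
      simp
    refine e1.le.trans ?_
    rw [lintegral_lintegral_swap]
    · calc ∫⁻ x, ∫⁻ y, H y ^ (ρ - 1) * f (x, y) ∂μ ∂ν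
          ≤ ∫⁻ x, A ^ ((ρ - 1) / ρ) * (∫⁻ y, f (x, y) ^ ρ ∂μ) ^ (1 / ρ) ∂ν := by
            refine lintegral_mono_ae ?_
            filter_upwards [hf.aestronglyMeasurable.prodMk_left] with x hx
            exact lintegral_rpow_sub_one_mul_le hρ hH hx.aemeasurable
        _ = _ := by
            rw [lintegral_const_mul']
            exact ENNReal.rpow_ne_top_of_nonneg (by positivity) hfin
    · exact ((hH.pow_const _).comp_fst).mul hf.prod_swap
  by_cases hz : A = 0
  · rw [hz, ENNReal.zero_rpow_of_pos (by positivity)]; exact zero_le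
  have hpos : A ^ ((ρ - 1) / ρ) ≠ 0 := by
    simp [ENNReal.rpow_eq_zero_iff, hz, hfin]
  have hnt : A ^ ((ρ - 1) / ρ) ≠ ⊤ := ENNReal.rpow_ne_top_of_nonneg (by positivity) hfin
  have e2 : A = A ^ ((ρ - 1) / ρ) * A ^ (1 / ρ) := by
    rw [← ENNReal.rpow_add _ _ hz hfin]
    have : (ρ - 1) / ρ + 1 / ρ = 1 := by field_simp; ring
    rw [this, ENNReal.rpow_one]
  rw [e2] at hkey
  conv_rhs at hkey => rw [← e2]
  exact (ENNReal.mul_le_mul_iff_right hpos hnt).1 hkey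

/-- A Carathéodory function composed with a measurable function is measurable. -/
theorem aestronglyMeasurable_caratheodory [TopologicalSpace E] [NormedAddCommGroup F]
    {μ : Measure α} {f : α → E → F} (hf : ∀ z, AEStronglyMeasurable (fun a => f a z) μ)
    (hc : ∀ᵐ a ∂μ, Continuous (f a)) {u : α → E} (hu : AEStronglyMeasurable u μ) :
    AEStronglyMeasurable (fun a => f a (u a)) μ := by
  obtain ⟨v, hv, huv⟩ := hu
  have hs : ∀ s : SimpleFunc α E, AEStronglyMeasurable (fun a => f a (s a)) μ := by
    intro s
    classical
    have : (fun a => f a (s a)) =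
        fun a => ∑ z ∈ s.range, (s ⁻¹' {z}).indicator (fun a => f a z) a := by
      ext a
      rw [Finset.sum_eq_single (s a)]
      · simp
      · intro z _ hz
        exact indicator_of_notMem (by simpa using Ne.symm hz) _
      · intro h; exact absurd (s.mem_range_self a) h
    rw [this]
    refine Finset.aestronglyMeasurable_fun_sum _ fun z _ => ?_
    exact (hf z).indicator (s.measurableSet_preimage _)
  have hlim : AEStronglyMeasurable (fun a => f a (v a)) μ := by
    refine aestronglyMeasurable_of_tendsto_ae atTop (fun n => hs (hv.approx n)) ?_
    filter_upwards [hc] with a ha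
    exact (ha.tendsto _).comp (hv.tendsto_approx a)
  refine hlim.congr ?_
  filter_upwards [huv] with a ha
  rw [ha]

variable [NormedAddCommGroup E] [NormedSpace ℝ E] [FiniteDimensional ℝ E]
  [NormedAddCommGroup F] [NormedSpace ℝ F]

theorem clm_eq_sum_smulRight (L : E →L[ℝ] F) :
    L = ∑ i, (LinearMap.toContinuousLinearMap ((Module.finBasis ℝ E).coord i)).smulRight
      (L (Module.finBasis ℝ E i)) := by
  ext w
  conv_lhs => rw [← (Module.finBasis ℝ E).sum_repr w]
  rw [map_sum]
  simp

theorem aestronglyMeasurable_clm {μ : Measure α} {g : α → E →L[ℝ] F}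
    (hg : ∀ w, AEStronglyMeasurable (fun a => g a w) μ) : AEStronglyMeasurable g μ := by
  have : g = fun a => ∑ i, (LinearMap.toContinuousLinearMap
      ((Module.finBasis ℝ E).coord i)).smulRight (g a (Module.finBasis ℝ E i)) := by
    ext1 a; exact clm_eq_sum_smulRight (g a)
  rw [this]
  refine Finset.aestronglyMeasurable_fun_sum _ fun i _ => ?_
  exact (ContinuousLinearMap.smulRightL ℝ E F _).continuous.comp_aestronglyMeasurable (hg _)

theorem aestronglyMeasurable_fderiv {μ : Measure α} {f : α → E → ℝ}
    (hf : ∀ z, AEStronglyMeasurable (fun a => f a z) μ)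
    (hc : ∀ᵐ a ∂μ, ContDiff ℝ 1 (f a)) (z : E) :
    AEStronglyMeasurable (fun a => fderiv ℝ (f a) z) μ := by
  refine aestronglyMeasurable_clm fun w => ?_
  refine aestronglyMeasurable_of_tendsto_ae atTop
    (f := fun (n : ℕ) a => ((n : ℝ) + 1) • (f a (z + ((n : ℝ) + 1)⁻¹ • w) - f a z))
    (fun n => ((hf (z + ((n : ℝ) + 1)⁻¹ • w)).sub (hf z)).const_smul ((n : ℝ) + 1)) ?_
  filter_upwards [hc] with a ha
  have hd := ((ha.differentiable one_ne_zero).differentiableAt (x := z)).hasFDerivAt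
  have h1 := hd.hasLineDerivAt w
  have h2 := h1.tendsto_slope_zero
  have h3 : Tendsto (fun n : ℕ => ((n : ℝ) + 1)⁻¹) atTop (𝓝[≠] 0) := by
    refine tendsto_nhdsWithin_iff.2 ⟨?_, Eventually.of_forall fun n => ?_⟩
    · exact (tendsto_natCast_atTop_atTop.atTop_add tendsto_const_nhds).inv_tendsto_atTop
    · have : (0 : ℝ) < (n : ℝ) + 1 := by positivity
      simpa using this.ne'
  have h4 := h2.comp h3
  simpa [Function.comp_def] using h4

theorem aestronglyMeasurable_fderiv_comp {μ : Measure α} {f : α → E → ℝ}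
    (hf : ∀ z, AEStronglyMeasurable (fun a => f a z) μ)
    (hc : ∀ᵐ a ∂μ, ContDiff ℝ 1 (f a)) {u : α → E} (hu : AEStronglyMeasurable u μ) :
    AEStronglyMeasurable (fun a => fderiv ℝ (f a) (u a)) μ :=
  aestronglyMeasurable_caratheodory (aestronglyMeasurable_fderiv hf hc)
    (hc.mono fun _ h => h.continuous_fderiv one_ne_zero) hu

end Tools

section RankOne

/-- A continuous function that lies below its averages with respect to the rescalings of a fixed
centred distribution is convex. -/
theorem convexOn_of_le_average {X : Type*} [MeasurableSpace X] (μ : Measure X) [IsFiniteMeasure μ]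
    {w : X → ℝ} (hw : AEStronglyMeasurable w μ) {B : ℝ} (hB : ∀ x, |w x| ≤ B)
    (hw0 : ∫ x, w x ∂μ = 0) (hneg : μ {x | w x < 0} ≠ 0) {h : ℝ → ℝ} (hc : Continuous h)
    (hmean : ∀ s r, 0 < r → μ.real univ * h s ≤ ∫ x, h (s + r * w x) ∂μ) :
    ConvexOn ℝ univ h := by
  refine LinearOrder.convexOn_of_lt convex_univ fun x _ y _ hxy a b ha hb hab => ?_
  by_contra! hlt
  set K := (h y - h x) / (y - x) with hK
  have hyx : 0 < y - x := sub_pos.2 hxy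
  set g : ℝ → ℝ := fun s => h s - (h x + (s - x) * K) with hg
  have hgc : Continuous g := by fun_prop
  have hgx : g x = 0 := by simp [hg]
  have hgy : g y = 0 := by
    simp only [hg, hK]; field_simp; ring
  set s₀ := a • x + b • y with hs₀
  have hs₀m : s₀ ∈ Icc x y := by
    simp only [hs₀, smul_eq_mul]
    have ha' : a = 1 - b := by linarith
    subst ha'
    constructor <;> nlinarith
  have hgs₀ : 0 < g s₀ := by
    have e : (s₀ - x) * K = b * (h y - h x) := by
      have : s₀ - x = b * (y - x) := by
        simp only [hs₀, smul_eq_mul]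
        have ha' : a = 1 - b := by linarith
        subst ha'; ring
      rw [this, hK]; field_simp
    have ha' : a = 1 - b := by linarith
    simp only [hg, e]
    simp only [smul_eq_mul] at hlt
    rw [ha'] at hlt
    nlinarith
  obtain ⟨sm, hsm, hmax⟩ := isCompact_Icc.exists_isMaxOn (nonempty_Icc.2 hxy.le) hgc.continuousOn
  set M₀ := g sm with hM₀
  have hM₀pos : 0 < M₀ := hgs₀.trans_le (hmax hs₀m)
  set S := Icc x y ∩ g ⁻¹' {M₀} with hS
  have hScomp : IsCompact S := isCompact_Icc.inter_right (isClosed_singleton.preimage hgc)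
  have hSne : S.Nonempty := ⟨sm, hsm, rfl⟩
  have hmem := hScomp.sInf_mem hSne
  set t := sInf S with ht
  have htg : g t = M₀ := hmem.2
  have hxt : x < t := lt_of_le_of_ne hmem.1.1 (by rintro h; rw [← h, hgx] at htg; linarith)
  have hty : t < y := lt_of_le_of_ne hmem.1.2 (by rintro h; rw [h, hgy] at htg; linarith)
  have hBnn : 0 ≤ B := by
    by_contra! hBneg
    refine hneg (measure_mono_null (t := ∅) ?_ measure_empty)
    intro z hz
    linarith [hB z, abs_nonneg (w z)]
  set r := min (t - x) (y - t) / (B + 1) with hr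
  have hmin : 0 < min (t - x) (y - t) := lt_min (by linarith) (by linarith)
  have hrpos : 0 < r := by positivity
  have hrw : ∀ z, |r * w z| ≤ min (t - x) (y - t) := by
    intro z
    rw [abs_mul, abs_of_pos hrpos, hr, div_mul_eq_mul_div, div_le_iff₀ (by positivity)]
    exact mul_le_mul_of_nonneg_left ((hB z).trans (by linarith)) hmin.le
  have hin : ∀ z, t + r * w z ∈ Icc x y := by
    intro z
    have h1 := abs_le.1 (hrw z)
    have h2 := min_le_left (t - x) (y - t)
    have h3 := min_le_right (t - x) (y - t)
    constructor <;> linarith [h1.1, h1.2]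
  have hwint : Integrable w μ := by
    refine Integrable.of_bound hw B (Eventually.of_forall fun z => ?_)
    simpa using hB z
  have hgint : ∀ f : ℝ → ℝ, Continuous f → Integrable (fun z => f (t + r * w z)) μ := by
    intro f hf
    obtain ⟨C, hC⟩ := isCompact_Icc.exists_bound_of_continuousOn (s := Icc x y) hf.continuousOn
    refine Integrable.of_bound (C := C) ?_ (Eventually.of_forall fun z => hC _ (hin z))
    exact hf.comp_aestronglyMeasurable ((hw.const_mul r).const_add t)
  have hint0 : ∫ z, (M₀ - g (t + r * w z)) ∂μ ≤ 0 := by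
    have e : ∀ z, M₀ - g (t + r * w z) = h t - h (t + r * w z) + (r * K) * w z := by
      intro z; rw [← htg]; simp only [hg]; ring
    simp_rw [e]
    have i1 : Integrable (fun z => h t - h (t + r * w z)) μ :=
      (integrable_const _).sub (hgint h hc)
    rw [integral_add i1 (hwint.const_mul _),
      integral_sub (integrable_const _) (hgint h hc), integral_const_mul, hw0]
    have := hmean t r hrpos
    simp only [integral_const, smul_eq_mul]
    linarith
  have hnn : 0 ≤ᵐ[μ] fun z => M₀ - g (t + r * w z) :=
    Eventually.of_forall fun z => sub_nonneg.2 (hmax (hin z))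
  have hz := (integral_eq_zero_iff_of_nonneg_ae hnn ((integrable_const _).sub (hgint g hgc))).1
    (le_antisymm hint0 (integral_nonneg_of_ae hnn))
  refine hneg (measure_mono_null (fun z hz' => ?_) (ae_iff.1 hz))
  change ¬ (M₀ - g (t + r * w z) = 0)
  replace hz' : w z < 0 := hz'
  intro h0
  have hmS : t + r * w z ∈ S := ⟨hin z, by simp only [mem_preimage, mem_singleton_iff]; linarith⟩
  have := csInf_le hScomp.bddBelow hmS
  have : r * w z < 0 := mul_neg_of_pos_of_neg hrpos hz'
  linarith

/-- The rank-one matrix `a ⊗ n`. -/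
noncomputable def rankOne (a n : Plane) : Mat := (innerSL ℝ n).smulRight a

theorem rankOne_apply (a n w : Plane) : rankOne a n w = (inner ℝ n w) • a := rfl

theorem norm_rankOne_le (a n : Plane) : ‖rankOne a n‖ ≤ ‖a‖ * ‖n‖ := by
  refine ContinuousLinearMap.opNorm_le_bound _ (by positivity) fun w => ?_
  rw [rankOne_apply, norm_smul]
  have := norm_inner_le_norm (𝕜 := ℝ) n w
  nlinarith [norm_nonneg a]

/-- The derivative of an oscillating test function. -/
theorem hasFDerivAt_oscillation {ψ : Plane → ℝ} (hψ : ContDiff ℝ ∞ ψ) (a n : Plane) {k : ℝ}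
    (hk : k ≠ 0) (c : ℝ) (x : Plane) :
    HasFDerivAt (fun x => (ψ x * (k⁻¹ * Real.sin (k * inner ℝ n x + c))) • a)
      ((ψ x * Real.cos (k * inner ℝ n x + c)) • rankOne a n +
        (k⁻¹ * Real.sin (k * inner ℝ n x + c)) • (fderiv ℝ ψ x).smulRight a) x := by
  have h1 : HasFDerivAt ψ (fderiv ℝ ψ x) x :=
    (hψ.differentiable (by simp)).differentiableAt.hasFDerivAt
  have h2 : HasFDerivAt (fun x : Plane => k * inner ℝ n x + c) (k • innerSL ℝ n) x :=
    (((innerSL ℝ n).hasFDerivAt (x := x)).const_mul k).add_const c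
  have h3 := h2.sin
  have h4 := (h1.mul (h3.const_mul k⁻¹)).smul_const a
  refine h4.congr_fderiv ?_
  ext1 w
  simp only [ContinuousLinearMap.smulRight_apply, add_apply,
    smul_apply, rankOne_apply, smul_eq_mul, innerSL_apply_apply, smul_smul,
    ← add_smul]
  congr 1
  field_simp

/-- Averaging over the phase removes the oscillation. -/
theorem le_integral_of_periodic_phase {μ : Measure Plane} [IsFiniteMeasure μ] {Q : Plane → ℝ → ℝ}
    (hQ : Continuous (Function.uncurry Q)) {C : ℝ} (hC : ∀ x c, ‖Q x c‖ ≤ C)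
    (hper : ∀ x, Function.Periodic (Q x) (2 * Real.pi)) {θ : Plane → ℝ} (hθ : Continuous θ) {A : ℝ}
    (hA : ∀ c, A ≤ ∫ x, Q x (θ x + c) ∂μ) :
    2 * Real.pi * A ≤ ∫ p, Q p.1 p.2 ∂(μ.prod (volume.restrict (Ioc 0 (2 * Real.pi)))) := by
  have hpi : 0 ≤ 2 * Real.pi := by positivity
  set ν := (volume : Measure ℝ).restrict (Ioc 0 (2 * Real.pi)) with hν
  have hint1 : Integrable (Function.uncurry fun x c => Q x (θ x + c)) (μ.prod ν) := by
    refine Integrable.of_bound (C := C) ?_ (Eventually.of_forall fun p => hC _ _)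
    refine Continuous.aestronglyMeasurable ?_
    exact hQ.comp (by fun_prop : Continuous fun p : Plane × ℝ => (p.1, θ p.1 + p.2))
  have hint2 : Integrable (fun p : Plane × ℝ => Q p.1 p.2) (μ.prod ν) :=
    Integrable.of_bound (C := C) hQ.aestronglyMeasurable (Eventually.of_forall fun p => hC _ _)
  have h1 : 2 * Real.pi * A ≤ ∫ c, ∫ x, Q x (θ x + c) ∂μ ∂ν := by
    calc 2 * Real.pi * A = ∫ _c, A ∂ν := by
          rw [integral_const, smul_eq_mul, hν, measureReal_restrict_apply_univ,
            Real.volume_real_Ioc, sub_zero, max_eq_left hpi]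
      _ ≤ _ := integral_mono (integrable_const _) hint1.integral_prod_right hA
  refine h1.trans (le_of_eq ?_)
  rw [integral_prod _ hint2, ← integral_integral_swap hint1]
  refine integral_congr_ae (Eventually.of_forall fun x => ?_)
  have e1 : ∀ F : ℝ → ℝ, ∫ c, F c ∂ν = ∫ c in (0 : ℝ)..2 * Real.pi, F c := fun F => by
    rw [intervalIntegral.integral_of_le hpi]
  simp only [e1]
  rw [intervalIntegral.integral_comp_add_left (fun c => Q x c)]
  have := (hper x).intervalIntegral_add_eq (θ x + 0) 0
  rw [zero_add] at this
  rw [← this]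
  congr 1; ring

/-- A quasiconvex function lies below its averages over oscillations in a rank-one direction. -/
theorem le_average_of_quasiconvex {Ω : Set Plane} (hΩb : Bornology.IsBounded Ω)
    {f : Mat → ℝ} (hf : Continuous f)
    (hq : ∀ ξ, ∀ φ : Plane → Plane, ContDiff ℝ ∞ φ → HasCompactSupport φ → tsupport φ ⊆ Ω →
      volume.real Ω * f ξ ≤ ∫ y in Ω, f (ξ + fderiv ℝ φ y))
    {ψ : Plane → ℝ} (hψ : ContDiff ℝ ∞ ψ) (hψc : HasCompactSupport ψ) (hψΩ : tsupport ψ ⊆ Ω)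
    (ξ : Mat) (a n : Plane) :
    ((volume.restrict Ω).prod (volume.restrict (Ioc 0 (2 * Real.pi)))).real univ * f ξ ≤
      ∫ p, f (ξ + (ψ p.1 * Real.cos p.2) • rankOne a n)
        ∂((volume.restrict Ω).prod (volume.restrict (Ioc 0 (2 * Real.pi)))) := by
  have : IsFiniteMeasure (volume.restrict Ω) := ⟨by simpa using hΩb.measure_lt_top⟩
  set μ := (volume : Measure Plane).restrict Ω
  set ν := (volume : Measure ℝ).restrict (Ioc 0 (2 * Real.pi))
  have hpi : 0 ≤ 2 * Real.pi := by positivity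
  set P : Plane → Mat := fun x => (fderiv ℝ ψ x).smulRight a with hP
  have hPc : Continuous P := by
    have := hψ.continuous_fderiv (by simp)
    exact ((ContinuousLinearMap.smulRightL ℝ Plane Plane).flip a).continuous.comp this
  obtain ⟨Cψ, hCψ⟩ := hψc.exists_bound_of_continuous hψ.continuous
  have hPs : HasCompactSupport P := by
    refine (hψc.fderiv (𝕜 := ℝ)).comp_left (g := fun L : Plane →L[ℝ] ℝ => L.smulRight a) ?_
    ext; simp
  obtain ⟨CP, hCP⟩ := hPs.exists_bound_of_continuous hPc
  set N := rankOne a n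
  -- the averaged oscillating integrand
  set Q : ℝ → Plane → ℝ → ℝ := fun κ x c =>
    f (ξ + ((ψ x * Real.cos c) • N + (κ * Real.sin c) • P x)) with hQ
  have hQc : ∀ κ, Continuous (Function.uncurry (Q κ)) := by
    intro κ
    have := hψ.continuous
    simp only [hQ, Function.uncurry_def]
    fun_prop
  obtain ⟨C, hC⟩ := (isCompact_closedBall (0 : Mat) (‖ξ‖ + (Cψ * ‖N‖ + CP))).exists_bound_of_continuousOn
    hf.continuousOn
  have hQb : ∀ κ, |κ| ≤ 1 → ∀ x c, ‖Q κ x c‖ ≤ C := by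
    intro κ hκ x c
    refine hC _ ?_
    rw [mem_closedBall_zero_iff]
    refine (norm_add_le _ _).trans (add_le_add le_rfl ((norm_add_le _ _).trans (add_le_add ?_ ?_)))
    · rw [norm_smul, norm_mul]
      refine mul_le_mul_of_nonneg_right ?_ (norm_nonneg _)
      have h1 := hCψ x
      have h2 : ‖Real.cos c‖ ≤ 1 := Real.abs_cos_le_one c
      nlinarith [norm_nonneg (ψ x), norm_nonneg (Real.cos c)]
    · rw [norm_smul, norm_mul]
      have h1 := hCP x
      have h2 : ‖Real.sin c‖ ≤ 1 := Real.abs_sin_le_one c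
      have h3 : ‖κ‖ * ‖Real.sin c‖ ≤ 1 := mul_le_one₀ hκ (norm_nonneg _) h2
      nlinarith [norm_nonneg (P x)]
  have hstep : ∀ k : ℝ, 1 ≤ k →
      (μ.prod ν).real univ * f ξ ≤ ∫ p, Q k⁻¹ p.1 p.2 ∂(μ.prod ν) := by
    intro k hk
    have hk0 : k ≠ 0 := by linarith
    have hk1 : |k⁻¹| ≤ 1 := by
      rw [abs_inv, abs_of_pos (by linarith)]
      exact inv_le_one_of_one_le₀ hk
    have hphase : ∀ c, volume.real Ω * f ξ ≤ ∫ x, Q k⁻¹ x (k * inner ℝ n x + c) ∂μ := by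
      intro c
      have hd := hasFDerivAt_oscillation hψ a n hk0 c
      have := hq ξ (fun x => (ψ x * (k⁻¹ * Real.sin (k * inner ℝ n x + c))) • a) ?_ ?_ ?_
      · simpa only [(hd _).fderiv] using this
      · have h2 : ContDiff ℝ ∞ fun x : Plane => k * inner ℝ n x + c :=
          (contDiff_const.mul ((innerSL ℝ n).contDiff)).add contDiff_const
        exact (hψ.mul (contDiff_const.mul h2.sin)).smul contDiff_const
      · exact (hψc.mul_right (f' := fun x => k⁻¹ * Real.sin (k * inner ℝ n x + c))).smul_right
          (f' := fun _ => a)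
      · refine (closure_mono fun x hx => ?_).trans hψΩ
        rw [Function.mem_support] at hx ⊢
        intro h; simp [h] at hx
    have hper : ∀ x, Function.Periodic (Q k⁻¹ x) (2 * Real.pi) := by
      intro x c; simp [hQ]
    refine le_trans (le_of_eq ?_) (le_integral_of_periodic_phase (hQc k⁻¹) (hQb _ hk1) hper
      (by fun_prop : Continuous fun x : Plane => k * inner ℝ n x) hphase)
    rw [← univ_prod_univ, measureReal_prod_prod]
    simp only [μ, ν, measureReal_restrict_apply_univ, Real.volume_real_Ioc]
    rw [sub_zero, max_eq_left hpi]; ring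
  have hlim : Tendsto (fun j : ℕ => ∫ p, Q ((j : ℝ) + 1)⁻¹ p.1 p.2 ∂(μ.prod ν)) atTop
      (𝓝 (∫ p, Q 0 p.1 p.2 ∂(μ.prod ν))) := by
    refine tendsto_integral_of_dominated_convergence (fun _ => C)
      (fun j => (hQc _).aestronglyMeasurable) (integrable_const _) (fun j => ?_) ?_
    · refine Eventually.of_forall fun p => hQb _ ?_ _ _
      rw [abs_inv, abs_of_pos (by positivity)]
      exact inv_le_one_of_one_le₀ (by linarith [(Nat.cast_nonneg j : (0 : ℝ) ≤ j)])
    · refine Eventually.of_forall fun p => ?_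
      have h3 : Tendsto (fun n : ℕ => ((n : ℝ) + 1)⁻¹) atTop (𝓝 0) :=
        (tendsto_natCast_atTop_atTop.atTop_add tendsto_const_nhds).inv_tendsto_atTop
      have h4 : Continuous fun κ => Q κ p.1 p.2 := by simp only [hQ]; fun_prop
      exact (h4.tendsto 0).comp h3
  have := ge_of_tendsto' hlim fun j => hstep ((j : ℝ) + 1) (by
    linarith [(Nat.cast_nonneg j : (0 : ℝ) ≤ j)])
  refine this.trans (le_of_eq (integral_congr_ae (Eventually.of_forall fun p => ?_)))
  change f _ = f _
  congr 1
  rw [zero_mul]; module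

/-- Quasiconvex functions are convex along rank-one lines. -/
theorem convexOn_rankOne_of_quasiconvex {Ω : Set Plane} (hΩ : IsOpen Ω)
    (hΩb : Bornology.IsBounded Ω) (hne : Ω.Nonempty) {f : Mat → ℝ} (hf : Continuous f)
    (hq : ∀ ξ, ∀ φ : Plane → Plane, ContDiff ℝ ∞ φ → HasCompactSupport φ → tsupport φ ⊆ Ω →
      volume.real Ω * f ξ ≤ ∫ y in Ω, f (ξ + fderiv ℝ φ y)) (ξ : Mat) (a n : Plane) :
    ConvexOn ℝ univ fun s : ℝ => f (ξ + s • rankOne a n) := by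
  have : IsFiniteMeasure (volume.restrict Ω) := ⟨by simpa using hΩb.measure_lt_top⟩
  obtain ⟨x₀, hx₀⟩ := hne
  obtain ⟨ψ, hψs, hψc, hψd, hψr, hψ1⟩ :=
    exists_contDiff_tsupport_subset (n := ⊤) (hΩ.mem_nhds hx₀)
  have hψd' : ContDiff ℝ ∞ ψ := hψd
  refine convexOn_of_le_average ((volume.restrict Ω).prod (volume.restrict (Ioc 0 (2 * Real.pi))))
    (w := fun p => ψ p.1 * Real.cos p.2) (B := 1) ?_ ?_ ?_ ?_ (by fun_prop) ?_
  · have := hψd.continuous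
    exact Continuous.aestronglyMeasurable (by fun_prop)
  · intro p
    rw [abs_mul]
    refine mul_le_one₀ ?_ (abs_nonneg _) (Real.abs_cos_le_one _)
    have := hψr (mem_range_self p.1)
    rw [abs_of_nonneg this.1]; exact this.2
  · rw [integral_prod_mul]
    have : ∫ c in Ioc 0 (2 * Real.pi), Real.cos c = 0 := by
      rw [← intervalIntegral.integral_of_le (by positivity)]; simp
    rw [this, mul_zero]
  · intro h0
    set V : Set (Plane × ℝ) := (Ω ∩ ψ ⁻¹' Ioi 0) ×ˢ Ioo (Real.pi / 2) (Real.pi + Real.pi / 2) with hV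
    have hVo : IsOpen V := (hΩ.inter (isOpen_Ioi.preimage hψd.continuous)).prod isOpen_Ioo
    have hVne : V.Nonempty := ⟨(x₀, Real.pi), ⟨hx₀, by simp [hψ1]⟩, by
      constructor <;> linarith [Real.pi_pos]⟩
    have hVsub : V ⊆ {p : Plane × ℝ | ψ p.1 * Real.cos p.2 < 0} := by
      rintro ⟨x, c⟩ ⟨hx, hc⟩
      exact mul_neg_of_pos_of_neg hx.2 (Real.cos_neg_of_pi_div_two_lt_of_lt hc.1 hc.2)
    have h1 := measure_mono_null hVsub h0
    rw [Measure.prod_restrict, Measure.restrict_apply hVo.measurableSet] at h1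
    have : V ∩ Ω ×ˢ Ioc 0 (2 * Real.pi) = V := by
      refine inter_eq_left.2 (prod_mono inter_subset_left fun c hc => ?_)
      constructor <;> linarith [hc.1, hc.2, Real.pi_pos]
    rw [this] at h1
    exact hVo.measure_ne_zero (volume.prod volume) hVne h1
  · intro s r _
    have := le_average_of_quasiconvex hΩb hf hq hψd' hψc hψs (ξ + s • rankOne a n) (r • a) n
    have e : rankOne (r • a) n = r • rankOne a n := by
      ext1 w; simp [rankOne_apply, smul_smul, mul_comm]
    refine this.trans (le_of_eq ?_)
    congr 1; ext p; congr 1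
    rw [e]; module

theorem fderiv_rankOne_le {f : Mat → ℝ} (hf : ContDiff ℝ 1 f) {ξ : Mat} {a n : Plane}
    (hconv : ConvexOn ℝ univ fun s : ℝ => f (ξ + s • rankOne a n)) (hnn : ∀ ξ, 0 ≤ f ξ) {p a₁ b : ℝ}
    (hp : 1 < p) (ha₁ : 0 ≤ a₁) (hb : 0 ≤ b) (hup : ∀ ξ, f ξ ≤ a₁ * ‖ξ‖ ^ p + b)
    (ha : ‖a‖ ≤ 1) (hn : ‖n‖ ≤ 1) :
    fderiv ℝ f ξ (rankOne a n) ≤ (a₁ * 2 ^ p + 1) * (‖ξ‖ + 1 + b ^ (1 / p)) ^ (p - 1) := by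
  set h := ‖ξ‖ + 1 + b ^ (1 / p) with hh
  have hbp : 0 ≤ b ^ (1 / p) := Real.rpow_nonneg hb _
  have hh0 : 0 < h := by positivity
  have hN : ‖rankOne a n‖ ≤ 1 := (norm_rankOne_le a n).trans (mul_le_one₀ ha (norm_nonneg _) hn)
  have hd : HasDerivAt (fun s : ℝ => f (ξ + s • rankOne a n)) (fderiv ℝ f ξ (rankOne a n)) 0 := by
    have h1 : HasDerivAt (fun s : ℝ => ξ + s • rankOne a n) (rankOne a n) 0 := by
      simpa using ((hasDerivAt_id (0 : ℝ)).smul_const (rankOne a n)).const_add ξ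
    have h2 := (hf.differentiable one_ne_zero).differentiableAt (x := ξ + (0 : ℝ) • rankOne a n)
    have h3 := h2.hasFDerivAt.comp_hasDerivAt (0 : ℝ) h1
    have h0 : ξ + (0 : ℝ) • rankOne a n = ξ := by module
    rw [h0] at h3
    exact h3
  have h1 := hconv.le_slope_of_hasDerivAt (mem_univ _) (mem_univ h) hh0 hd
  refine h1.trans ?_
  rw [slope_def_field, sub_zero, div_le_iff₀ hh0]
  have h0 : ξ + (0 : ℝ) • rankOne a n = ξ := by module
  rw [h0]
  have hb' : b ≤ h ^ p := by
    calc b = (b ^ (1 / p)) ^ p := by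
          rw [← Real.rpow_mul hb, one_div, inv_mul_cancel₀ (by linarith), Real.rpow_one]
      _ ≤ h ^ p := Real.rpow_le_rpow hbp (by rw [hh]; linarith [norm_nonneg ξ]) (by linarith)
  have hnorm : ‖ξ + h • rankOne a n‖ ≤ 2 * h := by
    refine (norm_add_le _ _).trans ?_
    rw [norm_smul, Real.norm_of_nonneg hh0.le]
    nlinarith [norm_nonneg ξ]
  have h2 : f (ξ + h • rankOne a n) ≤ a₁ * (2 ^ p * h ^ p) + h ^ p := by
    refine (hup _).trans (add_le_add ?_ hb')
    rw [← Real.mul_rpow (by norm_num) hh0.le]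
    exact mul_le_mul_of_nonneg_left (Real.rpow_le_rpow (norm_nonneg _) hnorm (by linarith)) ha₁
  have h3 : h ^ (p - 1) * h = h ^ p := by
    rw [← Real.rpow_add_one hh0.ne']; simp
  have h4 := hnn ξ
  rw [mul_assoc, h3]
  linarith

theorem eq_sum_rankOne (η : Mat) :
    η = ∑ i : Fin 2, rankOne (η (EuclideanSpace.single i 1)) (EuclideanSpace.single i 1) := by
  ext1 w
  have hw : w = ∑ i : Fin 2, (w i) • (EuclideanSpace.single i (1 : ℝ) : Plane) := by
    ext j; fin_cases j <;> simp
  conv_lhs => rw [hw, map_sum]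
  simp [rankOne_apply, EuclideanSpace.inner_single_left]

/-- Growth of the gradient of a quasiconvex function. -/
theorem norm_fderiv_le_of_quasiconvex {Ω : Set Plane} (hΩ : IsOpen Ω)
    (hΩb : Bornology.IsBounded Ω) (hne : Ω.Nonempty) {f : Mat → ℝ} (hf : ContDiff ℝ 1 f)
    (hq : ∀ ξ, ∀ φ : Plane → Plane, ContDiff ℝ ∞ φ → HasCompactSupport φ → tsupport φ ⊆ Ω →
      volume.real Ω * f ξ ≤ ∫ y in Ω, f (ξ + fderiv ℝ φ y)) (hnn : ∀ ξ, 0 ≤ f ξ) {p a₁ b : ℝ}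
    (hp : 1 < p) (ha₁ : 0 ≤ a₁) (hb : 0 ≤ b) (hup : ∀ ξ, f ξ ≤ a₁ * ‖ξ‖ ^ p + b) (ξ : Mat) :
    ‖fderiv ℝ f ξ‖ ≤ 2 * (a₁ * 2 ^ p + 1) * (‖ξ‖ + 1 + b ^ (1 / p)) ^ (p - 1) := by
  set C := (a₁ * 2 ^ p + 1) * (‖ξ‖ + 1 + b ^ (1 / p)) ^ (p - 1) with hC
  have hbp : 0 ≤ b ^ (1 / p) := Real.rpow_nonneg hb _
  have hC0 : 0 ≤ C := by positivity
  have hunit : ∀ a n : Plane, ‖a‖ ≤ 1 → ‖n‖ ≤ 1 → |fderiv ℝ f ξ (rankOne a n)| ≤ C := by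
    intro a n ha hn
    have hconv := fun a => convexOn_rankOne_of_quasiconvex hΩ hΩb hne hf.continuous hq ξ a n
    have h1 := fderiv_rankOne_le hf (hconv a) hnn hp ha₁ hb hup ha hn
    have h2 := fderiv_rankOne_le hf (hconv (-a)) hnn hp ha₁ hb hup (by simpa using ha) hn
    have e : rankOne (-a) n = -rankOne a n := by ext1 w; simp [rankOne_apply]
    rw [e, map_neg] at h2
    exact abs_le.2 ⟨by linarith, h1⟩
  have hgen : ∀ a n : Plane, ‖n‖ ≤ 1 → |fderiv ℝ f ξ (rankOne a n)| ≤ C * ‖a‖ := by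
    intro a n hn
    have h1 := hunit (‖a‖⁻¹ • a) n (by
      rw [norm_smul, norm_inv, norm_norm]; exact inv_mul_le_one) hn
    have e : rankOne a n = ‖a‖ • rankOne (‖a‖⁻¹ • a) n := by
      ext1 w
      rcases eq_or_ne a 0 with rfl | ha
      · simp [rankOne_apply]
      · simp only [rankOne_apply, smul_apply, smul_comm (‖a‖)]
        rw [inv_smul_smul₀ (norm_ne_zero_iff.2 ha)]
    rw [e, map_smul, smul_eq_mul, abs_mul, abs_norm, mul_comm C]
    exact mul_le_mul_of_nonneg_left h1 (norm_nonneg _)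
  refine ContinuousLinearMap.opNorm_le_bound _ (by positivity) fun η => ?_
  have hs : ∀ i : Fin 2, |fderiv ℝ f ξ (rankOne (η (EuclideanSpace.single i 1))
      (EuclideanSpace.single i 1))| ≤ C * ‖η‖ := by
    intro i
    refine (hgen _ _ (by simp)).trans (mul_le_mul_of_nonneg_left ?_ hC0)
    simpa using η.le_opNorm (EuclideanSpace.single i 1)
  conv_lhs => rw [eq_sum_rankOne η]
  rw [map_sum, Fin.sum_univ_two]
  refine (norm_add_le _ _).trans ?_
  have h0 := hs 0
  have h1 := hs 1
  simp only [Real.norm_eq_abs]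
  rw [mul_assoc 2, ← hC]
  linarith

end RankOne

section TimeFamilies

variable {E V : Type*} [NormedAddCommGroup E] [NormedSpace ℝ E] [FiniteDimensional ℝ E]
  [NormedAddCommGroup V] [NormedSpace ℝ V]

/-- Lebesgue measure on the time interval. -/
noncomputable abbrev timeMeasure (T : ℝ) : Measure ℝ := volume.restrict (Icc 0 T)

theorem ae_timeMeasure_mem (T : ℝ) : ∀ᵐ t ∂timeMeasure T, t ∈ Icc 0 T :=
  ae_restrict_mem measurableSet_Icc

/-- The integral identity for a family differentiable in time holds for all values of the
space variable at once. -/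
theorem ae_forall_sub_eq_integral {T : ℝ} {μ : Measure Plane} [IsFiniteMeasure μ]
    {f fdot : ℝ → Plane → E → V} {σ : ℝ} (hσ : 0 ≤ σ) {a : ℝ → ℝ≥0∞} {b : ℝ × Plane → ℝ≥0∞}
    (ha : AEMeasurable a (timeMeasure T)) (hai : ∫⁻ t, a t ∂timeMeasure T ≠ ⊤)
    (hb : AEMeasurable b ((timeMeasure T).prod μ)) (hbi : ∫⁻ p, b p ∂((timeMeasure T).prod μ) ≠ ⊤)
    (hmeas : ∀ z, AEStronglyMeasurable (fun p : ℝ × Plane => fdot p.1 p.2 z)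
      ((timeMeasure T).prod μ))
    (hf : ∀ᵐ x ∂μ, ∀ t ∈ Icc 0 T, Continuous (f t x))
    (hfdot : ∀ᵐ x ∂μ, ∀ t ∈ Icc 0 T, Continuous (fdot t x))
    (hbound : ∀ᵐ x ∂μ, ∀ t ∈ Icc 0 T, ∀ z, ‖fdot t x z‖ₑ ≤ a t * ‖z‖ₑ ^ σ + b (t, x))
    (heq : ∀ t ∈ Icc 0 T, ∀ z, ∀ᵐ x ∂μ, f t x z = f 0 x z + ∫ s in 0..t, fdot s x z)
    {t t' : ℝ} (ht : t ∈ Icc 0 T) (ht' : t' ∈ Icc 0 T) :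
    ∀ᵐ x ∂μ, ∀ z, Integrable (fun s => fdot s x z) (timeMeasure T) ∧
      f t' x z - f t x z = ∫ s in t..t', fdot s x z := by
  have := FiniteDimensional.proper_real E
  obtain ⟨D, hDc, hDd⟩ := TopologicalSpace.exists_countable_dense E
  have hT : 0 ≤ T := ht.1.trans ht.2
  have hbfin : ∀ᵐ x ∂μ, ∫⁻ s, b (s, x) ∂timeMeasure T < ⊤ := by
    refine ae_lt_top' hb.prod_swap.lintegral_prod_right' ?_
    rwa [← lintegral_prod_symm _ hb]
  have hbm : ∀ᵐ x ∂μ, AEMeasurable (fun s => b (s, x)) (timeMeasure T) :=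
    hb.aestronglyMeasurable.prodMk_right.mono fun x hx => hx.aemeasurable
  have hm : ∀ᵐ x ∂μ, ∀ z ∈ D, AEStronglyMeasurable (fun s => fdot s x z) (timeMeasure T) :=
    (ae_ball_iff hDc).2 fun z _ => (hmeas z).prodMk_right
  have h1 : ∀ᵐ x ∂μ, ∀ z ∈ D, f t x z = f 0 x z + ∫ s in 0..t, fdot s x z :=
    (ae_ball_iff hDc).2 fun z _ => heq t ht z
  have h2 : ∀ᵐ x ∂μ, ∀ z ∈ D, f t' x z = f 0 x z + ∫ s in 0..t', fdot s x z :=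
    (ae_ball_iff hDc).2 fun z _ => heq t' ht' z
  filter_upwards [hbfin, hbm, hm, h1, h2, hf, hfdot, hbound] with x hbx hbmx hmx h1x h2x hfx hfdx hbdx
  have hM : ∀ z, AEStronglyMeasurable (fun s => fdot s x z) (timeMeasure T) := by
    intro z
    obtain ⟨w, hw, hwz⟩ := mem_closure_iff_seq_limit.1 (hDd z)
    refine aestronglyMeasurable_of_tendsto_ae atTop (fun n => hmx (w n) (hw n)) ?_
    filter_upwards [ae_timeMeasure_mem T] with s hs
    exact ((hfdx s hs).tendsto z).comp hwz
  have hfin : ∀ R : ℝ≥0∞, R ≠ ⊤ → ∫⁻ s, (a s * R ^ σ + b (s, x)) ∂timeMeasure T ≠ ⊤ := by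
    intro R hR
    rw [lintegral_add_left' (ha.mul_const _), lintegral_mul_const'' _ ha]
    exact ENNReal.add_ne_top.2 ⟨ENNReal.mul_ne_top hai
      (ENNReal.rpow_ne_top_of_nonneg hσ hR), hbx.ne⟩
  have hI : ∀ z, Integrable (fun s => fdot s x z) (timeMeasure T) := by
    intro z
    refine ⟨hM z, lt_of_le_of_lt (lintegral_mono_ae ?_) (hfin ‖z‖ₑ enorm_ne_top).lt_top⟩
    filter_upwards [ae_timeMeasure_mem T] with s hs using hbdx s hs z
  have hle : ∀ τ ∈ Icc 0 T, volume.restrict (Ioc 0 τ) ≤ timeMeasure T := fun τ hτ =>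
    Measure.restrict_mono (Ioc_subset_Icc_self.trans (Icc_subset_Icc_right hτ.2)) le_rfl
  have hC : ∀ τ ∈ Icc 0 T, Continuous fun z => ∫ s in 0..τ, fdot s x z := by
    intro τ hτ
    rw [continuous_iff_continuousAt]
    intro z₀
    have e : (fun z => ∫ s in 0..τ, fdot s x z) =
        fun z => ∫ s, fdot s x z ∂volume.restrict (Ioc 0 τ) := by
      ext z; rw [intervalIntegral.integral_of_le hτ.1]
    rw [e]
    have hR : ‖z₀‖ₑ + 1 ≠ ⊤ := by simp
    refine continuousAt_of_dominated
      (bound := fun s => (a s * (‖z₀‖ₑ + 1) ^ σ + b (s, x)).toReal)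
      (Eventually.of_forall fun z => (hM z).mono_measure (hle τ hτ)) ?_ ?_ ?_
    · have hball : ∀ᶠ z in 𝓝 z₀, ‖z‖ₑ ≤ ‖z₀‖ₑ + 1 := by
        filter_upwards [Metric.ball_mem_nhds z₀ one_pos] with z hz
        rw [mem_ball_iff_norm] at hz
        have : ‖z‖ ≤ ‖z₀‖ + 1 := by linarith [norm_le_norm_add_norm_sub' z z₀]
        rw [← ofReal_norm, ← ofReal_norm, ← ENNReal.ofReal_one,
          ← ENNReal.ofReal_add (norm_nonneg _) zero_le_one]
        exact ENNReal.ofReal_le_ofReal this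
      filter_upwards [hball] with z hz
      refine ae_mono (hle τ hτ) ?_
      filter_upwards [ae_timeMeasure_mem T, ae_lt_top' ((ha.mul_const _).add hbmx) (hfin _ hR)]
        with s hs hlt
      rw [← toReal_enorm]
      refine ENNReal.toReal_mono hlt.ne ((hbdx s hs z).trans ?_)
      gcongr
    · exact (integrable_toReal_of_lintegral_ne_top ((ha.mul_const _).add hbmx)
        (hfin _ hR)).mono_measure (hle τ hτ)
    · refine ae_mono (hle τ hτ) ?_
      filter_upwards [ae_timeMeasure_mem T] with s hs
      exact (hfdx s hs).continuousAt
  have hall : ∀ τ ∈ Icc 0 T, (∀ z ∈ D, f τ x z = f 0 x z + ∫ s in 0..τ, fdot s x z) →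
      ∀ z, f τ x z = f 0 x z + ∫ s in 0..τ, fdot s x z := fun τ hτ h z =>
    congrFun (Continuous.ext_on hDd (hfx τ hτ)
      ((hfx 0 ⟨le_rfl, hT⟩).add (hC τ hτ)) h) z
  intro z
  refine ⟨hI z, ?_⟩
  have hii : ∀ τ ∈ Icc 0 T, IntervalIntegrable (fun s => fdot s x z) volume 0 τ := fun τ hτ =>
    (intervalIntegrable_iff_integrableOn_Ioc_of_le hτ.1).2 ((hI z).mono_measure (hle τ hτ))
  rw [hall t ht h1x z, hall t' ht' h2x z, add_sub_add_left_eq_sub,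
    intervalIntegral.integral_interval_sub_left (hii t' ht') (hii t ht)]

end TimeFamilies

section Growth

variable {E V : Type*} [NormedAddCommGroup E] [NormedSpace ℝ E] [FiniteDimensional ℝ E]
  [NormedAddCommGroup V]

theorem lintegral_growth_mul_le {μ : Measure Plane} {ρ : ℝ} (hρ : 1 < ρ) (a : ℝ≥0∞)
    {U b V : Plane → ℝ≥0∞} (hU : AEMeasurable U μ) (hb : AEMeasurable b μ) (hV : AEMeasurable V μ) :
    ∫⁻ x, (a * U x ^ (ρ - 1) + b x) * V x ∂μ ≤
      (a * (∫⁻ x, U x ^ ρ ∂μ) ^ ((ρ - 1) / ρ) +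
        (∫⁻ x, b x ^ (ρ / (ρ - 1)) ∂μ) ^ ((ρ - 1) / ρ)) * (∫⁻ x, V x ^ ρ ∂μ) ^ (1 / ρ) := by
  have h1 : 0 < ρ - 1 := by linarith
  have e : ∀ x, (a * U x ^ (ρ - 1) + b x) * V x =
      a * (U x ^ (ρ - 1) * V x) + (b x ^ (1 / (ρ - 1))) ^ (ρ - 1) * V x := by
    intro x
    rw [← ENNReal.rpow_mul, one_div, inv_mul_cancel₀ h1.ne', ENNReal.rpow_one]; ring
  simp_rw [e]
  have hUV : AEMeasurable (fun x => U x ^ (ρ - 1) * V x) μ := (hU.pow_const _).mul hV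
  rw [lintegral_add_left' (hUV.const_mul a), lintegral_const_mul'' _ hUV, add_mul, mul_assoc]
  gcongr
  · exact lintegral_rpow_sub_one_mul_le hρ hU hV
  · refine (lintegral_rpow_sub_one_mul_le hρ (hb.pow_const _) hV).trans (le_of_eq ?_)
    simp_rw [← ENNReal.rpow_mul]
    congr 4; ext x; congr 1; field_simp

theorem rpow_sub_one_le_one_add_rpow {ρ : ℝ} (hρ : 1 < ρ) (x : ℝ≥0∞) :
    x ^ (ρ - 1) ≤ 1 + x ^ ρ := by
  rcases le_total x 1 with h | h
  · exact (ENNReal.rpow_le_one h (by linarith)).trans le_self_add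
  · exact (ENNReal.rpow_le_rpow_of_exponent_le h (by linarith)).trans le_add_self

/-- The superposition operator of a Carathéodory function of growth `ρ - 1` is continuous from `L^ρ`
to `L¹`, uniformly with respect to the perturbation on bounded sets. -/
theorem exists_modulus_of_growth {μ : Measure Plane} [IsFiniteMeasure μ] {ρ : ℝ} (hρ : 1 < ρ)
    {ψ : Plane → E → V} (hm : ∀ z, AEStronglyMeasurable (fun x => ψ x z) μ)
    (hc : ∀ᵐ x ∂μ, Continuous (ψ x)) {a : ℝ≥0} {b : Plane → ℝ≥0∞} (hb : AEMeasurable b μ)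
    (hbi : ∫⁻ x, b x ∂μ ≠ ⊤) (hg : ∀ᵐ x ∂μ, ∀ z, ‖ψ x z‖ₑ ≤ a * ‖z‖ₑ ^ (ρ - 1) + b x)
    (C : ℝ≥0) {η : ℝ≥0∞} (hη : η ≠ 0) :
    ∃ σ : ℝ, 0 < σ ∧ ∀ u v : Plane → E, AEStronglyMeasurable u μ → AEStronglyMeasurable v μ →
      eLpNorm u (ENNReal.ofReal ρ) μ ≤ C → eLpNorm v (ENNReal.ofReal ρ) μ ≤ ENNReal.ofReal σ →
      ∫⁻ x, ‖ψ x (u x + v x) - ψ x (u x)‖ₑ ∂μ ≤ η := by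
  have hρ0 : 0 < ρ := by linarith
  have := FiniteDimensional.proper_real E
  by_contra! hcon
  have hseq : ∀ n : ℕ, ∃ u v : Plane → E, AEStronglyMeasurable u μ ∧ AEStronglyMeasurable v μ ∧
      eLpNorm u (ENNReal.ofReal ρ) μ ≤ C ∧
      eLpNorm v (ENNReal.ofReal ρ) μ ≤ ENNReal.ofReal (1 / ((n : ℝ) + 1)) ∧
      η < ∫⁻ x, ‖ψ x (u x + v x) - ψ x (u x)‖ₑ ∂μ := fun n => hcon _ (by positivity)
  choose u v hu hv huC hvn hbig using hseq
  -- pass to a subsequence along which `v` tends to zero almost everywhere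
  have hvlim : Tendsto (fun n => eLpNorm (v n - 0) (ENNReal.ofReal ρ) μ) atTop (𝓝 0) := by
    have h1 : Tendsto (fun n : ℕ => ENNReal.ofReal (1 / ((n : ℝ) + 1))) atTop (𝓝 0) := by
      rw [← ENNReal.ofReal_zero]
      exact ENNReal.tendsto_ofReal tendsto_one_div_add_atTop_nhds_zero_nat
    refine tendsto_of_tendsto_of_tendsto_of_le_of_le tendsto_const_nhds h1
      (fun _ => zero_le) fun n => ?_
    simpa using hvn n
  obtain ⟨ns, hns, hae⟩ := (tendstoInMeasure_of_tendsto_eLpNorm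
    (by simpa using hρ0) (fun n => hv n) aestronglyMeasurable_zero hvlim).exists_seq_tendsto_ae
  set m : ℕ → Plane → ℝ≥0∞ := fun n x => ‖u n x‖ₑ + ‖v n x‖ₑ with hmdef
  have hmm : ∀ n, AEMeasurable (m n) μ := fun n => (hu n).enorm.add (hv n).enorm
  set K : ℝ≥0∞ := ((C : ℝ≥0∞) + 1) ^ ρ with hK
  have hKtop : K ≠ ⊤ := ENNReal.rpow_ne_top_of_nonneg hρ0.le (by simp)
  have hmK : ∀ n, ∫⁻ x, m n x ^ ρ ∂μ ≤ K := by
    intro n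
    have h1 := ENNReal.lintegral_Lp_add_le (hu n).enorm (hv n).enorm hρ.le
    rw [← eLpNorm_ofReal_eq hρ0, ← eLpNorm_ofReal_eq hρ0] at h1
    have h2 : eLpNorm (v n) (ENNReal.ofReal ρ) μ ≤ 1 := by
      refine (hvn n).trans ?_
      rw [← ENNReal.ofReal_one]
      refine ENNReal.ofReal_le_ofReal ?_
      rw [div_le_one (by positivity)]
      linarith [(Nat.cast_nonneg n : (0 : ℝ) ≤ n)]
    have h3 := ENNReal.rpow_le_rpow (h1.trans (add_le_add (huC n) h2)) hρ0.le
    rw [← ENNReal.rpow_mul, one_div, inv_mul_cancel₀ hρ0.ne', ENNReal.rpow_one] at h3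
    exact h3
  set d : ℕ → Plane → ℝ≥0∞ := fun n x => ‖ψ x (u n x + v n x) - ψ x (u n x)‖ₑ with hd
  have hdm : ∀ n, AEMeasurable (d n) μ := fun n =>
    ((aestronglyMeasurable_caratheodory hm hc ((hu n).add (hv n))).sub
      (aestronglyMeasurable_caratheodory hm hc (hu n))).enorm
  have hdb : ∀ n, ∀ᵐ x ∂μ, d n x ≤ 2 * (a * m n x ^ (ρ - 1) + b x) := by
    intro n
    filter_upwards [hg] with x hx
    have h1 := hx (u n x + v n x)
    have h2 := hx (u n x)
    have h3 : ‖u n x + v n x‖ₑ ≤ m n x := enorm_add_le _ _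
    have h4 : ‖u n x‖ₑ ≤ m n x := le_self_add
    calc d n x ≤ ‖ψ x (u n x + v n x)‖ₑ + ‖ψ x (u n x)‖ₑ := enorm_sub_le
      _ ≤ (a * m n x ^ (ρ - 1) + b x) + (a * m n x ^ (ρ - 1) + b x) := by
          refine add_le_add (h1.trans ?_) (h2.trans ?_) <;> gcongr
      _ = _ := (two_mul _).symm
  -- the set where `m` is large contributes little
  have hη4 : η / 8 ≠ 0 := by simp [hη]
  obtain ⟨δ, hδ, hδb⟩ := exists_pos_setLIntegral_lt_of_measure_lt hbi hη4
  have hKR : Tendsto (fun n : ℕ => K / (n : ℝ≥0∞)) atTop (𝓝 0) := by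
    have := ENNReal.Tendsto.const_div (a := K) ENNReal.tendsto_nat_nhds_top (Or.inr hKtop)
    simpa using this
  have hKa : Tendsto (fun n : ℕ => (a : ℝ≥0∞) * (K / (n : ℝ≥0∞))) atTop (𝓝 0) := by
    have := ENNReal.Tendsto.const_mul (a := (a : ℝ≥0∞)) hKR (Or.inr (by simp))
    simpa using this
  obtain ⟨R, hRδ, hRa, hR1⟩ := ((hKR.eventually (gt_mem_nhds hδ)).and
    ((hKa.eventually (gt_mem_nhds (pos_iff_ne_zero.2 hη4))).and (eventually_ge_atTop 1))).exists
  have hR1' : (1 : ℝ≥0∞) ≤ R := by exact_mod_cast hR1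
  have hR0 : (R : ℝ≥0∞) ≠ 0 := (zero_lt_one.trans_le hR1').ne'
  have hRt : (R : ℝ≥0∞) ≠ ⊤ := ENNReal.natCast_ne_top R
  -- measurable representatives of the sets `{m > R}`
  set S : ℕ → Set Plane := fun n => {x | (R : ℝ≥0∞) < (hmm n).mk _ x} with hS
  have hSm : ∀ n, MeasurableSet (S n) := fun n =>
    measurableSet_lt measurable_const (hmm n).measurable_mk
  have hSae : ∀ n, ∀ᵐ x ∂μ, x ∈ S n ↔ (R : ℝ≥0∞) < m n x := fun n => by
    filter_upwards [(hmm n).ae_eq_mk] with x hx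
    change (R : ℝ≥0∞) < (hmm n).mk _ x ↔ _
    rw [hx]
  have hSbig : ∀ n, ∀ s : ℝ, 0 ≤ s → s + 1 ≤ ρ → ∫⁻ x in S n, m n x ^ s ∂μ ≤ K / R := by
    intro n s hs hsρ
    rw [ENNReal.le_div_iff_mul_le (Or.inl hR0) (Or.inl hRt), ← lintegral_mul_const' _ _ hRt]
    refine le_trans (lintegral_mono_ae ?_) ((setLIntegral_le_lintegral _ _).trans (hmK n))
    filter_upwards [ae_restrict_mem (hSm n), ae_restrict_of_ae (hSae n)] with x hx hx'
    have hlt := hx'.1 hx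
    calc m n x ^ s * R ≤ m n x ^ s * m n x ^ (1 : ℝ) := by
          rw [ENNReal.rpow_one]; gcongr
      _ = m n x ^ (s + 1) := (ENNReal.rpow_add_of_nonneg _ _ hs zero_le_one).symm
      _ ≤ m n x ^ ρ := ENNReal.rpow_le_rpow_of_exponent_le (hR1'.trans hlt.le) hsρ
  have hSbad : ∀ n, ∫⁻ x in S n, d n x ∂μ ≤ η / 2 := by
    intro n
    have h1 : μ (S n) < δ := by
      refine lt_of_le_of_lt ?_ hRδ
      have := hSbig n 0 le_rfl (by linarith)
      simpa using this
    calc ∫⁻ x in S n, d n x ∂μ ≤ ∫⁻ x in S n, 2 * (a * m n x ^ (ρ - 1) + b x) ∂μ :=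
          lintegral_mono_ae (ae_restrict_of_ae (hdb n))
      _ = 2 * (a * ∫⁻ x in S n, m n x ^ (ρ - 1) ∂μ + ∫⁻ x in S n, b x ∂μ) := by
          rw [lintegral_const_mul' _ _ (by simp),
            lintegral_add_right' _ hb.restrict, lintegral_const_mul' _ _ (by simp)]
      _ ≤ 2 * (η / 8 + η / 8) := by
          gcongr
          · exact (mul_le_mul_right (hSbig n (ρ - 1) (by linarith) (by linarith)) _).trans hRa.le
          · exact (hδb _ h1).le
      _ = η / 2 := by
          rw [← two_mul, ← mul_assoc]
          rw [ENNReal.div_eq_inv_mul, ENNReal.div_eq_inv_mul, ← mul_assoc]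
          congr 1
          rw [show (8 : ℝ≥0∞) = 2 * 2 * 2 by norm_num, ENNReal.mul_inv (Or.inr (by simp)) (Or.inr (by simp)),
            ← mul_assoc, ENNReal.mul_inv_cancel (by simp) (by finiteness), one_mul]
  -- on the rest use dominated convergence
  have hgood : Tendsto (fun k => ∫⁻ x, (S (ns k))ᶜ.indicator (d (ns k)) x ∂μ) atTop (𝓝 0) := by
    have h0 : (0 : ℝ≥0∞) = ∫⁻ _x : Plane, 0 ∂μ := by simp
    rw [h0]
    refine tendsto_lintegral_of_dominated_convergence'
      (fun x => 2 * (a * (R : ℝ≥0∞) ^ (ρ - 1) + b x))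
      (fun k => (hdm _).indicator (hSm _).compl) (fun k => ?_) ?_ ?_
    · filter_upwards [hdb (ns k), hSae (ns k)] with x hx hx'
      by_cases hxS : x ∈ S (ns k)
      · simp [hxS]
      · rw [indicator_of_mem (by exact hxS)]
        refine hx.trans ?_
        have : m (ns k) x ≤ R := not_lt.1 fun h => hxS (hx'.2 h)
        have : (0 : ℝ) ≤ ρ - 1 := by linarith
        gcongr
    · rw [lintegral_const_mul' _ _ (by simp), lintegral_add_right' _ hb]
      refine ENNReal.mul_ne_top (by simp) (ENNReal.add_ne_top.2 ⟨?_, hbi⟩)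
      rw [lintegral_const]
      exact ENNReal.mul_ne_top (ENNReal.mul_ne_top (by simp)
        (ENNReal.rpow_ne_top_of_nonneg (by linarith) hRt)) (measure_ne_top _ _)
    · filter_upwards [hae, hc, ae_all_iff.2 hSae] with x hx hcx hSx
      have hunif := ((isCompact_closedBall (0 : E) R).uniformContinuousOn_of_continuous
        hcx.continuousOn)
      rw [ENNReal.tendsto_nhds_zero]
      intro ε hε
      obtain ⟨ε', hε'0, hε'⟩ : ∃ ε' : ℝ, 0 < ε' ∧ ENNReal.ofReal ε' ≤ ε := by
        rcases eq_or_ne ε ⊤ with rfl | h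
        · exact ⟨1, one_pos, le_top⟩
        · exact ⟨ε.toReal, ENNReal.toReal_pos hε.ne' h, by rw [ENNReal.ofReal_toReal h]⟩
      obtain ⟨r, hr0, hr⟩ := Metric.uniformContinuousOn_iff.1 hunif ε' hε'0
      have hx0 : Tendsto (fun k => v (ns k) x) atTop (𝓝 0) := hx
      filter_upwards [hx0 (Metric.ball_mem_nhds 0 hr0)] with k hk
      by_cases hxS : x ∈ S (ns k)
      · simp [hxS]
      rw [indicator_of_mem (by exact hxS)]
      have hmR : m (ns k) x ≤ R := not_lt.1 fun h => hxS ((hSx (ns k)).2 h)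
      have hto : ∀ w : E, ‖w‖ₑ ≤ R → w ∈ Metric.closedBall (0 : E) R := by
        intro w hw
        rw [mem_closedBall_zero_iff]
        have := ENNReal.toReal_mono hRt hw
        simpa using this
      have hk' : ‖v (ns k) x‖ < r := by simpa using hk
      have h1 := hr (u (ns k) x + v (ns k) x) (hto _ ((enorm_add_le _ _).trans hmR))
        (u (ns k) x) (hto _ (le_self_add.trans hmR)) (by simpa [dist_eq_norm] using hk')
      rw [dist_eq_norm] at h1
      refine le_trans ?_ hε'
      change ‖_‖ₑ ≤ _
      rw [← ofReal_norm]
      exact ENNReal.ofReal_le_ofReal h1.le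
  have hη2 : 0 < η / 2 := by simp [pos_iff_ne_zero, hη]
  obtain ⟨k, hk⟩ := (hgood.eventually (gt_mem_nhds hη2)).exists
  refine absurd (hbig (ns k)) (not_lt.2 ?_)
  change ∫⁻ x, d (ns k) x ∂μ ≤ η
  rw [← lintegral_add_compl _ (hSm (ns k)), ← lintegral_indicator (hSm (ns k)).compl]
  exact (add_le_add (hSbad _) hk.le).trans (ENNReal.add_halves η).le

end Growth

section Potentials

variable {E : Type*} [NormedAddCommGroup E] [NormedSpace ℝ E] [FiniteDimensional ℝ E]

/-- A time-dependent potential of growth `ρ` on a measure space, together with its time derivative: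
what the bulk energy and the potentials of the body and surface forces have in common. -/
structure IsPotential (T ρ : ℝ) (μ : Measure Plane) (Φ Φdot : ℝ → Plane → E → ℝ) : Prop where
  one_lt : 1 < ρ
  meas : ∀ z, AEStronglyMeasurable (fun p : ℝ × Plane => Φ p.1 p.2 z) ((timeMeasure T).prod μ)
  meas_at : ∀ t ∈ Icc 0 T, ∀ z, AEStronglyMeasurable (fun x => Φ t x z) μ
  meas_dot : ∀ z, AEStronglyMeasurable (fun p : ℝ × Plane => Φdot p.1 p.2 z)
    ((timeMeasure T).prod μ)
  smooth : ∀ᵐ x ∂μ, ∀ t ∈ Icc 0 T, ContDiff ℝ 1 (Φ t x)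
  smooth_dot : ∀ᵐ x ∂μ, ∀ t ∈ Icc 0 T, ContDiff ℝ 1 (Φdot t x)
  eq_integral : ∀ t ∈ Icc 0 T, ∀ z, ∀ᵐ x ∂μ, Φ t x z = Φ 0 x z + ∫ s in 0..t, Φdot s x z
  fderiv_eq_integral : ∀ t ∈ Icc 0 T, ∀ z, ∀ᵐ x ∂μ,
    fderiv ℝ (Φ t x) z = fderiv ℝ (Φ 0 x) z + ∫ s in 0..t, fderiv ℝ (Φdot s x) z
  integrable_zero : ∀ t ∈ Icc 0 T, Integrable (fun x => Φ t x 0) μ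
  bound_fderiv : ∃ (a : ℝ≥0) (b : ℝ → Plane → ℝ≥0∞) (B : ℝ≥0), ∀ t ∈ Icc 0 T,
    AEMeasurable (b t) μ ∧ ∫⁻ x, b t x ^ (ρ / (ρ - 1)) ∂μ ≤ B ∧
      ∀ᵐ x ∂μ, ∀ z, ‖fderiv ℝ (Φ t x) z‖ₑ ≤ a * ‖z‖ₑ ^ (ρ - 1) + b t x
  bound_dot : ∃ (a : ℝ → ℝ≥0∞) (b : ℝ × Plane → ℝ≥0∞),
    AEMeasurable a (timeMeasure T) ∧ ∫⁻ t, a t ∂timeMeasure T ≠ ⊤ ∧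
    AEMeasurable b ((timeMeasure T).prod μ) ∧ ∫⁻ p, b p ∂((timeMeasure T).prod μ) ≠ ⊤ ∧
    ∀ᵐ x ∂μ, ∀ t ∈ Icc 0 T, ∀ z, ‖Φdot t x z‖ₑ ≤ a t * ‖z‖ₑ ^ ρ + b (t, x)
  bound_fderiv_dot : ∃ (a : ℝ → ℝ≥0∞) (b : ℝ × Plane → ℝ≥0∞),
    AEMeasurable a (timeMeasure T) ∧ ∫⁻ t, a t ∂timeMeasure T ≠ ⊤ ∧
    AEMeasurable b ((timeMeasure T).prod μ) ∧ ∫⁻ p, b p ∂((timeMeasure T).prod μ) ≠ ⊤ ∧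
    ∀ᵐ x ∂μ, ∀ t ∈ Icc 0 T, ∀ z, ‖fderiv ℝ (Φdot t x) z‖ₑ ≤ a t * ‖z‖ₑ ^ (ρ - 1) + b (t, x)

variable {T ρ : ℝ} {μ : Measure Plane} {Φ Φdot : ℝ → Plane → E → ℝ}

theorem enorm_sub_le_of_enorm_fderiv_le {f : E → ℝ} (hf : ContDiff ℝ 1 f) {z : E} {K : ℝ≥0∞}
    (hK : ∀ y, ‖y‖ ≤ ‖z‖ → ‖fderiv ℝ f y‖ₑ ≤ K) : ‖f z - f 0‖ₑ ≤ K * ‖z‖ₑ := by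
  rcases eq_or_ne z 0 with rfl | hz
  · simp
  rcases eq_or_ne K ⊤ with rfl | hKt
  · rw [ENNReal.top_mul (by simpa using hz)]; exact le_top
  have h := Convex.norm_image_sub_le_of_norm_fderiv_le (𝕜 := ℝ) (f := f) (C := K.toReal)
    (s := Metric.closedBall 0 ‖z‖) (x := 0) (y := z)
    (fun y _ => (hf.differentiable one_ne_zero).differentiableAt)
    (fun y hy => by
      rw [← toReal_enorm]
      exact ENNReal.toReal_mono hKt (hK y (by simpa using hy)))
    (convex_closedBall _ _) (by simp) (by simp)
  rw [sub_zero] at h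
  rw [← ofReal_norm, ← ofReal_norm (x := z), ← ENNReal.ofReal_toReal hKt,
    ← ENNReal.ofReal_mul ENNReal.toReal_nonneg]
  exact ENNReal.ofReal_le_ofReal h

theorem lintegral_rpow_sub_one_le [IsFiniteMeasure μ] (hρ : 1 < ρ) (u : Plane → E) :
    ∫⁻ x, ‖u x‖ₑ ^ (ρ - 1) ∂μ ≤ μ univ + eLpNorm u (ENNReal.ofReal ρ) μ ^ ρ := by
  rw [← lintegral_rpow_enorm_eq (by linarith)]
  refine (lintegral_mono fun x => rpow_sub_one_le_one_add_rpow hρ _).trans ?_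
  rw [lintegral_add_left measurable_const]
  simp

theorem lintegral_enorm_le_eLpNorm [IsFiniteMeasure μ] (hρ : 1 < ρ) {w : Plane → E}
    (hw : AEStronglyMeasurable w μ) :
    ∫⁻ x, ‖w x‖ₑ ∂μ ≤ eLpNorm w (ENNReal.ofReal ρ) μ * (μ univ) ^ (1 - 1 / ρ) := by
  have := eLpNorm_le_eLpNorm_mul_rpow_measure_univ (p := 1) (q := ENNReal.ofReal ρ) (μ := μ)
    (by simpa using hρ.le) hw
  rw [eLpNorm_one_eq_lintegral_enorm] at this
  simpa [ENNReal.toReal_ofReal (by linarith : 0 ≤ ρ)] using this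

namespace IsPotential

theorem smooth_at (h : IsPotential T ρ μ Φ Φdot) {t : ℝ} (ht : t ∈ Icc 0 T) : ∀ᵐ x ∂μ, ContDiff ℝ 1 (Φ t x) :=
  h.smooth.mono fun _ hx => hx t ht

theorem aesm_at (h : IsPotential T ρ μ Φ Φdot) {t : ℝ} (ht : t ∈ Icc 0 T) {u : Plane → E} (hu : AEStronglyMeasurable u μ) :
    AEStronglyMeasurable (fun x => Φ t x (u x)) μ :=
  aestronglyMeasurable_caratheodory (h.meas_at t ht) ((h.smooth_at ht).mono fun _ hx => hx.continuous)
    hu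

theorem aesm_fderiv_at (h : IsPotential T ρ μ Φ Φdot) {t : ℝ} (ht : t ∈ Icc 0 T) {u : Plane → E}
    (hu : AEStronglyMeasurable u μ) : AEStronglyMeasurable (fun x => fderiv ℝ (Φ t x) (u x)) μ :=
  aestronglyMeasurable_fderiv_comp (h.meas_at t ht) (h.smooth_at ht) hu

theorem ae_prod_smooth (h : IsPotential T ρ μ Φ Φdot) [IsFiniteMeasure μ] :
    ∀ᵐ p : ℝ × Plane ∂((timeMeasure T).prod μ), ContDiff ℝ 1 (Φ p.1 p.2) ∧
      ContDiff ℝ 1 (Φdot p.1 p.2) := by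
  have h1 : ∀ᵐ p : ℝ × Plane ∂((timeMeasure T).prod μ), p.1 ∈ Icc 0 T :=
    Measure.quasiMeasurePreserving_fst.ae (ae_timeMeasure_mem T)
  have h2 : ∀ᵐ p : ℝ × Plane ∂((timeMeasure T).prod μ), (∀ t ∈ Icc 0 T, ContDiff ℝ 1 (Φ t p.2)) ∧
      (∀ t ∈ Icc 0 T, ContDiff ℝ 1 (Φdot t p.2)) :=
    Measure.quasiMeasurePreserving_snd.ae (h.smooth.and h.smooth_dot)
  filter_upwards [h1, h2] with p hp1 hp2
  exact ⟨hp2.1 _ hp1, hp2.2 _ hp1⟩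

theorem aesm_dot_prod (h : IsPotential T ρ μ Φ Φdot) [IsFiniteMeasure μ] {u : Plane → E} (hu : AEStronglyMeasurable u μ) :
    AEStronglyMeasurable (fun p : ℝ × Plane => Φdot p.1 p.2 (u p.2)) ((timeMeasure T).prod μ) :=
  aestronglyMeasurable_caratheodory (f := fun p : ℝ × Plane => Φdot p.1 p.2) h.meas_dot
    (h.ae_prod_smooth.mono fun _ hx => hx.2.continuous) hu.comp_snd

theorem aesm_fderiv_prod (h : IsPotential T ρ μ Φ Φdot) [IsFiniteMeasure μ] {u : Plane → E} (hu : AEStronglyMeasurable u μ) :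
    AEStronglyMeasurable (fun p : ℝ × Plane => fderiv ℝ (Φ p.1 p.2) (u p.2))
      ((timeMeasure T).prod μ) :=
  aestronglyMeasurable_fderiv_comp (f := fun p : ℝ × Plane => Φ p.1 p.2) h.meas
    (h.ae_prod_smooth.mono fun _ hx => hx.1) hu.comp_snd

/-- The derivative of the potential maps bounded sets of `L^ρ` to bounded sets of the dual. -/
theorem exists_pairing_bound (h : IsPotential T ρ μ Φ Φdot) (C : ℝ≥0) : ∃ κ : ℝ≥0, ∀ t ∈ Icc 0 T, ∀ u : Plane → E,
    AEStronglyMeasurable u μ → eLpNorm u (ENNReal.ofReal ρ) μ ≤ C → ∀ w : Plane → ℝ≥0∞,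
      AEMeasurable w μ → ∫⁻ x, ‖fderiv ℝ (Φ t x) (u x)‖ₑ * w x ∂μ ≤
        κ * (∫⁻ x, w x ^ ρ ∂μ) ^ (1 / ρ) := by
  have hρ := h.one_lt
  have hρ0 : 0 < ρ := by linarith
  have hρ1 : 0 < ρ - 1 := by linarith
  obtain ⟨a, b, B, hb⟩ := h.bound_fderiv
  refine ⟨a * C ^ (ρ - 1) + B ^ ((ρ - 1) / ρ), fun t ht u hu huC w hw => ?_⟩
  obtain ⟨hbm, hbB, hbound⟩ := hb t ht
  calc ∫⁻ x, ‖fderiv ℝ (Φ t x) (u x)‖ₑ * w x ∂μ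
      ≤ ∫⁻ x, (a * ‖u x‖ₑ ^ (ρ - 1) + b t x) * w x ∂μ := by
        refine lintegral_mono_ae ?_
        filter_upwards [hbound] with x hx
        gcongr
        exact hx _
    _ ≤ _ := lintegral_growth_mul_le hρ _ hu.enorm hbm hw
    _ ≤ _ := by
        push_cast
        rw [ENNReal.coe_rpow_of_nonneg _ hρ1.le, ENNReal.coe_rpow_of_nonneg _ (by positivity),
          lintegral_rpow_enorm_eq hρ0, ← ENNReal.rpow_mul,
          show ρ * ((ρ - 1) / ρ) = ρ - 1 by field_simp]
        gcongr

theorem integrable_at (h : IsPotential T ρ μ Φ Φdot) [IsFiniteMeasure μ] {t : ℝ} (ht : t ∈ Icc 0 T) {u : Plane → E}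
    (hu : AEStronglyMeasurable u μ) (huf : eLpNorm u (ENNReal.ofReal ρ) μ ≠ ⊤) :
    Integrable (fun x => Φ t x (u x)) μ := by
  have hρ := h.one_lt
  have hρ0 : 0 < ρ := by linarith
  have hρ1 : 0 < ρ - 1 := by linarith
  obtain ⟨a, b, B, hb⟩ := h.bound_fderiv
  obtain ⟨hbm, hbB, hbound⟩ := hb t ht
  have h1 : Integrable (fun x => Φ t x (u x) - Φ t x 0) μ := by
    refine ⟨(h.aesm_at ht hu).sub (h.meas_at t ht 0), ?_⟩
    have h2 : ∫⁻ x, ‖Φ t x (u x) - Φ t x 0‖ₑ ∂μ ≤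
        ∫⁻ x, (a * ‖u x‖ₑ ^ (ρ - 1) + b t x) * ‖u x‖ₑ ∂μ := by
      refine lintegral_mono_ae ?_
      filter_upwards [hbound, h.smooth_at ht] with x hx hs
      refine enorm_sub_le_of_enorm_fderiv_le hs fun y hy => (hx y).trans ?_
      have : ‖y‖ₑ ≤ ‖u x‖ₑ := enorm_le_iff_norm_le.2 hy
      gcongr
    refine (h2.trans (lintegral_growth_mul_le hρ _ hu.enorm hbm hu.enorm)).trans_lt ?_
    rw [lintegral_rpow_enorm_eq hρ0]
    refine ENNReal.mul_lt_top (ENNReal.add_lt_top.2 ⟨ENNReal.mul_lt_top (by simp) ?_, ?_⟩) ?_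
    · exact (ENNReal.rpow_ne_top_of_nonneg (by positivity)
        (ENNReal.rpow_ne_top_of_nonneg hρ0.le huf)).lt_top
    · exact (ENNReal.rpow_ne_top_of_nonneg (by positivity)
        (ne_top_of_le_ne_top (by simp) hbB)).lt_top
    · exact (ENNReal.rpow_ne_top_of_nonneg (by positivity)
        (ENNReal.rpow_ne_top_of_nonneg hρ0.le huf)).lt_top
  refine (h1.add (h.integrable_zero t ht)).congr (Eventually.of_forall fun x => ?_)
  simp

theorem sub_eq_integral (h : IsPotential T ρ μ Φ Φdot) [IsFiniteMeasure μ] {t t' : ℝ} (ht : t ∈ Icc 0 T) (ht' : t' ∈ Icc 0 T) :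
    ∀ᵐ x ∂μ, ∀ z, Integrable (fun s => Φdot s x z) (timeMeasure T) ∧
      Φ t' x z - Φ t x z = ∫ s in t..t', Φdot s x z := by
  have hρ := h.one_lt
  obtain ⟨a, b, ha, hai, hb, hbi, hbound⟩ := h.bound_dot
  exact ae_forall_sub_eq_integral (by linarith) ha hai hb hbi h.meas_dot
    (h.smooth.mono fun x hx t ht => (hx t ht).continuous)
    (h.smooth_dot.mono fun x hx t ht => (hx t ht).continuous) hbound h.eq_integral ht ht'

theorem integrable_dot_prod (h : IsPotential T ρ μ Φ Φdot) [IsFiniteMeasure μ] {u : Plane → E} (hu : AEStronglyMeasurable u μ)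
    (huf : eLpNorm u (ENNReal.ofReal ρ) μ ≠ ⊤) :
    Integrable (fun p : ℝ × Plane => Φdot p.1 p.2 (u p.2)) ((timeMeasure T).prod μ) := by
  have hρ0 : 0 < ρ := by linarith [h.one_lt]
  obtain ⟨a, b, ha, hai, hb, hbi, hbound⟩ := h.bound_dot
  refine ⟨h.aesm_dot_prod hu, ?_⟩
  have h1 : ∀ᵐ p : ℝ × Plane ∂((timeMeasure T).prod μ), p.1 ∈ Icc 0 T :=
    Measure.quasiMeasurePreserving_fst.ae (ae_timeMeasure_mem T)
  have h2 := (Measure.quasiMeasurePreserving_snd (μ := timeMeasure T) (ν := μ)).ae hbound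
  calc ∫⁻ p, ‖Φdot p.1 p.2 (u p.2)‖ₑ ∂((timeMeasure T).prod μ)
      ≤ ∫⁻ p, (a p.1 * ‖u p.2‖ₑ ^ ρ + b p) ∂((timeMeasure T).prod μ) := by
        refine lintegral_mono_ae ?_
        filter_upwards [h1, h2] with p hp1 hp2 using hp2 p.1 hp1 _
    _ = (∫⁻ t, a t ∂timeMeasure T) * (∫⁻ x, ‖u x‖ₑ ^ ρ ∂μ) + ∫⁻ p, b p ∂((timeMeasure T).prod μ) := by
        rw [lintegral_add_right' _ hb, lintegral_prod_mul ha (hu.enorm.pow_const _)]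
    _ < ⊤ := by
        rw [lintegral_rpow_enorm_eq hρ0]
        exact ENNReal.add_lt_top.2 ⟨ENNReal.mul_lt_top hai.lt_top
          (ENNReal.rpow_ne_top_of_nonneg hρ0.le huf).lt_top, hbi.lt_top⟩

theorem integrable_work_dot (h : IsPotential T ρ μ Φ Φdot) [IsFiniteMeasure μ] {u : Plane → E} (hu : AEStronglyMeasurable u μ)
    (huf : eLpNorm u (ENNReal.ofReal ρ) μ ≠ ⊤) :
    Integrable (fun t => ∫ x, Φdot t x (u x) ∂μ) (timeMeasure T) :=
  (h.integrable_dot_prod hu huf).integral_prod_left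

theorem integral_sub_eq (h : IsPotential T ρ μ Φ Φdot) [IsFiniteMeasure μ] {t t' : ℝ} (ht : t ∈ Icc 0 T) (ht' : t' ∈ Icc 0 T)
    (htt' : t ≤ t') {u : Plane → E} (hu : AEStronglyMeasurable u μ)
    (huf : eLpNorm u (ENNReal.ofReal ρ) μ ≠ ⊤) :
    ∫ x, Φ t' x (u x) ∂μ - ∫ x, Φ t x (u x) ∂μ = ∫ τ in t..t', ∫ x, Φdot τ x (u x) ∂μ := by
  rw [← integral_sub (h.integrable_at ht' hu huf) (h.integrable_at ht hu huf)]
  have h1 : ∫ x, (Φ t' x (u x) - Φ t x (u x)) ∂μ = ∫ x, (∫ τ in t..t', Φdot τ x (u x)) ∂μ := by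
    refine integral_congr_ae ?_
    filter_upwards [h.sub_eq_integral ht ht'] with x hx using (hx _).2
  rw [h1]
  simp only [intervalIntegral.integral_of_le htt']
  refine (integral_integral_swap ?_).symm
  refine (h.integrable_dot_prod hu huf).mono_measure ?_
  have hsub : Ioc t t' ⊆ Icc 0 T := fun s hs => ⟨ht.1.trans hs.1.le, hs.2.trans ht'.2⟩
  exact Measure.prod_mono (Measure.restrict_mono hsub le_rfl) le_rfl

/-- Uniform continuity in time of the derivative of the potential. -/
theorem exists_time_modulus (h : IsPotential T ρ μ Φ Φdot) [IsFiniteMeasure μ] (C : ℝ≥0) {η : ℝ≥0∞} (hη : η ≠ 0) :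
    ∃ σ : ℝ, 0 < σ ∧ ∀ t ∈ Icc 0 T, ∀ t' ∈ Icc 0 T, |t' - t| ≤ σ → ∀ u : Plane → E,
      AEStronglyMeasurable u μ → eLpNorm u (ENNReal.ofReal ρ) μ ≤ C →
      ∫⁻ x, ‖fderiv ℝ (Φ t' x) (u x) - fderiv ℝ (Φ t x) (u x)‖ₑ ∂μ ≤ η := by
  have hρ := h.one_lt
  have hρ0 : 0 < ρ := by linarith
  obtain ⟨a, b, ha, hai, hb, hbi, hbound⟩ := h.bound_fderiv_dot
  set K : ℝ≥0∞ := μ univ + (C : ℝ≥0∞) ^ ρ with hK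
  have hKt : K ≠ ⊤ := ENNReal.add_ne_top.2 ⟨measure_ne_top _ _,
    ENNReal.rpow_ne_top_of_nonneg hρ0.le (by simp)⟩
  set β : ℝ → ℝ≥0∞ := fun s => a s * K + ∫⁻ x, b (s, x) ∂μ with hβ
  have hβi : ∫⁻ s, β s ∂timeMeasure T ≠ ⊤ := by
    rw [lintegral_add_left' (ha.mul_const _), lintegral_mul_const'' _ ha, ← lintegral_prod _ hb]
    exact ENNReal.add_ne_top.2 ⟨ENNReal.mul_ne_top hai hKt, hbi⟩
  obtain ⟨δ, hδ, hδβ⟩ := exists_pos_setLIntegral_lt_of_measure_lt hβi hη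
  obtain ⟨σ, hσ0, hσδ⟩ : ∃ σ : ℝ, 0 < σ ∧ ENNReal.ofReal σ < δ := by
    obtain ⟨r, hr0, hr⟩ := ENNReal.lt_iff_exists_nnreal_btwn.1 hδ
    exact ⟨r, by exact_mod_cast hr0, by simpa using hr⟩
  refine ⟨σ, hσ0, ?_⟩
  have key : ∀ t ∈ Icc 0 T, ∀ t' ∈ Icc 0 T, t ≤ t' → t' - t ≤ σ → ∀ u : Plane → E,
      AEStronglyMeasurable u μ → eLpNorm u (ENNReal.ofReal ρ) μ ≤ C →
      ∫⁻ x, ‖fderiv ℝ (Φ t' x) (u x) - fderiv ℝ (Φ t x) (u x)‖ₑ ∂μ ≤ η := by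
    intro t ht t' ht' htt' hσ u hu huC
    have hmeasd : ∀ z, AEStronglyMeasurable (fun p : ℝ × Plane => fderiv ℝ (Φdot p.1 p.2) z)
        ((timeMeasure T).prod μ) := aestronglyMeasurable_fderiv
      (f := fun p : ℝ × Plane => Φdot p.1 p.2) h.meas_dot (h.ae_prod_smooth.mono fun _ hx => hx.2)
    have heq := ae_forall_sub_eq_integral (f := fun t x z => fderiv ℝ (Φ t x) z)
      (fdot := fun t x z => fderiv ℝ (Φdot t x) z) (by linarith) ha hai hb hbi hmeasd
      (h.smooth.mono fun x hx t ht => (hx t ht).continuous_fderiv one_ne_zero)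
      (h.smooth_dot.mono fun x hx t ht => (hx t ht).continuous_fderiv one_ne_zero) hbound
      h.fderiv_eq_integral ht ht'
    have hsub : Ioc t t' ⊆ Icc 0 T := fun s hs => ⟨ht.1.trans hs.1.le, hs.2.trans ht'.2⟩
    have hrest : (timeMeasure T).restrict (Ioc t t') = volume.restrict (Ioc t t') :=
      Measure.restrict_restrict_of_subset hsub
    have hle : volume.restrict (Ioc t t') ≤ timeMeasure T := Measure.restrict_mono hsub le_rfl
    have hb' : AEMeasurable b ((volume.restrict (Ioc t t')).prod μ) :=
      hb.mono_measure (Measure.prod_mono hle le_rfl)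
    have ha' : AEMeasurable a (volume.restrict (Ioc t t')) := ha.mono_measure hle
    have hua : AEMeasurable (fun x => ‖u x‖ₑ ^ (ρ - 1)) μ := hu.enorm.pow_const _
    have hab : AEMeasurable (fun p : ℝ × Plane => a p.1 * ‖u p.2‖ₑ ^ (ρ - 1) + b p)
        ((volume.restrict (Ioc t t')).prod μ) := (ha'.comp_fst.mul hua.comp_snd).add hb'
    calc ∫⁻ x, ‖fderiv ℝ (Φ t' x) (u x) - fderiv ℝ (Φ t x) (u x)‖ₑ ∂μ
        ≤ ∫⁻ x, ∫⁻ s in Ioc t t', (a s * ‖u x‖ₑ ^ (ρ - 1) + b (s, x)) ∂volume ∂μ := by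
          refine lintegral_mono_ae ?_
          filter_upwards [heq, hbound] with x hx hbx
          rw [(hx _).2, intervalIntegral.integral_of_le htt']
          refine (enorm_integral_le_lintegral_enorm _).trans (lintegral_mono_ae ?_)
          filter_upwards [ae_restrict_mem measurableSet_Ioc] with s hs
          exact hbx s (hsub hs) _
      _ = ∫⁻ s in Ioc t t', ∫⁻ x, (a s * ‖u x‖ₑ ^ (ρ - 1) + b (s, x)) ∂μ ∂volume :=
          (lintegral_lintegral_swap hab).symm
      _ ≤ ∫⁻ s in Ioc t t', β s ∂volume := by
          refine lintegral_mono fun s => ?_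
          simp only [hβ]
          rw [lintegral_add_left' (hua.const_mul _), lintegral_const_mul'' _ hua]
          gcongr
          refine (lintegral_rpow_sub_one_le hρ u).trans ?_
          rw [hK]; gcongr
      _ = ∫⁻ s in Ioc t t', β s ∂timeMeasure T := by rw [hrest]
      _ ≤ η := by
          refine (hδβ _ ?_).le
          rw [Measure.restrict_apply measurableSet_Ioc, inter_eq_left.2 hsub, Real.volume_Ioc]
          exact (ENNReal.ofReal_le_ofReal hσ).trans_lt hσδ
  intro t ht t' ht' hσ u hu huC
  rcases le_total t t' with hle | hle
  · exact key t ht t' ht' hle ((le_abs_self _).trans hσ) u hu huC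
  · have := key t' ht' t ht hle (by rw [abs_sub_comm] at hσ; exact (le_abs_self _).trans hσ) u hu huC
    simpa only [← edist_eq_enorm_sub, edist_comm] using this

/-- Uniform continuity of the derivative of the potential, in time and with respect to
perturbations of the argument. -/
theorem exists_modulus (h : IsPotential T ρ μ Φ Φdot) [IsFiniteMeasure μ] (C : ℝ≥0) {η : ℝ≥0∞} (hη : η ≠ 0) :
    ∃ σ : ℝ, 0 < σ ∧ σ ≤ 1 ∧ ∀ t ∈ Icc 0 T, ∀ t' ∈ Icc 0 T, |t' - t| ≤ σ → ∀ u v : Plane → E,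
      AEStronglyMeasurable u μ → AEStronglyMeasurable v μ → eLpNorm u (ENNReal.ofReal ρ) μ ≤ C →
      eLpNorm v (ENNReal.ofReal ρ) μ ≤ ENNReal.ofReal σ →
      ∫⁻ x, ‖fderiv ℝ (Φ t' x) (u x + v x) - fderiv ℝ (Φ t x) (u x)‖ₑ ∂μ ≤ η := by
  have hρ := h.one_lt
  have hρ0 : 0 < ρ := by linarith
  have hρ1 : 0 < ρ - 1 := by linarith
  have hη3 : η / 3 ≠ 0 := by simp [hη]
  obtain ⟨σ₁, hσ₁, hmod⟩ := h.exists_time_modulus (C + 1) hη3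
  obtain ⟨s, hsI, hsf, hcov⟩ := isCompact_Icc.finite_cover_balls (s := Icc (0 : ℝ) T)
    (half_pos hσ₁)
  have hfix : ∀ τ ∈ s, ∃ σ : ℝ, 0 < σ ∧ ∀ u v : Plane → E, AEStronglyMeasurable u μ →
      AEStronglyMeasurable v μ → eLpNorm u (ENNReal.ofReal ρ) μ ≤ C →
      eLpNorm v (ENNReal.ofReal ρ) μ ≤ ENNReal.ofReal σ →
      ∫⁻ x, ‖fderiv ℝ (Φ τ x) (u x + v x) - fderiv ℝ (Φ τ x) (u x)‖ₑ ∂μ ≤ η / 3 := by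
    intro τ hτ
    obtain ⟨a, b, B, hb⟩ := h.bound_fderiv
    obtain ⟨hbm, hbB, hbound⟩ := hb τ (hsI hτ)
    refine exists_modulus_of_growth hρ (ψ := fun x z => fderiv ℝ (Φ τ x) z)
      (aestronglyMeasurable_fderiv (h.meas_at τ (hsI hτ)) (h.smooth_at (hsI hτ)))
      ((h.smooth_at (hsI hτ)).mono fun x hx => hx.continuous_fderiv one_ne_zero) hbm ?_ hbound C hη3
    refine ne_top_of_le_ne_top ?_ (lintegral_mono (g := fun x => 1 + b τ x ^ (ρ / (ρ - 1)))
      fun x => ?_)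
    · rw [lintegral_add_left measurable_const, lintegral_const, one_mul]
      exact ENNReal.add_ne_top.2 ⟨measure_ne_top _ _, ne_top_of_le_ne_top (by simp) hbB⟩
    · rcases le_total (b τ x) 1 with hle | hle
      · exact hle.trans le_self_add
      · refine le_trans ?_ le_add_self
        conv_lhs => rw [← ENNReal.rpow_one (b τ x)]
        exact ENNReal.rpow_le_rpow_of_exponent_le hle (by rw [le_div_iff₀ hρ1]; linarith)
  choose! σf hσf0 hσf using hfix
  obtain ⟨σ₂, hσ₂, hσ₂le⟩ : ∃ σ₂ : ℝ, 0 < σ₂ ∧ ∀ τ ∈ s, σ₂ ≤ σf τ := by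
    have : ∀ᶠ r in 𝓝[>] (0 : ℝ), ∀ τ ∈ s, r ≤ σf τ := by
      rw [eventually_all_finite hsf]
      intro τ hτ
      exact mem_nhdsWithin_of_mem_nhds (Iic_mem_nhds (hσf0 τ hτ))
    obtain ⟨r, hr, hr0⟩ := (this.and self_mem_nhdsWithin).exists
    exact ⟨r, hr0, hr⟩
  refine ⟨min (min (σ₁ / 2) σ₂) 1, by positivity, min_le_right _ _, ?_⟩
  intro t ht t' ht' htt u v hu hv huC hvσ
  obtain ⟨τ, hτ, htτ⟩ := mem_iUnion₂.1 (hcov ht)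
  have hτI := hsI hτ
  rw [Metric.mem_ball, Real.dist_eq] at htτ
  have hm1 : min (min (σ₁ / 2) σ₂) 1 ≤ σ₁ / 2 := (min_le_left _ _).trans (min_le_left _ _)
  have hm2 : min (min (σ₁ / 2) σ₂) 1 ≤ σ₂ := (min_le_left _ _).trans (min_le_right _ _)
  have ht'τ : |t' - τ| ≤ σ₁ := by
    have := abs_sub_le t' t τ
    linarith
  have hρ1e : (1 : ℝ≥0∞) ≤ ENNReal.ofReal ρ := by simpa using hρ.le
  have huv : eLpNorm (u + v) (ENNReal.ofReal ρ) μ ≤ (C + 1 : ℝ≥0) := by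
    refine (eLpNorm_add_le hu hv hρ1e).trans ?_
    push_cast
    refine add_le_add huC (hvσ.trans ?_)
    rw [← ENNReal.ofReal_one]
    exact ENNReal.ofReal_le_ofReal (min_le_right _ _)
  have huC' : eLpNorm u (ENNReal.ofReal ρ) μ ≤ (C + 1 : ℝ≥0) := huC.trans (by push_cast; exact le_self_add)
  have e1 := hmod τ hτI t' ht' ht'τ (u + v) (hu.add hv) huv
  have e2 := hσf τ hτ u v hu hv huC (hvσ.trans (ENNReal.ofReal_le_ofReal (hm2.trans (hσ₂le τ hτ))))
  have e3 := hmod t ht τ hτI (by rw [abs_sub_comm]; linarith) u hu huC'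
  have m1 := h.aesm_fderiv_at ht' (hu.add hv)
  have m2 := h.aesm_fderiv_at hτI (hu.add hv)
  have m3 := h.aesm_fderiv_at hτI hu
  simp only [Pi.add_apply] at e1 m1 m2
  have n1 : AEMeasurable (fun x => ‖fderiv ℝ (Φ t' x) (u x + v x) -
      fderiv ℝ (Φ τ x) (u x + v x)‖ₑ) μ := (m1.sub m2).enorm
  have n2 : AEMeasurable (fun x => ‖fderiv ℝ (Φ τ x) (u x + v x) -
      fderiv ℝ (Φ τ x) (u x)‖ₑ) μ := (m2.sub m3).enorm
  calc ∫⁻ x, ‖fderiv ℝ (Φ t' x) (u x + v x) - fderiv ℝ (Φ t x) (u x)‖ₑ ∂μ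
      ≤ ∫⁻ x, (‖fderiv ℝ (Φ t' x) (u x + v x) - fderiv ℝ (Φ τ x) (u x + v x)‖ₑ +
          (‖fderiv ℝ (Φ τ x) (u x + v x) - fderiv ℝ (Φ τ x) (u x)‖ₑ +
            ‖fderiv ℝ (Φ τ x) (u x) - fderiv ℝ (Φ t x) (u x)‖ₑ)) ∂μ := by
        refine lintegral_mono fun x => ?_
        simp only [← edist_eq_enorm_sub]
        rw [← add_assoc]
        exact edist_triangle4 _ _ _ _
    _ = _ := by
        rw [lintegral_add_left' n1, lintegral_add_left' n2]
    _ ≤ η / 3 + (η / 3 + η / 3) := add_le_add e1 (add_le_add e2 e3)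
    _ = η := by rw [← add_assoc]; exact ENNReal.add_thirds η

theorem exists_integral_sub_eq [IsFiniteMeasure μ] (h : IsPotential T ρ μ Φ Φdot) {t : ℝ}
    (ht : t ∈ Icc 0 T) {u v : Plane → E} (hu : AEStronglyMeasurable u μ)
    (huf : eLpNorm u (ENNReal.ofReal ρ) μ ≠ ⊤) (hv : AEStronglyMeasurable v μ)
    (hvf : eLpNorm v (ENNReal.ofReal ρ) μ ≠ ⊤) :
    ∃ s ∈ Ioo (0 : ℝ) 1, ∫ x, Φ t x (u x + v x) ∂μ - ∫ x, Φ t x (u x) ∂μ =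
      ∫ x, fderiv ℝ (Φ t x) (u x + s • v x) (v x) ∂μ := by
  have hρ := h.one_lt
  have hρ0 : 0 < ρ := by linarith
  have hρ1 : 0 < ρ - 1 := by linarith
  have hρ1e : (1 : ℝ≥0∞) ≤ ENNReal.ofReal ρ := by simpa using hρ.le
  have hus : ∀ s : ℝ, AEStronglyMeasurable (fun x => u x + s • v x) μ := fun s =>
    hu.add (hv.const_smul s)
  have husf : ∀ s : ℝ, eLpNorm (fun x => u x + s • v x) (ENNReal.ofReal ρ) μ ≠ ⊤ := fun s => by
    refine ne_top_of_le_ne_top ?_ (eLpNorm_add_le hu (hv.const_smul s) hρ1e)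
    rw [show (fun x => s • v x) = s • v from rfl, eLpNorm_const_smul]
    exact ENNReal.add_ne_top.2 ⟨huf, ENNReal.mul_ne_top enorm_ne_top hvf⟩
  obtain ⟨a, b, B, hb⟩ := h.bound_fderiv
  obtain ⟨hbm, hbB, hbound⟩ := hb t ht
  have hderiv : ∀ s₀ : ℝ, HasDerivAt (fun s : ℝ => ∫ x, Φ t x (u x + s • v x) ∂μ)
      (∫ x, fderiv ℝ (Φ t x) (u x + s₀ • v x) (v x) ∂μ) s₀ := by
    intro s₀
    set c : ℝ := |s₀| + 1 with hc
    have hc0 : 0 ≤ c := by positivity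
    set U : Plane → ℝ≥0∞ := fun x => ‖u x‖ₑ + ‖c • v x‖ₑ with hU
    have hUm : AEMeasurable U μ := hu.enorm.add (hv.const_smul c).enorm
    have hUfin : ∫⁻ x, U x ^ ρ ∂μ ≠ ⊤ := by
      refine (ENNReal.lintegral_rpow_add_lt_top_of_lintegral_rpow_lt_top hu.enorm ?_ ?_ hρ.le).ne
      · rw [lintegral_rpow_enorm_eq hρ0]
        exact (ENNReal.rpow_ne_top_of_nonneg hρ0.le huf).lt_top
      · rw [lintegral_rpow_enorm_eq hρ0 (f := fun x => c • v x)]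
        refine (ENNReal.rpow_ne_top_of_nonneg hρ0.le ?_).lt_top
        have : (fun x => c • v x) = c • v := rfl
        rw [this, eLpNorm_const_smul]
        exact ENNReal.mul_ne_top enorm_ne_top hvf
    set g : Plane → ℝ≥0∞ := fun x => (a * U x ^ (ρ - 1) + b t x) * ‖v x‖ₑ with hg
    have hgm : AEMeasurable g μ := (((hUm.pow_const _).const_mul _).add hbm).mul hv.enorm
    have hgfin : ∫⁻ x, g x ∂μ ≠ ⊤ := by
      refine ne_top_of_le_ne_top ?_ (lintegral_growth_mul_le hρ _ hUm hbm hv.enorm)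
      rw [lintegral_rpow_enorm_eq hρ0]
      refine ENNReal.mul_ne_top (ENNReal.add_ne_top.2 ⟨ENNReal.mul_ne_top (by simp) ?_, ?_⟩) ?_
      · exact ENNReal.rpow_ne_top_of_nonneg (by positivity) hUfin
      · exact ENNReal.rpow_ne_top_of_nonneg (by positivity) (ne_top_of_le_ne_top (by simp) hbB)
      · exact ENNReal.rpow_ne_top_of_nonneg (by positivity)
          (ENNReal.rpow_ne_top_of_nonneg hρ0.le hvf)
    refine (hasDerivAt_integral_of_dominated_loc_of_deriv_le
      (F := fun s x => Φ t x (u x + s • v x))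
      (F' := fun s x => fderiv ℝ (Φ t x) (u x + s • v x) (v x))
      (bound := fun x => (g x).toReal) (Metric.ball_mem_nhds s₀ one_pos)
      (Eventually.of_forall fun s => h.aesm_at ht (hus s)) (h.integrable_at ht (hus s₀) (husf s₀))
      ?_ ?_ (integrable_toReal_of_lintegral_ne_top hgm hgfin) ?_).2
    · exact (ContinuousLinearMap.apply ℝ ℝ).aestronglyMeasurable_comp₂ hv (h.aesm_fderiv_at ht (hus s₀))
    · filter_upwards [hbound, ae_lt_top' hgm hgfin] with x hx hgx s hs
      rw [← toReal_enorm]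
      refine ENNReal.toReal_mono hgx.ne ?_
      refine (ContinuousLinearMap.le_opENorm _ _).trans ?_
      simp only [hg]
      gcongr
      refine (hx _).trans ?_
      have : ‖u x + s • v x‖ₑ ≤ U x := by
        refine (enorm_add_le _ _).trans (add_le_add le_rfl ?_)
        rw [enorm_le_iff_norm_le, norm_smul, norm_smul, Real.norm_of_nonneg hc0]
        refine mul_le_mul_of_nonneg_right ?_ (norm_nonneg _)
        rw [Metric.mem_ball, Real.dist_eq] at hs
        have := abs_sub_abs_le_abs_sub s s₀
        rw [Real.norm_eq_abs]; linarith
      gcongr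
    · filter_upwards [h.smooth_at ht] with x hx s _
      have h1 : HasDerivAt (fun s : ℝ => u x + s • v x) (v x) s := by
        simpa using ((hasDerivAt_id s).smul_const (v x)).const_add (u x)
      exact ((hx.differentiable one_ne_zero).differentiableAt.hasFDerivAt).comp_hasDerivAt s h1
  obtain ⟨s, hs, hse⟩ := exists_hasDerivAt_eq_slope
    (fun s : ℝ => ∫ x, Φ t x (u x + s • v x) ∂μ)
    (fun s => ∫ x, fderiv ℝ (Φ t x) (u x + s • v x) (v x) ∂μ) zero_lt_one
    (fun s _ => (hderiv s).continuousAt.continuousWithinAt) (fun s _ => hderiv s)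
  refine ⟨s, hs, ?_⟩
  rw [hse]; simp

theorem lintegral_pairing_prod_lt_top [IsFiniteMeasure μ] {ν : Measure ℝ} [SFinite ν]
    {ρ : ℝ} (hρ : 0 < ρ) {L : ℝ × Plane → E →L[ℝ] ℝ} (hL : AEStronglyMeasurable L (ν.prod μ))
    {κ : ℝ≥0} (hκ : ∀ᵐ t ∂ν, ∀ w : Plane → ℝ≥0∞, AEMeasurable w μ →
      ∫⁻ x, ‖L (t, x)‖ₑ * w x ∂μ ≤ κ * (∫⁻ x, w x ^ ρ ∂μ) ^ (1 / ρ))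
    {γ : ℝ → Plane → E} (hγ : AEStronglyMeasurable (Function.uncurry γ) (ν.prod μ))
    (hγi : ∫⁻ t, eLpNorm (γ t) (ENNReal.ofReal ρ) μ ∂ν ≠ ⊤) :
    Integrable (fun p : ℝ × Plane => L p (γ p.1 p.2)) (ν.prod μ) := by
  have hm : AEStronglyMeasurable (fun p : ℝ × Plane => L p (γ p.1 p.2)) (ν.prod μ) :=
    (ContinuousLinearMap.apply ℝ ℝ).aestronglyMeasurable_comp₂ hγ hL
  refine ⟨hm, ?_⟩
  calc ∫⁻ p, ‖L p (γ p.1 p.2)‖ₑ ∂(ν.prod μ) = ∫⁻ t, ∫⁻ x, ‖L (t, x) (γ t x)‖ₑ ∂μ ∂ν :=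
        lintegral_prod _ hm.enorm
    _ ≤ ∫⁻ t, κ * eLpNorm (γ t) (ENNReal.ofReal ρ) μ ∂ν := by
        refine lintegral_mono_ae ?_
        filter_upwards [hκ, hγ.prodMk_left] with t ht hγt
        rw [eLpNorm_ofReal_eq hρ]
        refine (lintegral_mono fun x => ?_).trans (ht (fun x => ‖γ t x‖ₑ) hγt.enorm)
        exact ContinuousLinearMap.le_opENorm _ _
    _ < ⊤ := by
        rw [lintegral_const_mul' _ _ (by simp)]
        exact ENNReal.mul_lt_top (by simp) hγi.lt_top

theorem integrable_pairing_prod [IsFiniteMeasure μ] (h : IsPotential T ρ μ Φ Φdot) {u : Plane → E}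
    (hu : AEStronglyMeasurable u μ) (huf : eLpNorm u (ENNReal.ofReal ρ) μ ≠ ⊤)
    {γ : ℝ → Plane → E} (hγ : AEStronglyMeasurable (Function.uncurry γ) ((timeMeasure T).prod μ))
    (hγi : ∫⁻ t, eLpNorm (γ t) (ENNReal.ofReal ρ) μ ∂timeMeasure T ≠ ⊤) :
    Integrable (fun p : ℝ × Plane => fderiv ℝ (Φ p.1 p.2) (u p.2) (γ p.1 p.2))
      ((timeMeasure T).prod μ) := by
  obtain ⟨κ, hκ⟩ := h.exists_pairing_bound (eLpNorm u (ENNReal.ofReal ρ) μ).toNNReal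
  refine lintegral_pairing_prod_lt_top (by linarith [h.one_lt]) (h.aesm_fderiv_prod hu) (κ := κ) ?_ hγ hγi
  filter_upwards [ae_timeMeasure_mem T] with t ht w hw
  exact hκ t ht u hu (by rw [ENNReal.coe_toNNReal huf]) w hw

theorem integrable_pairing [IsFiniteMeasure μ] (h : IsPotential T ρ μ Φ Φdot) {u : Plane → E}
    (hu : AEStronglyMeasurable u μ) (huf : eLpNorm u (ENNReal.ofReal ρ) μ ≠ ⊤)
    {γ : ℝ → Plane → E} (hγ : AEStronglyMeasurable (Function.uncurry γ) ((timeMeasure T).prod μ))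
    (hγi : ∫⁻ t, eLpNorm (γ t) (ENNReal.ofReal ρ) μ ∂timeMeasure T ≠ ⊤) :
    Integrable (fun t => ∫ x, fderiv ℝ (Φ t x) (u x) (γ t x) ∂μ) (timeMeasure T) :=
  (h.integrable_pairing_prod hu huf hγ hγi).integral_prod_left

/-- The change of a potential along a time step differs from the integral of its formal time
derivative, with frozen argument, by a small amount. -/
theorem exists_step_bound [IsFiniteMeasure μ] (h : IsPotential T ρ μ Φ Φdot) (C : ℝ≥0) :
    ∃ κ : ℝ≥0, ∀ η : ℝ≥0∞, η ≠ 0 → ∃ σ : ℝ, 0 < σ ∧ ∀ t ∈ Icc 0 T, ∀ t' ∈ Icc 0 T,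
      t ≤ t' → t' - t ≤ σ → ∀ u v : Plane → E, ∀ γ γ' : ℝ → Plane → E, ∀ m : ℝ → ℝ≥0∞,
      AEStronglyMeasurable u μ → eLpNorm u (ENNReal.ofReal ρ) μ ≤ C →
      AEStronglyMeasurable v μ → eLpNorm v (ENNReal.ofReal ρ) μ ≤ ENNReal.ofReal σ →
      AEStronglyMeasurable (Function.uncurry γ) ((timeMeasure T).prod μ) →
      ∫⁻ t, eLpNorm (γ t) (ENNReal.ofReal ρ) μ ∂timeMeasure T ≠ ⊤ →
      AEStronglyMeasurable (Function.uncurry γ') ((timeMeasure T).prod μ) →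
      (∀ᵐ τ ∂timeMeasure T, ∀ᵐ x ∂μ, ‖γ' τ x‖ₑ ≤ m τ) →
      (∀ᵐ x ∂μ, v x = ∫ τ in t..t', γ τ x) →
      ‖∫ x, Φ t' x (u x + v x) ∂μ - ∫ x, Φ t x (u x) ∂μ
          - (∫ τ in t..t', ∫ x, Φdot τ x (u x) ∂μ)
          - ∫ τ in t..t', ∫ x, fderiv ℝ (Φ τ x) (u x) (γ τ x) ∂μ‖ₑ ≤
        ∫⁻ τ in Ioc t t', (κ * eLpNorm (γ τ - γ' τ) (ENNReal.ofReal ρ) μ + η * m τ) := by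
  have hρ := h.one_lt
  have hρ0 : 0 < ρ := by linarith
  have hρ1e : (1 : ℝ≥0∞) ≤ ENNReal.ofReal ρ := by simpa using hρ.le
  obtain ⟨κ, hκ⟩ := h.exists_pairing_bound (C + 1)
  refine ⟨κ + κ, fun η hη => ?_⟩
  obtain ⟨σ, hσ0, hσ1, hσ⟩ := h.exists_modulus C hη
  refine ⟨σ, hσ0, fun t ht t' ht' htt' hd u v γ γ' m hu huC hv hvσ hγ hγi hγ' hm hvγ => ?_⟩
  have huf : eLpNorm u (ENNReal.ofReal ρ) μ ≠ ⊤ := ne_top_of_le_ne_top (by simp) huC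
  have hvf : eLpNorm v (ENNReal.ofReal ρ) μ ≠ ⊤ := ne_top_of_le_ne_top (by simp) hvσ
  have hsub : Ioc t t' ⊆ Icc 0 T := fun s hs => ⟨ht.1.trans hs.1.le, hs.2.trans ht'.2⟩
  set ν := (volume : Measure ℝ).restrict (Ioc t t') with hν
  have hle : ν ≤ timeMeasure T := Measure.restrict_mono hsub le_rfl
  have hlep : ν.prod μ ≤ (timeMeasure T).prod μ := Measure.prod_mono hle le_rfl
  have hγν := hγ.mono_measure hlep
  have hγ'ν := hγ'.mono_measure hlep
  have hγiν : ∫⁻ t, eLpNorm (γ t) (ENNReal.ofReal ρ) μ ∂ν ≠ ⊤ :=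
    ne_top_of_le_ne_top hγi (lintegral_mono' hle le_rfl)
  obtain ⟨s, hs, hse⟩ := h.exists_integral_sub_eq ht' hu huf hv hvf
  set w : Plane → E := fun x => u x + s • v x with hw
  have hsv : eLpNorm (s • v) (ENNReal.ofReal ρ) μ ≤ ENNReal.ofReal σ := by
    rw [eLpNorm_const_smul]
    refine le_trans (mul_le_of_le_one_left' ?_) hvσ
    rw [← ofReal_norm, ← ENNReal.ofReal_one]
    refine ENNReal.ofReal_le_ofReal ?_
    rw [Real.norm_of_nonneg hs.1.le]; exact hs.2.le
  have hwm : AEStronglyMeasurable w μ := hu.add (hv.const_smul s)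
  have hwC : eLpNorm w (ENNReal.ofReal ρ) μ ≤ (C + 1 : ℝ≥0) := by
    refine (eLpNorm_add_le hu (hv.const_smul s) hρ1e).trans ?_
    push_cast
    refine add_le_add huC (hsv.trans ?_)
    rw [← ENNReal.ofReal_one]
    exact ENNReal.ofReal_le_ofReal hσ1
  have huC' : eLpNorm u (ENNReal.ofReal ρ) μ ≤ (C + 1 : ℝ≥0) :=
    huC.trans (by push_cast; exact le_self_add)
  set L : Plane → E →L[ℝ] ℝ := fun x => fderiv ℝ (Φ t' x) (w x) with hL
  have hLm : AEStronglyMeasurable L μ := h.aesm_fderiv_at ht' hwm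
  have hLint : Integrable (fun p : ℝ × Plane => L p.2 (γ p.1 p.2)) (ν.prod μ) :=
    lintegral_pairing_prod_lt_top hρ0 (L := fun p => L p.2) hLm.comp_snd (κ := κ)
      (Eventually.of_forall fun τ w' hw' => hκ t' ht' w hwm hwC w' hw') hγν hγiν
  have hPint : Integrable (fun p : ℝ × Plane => fderiv ℝ (Φ p.1 p.2) (u p.2) (γ p.1 p.2))
      (ν.prod μ) := (h.integrable_pairing_prod hu huf hγ hγi).mono_measure hlep
  have hγint : ∀ᵐ x ∂μ, Integrable (fun τ => γ τ x) ν := by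
    have : Integrable (Function.uncurry γ) (ν.prod μ) := by
      refine ⟨hγν, ?_⟩
      calc ∫⁻ p, ‖Function.uncurry γ p‖ₑ ∂(ν.prod μ) = ∫⁻ t, ∫⁻ x, ‖γ t x‖ₑ ∂μ ∂ν :=
            lintegral_prod _ hγν.enorm
        _ ≤ ∫⁻ t, eLpNorm (γ t) (ENNReal.ofReal ρ) μ * (μ univ) ^ (1 - 1 / ρ) ∂ν := by
            refine lintegral_mono_ae ?_
            filter_upwards [hγν.prodMk_left] with τ hτ
            exact lintegral_enorm_le_eLpNorm hρ hτ
        _ < ⊤ := by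
            have hρ' : 0 ≤ 1 - 1 / ρ := by
              rw [sub_nonneg, div_le_one hρ0]; exact hρ.le
            have := ENNReal.rpow_ne_top_of_nonneg hρ' (measure_ne_top μ univ)
            rw [lintegral_mul_const' _ _ this]
            exact ENNReal.mul_lt_top hγiν.lt_top this.lt_top
    exact this.prod_left_ae
  have e1 : ∫ x, L x (v x) ∂μ = ∫ τ, ∫ x, L x (γ τ x) ∂μ ∂ν := by
    rw [integral_integral_swap (f := fun τ x => L x (γ τ x)) hLint]
    refine integral_congr_ae ?_
    filter_upwards [hvγ, hγint] with x hx hxi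
    change L x (v x) = ∫ τ, L x (γ τ x) ∂ν
    rw [hx, intervalIntegral.integral_of_le htt', ContinuousLinearMap.integral_comp_comm _ hxi]
  have e2 := h.integral_sub_eq ht ht' htt' hu huf
  have e3 : ∫ x, Φ t' x (u x + v x) ∂μ - ∫ x, Φ t x (u x) ∂μ
          - (∫ τ in t..t', ∫ x, Φdot τ x (u x) ∂μ)
          - ∫ τ in t..t', ∫ x, fderiv ℝ (Φ τ x) (u x) (γ τ x) ∂μ =
      ∫ τ, ∫ x, (L x - fderiv ℝ (Φ τ x) (u x)) (γ τ x) ∂μ ∂ν := by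
    have e4 : ∫ τ, ∫ x, (L x - fderiv ℝ (Φ τ x) (u x)) (γ τ x) ∂μ ∂ν =
        ∫ τ, (∫ x, L x (γ τ x) ∂μ - ∫ x, fderiv ℝ (Φ τ x) (u x) (γ τ x) ∂μ) ∂ν := by
      refine integral_congr_ae ?_
      filter_upwards [hLint.prod_right_ae, hPint.prod_right_ae] with τ h1 h2
      exact integral_sub h1 h2
    rw [e4, integral_sub hLint.integral_prod_left hPint.integral_prod_left, ← e1, ← hse, ← e2,
      intervalIntegral.integral_of_le htt']
    ring
  rw [e3]
  refine (enorm_integral_le_lintegral_enorm _).trans (lintegral_mono_ae ?_)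
  filter_upwards [ae_restrict_mem measurableSet_Ioc, ae_mono hle hm, hγν.prodMk_left,
    hγ'ν.prodMk_left] with τ hτ hmτ hγτ hγ'τ
  have hτI := hsub hτ
  have hPm := h.aesm_fderiv_at hτI hu
  have hdiff : AEMeasurable (fun x => ‖γ τ x - γ' τ x‖ₑ) μ := (hγτ.sub hγ'τ).enorm
  have hmod := hσ τ hτI t' ht' (by
    rw [abs_of_nonneg (by linarith [hτ.2])]; linarith [hτ.1]) u (s • v) hu (hv.const_smul s) huC hsv
  have hdn : eLpNorm (γ τ - γ' τ) (ENNReal.ofReal ρ) μ =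
      (∫⁻ x, ‖γ τ x - γ' τ x‖ₑ ^ ρ ∂μ) ^ (1 / ρ) := eLpNorm_ofReal_eq hρ0 _
  have mL : AEMeasurable (fun x => ‖L x‖ₑ * ‖γ τ x - γ' τ x‖ₑ) μ := hLm.enorm.mul hdiff
  have mP : AEMeasurable (fun x => ‖fderiv ℝ (Φ τ x) (u x)‖ₑ * ‖γ τ x - γ' τ x‖ₑ) μ :=
    hPm.enorm.mul hdiff
  have mD : AEMeasurable (fun x => ‖L x - fderiv ℝ (Φ τ x) (u x)‖ₑ) μ := (hLm.sub hPm).enorm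
  calc ‖∫ x, (L x - fderiv ℝ (Φ τ x) (u x)) (γ τ x) ∂μ‖ₑ
      ≤ ∫⁻ x, ‖(L x - fderiv ℝ (Φ τ x) (u x)) (γ τ x)‖ₑ ∂μ := enorm_integral_le_lintegral_enorm _
    _ ≤ ∫⁻ x, (‖L x‖ₑ * ‖γ τ x - γ' τ x‖ₑ +
          (‖fderiv ℝ (Φ τ x) (u x)‖ₑ * ‖γ τ x - γ' τ x‖ₑ +
            ‖L x - fderiv ℝ (Φ τ x) (u x)‖ₑ * m τ)) ∂μ := by
        refine lintegral_mono_ae ?_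
        filter_upwards [hmτ] with x hx
        refine (ContinuousLinearMap.le_opENorm _ _).trans ?_
        rw [← add_assoc, ← add_mul]
        calc ‖L x - fderiv ℝ (Φ τ x) (u x)‖ₑ * ‖γ τ x‖ₑ
            ≤ ‖L x - fderiv ℝ (Φ τ x) (u x)‖ₑ * (‖γ τ x - γ' τ x‖ₑ + ‖γ' τ x‖ₑ) := by
              gcongr
              simpa using enorm_add_le (γ τ x - γ' τ x) (γ' τ x)
          _ ≤ _ := by
              rw [mul_add]
              gcongr
              exact enorm_sub_le
    _ = ∫⁻ x, ‖L x‖ₑ * ‖γ τ x - γ' τ x‖ₑ ∂μ +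
          (∫⁻ x, ‖fderiv ℝ (Φ τ x) (u x)‖ₑ * ‖γ τ x - γ' τ x‖ₑ ∂μ +
            (∫⁻ x, ‖L x - fderiv ℝ (Φ τ x) (u x)‖ₑ ∂μ) * m τ) := by
        rw [lintegral_add_left' mL, lintegral_add_left' mP, lintegral_mul_const'' _ mD]
    _ ≤ κ * eLpNorm (γ τ - γ' τ) (ENNReal.ofReal ρ) μ +
          (κ * eLpNorm (γ τ - γ' τ) (ENNReal.ofReal ρ) μ + η * m τ) := by
        rw [hdn]
        gcongr
        · exact hκ t' ht' w hwm hwC _ hdiff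
        · exact hκ τ hτI u hu huC' _ hdiff
        · exact hmod
    _ = _ := by push_cast; ring

end IsPotential

end Potentials

section Geometry

/-- The union of the lines `ℓ x = c`, for `(ℓ, c)` in the given set. -/
def linesUnion (𝓛 : Set ((Plane →L[ℝ] ℝ) × ℝ)) : Set Plane := {x | ∃ l ∈ 𝓛, l.1 x = l.2}

/-- A finite set of (equations of) lines. -/
def IsLineSet (𝓛 : Set ((Plane →L[ℝ] ℝ) × ℝ)) : Prop := 𝓛.Finite ∧ ∀ l ∈ 𝓛, l.1 ≠ 0

theorem IsLineSet.union {𝓛 𝓛' : Set ((Plane →L[ℝ] ℝ) × ℝ)} (h : IsLineSet 𝓛) (h' : IsLineSet 𝓛') :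
    IsLineSet (𝓛 ∪ 𝓛') :=
  ⟨h.1.union h'.1, fun l hl => hl.elim (h.2 l) (h'.2 l)⟩

theorem linesUnion_mono {𝓛 𝓛' : Set ((Plane →L[ℝ] ℝ) × ℝ)} (h : 𝓛 ⊆ 𝓛') :
    linesUnion 𝓛 ⊆ linesUnion 𝓛' := fun _ ⟨l, hl, hx⟩ => ⟨l, h hl, hx⟩

theorem linesUnion_eq_biUnion (𝓛 : Set ((Plane →L[ℝ] ℝ) × ℝ)) :
    linesUnion 𝓛 = ⋃ l ∈ 𝓛, {x | l.1 x = l.2} := by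
  ext x; simp [linesUnion]

theorem volume_line_eq_zero {ℓ : Plane →L[ℝ] ℝ} (hℓ : ℓ ≠ 0) (c : ℝ) :
    volume {x | ℓ x = c} = 0 := by
  obtain ⟨w, hw⟩ : ∃ w, ℓ w ≠ 0 := by
    by_contra! h; exact hℓ (ContinuousLinearMap.ext h)
  set x₀ : Plane := (c / ℓ w) • w with hx₀
  have hx₀c : ℓ x₀ = c := by simp [hx₀, hw]
  have h0 : volume ((LinearMap.ker (ℓ : Plane →ₗ[ℝ] ℝ) : Submodule ℝ Plane) : Set Plane) = 0 := by
    refine Measure.addHaar_submodule _ _ fun h => hw ?_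
    have : w ∈ LinearMap.ker (ℓ : Plane →ₗ[ℝ] ℝ) := by rw [h]; trivial
    simpa using this
  have : {x | ℓ x = c} = (fun x => x + (-x₀)) ⁻¹'
      ((LinearMap.ker (ℓ : Plane →ₗ[ℝ] ℝ) : Submodule ℝ Plane) : Set Plane) := by
    ext x
    simp only [mem_preimage, SetLike.mem_coe, LinearMap.mem_ker, ContinuousLinearMap.coe_coe,
      map_add, map_neg, hx₀c]
    change ℓ x = c ↔ _
    constructor <;> intro h <;> linarith
  rw [this, measure_preimage_add_right, h0]

theorem IsLineSet.volume_eq_zero {𝓛 : Set ((Plane →L[ℝ] ℝ) × ℝ)} (h : IsLineSet 𝓛) :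
    volume (linesUnion 𝓛) = 0 := by
  rw [linesUnion_eq_biUnion, measure_biUnion_null_iff h.1.countable]
  exact fun l hl => volume_line_eq_zero (h.2 l hl) _

theorem IsLineSet.isClosed_linesUnion {𝓛 : Set ((Plane →L[ℝ] ℝ) × ℝ)} (h : IsLineSet 𝓛) :
    IsClosed (linesUnion 𝓛) := by
  rw [linesUnion_eq_biUnion]
  exact h.1.isClosed_biUnion fun l _ => isClosed_eq l.1.continuous continuous_const

/-- A finite family of closed convex sets with nonempty interior and polygonal boundary that covers
the closure of `Ω`. -/
structure IsConvexCover (Ω : Set Plane) (𝒯 : Set (Set Plane)) : Prop where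
  finite : 𝒯.Finite
  closed : ∀ t ∈ 𝒯, IsClosed t
  convex : ∀ t ∈ 𝒯, Convex ℝ t
  interior_nonempty : ∀ t ∈ 𝒯, (interior t).Nonempty
  cover : ⋃ t ∈ 𝒯, t = closure Ω
  lines : ∃ 𝓛, IsLineSet 𝓛 ∧ ∀ t ∈ 𝒯, frontier t ⊆ linesUnion 𝓛

/-- A domain with Lipschitz boundary lies locally on one side of its boundary. -/
theorem interior_closure_subset {Ω : Set Plane} (hL : HasLipschitzBoundary Ω) :
    interior (closure Ω) ⊆ Ω := by
  intro x hx
  by_contra hxΩ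
  have hfr : x ∈ frontier Ω := ⟨interior_subset hx, fun h => hxΩ (interior_subset h)⟩
  obtain ⟨U, hU, φ, K, γ, hγ, hU2⟩ := hL x hfr
  have hxle : φ x 1 ≤ γ (φ x 0) := by
    by_contra! hlt
    have : x ∈ Ω ∩ U := by rw [hU2]; exact ⟨hlt, mem_of_mem_nhds hU⟩
    exact hxΩ this.1
  set e : Plane := φ.symm (EuclideanSpace.single 1 1) with he
  have hcont : Continuous fun s : ℝ => x - s • e := by fun_prop
  have h0 : Tendsto (fun s : ℝ => x - s • e) (𝓝[>] 0) (𝓝 x) := by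
    have := hcont.tendsto 0
    simp only [zero_smul, sub_zero] at this
    exact this.mono_left nhdsWithin_le_nhds
  have hev : ∀ᶠ s in 𝓝[>] (0 : ℝ), x - s • e ∈ interior (closure Ω) ∩ interior U :=
    h0 ((isOpen_interior.inter isOpen_interior).mem_nhds ⟨hx, mem_interior_iff_mem_nhds.2 hU⟩)
  obtain ⟨s, ⟨hs1, hs2⟩, hs0⟩ := (hev.and self_mem_nhdsWithin).exists
  replace hs0 : 0 < s := hs0
  set V : Set Plane := interior U ∩ {y | φ y 1 < γ (φ y 0)} with hV
  have hVo : IsOpen V := by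
    refine isOpen_interior.inter (isOpen_lt ?_ ?_)
    · exact (EuclideanSpace.proj 1).continuous.comp φ.continuous
    · exact hγ.continuous.comp ((EuclideanSpace.proj 0).continuous.comp φ.continuous)
  have hyV : x - s • e ∈ V := by
    refine ⟨hs2, ?_⟩
    have e1 : φ (x - s • e) = φ x - s • EuclideanSpace.single 1 1 := by simp [he]
    change φ (x - s • e) 1 < γ (φ (x - s • e) 0)
    rw [e1]
    simp
    linarith
  obtain ⟨y, hy1, hy2⟩ := mem_closure_iff.1 (interior_subset hs1) V hVo hyV
  have : y ∈ Ω ∩ U := ⟨hy2, interior_subset hy1.1⟩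
  rw [hU2] at this
  have h1 : γ (φ y 0) < φ y 1 := this.1
  have h2 : φ y 1 < γ (φ y 0) := hy1.2
  exact lt_asymm h1 h2

variable {Ω : Set Plane} {𝒯 : Set (Set Plane)}

namespace IsConvexCover

theorem subset_closure_domain (h : IsConvexCover Ω 𝒯) {t : Set Plane} (ht : t ∈ 𝒯) : t ⊆ closure Ω :=
  h.cover ▸ subset_biUnion_of_mem (u := id) ht

theorem interior_subset_domain (h : IsConvexCover Ω 𝒯) (hL : HasLipschitzBoundary Ω) {t : Set Plane}
    (ht : t ∈ 𝒯) : interior t ⊆ Ω :=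
  (interior_mono (h.subset_closure_domain ht)).trans (interior_closure_subset hL)

theorem exists_mem (h : IsConvexCover Ω 𝒯) {x : Plane} (hx : x ∈ closure Ω) : ∃ t ∈ 𝒯, x ∈ t := by
  rw [← h.cover] at hx
  simpa using hx

theorem exists_mem_interior (h : IsConvexCover Ω 𝒯) {𝓛 : Set ((Plane →L[ℝ] ℝ) × ℝ)}
    (h𝓛 : ∀ t ∈ 𝒯, frontier t ⊆ linesUnion 𝓛) {x : Plane} (hx : x ∈ closure Ω)
    (hx𝓛 : x ∉ linesUnion 𝓛) : ∃ t ∈ 𝒯, x ∈ interior t := by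
  obtain ⟨t, ht, hxt⟩ := h.exists_mem hx
  refine ⟨t, ht, ?_⟩
  by_contra hi
  exact hx𝓛 (h𝓛 t ht ⟨subset_closure hxt, hi⟩)

theorem ball_subset_interior_inter_ball {t : Set Plane} (hconv : Convex ℝ t) {p x : Plane} {r : ℝ}
    (hp : Metric.ball p r ⊆ t) (hx : x ∈ t) {θ : ℝ} (hθ : 0 < θ) (hθ1 : θ ≤ 1) :
    Metric.ball (x + θ • (p - x)) (θ * r) ⊆ interior t ∩ Metric.ball x (θ * (‖p - x‖ + r)) := by
  have h1 : Metric.ball (x + θ • (p - x)) (θ * r) ⊆ t := by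
    intro y hy
    rw [mem_ball_iff_norm] at hy
    have hq : x + θ⁻¹ • (y - x) ∈ t := by
      refine hp ?_
      rw [mem_ball_iff_norm]
      have : x + θ⁻¹ • (y - x) - p = θ⁻¹ • (y - (x + θ • (p - x))) := by
        rw [smul_sub, smul_sub, smul_add, inv_smul_smul₀ hθ.ne']; abel
      rw [this, norm_smul, norm_inv, Real.norm_of_nonneg hθ.le, inv_mul_lt_iff₀ hθ]
      exact hy
    have : y = (1 - θ) • x + θ • (x + θ⁻¹ • (y - x)) := by
      rw [smul_add, smul_inv_smul₀ hθ.ne']; module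
    rw [this]
    exact hconv hx hq (by linarith) hθ.le (by ring)
  refine subset_inter (interior_maximal h1 Metric.isOpen_ball) fun y hy => ?_
  rw [mem_ball_iff_norm] at hy ⊢
  have : y - x = (y - (x + θ • (p - x))) + θ • (p - x) := by abel
  rw [this]
  refine (norm_add_le _ _).trans_lt ?_
  rw [norm_smul, Real.norm_of_nonneg hθ.le]
  linarith

theorem affine_eq_of_hasApproxLimWithin (h : IsConvexCover Ω 𝒯) (hL : HasLipschitzBoundary Ω)
    {u : Plane → Plane} {t : Set Plane} (ht : t ∈ 𝒯) {A : Plane →ᵃ[ℝ] Plane}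
    (hu : EqOn u A (interior t)) {x z : Plane} (hx : x ∈ t) (hz : HasApproxLimWithin Ω u x z) :
    A x = z := by
  by_contra hne
  set η := ‖A x - z‖ / 2 with hη
  have hpos : 0 < ‖A x - z‖ := norm_pos_iff.2 (sub_ne_zero.2 hne)
  have hη0 : 0 < η := by positivity
  obtain ⟨p, hp⟩ := h.interior_nonempty t ht
  obtain ⟨r, hr, hpr⟩ := Metric.isOpen_iff.1 isOpen_interior p hp
  set c := ‖p - x‖ + r with hc
  have hc0 : 0 < c := by positivity
  have hAc : Continuous A := A.continuous_of_finiteDimensional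
  have hnear : ∀ᶠ y in 𝓝 x, η < ‖A y - z‖ := by
    have : ContinuousAt (fun y => ‖A y - z‖) x := by fun_prop
    exact this.eventually (lt_mem_nhds (by rw [hη]; linarith))
  obtain ⟨ρ₀, hρ₀, hball⟩ := Metric.eventually_nhds_iff_ball.1 hnear
  set V := volume (Metric.ball (0 : Plane) 1) with hV
  have hVpos : V ≠ 0 := (Metric.measure_ball_pos volume _ one_pos).ne'
  have hlow : ∀ᶠ ρ in 𝓝[>] (0 : ℝ), ENNReal.ofReal ((r / c) ^ 2) * V ≤
      volume {y | y ∈ Metric.ball x ρ ∧ y ∈ Ω ∧ η < ‖u y - z‖} / ENNReal.ofReal (ρ ^ 2) := by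
    filter_upwards [Ioo_mem_nhdsGT (lt_min hρ₀ hc0)] with ρ hρ
    have hρ0 : 0 < ρ := hρ.1
    have hρ1 : ρ < ρ₀ := hρ.2.trans_le (min_le_left _ _)
    have hρc : ρ < c := hρ.2.trans_le (min_le_right _ _)
    have hsub := ball_subset_interior_inter_ball (h.convex t ht) (hpr.trans interior_subset) hx
      (θ := ρ / c) (by positivity) ((div_le_one hc0).2 hρc.le)
    have hθc : ρ / c * c = ρ := by field_simp
    rw [← hc, hθc] at hsub
    have hsub2 : Metric.ball (x + (ρ / c) • (p - x)) (ρ / c * r) ⊆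
        {y | y ∈ Metric.ball x ρ ∧ y ∈ Ω ∧ η < ‖u y - z‖} := by
      intro y hy
      obtain ⟨hy1, hy2⟩ := hsub hy
      refine ⟨hy2, h.interior_subset_domain hL ht hy1, ?_⟩
      rw [hu hy1]
      exact hball y (Metric.ball_subset_ball hρ1.le hy2)
    rw [ENNReal.le_div_iff_mul_le (Or.inl (by simpa using hρ0.ne')) (Or.inl ENNReal.ofReal_ne_top)]
    refine le_trans (le_of_eq ?_) (measure_mono hsub2)
    rw [Measure.addHaar_ball _ _ (by positivity), finrank_euclideanSpace, Fintype.card_fin,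
      mul_right_comm, ← ENNReal.ofReal_mul (by positivity)]
    congr 2
    field_simp
  have := ge_of_tendsto (hz η hη0) hlow
  rw [nonpos_iff_eq_zero, mul_eq_zero] at this
  rcases this with h0 | h0
  · rw [ENNReal.ofReal_eq_zero] at h0
    have : 0 < (r / c) ^ 2 := by positivity
    linarith
  · exact hVpos h0

theorem hasApproxLimWithin_of_affine_eq (h : IsConvexCover Ω 𝒯) {u : Plane → Plane}
    {A : Set Plane → Plane →ᵃ[ℝ] Plane} (hu : ∀ t ∈ 𝒯, EqOn u (A t) (interior t)) {x z : Plane}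
    (hz : ∀ t ∈ 𝒯, x ∈ t → A t x = z) : HasApproxLimWithin Ω u x z := by
  intro η hη
  obtain ⟨𝓛, h𝓛, hfr⟩ := h.lines
  have hev : ∀ᶠ y in 𝓝 x, ∀ t ∈ 𝒯, y ∈ interior t → ‖u y - z‖ ≤ η := by
    rw [eventually_all_finite h.finite]
    intro t ht
    by_cases hxt : x ∈ t
    · have hAc : Continuous (A t) := (A t).continuous_of_finiteDimensional
      have h1 : ContinuousAt (fun y => ‖A t y - z‖) x := by fun_prop
      have h2 : ‖A t x - z‖ < η := by rw [hz t ht hxt, sub_self, norm_zero]; exact hη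
      filter_upwards [h1.eventually (gt_mem_nhds h2)] with y hy hyt
      rw [hu t ht hyt]; exact le_of_lt hy
    · filter_upwards [(h.closed t ht).isOpen_compl.mem_nhds hxt] with y hy hyt
      exact absurd (interior_subset hyt) hy
  obtain ⟨ρ₀, hρ₀, hball⟩ := Metric.eventually_nhds_iff_ball.1 hev
  refine tendsto_const_nhds.congr' ?_
  filter_upwards [Ioo_mem_nhdsGT hρ₀] with ρ hρ
  have : volume {y | y ∈ Metric.ball x ρ ∧ y ∈ Ω ∧ η < ‖u y - z‖} = 0 := by
    refine measure_mono_null ?_ h𝓛.volume_eq_zero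
    rintro y ⟨hy1, hy2, hy3⟩
    by_contra hy𝓛
    obtain ⟨t, ht, hyt⟩ := h.exists_mem_interior hfr (subset_closure hy2) hy𝓛
    exact absurd (hball y (Metric.ball_subset_ball hρ.2.le hy1) t ht hyt) (not_le.2 hy3)
  rw [this, ENNReal.zero_div]

theorem hasApproxLimWithin_iff (h : IsConvexCover Ω 𝒯) (hL : HasLipschitzBoundary Ω)
    {u : Plane → Plane} {A : Set Plane → Plane →ᵃ[ℝ] Plane}
    (hu : ∀ t ∈ 𝒯, EqOn u (A t) (interior t)) {x z : Plane} :
    HasApproxLimWithin Ω u x z ↔ ∀ t ∈ 𝒯, x ∈ t → A t x = z :=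
  ⟨fun hz _ ht hx => h.affine_eq_of_hasApproxLimWithin hL ht (hu _ ht) hx hz,
    h.hasApproxLimWithin_of_affine_eq hu⟩

theorem trace_eq (h : IsConvexCover Ω 𝒯) (hL : HasLipschitzBoundary Ω)
    {u : Plane → Plane} {A : Set Plane → Plane →ᵃ[ℝ] Plane}
    (hu : ∀ t ∈ 𝒯, EqOn u (A t) (interior t)) {x : Plane}
    (hex : ∃ z, HasApproxLimWithin Ω u x z) {t : Set Plane} (ht : t ∈ 𝒯) (hx : x ∈ t) :
    trace Ω u x = A t x :=
  (h.affine_eq_of_hasApproxLimWithin hL ht (hu t ht) hx (Classical.epsilon_spec hex)).symm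

theorem trace_eq_of_hasApproxLimWithin (h : IsConvexCover Ω 𝒯) (hL : HasLipschitzBoundary Ω)
    {u : Plane → Plane} {A : Set Plane → Plane →ᵃ[ℝ] Plane}
    (hu : ∀ t ∈ 𝒯, EqOn u (A t) (interior t)) {x z : Plane} (hx : x ∈ closure Ω)
    (hz : HasApproxLimWithin Ω u x z) : trace Ω u x = z := by
  obtain ⟨t, ht, hxt⟩ := h.exists_mem hx
  rw [h.trace_eq hL hu ⟨z, hz⟩ ht hxt]
  exact h.affine_eq_of_hasApproxLimWithin hL ht (hu t ht) hxt hz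

end IsConvexCover

/-- Sets with empty interior may be dropped from a cover by finitely many closed convex sets. -/
theorem biUnion_filter_interior_nonempty (hΩ : IsOpen Ω) (hf : 𝒯.Finite)
    (hc : ∀ t ∈ 𝒯, IsClosed t) (hconv : ∀ t ∈ 𝒯, Convex ℝ t) (hcov : ⋃ t ∈ 𝒯, t = closure Ω) :
    ⋃ t ∈ {t ∈ 𝒯 | (interior t).Nonempty}, t = closure Ω := by
  set K := ⋃ t ∈ {t ∈ 𝒯 | (interior t).Nonempty}, t with hK
  have hKc : IsClosed K := (hf.subset (sep_subset _ _)).isClosed_biUnion fun t ht => hc t ht.1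
  refine Subset.antisymm ?_ (closure_minimal ?_ hKc)
  · rw [← hcov]
    exact biUnion_subset_biUnion_left (sep_subset _ _)
  · have ho : IsOpen (Ω \ K) := hΩ.sdiff hKc
    have hnull : volume (Ω \ K) = 0 := by
      refine measure_mono_null (t := ⋃ t ∈ {t ∈ 𝒯 | ¬ (interior t).Nonempty}, t) ?_ ?_
      · rintro x ⟨hx, hxK⟩
        have : x ∈ ⋃ t ∈ 𝒯, t := hcov ▸ subset_closure hx
        obtain ⟨t, ht, hxt⟩ := mem_iUnion₂.1 this
        refine mem_iUnion₂.2 ⟨t, ⟨ht, fun hn => hxK ?_⟩, hxt⟩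
        exact mem_iUnion₂.2 ⟨t, ⟨ht, hn⟩, hxt⟩
      · rw [measure_biUnion_null_iff (hf.subset (sep_subset _ _)).countable]
        rintro t ⟨ht, hn⟩
        refine measure_mono_null ?_ ((hconv t ht).addHaar_frontier volume)
        intro x hx
        refine ⟨subset_closure hx, fun hi => hn ⟨x, hi⟩⟩
    by_contra hsub
    have hne : (Ω \ K).Nonempty := sdiff_nonempty.2 hsub
    exact ho.measure_ne_zero volume hne hnull

end Geometry

section Triangles

theorem mem_convexHull_triple {x y z p : Plane} :
    p ∈ convexHull ℝ ({x, y, z} : Set Plane) ↔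
      ∃ α β γ : ℝ, 0 ≤ α ∧ 0 ≤ β ∧ 0 ≤ γ ∧ α + β + γ = 1 ∧ p = α • x + β • y + γ • z := by
  constructor
  · intro hp
    rw [convexHull_insert (by simp), convexHull_pair] at hp
    simp only [mem_convexJoin, mem_singleton_iff, exists_eq_left] at hp
    obtain ⟨q, ⟨a, b, ha, hb, hab, rfl⟩, ⟨c, d, hc, hd, hcd, rfl⟩⟩ := hp
    refine ⟨c, d * a, d * b, hc, by positivity, by positivity, ?_, by module⟩
    rw [add_assoc, ← mul_add, hab, mul_one, hcd]
  · rintro ⟨α, β, γ, hα, hβ, hγ, hs, rfl⟩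
    have hc := convex_convexHull ℝ ({x, y, z} : Set Plane)
    have hsub := subset_convexHull ℝ ({x, y, z} : Set Plane)
    have := hc.sum_mem (t := Finset.univ) (w := ![α, β, γ]) (z := ![x, y, z])
      (by intro i _; fin_cases i <;> simpa) (by simp [Fin.sum_univ_three, hs])
      (by intro i _; fin_cases i <;> exact hsub (by simp))
    simpa [Fin.sum_univ_three] using this

/-- The boundary of a triangle lies on three lines. -/
theorem exists_lines_of_triangle {x y z : Plane}
    (hne : (interior (convexHull ℝ ({x, y, z} : Set Plane))).Nonempty) :
    ∃ 𝓛, IsLineSet 𝓛 ∧ frontier (convexHull ℝ ({x, y, z} : Set Plane)) ⊆ linesUnion 𝓛 := by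
  have hr : range ![x, y, z] = {x, y, z} := by
    ext p
    simp only [mem_range, Fin.exists_fin_succ, mem_insert_iff, mem_singleton_iff]
    simp [eq_comm]
  have htop : affineSpan ℝ (range ![x, y, z]) = ⊤ := by
    rw [hr]; exact interior_convexHull_nonempty_iff_affineSpan_eq_top.1 hne
  have hind : AffineIndependent ℝ ![x, y, z] := by
    rw [affineIndependent_iff_finrank_vectorSpan_eq ℝ _ (n := 2) (by simp),
      ← direction_affineSpan, htop, AffineSubspace.direction_top, finrank_top,
      finrank_euclideanSpace, Fintype.card_fin]
  let b : AffineBasis (Fin 3) ℝ Plane := ⟨![x, y, z], hind, htop⟩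
  have hrb : range b = {x, y, z} := hr
  set nxt : Fin 3 → Fin 3 := fun i => i + 1
  have hnxt : ∀ i, nxt i ≠ i := by intro i; fin_cases i <;> simp [nxt]
  set ℓ : Fin 3 → Plane →L[ℝ] ℝ := fun i => LinearMap.toContinuousLinearMap (b.coord i).linear
    with hℓ
  have hcoord : ∀ i p, b.coord i p = ℓ i p - ℓ i (b (nxt i)) := by
    intro i p
    have h1 := (b.coord i).linearMap_vsub p (b (nxt i))
    rw [b.coord_apply_ne (hnxt i).symm] at h1
    simp only [vsub_eq_sub, sub_zero, map_sub] at h1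
    simp [hℓ, ← h1]
  refine ⟨range fun i => (ℓ i, ℓ i (b (nxt i))), ⟨finite_range _, ?_⟩, ?_⟩
  · rintro _ ⟨i, rfl⟩ h0
    have h1 := hcoord i (b i)
    have h0' : ℓ i = 0 := h0
    rw [b.coord_apply_eq, h0'] at h1
    simp at h1
  · rw [← hrb]
    intro p hp
    have hc : IsClosed (convexHull ℝ (range b)) := by
      rw [hrb]; exact (toFinite _).isClosed_convexHull ℝ
    rw [hc.frontier_eq, b.interior_convexHull, b.convexHull_eq_nonneg_coord] at hp
    obtain ⟨hp1, hp2⟩ := hp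
    simp only [mem_ofPred_eq, not_forall, not_lt] at hp1 hp2
    obtain ⟨i, hi⟩ := hp2
    refine ⟨_, ⟨i, rfl⟩, ?_⟩
    have := hcoord i p
    have h0 := le_antisymm hi (hp1 i)
    change ℓ i p = ℓ i (b (nxt i))
    linarith

theorem exists_lines_of_ncard_three {s : Set Plane} (hs : s.ncard = 3)
    (hne : (interior (convexHull ℝ s)).Nonempty) :
    ∃ 𝓛, IsLineSet 𝓛 ∧ frontier (convexHull ℝ s) ⊆ linesUnion 𝓛 := by
  obtain ⟨x, y, z, -, -, -, rfl⟩ := ncard_eq_three.1 hs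
  exact exists_lines_of_triangle hne

theorem exists_common_lines {𝒯 : Set (Set Plane)} (hf : 𝒯.Finite)
    (h : ∀ t ∈ 𝒯, ∃ 𝓛, IsLineSet 𝓛 ∧ frontier t ⊆ linesUnion 𝓛) :
    ∃ 𝓛, IsLineSet 𝓛 ∧ ∀ t ∈ 𝒯, frontier t ⊆ linesUnion 𝓛 := by
  choose! 𝓛 h𝓛 hfr using h
  refine ⟨⋃ t ∈ 𝒯, 𝓛 t, ⟨hf.biUnion fun t ht => (h𝓛 t ht).1, ?_⟩, fun t ht => ?_⟩
  · intro l hl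
    obtain ⟨t, ht, hlt⟩ := mem_iUnion₂.1 hl
    exact (h𝓛 t ht).2 l hlt
  · exact (hfr t ht).trans (linesUnion_mono (subset_biUnion_of_mem (u := 𝓛) ht))

variable {c₁ c₂ ε a : ℝ} {Ω : Set Plane} {R : Set (Set Plane)} {κ : Sym2 Plane → Plane}

theorem IsRegularTriangulation.isConvexCover (hR : IsRegularTriangulation c₁ c₂ ε Ω R)
    (hc₁ : 0 < c₁) (hε : 0 < ε) : IsConvexCover Ω (convexHull ℝ '' R) := by
  have hfin : ∀ s ∈ R, s.Finite := fun s hs =>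
    finite_of_ncard_ne_zero (by rw [hR.card s hs]; norm_num)
  have hinter : ∀ s ∈ R, (interior (convexHull ℝ s)).Nonempty := by
    intro s hs
    obtain ⟨x, hx⟩ := hR.inner_ball s hs
    exact ⟨x, interior_maximal hx Metric.isOpen_ball (Metric.mem_ball_self (by positivity))⟩
  refine ⟨hR.finite.image _, ?_, ?_, ?_, ?_, exists_common_lines (hR.finite.image _) ?_⟩
  · rintro _ ⟨s, hs, rfl⟩; exact (hfin s hs).isClosed_convexHull ℝ
  · rintro _ ⟨s, hs, rfl⟩; exact convex_convexHull ℝ s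
  · rintro _ ⟨s, hs, rfl⟩; exact hinter s hs
  · rw [biUnion_image]; exact hR.cover
  · rintro _ ⟨s, hs, rfl⟩; exact exists_lines_of_ncard_three (hR.card s hs) (hinter s hs)

/-- Four triangles obtained by joining points on the three edges of a triangle cover it. -/
theorem mem_subdivision {x y z p : Plane} {s₁ s₂ s₃ : ℝ} (h₁ : s₁ ∈ Ioo (0 : ℝ) 1)
    (h₂ : s₂ ∈ Ioo (0 : ℝ) 1) (h₃ : s₃ ∈ Ioo (0 : ℝ) 1) {A B C : Plane}
    (hA : A = (1 - s₁) • x + s₁ • y) (hB : B = (1 - s₂) • y + s₂ • z)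
    (hC : C = (1 - s₃) • z + s₃ • x) (hp : p ∈ convexHull ℝ ({x, y, z} : Set Plane)) :
    p ∈ convexHull ℝ ({x, A, C} : Set Plane) ∨ p ∈ convexHull ℝ ({y, B, A} : Set Plane) ∨
      p ∈ convexHull ℝ ({z, C, B} : Set Plane) ∨ p ∈ convexHull ℝ ({A, B, C} : Set Plane) := by
  obtain ⟨α, β, γ, hα, hβ, hγ, hs, rfl⟩ := mem_convexHull_triple.1 hp
  obtain ⟨h10, h11⟩ := h₁
  obtain ⟨h20, h21⟩ := h₂
  obtain ⟨h30, h31⟩ := h₃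
  have g1 : 0 < 1 - s₁ := by linarith
  have g2 : 0 < 1 - s₂ := by linarith
  have g3 : 0 < 1 - s₃ := by linarith
  have corner : ∀ {x y z A C : Plane} {α β γ s s' : ℝ}, 0 < s → 0 < s' → 0 ≤ β → 0 ≤ γ →
      α + β + γ = 1 → A = (1 - s) • x + s • y → C = (1 - s') • x + s' • z → β / s + γ / s' ≤ 1 →
      α • x + β • y + γ • z ∈ convexHull ℝ ({x, A, C} : Set Plane) := by
    intro x y z A C α β γ s s' hs hs' hβ hγ hsum hA hC hle
    refine mem_convexHull_triple.2 ⟨1 - β / s - γ / s', β / s, γ / s', by linarith, by positivity,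
      by positivity, by ring, ?_⟩
    have e1 : (1 - β / s - γ / s') + (β / s) * (1 - s) + (γ / s') * (1 - s') = α := by
      have : α = 1 - β - γ := by linarith
      rw [this]; field_simp; ring
    have e2 : β / s * s = β := by field_simp
    have e3 : γ / s' * s' = γ := by field_simp
    rw [hA, hC, ← e1]
    conv_lhs => rw [← e2, ← e3]
    rw [e2, e3]
    conv_lhs => rw [← e2, ← e3]
    rw [show β / s * s / s = β / s by field_simp, show γ / s' * s' / s' = γ / s' by field_simp]
    module
  by_cases k1 : β / s₁ + γ / (1 - s₃) ≤ 1
  · exact Or.inl (corner h10 g3 hβ hγ hs hA (by rw [hC]; module) k1)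
  by_cases k2 : γ / s₂ + α / (1 - s₁) ≤ 1
  · refine Or.inr (Or.inl ?_)
    have := corner (x := y) (y := z) (z := x) (A := B) (C := A) (α := β) h20 g1 hγ hα (by linarith) hB
      (by rw [hA]; module) k2
    rwa [show α • x + β • y + γ • z = β • y + γ • z + α • x by abel]
  by_cases k3 : α / s₃ + β / (1 - s₂) ≤ 1
  · refine Or.inr (Or.inr (Or.inl ?_))
    have := corner (x := z) (y := x) (z := y) (A := C) (C := B) (α := γ) h30 g2 hα hβ (by linarith) hC
      (by rw [hB]; module) k3
    rwa [show α • x + β • y + γ • z = γ • z + α • x + β • y by abel]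
  refine Or.inr (Or.inr (Or.inr ?_))
  rw [not_le, div_add_div _ _ h10.ne' g3.ne', one_lt_div (by positivity)] at k1
  rw [not_le, div_add_div _ _ h20.ne' g1.ne', one_lt_div (by positivity)] at k2
  rw [not_le, div_add_div _ _ h30.ne' g2.ne', one_lt_div (by positivity)] at k3
  set D := (1 - s₁) * (1 - s₂) * (1 - s₃) + s₁ * s₂ * s₃ with hD
  have hD0 : 0 < D := by positivity
  set wa := (α * (1 - s₂) + β * s₃ - s₃ * (1 - s₂)) / D with hwa
  set wb := (β * (1 - s₃) + γ * s₁ - s₁ * (1 - s₃)) / D with hwb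
  set wc := (γ * (1 - s₁) + α * s₂ - s₂ * (1 - s₁)) / D with hwc
  have ha : wa * D = α * (1 - s₂) + β * s₃ - s₃ * (1 - s₂) := by rw [hwa]; field_simp
  have hb : wb * D = β * (1 - s₃) + γ * s₁ - s₁ * (1 - s₃) := by rw [hwb]; field_simp
  have hc : wc * D = γ * (1 - s₁) + α * s₂ - s₂ * (1 - s₁) := by rw [hwc]; field_simp
  have hγ' : γ = 1 - α - β := by linarith
  have c1 : wa * (1 - s₁) + wc * s₃ = α := by
    refine mul_right_cancel₀ hD0.ne' ?_
    rw [add_mul, mul_right_comm, mul_right_comm wc, ha, hc, hγ', hD]; ring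
  have c2 : wa * s₁ + wb * (1 - s₂) = β := by
    refine mul_right_cancel₀ hD0.ne' ?_
    rw [add_mul, mul_right_comm, mul_right_comm wb, ha, hb, hγ', hD]; ring
  have c3 : wb * s₂ + wc * (1 - s₃) = γ := by
    refine mul_right_cancel₀ hD0.ne' ?_
    rw [add_mul, mul_right_comm, mul_right_comm wc, hb, hc, hγ', hD]; ring
  refine mem_convexHull_triple.2 ⟨wa, wb, wc, ?_, ?_, ?_, by linarith, ?_⟩
  · exact div_nonneg (by nlinarith) hD0.le
  · exact div_nonneg (by nlinarith) hD0.le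
  · exact div_nonneg (by nlinarith) hD0.le
  · rw [hA, hB, hC, ← c1, ← c2, ← c3]
    clear_value wa wb wc
    module

theorem adaptive_vertex (ha : 0 < a) (hκ : IsAdaptiveVertexChoice R a κ) {s : Set Plane} (hs : s ∈ R)
    {x y : Plane} (hx : x ∈ s) (hy : y ∈ s) (hxy : x ≠ y) :
    ∃ τ ∈ Ioo (0 : ℝ) 1, κ s(x, y) = (1 - τ) • x + τ • y := by
  obtain ⟨t, ht, h⟩ := hκ s hs x hx y hy hxy
  refine ⟨1 - t, ⟨by linarith [ht.2], by linarith [ht.1]⟩, ?_⟩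
  rw [h]; simp

theorem adaptive_vertex_mem (ha : 0 < a) (hκ : IsAdaptiveVertexChoice R a κ) {s : Set Plane}
    (hs : s ∈ R) {x y : Plane} (hx : x ∈ s) (hy : y ∈ s) (hxy : x ≠ y) :
    κ s(x, y) ∈ convexHull ℝ s := by
  obtain ⟨τ, hτ, h⟩ := adaptive_vertex ha hκ hs hx hy hxy
  rw [h]
  exact convex_convexHull ℝ s (subset_convexHull ℝ s hx) (subset_convexHull ℝ s hy)
    (by linarith [hτ.2]) hτ.1.le (by ring)

theorem adaptiveTriangulation_subset (ha : 0 < a) (hκ : IsAdaptiveVertexChoice R a κ) {t : Set Plane}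
    (ht : t ∈ adaptiveTriangulation R κ) : ∃ s ∈ R, convexHull ℝ t ⊆ convexHull ℝ s := by
  obtain ⟨x, y, z, hxy, hyz, hzx, hs, h | h⟩ := ht
  · refine ⟨_, hs, convexHull_min ?_ (convex_convexHull ℝ _)⟩
    rw [h]
    rintro p (rfl | rfl | rfl)
    · exact subset_convexHull ℝ _ (by simp)
    · exact adaptive_vertex_mem ha hκ hs (by simp) (by simp) hxy
    · exact adaptive_vertex_mem ha hκ hs (by simp) (by simp) hzx.symm
  · refine ⟨_, hs, convexHull_min ?_ (convex_convexHull ℝ _)⟩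
    rw [h]
    rintro p (rfl | rfl | rfl)
    · exact adaptive_vertex_mem ha hκ hs (by simp) (by simp) hxy
    · exact adaptive_vertex_mem ha hκ hs (by simp) (by simp) hyz
    · exact adaptive_vertex_mem ha hκ hs (by simp) (by simp) hzx

theorem adaptiveTriangulation_cover (ha : 0 < a) (hκ : IsAdaptiveVertexChoice R a κ)
    (hcard : ∀ s ∈ R, s.ncard = 3) {s : Set Plane} (hs : s ∈ R) {p : Plane}
    (hp : p ∈ convexHull ℝ s) : ∃ t ∈ adaptiveTriangulation R κ, p ∈ convexHull ℝ t := by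
  obtain ⟨x, y, z, hxy, hxz, hyz, rfl⟩ := ncard_eq_three.1 (hcard s hs)
  obtain ⟨τ₁, h₁, e₁⟩ := adaptive_vertex ha hκ hs (x := x) (y := y) (by simp) (by simp) hxy
  obtain ⟨τ₂, h₂, e₂⟩ := adaptive_vertex ha hκ hs (x := y) (y := z) (by simp) (by simp) hyz
  obtain ⟨τ₃, h₃, e₃⟩ := adaptive_vertex ha hκ hs (x := z) (y := x) (by simp) (by simp) hxz.symm
  have r1 : ({y, z, x} : Set Plane) = {x, y, z} := by ext; simp; tauto
  have r2 : ({z, x, y} : Set Plane) = {x, y, z} := by ext; simp; tauto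
  rcases mem_subdivision h₁ h₂ h₃ e₁ e₂ e₃ hp with h | h | h | h
  · exact ⟨_, ⟨x, y, z, hxy, hyz, hxz.symm, hs, Or.inl (by rw [Sym2.eq_swap (a := x) (b := z)])⟩, h⟩
  · exact ⟨_, ⟨y, z, x, hyz, hxz.symm, hxy, r1 ▸ hs, Or.inl (by rw [Sym2.eq_swap (a := y) (b := x)])⟩, h⟩
  · exact ⟨_, ⟨z, x, y, hxz.symm, hxy, hyz, r2 ▸ hs, Or.inl (by rw [Sym2.eq_swap (a := z) (b := y)])⟩, h⟩
  · exact ⟨_, ⟨x, y, z, hxy, hyz, hxz.symm, hs, Or.inr rfl⟩, h⟩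

theorem adaptiveTriangulation_triple {t : Set Plane} (ht : t ∈ adaptiveTriangulation R κ) :
    ∃ x y z, t = {x, y, z} := by
  obtain ⟨x, y, z, -, -, -, -, h | h⟩ := ht
  · exact ⟨_, _, _, h⟩
  · exact ⟨_, _, _, h⟩

theorem adaptiveTriangulation_finite (hR : R.Finite) (hcard : ∀ s ∈ R, s.ncard = 3) :
    (adaptiveTriangulation R κ).Finite := by
  have hfin : (⋃ s ∈ R, s).Finite := hR.biUnion fun s hs =>
    finite_of_ncard_ne_zero (by rw [hcard s hs]; norm_num)
  set P := ⋃ s ∈ R, s with hP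
  have hP3 : ((P ×ˢ P) ×ˢ P).Finite := (hfin.prod hfin).prod hfin
  refine ((hP3.image fun q => ({q.1.1, κ s(q.1.1, q.1.2), κ s(q.1.1, q.2)} : Set Plane)).union
    (hP3.image fun q => ({κ s(q.1.1, q.1.2), κ s(q.1.2, q.2), κ s(q.2, q.1.1)} : Set Plane))).subset ?_
  rintro t ⟨x, y, z, -, -, -, hs, h⟩
  have hmem : ∀ w ∈ ({x, y, z} : Set Plane), w ∈ P := fun w hw => mem_iUnion₂.2 ⟨_, hs, hw⟩
  have hq : ((x, y), z) ∈ (P ×ˢ P) ×ˢ P :=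
    ⟨⟨hmem x (by simp), hmem y (by simp)⟩, hmem z (by simp)⟩
  rcases h with h | h
  · exact Or.inl ⟨_, hq, h.symm⟩
  · exact Or.inr ⟨_, hq, h.symm⟩

/-- The nondegenerate triangles of an adaptive triangulation. -/
def adaptiveCover (R : Set (Set Plane)) (κ : Sym2 Plane → Plane) : Set (Set Plane) :=
  {t ∈ convexHull ℝ '' adaptiveTriangulation R κ | (interior t).Nonempty}

theorem IsRegularTriangulation.isConvexCover_adaptive
    (hR : IsRegularTriangulation c₁ c₂ ε Ω R) (hΩ : IsOpen Ω) (ha : 0 < a)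
    (hκ : IsAdaptiveVertexChoice R a κ) : IsConvexCover Ω (adaptiveCover R κ) := by
  have hf := (adaptiveTriangulation_finite (κ := κ) hR.finite hR.card).image (convexHull ℝ)
  have hcl : ∀ t ∈ convexHull ℝ '' adaptiveTriangulation R κ, IsClosed t := by
    rintro _ ⟨t, ht, rfl⟩
    obtain ⟨x, y, z, rfl⟩ := adaptiveTriangulation_triple ht
    exact (toFinite _).isClosed_convexHull ℝ
  have hconv : ∀ t ∈ convexHull ℝ '' adaptiveTriangulation R κ, Convex ℝ t := by
    rintro _ ⟨t, ht, rfl⟩; exact convex_convexHull ℝ t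
  have hcov : ⋃ t ∈ convexHull ℝ '' adaptiveTriangulation R κ, t = closure Ω := by
    rw [biUnion_image, ← hR.cover]
    refine Subset.antisymm (iUnion₂_subset fun t ht => ?_) (iUnion₂_subset fun s hs p hp => ?_)
    · obtain ⟨s, hs, hts⟩ := adaptiveTriangulation_subset ha hκ ht
      exact hts.trans (subset_biUnion_of_mem (u := fun s => convexHull ℝ s) hs)
    · obtain ⟨t, ht, hpt⟩ := adaptiveTriangulation_cover ha hκ hR.card hs hp
      exact mem_iUnion₂.2 ⟨t, ht, hpt⟩
  refine ⟨hf.subset (sep_subset _ _), fun t ht => hcl t ht.1, fun t ht => hconv t ht.1,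
    fun t ht => ht.2, biUnion_filter_interior_nonempty hΩ hf hcl hconv hcov,
    exists_common_lines (hf.subset (sep_subset _ _)) ?_⟩
  rintro _ ⟨⟨t, ht, rfl⟩, hne⟩
  obtain ⟨x, y, z, rfl⟩ := adaptiveTriangulation_triple ht
  exact exists_lines_of_triangle hne

end Triangles

section ApproxLim

variable {A : Set Plane} {u h : Plane → Plane} {x z : Plane}

theorem HasApproxLimWithin.add_continuous (hz : HasApproxLimWithin A u x z)
    (hh : ContinuousWithinAt h A x) : HasApproxLimWithin A (u + h) x (z + h x) := by
  intro η hη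
  refine tendsto_of_tendsto_of_tendsto_of_le_of_le' tendsto_const_nhds (hz (η / 2) (by positivity))
    (Eventually.of_forall fun _ => zero_le) ?_
  have h1 : ∀ᶠ y in 𝓝[A] x, ‖h y - h x‖ < η / 2 := by
    have h2 := (hh.sub continuousWithinAt_const : ContinuousWithinAt (fun y => h y - h x) A x).norm
    exact h2.eventually (gt_mem_nhds (by simpa using hη))
  rw [eventually_nhdsWithin_iff] at h1
  obtain ⟨ρ₀, hρ₀, hball⟩ := Metric.eventually_nhds_iff_ball.1 h1
  filter_upwards [Ioo_mem_nhdsGT hρ₀] with ρ hρ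
  refine ENNReal.div_le_div_right (measure_mono ?_) _
  rintro y ⟨hy1, hy2, hy3⟩
  refine ⟨hy1, hy2, ?_⟩
  have h3 := hball y (Metric.ball_subset_ball hρ.2.le hy1) hy2
  have h4 : ‖(u + h) y - (z + h x)‖ ≤ ‖u y - z‖ + ‖h y - h x‖ := by
    rw [Pi.add_apply, show u y + h y - (z + h x) = (u y - z) + (h y - h x) by abel]
    exact norm_add_le _ _
  linarith

theorem hasApproxLimWithin_add_continuous_iff (hh : ContinuousWithinAt h A x) :
    HasApproxLimWithin A (u + h) x (z + h x) ↔ HasApproxLimWithin A u x z := by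
  refine ⟨fun hz => ?_, fun hz => hz.add_continuous hh⟩
  have := hz.add_continuous (h := -h) hh.neg
  simpa using this

theorem hasApproxLimWithin_of_continuous (hh : ContinuousWithinAt h A x) :
    HasApproxLimWithin A h x (h x) := by
  have h0 : HasApproxLimWithin A 0 x 0 := by
    intro η hη
    simp [hη.not_gt]
  simpa using h0.add_continuous hh

theorem jumpSet_add_continuous (hh : ContinuousOn h A) : jumpSet A (u + h) = jumpSet A u := by
  ext x
  refine and_congr_right fun hx => not_congr ⟨?_, ?_⟩
  · rintro ⟨z, hz⟩
    refine ⟨z - h x, (hasApproxLimWithin_add_continuous_iff (hh x hx)).1 (by simpa using hz)⟩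
  · rintro ⟨z, hz⟩
    exact ⟨_, hz.add_continuous (hh x hx)⟩

theorem jumpSet_of_continuous (hh : ContinuousOn h A) : jumpSet A h = ∅ := by
  refine eq_empty_of_forall_notMem fun x hx => hx.2 ⟨_, hasApproxLimWithin_of_continuous (hh x hx.1)⟩

end ApproxLim

section Normal

theorem isLocalEquation_line {ℓ : Plane →L[ℝ] ℝ} (hℓ : ℓ ≠ 0) (c : ℝ) (x : Plane) :
    IsLocalEquation {y | ℓ y = c} x univ (fun y => ℓ y - c) := by
  have hd : ∀ y, fderiv ℝ (fun y => ℓ y - c) y = ℓ := fun y => by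
    rw [fderiv_sub_const]; exact ℓ.fderiv
  refine ⟨isOpen_univ, mem_univ _, (ℓ.contDiff.sub contDiff_const).contDiffOn, fun y _ => ?_, ?_⟩
  · rw [hd]; exact hℓ
  · ext y; simp [sub_eq_zero]

theorem isC1Curve_line {ℓ : Plane →L[ℝ] ℝ} (hℓ : ℓ ≠ 0) (c : ℝ) : IsC1Curve {y | ℓ y = c} :=
  fun x _ => ⟨_, _, isLocalEquation_line hℓ c x⟩

theorem exists_isUnitNormalAt_line {ℓ : Plane →L[ℝ] ℝ} (hℓ : ℓ ≠ 0) (c : ℝ) :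
    ∃ n : Plane, ‖n‖ = 1 ∧ ∀ x, ℓ x = c → IsUnitNormalAt {y | ℓ y = c} x n := by
  set w : Plane := (InnerProductSpace.toDual ℝ Plane).symm ℓ with hw
  have hw0 : w ≠ 0 := by simpa [hw] using hℓ
  have hin : ∀ y, inner ℝ w y = ℓ y := fun y => InnerProductSpace.toDual_symm_apply
  have hn : ‖‖w‖⁻¹ • w‖ = 1 := norm_smul_inv_norm hw0
  refine ⟨‖w‖⁻¹ • w, hn, fun x hx => ⟨hn, hx, univ, _, isLocalEquation_line hℓ c x, ?_⟩⟩
  intro y hy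
  have hd : fderiv ℝ (fun y => ℓ y - c) x = ℓ := by
    rw [fderiv_sub_const]; exact ℓ.fderiv
  rw [hd] at hy
  rw [real_inner_smul_left, hin, hy, mul_zero]

/-- A set contained in a finite union of lines has a unit normal field. -/
theorem IsLineSet.exists_isNormalField {𝓛 : Set ((Plane →L[ℝ] ℝ) × ℝ)} (h : IsLineSet 𝓛)
    {Γ : Set Plane} (hΓ : H1 (Γ \ linesUnion 𝓛) = 0) :
    ∃ ν : Plane → Plane, (∀ x, ‖ν x‖ ≤ 1) ∧ IsNormalField Γ ν := by
  classical
  have hex : ∀ l : (Plane →L[ℝ] ℝ) × ℝ, ∃ n : Plane, l ∈ 𝓛 →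
      ‖n‖ = 1 ∧ ∀ x, l.1 x = l.2 → IsUnitNormalAt {y | l.1 y = l.2} x n := by
    intro l
    by_cases hl : l ∈ 𝓛
    · obtain ⟨n, hn⟩ := exists_isUnitNormalAt_line (h.2 l hl) l.2
      exact ⟨n, fun _ => hn⟩
    · exact ⟨0, fun h' => absurd h' hl⟩
  choose n hn using hex
  obtain ⟨f, hf⟩ := countable_iff_exists_subset_range.1 h.1.countable
  refine ⟨fun x => if hx : ∃ l ∈ 𝓛, l.1 x = l.2 then n hx.choose else 0, fun x => ?_,
    fun k => if f k ∈ 𝓛 then {x | (f k).1 x = (f k).2} else ∅, fun k => ?_, ?_⟩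
  · dsimp only
    split_ifs with hx
    · exact (hn _ hx.choose_spec.1).1.le
    · simp
  · dsimp only
    split_ifs with hk
    · exact isC1Curve_line (h.2 _ hk) _
    · exact fun x hx => absurd hx (notMem_empty x)
  · refine measure_mono_null ?_ hΓ
    rintro x ⟨hxΓ, hx⟩
    refine ⟨hxΓ, fun hx' => hx ?_⟩
    have hxL : ∃ l ∈ 𝓛, l.1 x = l.2 := hx'
    obtain ⟨k, hk⟩ := hf hxL.choose_spec.1
    refine ⟨k, ?_⟩
    dsimp only
    rw [dif_pos hxL, hk, if_pos hxL.choose_spec.1]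
    exact (hn _ hxL.choose_spec.1).2 x hxL.choose_spec.2

theorem IsNormalField.union {Γ S : Set Plane} {ν ν' : Plane → Plane} (h : IsNormalField Γ ν)
    (h' : IsNormalField (S \ Γ) ν') [∀ x, Decidable (x ∈ Γ)] :
    IsNormalField (Γ ∪ S) (fun x => if x ∈ Γ then ν x else ν' x) := by
  obtain ⟨C, hC, hn⟩ := h
  obtain ⟨C', hC', hn'⟩ := h'
  refine ⟨fun k => Sum.elim C C' (Equiv.natSumNatEquivNat.symm k), fun k => ?_, ?_⟩
  · dsimp only
    rcases Equiv.natSumNatEquivNat.symm k with i | i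
    · exact hC i
    · exact hC' i
  · refine measure_mono_null ?_ (measure_union_null hn hn')
    rintro x ⟨hx, hx2⟩
    by_cases hxΓ : x ∈ Γ
    · refine Or.inl ⟨hxΓ, fun ⟨i, hi⟩ => hx2 ⟨Equiv.natSumNatEquivNat (Sum.inl i), ?_⟩⟩
      simpa [hxΓ] using hi
    · refine Or.inr ⟨⟨hx.resolve_left hxΓ, hxΓ⟩, fun ⟨i, hi⟩ =>
        hx2 ⟨Equiv.natSumNatEquivNat (Sum.inr i), ?_⟩⟩
      simpa [hxΓ] using hi

end Normal

namespace Data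

variable {m : Data}

theorem surfaceEnergy_empty : m.surfaceEnergy ∅ = 0 := by
  refine le_antisymm (iInf₂_le_of_le 0 ⟨fun _ => ∅, fun _ x hx => absurd hx (notMem_empty x), ?_⟩ ?_)
    zero_le
  · simp
  · simp

theorem surfaceEnergy_union_le {Γ S : Set Plane} (hΓ : NullMeasurableSet Γ H1)
    (hS : NullMeasurableSet S H1) :
    m.surfaceEnergy (Γ ∪ S) ≤ m.surfaceEnergy Γ + m.surfaceEnergy (S \ Γ) := by
  classical
  conv_rhs => rw [surfaceEnergy, surfaceEnergy]
  simp only [iInf_subtype']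
  refine ENNReal.le_iInf_add_iInf ?_
  rintro ⟨ν, hν⟩ ⟨ν', hν'⟩
  refine (iInf₂_le _ (hν.union hν')).trans ?_
  rw [← union_sdiff_self]
  refine (lintegral_union_le _ _ _).trans (add_le_add (le_of_eq ?_) (le_of_eq ?_))
  · refine lintegral_congr_ae ?_
    filter_upwards [ae_restrict_mem₀ hΓ] with x hx
    simp [hx]
  · refine lintegral_congr_ae ?_
    filter_upwards [ae_restrict_mem₀ (hS.diff hΓ)] with x hx
    simp [hx.2]

theorem surfaceEnergy_lt_top (hk : m.SurfaceDensityOK) {Γ : Set Plane}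
    {𝓛 : Set ((Plane →L[ℝ] ℝ) × ℝ)} (h : IsLineSet 𝓛) (hΓ : H1 (Γ \ linesUnion 𝓛) = 0)
    (hB : H1 (Γ \ closure m.ΩB) = 0) (hfin : H1 Γ < ⊤) : m.surfaceEnergy Γ < ⊤ := by
  classical
  obtain ⟨ν, hν1, hν⟩ := h.exists_isNormalField hΓ
  obtain ⟨K₁, K₂, -, hK₂, hK⟩ := hk.bounds
  refine (iInf₂_le ν hν).trans_lt ?_
  have hB' : ∀ᵐ x ∂H1.restrict Γ, x ∈ closure m.ΩB := by
    rw [ae_iff, show {x | x ∉ closure m.ΩB} = (closure m.ΩB)ᶜ from rfl,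
      Measure.restrict_apply isClosed_closure.measurableSet.compl]
    rwa [inter_comm, ← sdiff_eq]
  calc _ ≤ ∫⁻ x in Γ, ENNReal.ofReal K₂ ∂H1 := by
        refine lintegral_mono_ae ?_
        filter_upwards [hB'] with x hx
        rw [if_pos hx]
        refine ENNReal.ofReal_le_ofReal ((hK x hx _).2.trans ?_)
        nlinarith [hν1 x]
    _ < ⊤ := by
        rw [setLIntegral_const]
        exact ENNReal.mul_lt_top ENNReal.ofReal_lt_top hfin

theorem fullJump_add_continuous {g h u : Plane → Plane}
    (hh : ContinuousOn h (closure m.Ω)) : m.fullJump (g + h) (u + h) = m.fullJump g u := by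
  unfold fullJump
  rw [jumpSet_add_continuous (hh.mono subset_closure)]
  congr 1
  ext x
  refine and_congr_right fun hx => not_congr ?_
  exact hasApproxLimWithin_add_continuous_iff
    ((hh x (frontier_subset_closure hx.1)).mono subset_closure)

theorem fullJump_self {g : Plane → Plane} (hg : ContinuousOn g (closure m.Ω)) :
    m.fullJump g g = ∅ := by
  unfold fullJump
  rw [jumpSet_of_continuous (hg.mono subset_closure), empty_union]
  refine eq_empty_of_forall_notMem fun x hx => hx.2 ?_
  exact hasApproxLimWithin_of_continuous ((hg x (frontier_subset_closure hx.1.1)).mono subset_closure)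

end Data

section Pieces

variable {Ω : Set Plane} {𝒯 : Set (Set Plane)} {u : Plane → Plane}
  {A : Set Plane → Plane →ᵃ[ℝ] Plane}

theorem hasApproxLimWithin_of_mem_interior {t : Set Plane} {L : Plane →ᵃ[ℝ] Plane}
    (hu : EqOn u L (interior t)) {x : Plane} (hx : x ∈ interior t) :
    HasApproxLimWithin Ω u x (u x) := by
  refine hasApproxLimWithin_of_continuous (ContinuousAt.continuousWithinAt ?_)
  have hL : ContinuousAt L x := L.continuous_of_finiteDimensional.continuousAt
  exact hL.congr (hu.eventuallyEq_of_mem (isOpen_interior.mem_nhds hx)).symm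

namespace IsConvexCover

theorem jumpSet_eq (h : IsConvexCover Ω 𝒯) (hL : HasLipschitzBoundary Ω)
    (hu : ∀ t ∈ 𝒯, EqOn u (A t) (interior t)) :
    jumpSet Ω u = ⋃ t ∈ 𝒯, ⋃ t' ∈ 𝒯, Ω ∩ (t ∩ t' ∩ {x | A t x ≠ A t' x}) := by
  ext x
  simp only [jumpSet, mem_ofPred_eq, h.hasApproxLimWithin_iff hL hu, mem_iUnion, mem_inter_iff,
    exists_prop]
  constructor
  · rintro ⟨hx, hne⟩
    obtain ⟨t, ht, hxt⟩ := h.exists_mem (subset_closure hx)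
    push Not at hne
    obtain ⟨t', ht', hxt', hne'⟩ := hne (A t x)
    exact ⟨t, ht, t', ht', hx, ⟨hxt, hxt'⟩, hne'.symm⟩
  · rintro ⟨t, ht, t', ht', hx, ⟨hxt, hxt'⟩, hne⟩
    exact ⟨hx, fun ⟨z, hz⟩ => hne ((hz t ht hxt).trans (hz t' ht' hxt').symm)⟩

theorem measurableSet_jumpSet (h : IsConvexCover Ω 𝒯) (hL : HasLipschitzBoundary Ω) (hΩ : IsOpen Ω)
    (hu : ∀ t ∈ 𝒯, EqOn u (A t) (interior t)) : MeasurableSet (jumpSet Ω u) := by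
  rw [h.jumpSet_eq hL hu]
  refine h.finite.measurableSet_biUnion fun t ht => h.finite.measurableSet_biUnion fun t' ht' => ?_
  refine hΩ.measurableSet.inter (((h.closed t ht).measurableSet.inter
    (h.closed t' ht').measurableSet).inter ?_)
  exact (isOpen_ne_fun (A t).continuous_of_finiteDimensional
    (A t').continuous_of_finiteDimensional).measurableSet

end IsConvexCover

theorem IsConvexCover.measurableSet_fullJump {m : Data} (hm : m.GeometryOK)
    (h : IsConvexCover m.Ω 𝒯) (hu : ∀ t ∈ 𝒯, EqOn u (A t) (interior t)) {g : Plane → Plane}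
    (hg : ContinuousOn g (closure m.Ω)) : MeasurableSet (m.fullJump g u) := by
  refine (h.measurableSet_jumpSet hm.lipschitz_Ω hm.open_Ω hu).union ?_
  have hD : MeasurableSet m.bdD := isClosed_frontier.measurableSet.diff hm.closed_bdN.measurableSet
  have : {x | x ∈ m.bdD ∧ ¬ HasApproxLimWithin m.Ω u x (g x)} =
      m.bdD ∩ ⋃ t ∈ 𝒯, t \ {x ∈ closure m.Ω | A t x = g x} := by
    ext x
    simp only [h.hasApproxLimWithin_iff hm.lipschitz_Ω hu, mem_ofPred_eq, mem_inter_iff, mem_iUnion,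
      exists_prop, Set.mem_sdiff]
    refine and_congr_right fun hx => ?_
    have hxc : x ∈ closure m.Ω := frontier_subset_closure hx.1
    push Not
    simp [hxc]
  rw [this]
  refine hD.inter (h.finite.measurableSet_biUnion fun t ht => (h.closed t ht).measurableSet.diff ?_)
  have hc : IsClosed {x ∈ closure m.Ω | A t x = g x} := by
    have := ContinuousOn.preimage_isClosed_of_isClosed (f := fun x => A t x - g x)
      (((A t).continuous_of_finiteDimensional.continuousOn).sub hg) isClosed_closure
      (isClosed_singleton (x := (0 : Plane)))
    convert this using 1
    ext x; simp [sub_eq_zero]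
  exact hc.measurableSet

theorem IsConvexCover.fullJump_subset {m : Data} (hm : m.GeometryOK)
    (h : IsConvexCover m.Ω 𝒯) (hu : ∀ t ∈ 𝒯, EqOn u (A t) (interior t)) {g : Plane → Plane}
    {𝓛 : Set ((Plane →L[ℝ] ℝ) × ℝ)} (h𝓛 : ∀ t ∈ 𝒯, frontier t ⊆ linesUnion 𝓛) :
    m.fullJump g u ⊆ linesUnion 𝓛 := by
  rintro x (hx | hx)
  · by_contra hx𝓛
    obtain ⟨t, ht, hxt⟩ := h.exists_mem_interior h𝓛 (subset_closure hx.1) hx𝓛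
    exact hx.2 ⟨_, hasApproxLimWithin_of_mem_interior (hu t ht) hxt⟩
  · by_contra hx𝓛
    obtain ⟨t, ht, hxt⟩ := h.exists_mem_interior h𝓛 (frontier_subset_closure hx.1.1) hx𝓛
    have := hx.1.1.2
    rw [hm.open_Ω.interior_eq] at this
    exact this (h.interior_subset_domain hm.lipschitz_Ω ht hxt)

end Pieces

theorem IsContinuousAffine.sub {Ω : Set Plane} {R : Set (Set Plane)} {g h : Plane → Plane}
    (hg : IsContinuousAffine Ω R g) (hh : IsContinuousAffine Ω R h) :
    IsContinuousAffine Ω R (g - h) := by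
  refine ⟨hg.1.sub hh.1, fun s hs => ?_⟩
  obtain ⟨L, hL⟩ := hg.2 s hs
  obtain ⟨L', hL'⟩ := hh.2 s hs
  exact ⟨L - L', fun x hx => by simp [hL hx, hL' hx]⟩

namespace Data

variable {m : Data} {c₁ c₂ ε a δ t : ℝ} {R : Set (Set Plane)} {g : ℝ → Plane → Plane}
  {u v h : Plane → Plane} {Γ Γ₀ : Set Plane} {w : ℕ → Plane → Plane}

/-- A function of the finite element space is affine on the sets of a convex cover nested in `R`. -/
theorem exists_cover_of_mem_feSpace (hΩ : IsOpen m.Ω) (hR : IsRegularTriangulation c₁ c₂ ε m.Ω R)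
    (ha : 0 < a) (hu : u ∈ m.feSpace R a) :
    ∃ (𝒯 : Set (Set Plane)) (A : Set Plane → Plane →ᵃ[ℝ] Plane), IsConvexCover m.Ω 𝒯 ∧
      (∀ t ∈ 𝒯, EqOn u (A t) (interior t)) ∧
      ∀ t ∈ 𝒯, ∃ s ∈ R, t ⊆ convexHull ℝ s := by
  obtain ⟨κ, hκ, hA⟩ := hu.1
  have : ∀ t ∈ adaptiveCover R κ, ∃ L : Plane →ᵃ[ℝ] Plane, EqOn u L (interior t) := by
    rintro _ ⟨⟨t, ht, rfl⟩, -⟩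
    exact hA t ht
  choose! A hA using this
  refine ⟨adaptiveCover R κ, A, hR.isConvexCover_adaptive hΩ ha hκ, hA, ?_⟩
  rintro _ ⟨⟨t, ht, rfl⟩, -⟩
  exact adaptiveTriangulation_subset ha hκ ht

theorem add_mem_feSpace (ha : 0 < a) (hu : u ∈ m.feSpace R a) (hh : IsContinuousAffine m.Ω R h) :
    u + h ∈ m.feSpace R a := by
  obtain ⟨⟨κ, hκ, hA⟩, hj⟩ := hu
  refine ⟨⟨κ, hκ, fun t ht => ?_⟩, ?_⟩
  · obtain ⟨L, hL⟩ := hA t ht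
    obtain ⟨s, hs, hts⟩ := adaptiveTriangulation_subset ha hκ ht
    obtain ⟨L', hL'⟩ := hh.2 s hs
    exact ⟨L + L', fun x hx => by simp [hL hx, hL' (hts (interior_subset hx))]⟩
  · rw [jumpSet_add_continuous (hh.1.mono subset_closure)]
    exact hj

theorem mem_feSpace_of_isContinuousAffine (ha : 0 < a) (hu : u ∈ m.feSpace R a)
    (hh : IsContinuousAffine m.Ω R h) : h ∈ m.feSpace R a := by
  have h0 : (0 : Plane → Plane) ∈ m.feSpace R a := by
    obtain ⟨⟨κ, hκ, -⟩, -⟩ := hu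
    refine ⟨⟨κ, hκ, fun t _ => ⟨0, fun x _ => by simp⟩⟩, ?_⟩
    rw [jumpSet_of_continuous (h := (0 : Plane → Plane)) continuousOn_const]
    exact empty_subset _
  simpa using add_mem_feSpace ha h0 hh

theorem measurableSet_fullJump (hm : m.GeometryOK) (hR : IsRegularTriangulation c₁ c₂ ε m.Ω R)
    (ha : 0 < a) (hu : u ∈ m.feSpace R a) (hh : ContinuousOn h (closure m.Ω)) :
    MeasurableSet (m.fullJump h u) := by
  obtain ⟨𝒯, A, h𝒯, hA, -⟩ := exists_cover_of_mem_feSpace hm.open_Ω hR ha hu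
  exact h𝒯.measurableSet_fullJump hm hA hh

theorem IsMinimizer.surfaceEnergy_ne_top_and_le (hu : m.IsMinimizer R a t h Γ u)
    (hv : v ∈ m.feSpace R a) (hv0 : m.fullJump h v ⊆ Γ) :
    m.surfaceEnergy (m.fullJump h u \ Γ) ≠ ⊤ ∧
      m.elasticEnergy t u + (m.surfaceEnergy (m.fullJump h u \ Γ)).toReal ≤ m.elasticEnergy t v := by
  have h1 := hu.2 v hv
  rw [sdiff_eq_empty.2 hv0, surfaceEnergy_empty, EReal.coe_ennreal_zero, add_zero] at h1
  generalize m.surfaceEnergy (m.fullJump h u \ Γ) = s at h1 ⊢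
  have hs : s ≠ ⊤ := by
    rintro rfl
    rw [EReal.coe_ennreal_top, EReal.coe_add_top] at h1
    exact absurd h1 (by simp)
  refine ⟨hs, ?_⟩
  rw [← ENNReal.ofReal_toReal hs, EReal.coe_ennreal_ofReal, ← EReal.coe_add, EReal.coe_le_coe_iff,
    max_eq_left ENNReal.toReal_nonneg] at h1
  exact h1

theorem IsMinimizer.elasticEnergy_le (ha : 0 < a) (hu : m.IsMinimizer R a t h Γ u)
    (hh : IsContinuousAffine m.Ω R h) : m.elasticEnergy t u ≤ m.elasticEnergy t h := by
  have h1 := hu.surfaceEnergy_ne_top_and_le (mem_feSpace_of_isContinuousAffine ha hu.1 hh)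
    (by rw [fullJump_self hh.1]; exact empty_subset _)
  have : 0 ≤ (m.surfaceEnergy (m.fullJump h u \ Γ)).toReal := ENNReal.toReal_nonneg
  linarith [h1.2]

theorem numSteps_pos (hT : 0 < m.T) (hδ : 0 < δ) : 0 < m.numSteps δ :=
  Nat.ceil_pos.2 (by positivity)

theorem time_zero (hT : 0 < m.T) (hδ : 0 < δ) : m.time δ 0 = 0 := by
  simp [time, numSteps_pos hT hδ]

theorem lt_numSteps_iff (hδ : 0 < δ) {i : ℕ} : i < m.numSteps δ ↔ i * δ < m.T := by
  rw [numSteps, Nat.lt_ceil, lt_div_iff₀ hδ]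

theorem time_mem (hT : 0 < m.T) (hδ : 0 < δ) (i : ℕ) : m.time δ i ∈ Icc 0 m.T := by
  unfold time
  split_ifs with h
  · exact ⟨by positivity, ((lt_numSteps_iff hδ).1 h).le⟩
  · exact ⟨hT.le, le_rfl⟩

theorem time_le_succ (hδ : 0 < δ) (i : ℕ) : m.time δ i ≤ m.time δ (i + 1) := by
  unfold time
  split_ifs with h h' h'
  · push_cast; nlinarith
  · exact ((lt_numSteps_iff hδ).1 h).le
  · omega
  · exact le_rfl

theorem time_succ_sub_le (hδ : 0 < δ) (i : ℕ) : m.time δ (i + 1) - m.time δ i ≤ δ := by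
  unfold time
  split_ifs with h h' h'
  · push_cast; linarith
  · omega
  · have : ¬ ((i + 1 : ℕ) : ℝ) * δ < m.T := fun h'' => h ((lt_numSteps_iff hδ).2 h'')
    push_cast at this
    linarith
  · linarith

theorem interpolation_eq (hδ : 0 < δ) {i : ℕ} (hi : i < m.numSteps δ) {τ : ℝ}
    (hτ : τ ∈ Ico (m.time δ i) (m.time δ (i + 1))) : m.interpolation δ w τ = w i := by
  have h1 : m.time δ i = i * δ := if_pos hi
  rw [h1] at hτ
  have hT : m.time δ (i + 1) ≤ m.T := by
    unfold time
    split_ifs with h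
    · exact ((lt_numSteps_iff hδ).1 h).le
    · exact le_rfl
  have hle : m.time δ (i + 1) ≤ (i + 1 : ℕ) * δ := by
    unfold time
    split_ifs with h
    · exact le_rfl
    · exact not_lt.1 fun h'' => h ((lt_numSteps_iff hδ).2 h'')
  rw [interpolation, if_pos (hτ.2.trans_le hT)]
  congr 1
  rw [Nat.floor_eq_iff (div_nonneg ((by positivity : (0 : ℝ) ≤ i * δ).trans hτ.1) hδ.le)]
  refine ⟨(le_div_iff₀ hδ).2 hτ.1, (div_lt_iff₀ hδ).2 ?_⟩
  have := hτ.2.trans_le hle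
  push_cast at this
  exact this

theorem crack_zero : m.crack δ g Γ₀ w 0 = Γ₀ ∪ m.fullJump (g (m.time δ 0)) (w 0) := by
  simp [crack]

theorem crack_succ (i : ℕ) : m.crack δ g Γ₀ w (i + 1) =
    m.crack δ g Γ₀ w i ∪ m.fullJump (g (m.time δ (i + 1))) (w (i + 1)) := by
  unfold crack
  rw [union_assoc]
  congr 1
  ext x
  simp only [mem_iUnion, mem_union, exists_prop, Nat.le_succ_iff]
  constructor
  · rintro ⟨l, hl | rfl, hx⟩
    · exact Or.inl ⟨l, hl, hx⟩
    · exact Or.inr hx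
  · rintro (⟨l, hl, hx⟩ | hx)
    · exact ⟨l, Or.inl hl, hx⟩
    · exact ⟨_, Or.inr rfl, hx⟩

theorem IsDiscreteEvolution.mem_feSpace (hw : m.IsDiscreteEvolution R a δ g Γ₀ w) {i : ℕ}
    (hi : i ≤ m.numSteps δ) : w i ∈ m.feSpace R a := by
  rcases i with _ | i
  · exact hw.initial.1
  · exact (hw.step i hi).1

theorem IsDiscreteEvolution.elasticEnergy_le (hT : 0 < m.T) (ha : 0 < a) (hδ : 0 < δ)
    (hw : m.IsDiscreteEvolution R a δ g Γ₀ w)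
    (hg : ∀ t ∈ Icc 0 m.T, IsContinuousAffine m.Ω R (g t)) {i : ℕ} (hi : i ≤ m.numSteps δ) :
    m.elasticEnergy (m.time δ i) (w i) ≤ m.elasticEnergy (m.time δ i) (g (m.time δ i)) := by
  rcases i with _ | i
  · rw [time_zero hT hδ]
    exact hw.initial.elasticEnergy_le ha (hg 0 ⟨le_rfl, hT.le⟩)
  · exact (hw.step i hi).elasticEnergy_le ha (hg _ (time_mem hT hδ _))

theorem IsInitialCrack.nullMeasurableSet (hm : m.GeometryOK)
    (hR : IsRegularTriangulation c₁ c₂ ε m.Ω R) (ha : 0 < a) (h₀ : m.IsInitialCrack R a Γ₀) :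
    NullMeasurableSet Γ₀ H1 := by
  obtain ⟨-, -, z, hz, hΓ⟩ := h₀
  exact (measurableSet_fullJump hm hR ha hz continuousOn_const).nullMeasurableSet.congr hΓ.symm

theorem IsInitialCrack.surfaceEnergy_lt_top (hm : m.GeometryOK) (hk : m.SurfaceDensityOK)
    (hR : IsRegularTriangulation c₁ c₂ ε m.Ω R) (ha : 0 < a) (h₀ : m.IsInitialCrack R a Γ₀) :
    m.surfaceEnergy Γ₀ < ⊤ := by
  obtain ⟨hB, hfin, z, hz, hΓ⟩ := h₀
  obtain ⟨𝒯, A, h𝒯, hA, -⟩ := exists_cover_of_mem_feSpace hm.open_Ω hR ha hz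
  obtain ⟨𝓛, h𝓛, hfr⟩ := h𝒯.lines
  refine Data.surfaceEnergy_lt_top hk h𝓛 ?_ hB hfin
  refine measure_mono_null (t := Γ₀ \ m.fullJump 0 z)
    (sdiff_subset_sdiff_right (h𝒯.fullJump_subset hm hA hfr)) ?_
  exact (ae_le_set.1 hΓ.le)

theorem nullMeasurableSet_crack (hm : m.GeometryOK) (hT : 0 < m.T)
    (hR : IsRegularTriangulation c₁ c₂ ε m.Ω R) (ha : 0 < a) (hδ : 0 < δ)
    (hg : ∀ t ∈ Icc 0 m.T, IsContinuousAffine m.Ω R (g t)) (h₀ : m.IsInitialCrack R a Γ₀)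
    (hw : m.IsDiscreteEvolution R a δ g Γ₀ w) {i : ℕ} (hi : i ≤ m.numSteps δ) :
    NullMeasurableSet (m.crack δ g Γ₀ w i) H1 := by
  refine (h₀.nullMeasurableSet hm hR ha).union ?_
  refine NullMeasurableSet.iUnion fun l => NullMeasurableSet.iUnion fun hl => ?_
  exact (measurableSet_fullJump hm hR ha (hw.mem_feSpace (hl.trans hi))
    (hg _ (time_mem hT hδ _)).1).nullMeasurableSet

theorem surfaceEnergy_crack_ne_top (hm : m.GeometryOK) (hk : m.SurfaceDensityOK) (hT : 0 < m.T)
    (hR : IsRegularTriangulation c₁ c₂ ε m.Ω R) (ha : 0 < a) (hδ : 0 < δ)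
    (hg : ∀ t ∈ Icc 0 m.T, IsContinuousAffine m.Ω R (g t)) (h₀ : m.IsInitialCrack R a Γ₀)
    (hw : m.IsDiscreteEvolution R a δ g Γ₀ w) {i : ℕ} (hi : i ≤ m.numSteps δ) :
    m.surfaceEnergy (m.crack δ g Γ₀ w i) ≠ ⊤ := by
  have hgt : ∀ i, IsContinuousAffine m.Ω R (g (m.time δ i)) := fun i => hg _ (time_mem hT hδ i)
  have hsub : ∀ i Γ, m.fullJump (g (m.time δ i)) (g (m.time δ i)) ⊆ Γ := fun i Γ => by
    rw [fullJump_self (hgt i).1]; exact empty_subset _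
  induction i with
  | zero =>
    rw [crack_zero]
    refine ne_top_of_le_ne_top (ENNReal.add_ne_top.2 ⟨?_, ?_⟩) (surfaceEnergy_union_le
      (h₀.nullMeasurableSet hm hR ha)
      (measurableSet_fullJump hm hR ha (hw.mem_feSpace hi) (hgt 0).1).nullMeasurableSet)
    · exact (h₀.surfaceEnergy_lt_top hm hk hR ha).ne
    · have := hw.initial
      rw [← time_zero hT hδ] at this
      exact (this.surfaceEnergy_ne_top_and_le
        (mem_feSpace_of_isContinuousAffine ha this.1 (hgt 0)) (hsub _ _)).1
  | succ i ih =>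
    rw [crack_succ]
    refine ne_top_of_le_ne_top (ENNReal.add_ne_top.2 ⟨ih (by omega), ?_⟩) (surfaceEnergy_union_le
      (nullMeasurableSet_crack hm hT hR ha hδ hg h₀ hw (by omega))
      (measurableSet_fullJump hm hR ha (hw.mem_feSpace hi) (hgt _).1).nullMeasurableSet)
    exact ((hw.step i hi).surfaceEnergy_ne_top_and_le
        (mem_feSpace_of_isContinuousAffine ha (hw.step i hi).1 (hgt _)) (hsub _ _)).1

/-- The energy inequality obtained by comparing a minimizer with the previous one, corrected by the
increment of the boundary datum. -/
theorem totalEnergy_succ_le (hm : m.GeometryOK) (hk : m.SurfaceDensityOK) (hT : 0 < m.T)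
    (hR : IsRegularTriangulation c₁ c₂ ε m.Ω R) (ha : 0 < a) (hδ : 0 < δ)
    (hg : ∀ t ∈ Icc 0 m.T, IsContinuousAffine m.Ω R (g t)) (h₀ : m.IsInitialCrack R a Γ₀)
    (hw : m.IsDiscreteEvolution R a δ g Γ₀ w) {i : ℕ} (hi : i < m.numSteps δ) :
    m.totalEnergy (m.time δ (i + 1)) (w (i + 1)) (m.crack δ g Γ₀ w (i + 1)) ≤
      m.elasticEnergy (m.time δ (i + 1)) (w i + (g (m.time δ (i + 1)) - g (m.time δ i))) +
        (m.surfaceEnergy (m.crack δ g Γ₀ w i)).toReal := by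
  have hgt : ∀ i, IsContinuousAffine m.Ω R (g (m.time δ i)) := fun i => hg _ (time_mem hT hδ i)
  have hd := (hgt (i + 1)).sub (hgt i)
  have hsub : m.fullJump (g (m.time δ (i + 1))) (w i + (g (m.time δ (i + 1)) - g (m.time δ i))) ⊆
      m.crack δ g Γ₀ w i := by
    have := fullJump_add_continuous (m := m) (g := g (m.time δ i)) (u := w i) hd.1
    rw [add_sub_cancel] at this
    rw [this]
    refine subset_union_of_subset_right ?_ _
    exact subset_biUnion_of_mem (u := fun l => m.fullJump (g (m.time δ l)) (w l)) (le_refl i)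
  obtain ⟨h1, h2⟩ := (hw.step i hi).surfaceEnergy_ne_top_and_le
    (add_mem_feSpace ha (hw.mem_feSpace hi.le) hd) hsub
  have h3 := surfaceEnergy_union_le (m := m)
    (nullMeasurableSet_crack hm hT hR ha hδ hg h₀ hw hi.le)
    (measurableSet_fullJump hm hR ha (hw.mem_feSpace (i := i + 1) hi) (hgt (i + 1)).1).nullMeasurableSet
  have h4 := surfaceEnergy_crack_ne_top hm hk hT hR ha hδ hg h₀ hw hi.le
  have h5 := ENNReal.toReal_mono (ENNReal.add_ne_top.2 ⟨h4, h1⟩) h3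
  rw [ENNReal.toReal_add h4 h1, ← crack_succ] at h5
  unfold totalEnergy
  linarith

end Data

section Ray

variable {E : Type*} [NormedAddCommGroup E] [NormedSpace ℝ E] [CompleteSpace E]

theorem enorm_sub_le_lintegral_deriv {f f' : ℝ → E} {ℓ : ℝ} {B : ℝ} (hℓ : 0 ≤ ℓ)
    (hf : ContinuousOn f (Icc 0 ℓ)) {D : Set ℝ} (hD : D.Countable)
    (hdiff : ∀ s ∈ Ioo 0 ℓ \ D, HasDerivAt f (f' s) s ∧ ‖f' s‖ ≤ B) :
    ‖f ℓ - f 0‖ₑ ≤ ∫⁻ s in Ioo 0 ℓ, ‖f' s‖ₑ := by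
  have hae : ∀ᵐ s ∂volume.restrict (Ioc 0 ℓ), s ∈ Ioo 0 ℓ \ D := by
    rw [← restrict_Ioo_eq_restrict_Ioc]
    filter_upwards [ae_restrict_mem measurableSet_Ioo,
      ae_restrict_of_ae ((hD.ae_notMem volume))] with s h1 h2 using ⟨h1, h2⟩
  have hder : f' =ᵐ[volume.restrict (Ioc 0 ℓ)] deriv f := by
    filter_upwards [hae] with s hs using (hdiff s hs).1.deriv.symm
  have hinter : IntervalIntegrable f' volume 0 ℓ := by
    rw [intervalIntegrable_iff_integrableOn_Ioc_of_le hℓ]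
    refine Integrable.of_bound (C := B) ?_ (hae.mono fun s hs => (hdiff s hs).2)
    exact (aestronglyMeasurable_deriv f _).congr hder.symm
  rw [← integral_eq_of_hasDerivAt_off_countable_of_le f f' hℓ hD hf
    (fun s hs => (hdiff s hs).1) hinter, intervalIntegral.integral_of_le hℓ,
    ← restrict_Ioo_eq_restrict_Ioc]
  exact enorm_integral_le_lintegral_enorm _

theorem enorm_rpow_le_lintegral_deriv {f f' : ℝ → Plane} {ℓ r B : ℝ} (hr : 1 ≤ r) (hℓ : 0 ≤ ℓ)
    (hf : ContinuousOn f (Icc 0 ℓ)) (hfℓ : f ℓ = 0) {D : Set ℝ} (hD : D.Countable)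
    (hdiff : ∀ s ∈ Ioo 0 ℓ \ D, HasDerivAt f (f' s) s ∧ ‖f' s‖ ≤ B) :
    ‖f 0‖ₑ ^ r ≤ ∫⁻ s in Ioo 0 ℓ, ENNReal.ofReal r * ‖f s‖ₑ ^ (r - 1) * ‖f' s‖ₑ := by
  rcases hr.eq_or_lt with rfl | hr1
  · have := enorm_sub_le_lintegral_deriv hℓ hf hD hdiff
    rw [hfℓ, zero_sub, enorm_neg] at this
    simpa using this
  · obtain ⟨b, hb⟩ := (isCompact_Icc.bddAbove_image hf.norm)
    have hb' : ∀ s ∈ Icc 0 ℓ, ‖f s‖ ≤ b := fun s hs => hb ⟨s, hs, rfl⟩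
    have hb0 : 0 ≤ b := (norm_nonneg _).trans (hb' 0 ⟨le_rfl, hℓ⟩)
    have hbound : ∀ s, ‖((r * ‖f s‖ ^ (r - 2)) • innerSL ℝ (f s)) (f' s)‖ ≤
        r * ‖f s‖ ^ (r - 1) * ‖f' s‖ := by
      intro s
      rw [smul_apply, norm_smul, norm_mul, Real.norm_of_nonneg (by linarith),
        Real.norm_of_nonneg (by positivity), innerSL_apply_apply]
      refine (mul_le_mul_of_nonneg_left (norm_inner_le_norm _ _) (by positivity)).trans (le_of_eq ?_)
      rcases eq_or_ne (f s) 0 with h0 | h0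
      · simp [h0, Real.zero_rpow (by linarith : r - 1 ≠ 0)]
      · have : ‖f s‖ ^ (r - 1) = ‖f s‖ ^ (r - 2) * ‖f s‖ := by
          rw [← Real.rpow_add_one (norm_pos_iff.2 h0).ne']; ring_nf
        rw [this]; ring
    have key := enorm_sub_le_lintegral_deriv (f := fun s => ‖f s‖ ^ r)
      (f' := fun s => ((r * ‖f s‖ ^ (r - 2)) • innerSL ℝ (f s)) (f' s))
      (B := r * b ^ (r - 1) * B) hℓ
      (hf.norm.rpow_const fun _ _ => Or.inr (by linarith)) hD ?_
    · simp only [hfℓ, norm_zero] at key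
      rw [Real.zero_rpow (by linarith), zero_sub, enorm_neg] at key
      have e1 : ‖‖f 0‖ ^ r‖ₑ = ‖f 0‖ₑ ^ r := by
        rw [Real.enorm_eq_ofReal (by positivity), ← ENNReal.ofReal_rpow_of_nonneg (norm_nonneg _)
          (by linarith), ofReal_norm]
      rw [e1] at key
      refine key.trans (lintegral_mono fun s => ?_)
      rw [← ofReal_norm, ← ofReal_norm, ← ofReal_norm,
        ENNReal.ofReal_rpow_of_nonneg (norm_nonneg _) (by linarith),
        ← ENNReal.ofReal_mul (by linarith), ← ENNReal.ofReal_mul (by positivity)]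
      exact ENNReal.ofReal_le_ofReal (hbound s)
    · intro s hs
      refine ⟨?_, (hbound s).trans ?_⟩
      · exact (hasFDerivAt_norm_rpow (f s) hr1).comp_hasDerivAt s (hdiff s hs).1
      · have h1 : ‖f s‖ ^ (r - 1) ≤ b ^ (r - 1) :=
          Real.rpow_le_rpow (norm_nonneg _) (hb' s (Ioo_subset_Icc_self hs.1)) (by linarith)
        have h2 := (hdiff s hs).2
        gcongr

end Ray

section Epigraph

/-- Integration in oblique coordinates. -/
theorem exists_lintegral_oblique {d₁ d₂ : Plane}
    (hd : ∀ a b : ℝ, a • d₁ + b • d₂ = 0 → a = 0 ∧ b = 0) :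
    ∃ c : ℝ≥0, c ≠ 0 ∧ ∀ F : Plane → ℝ≥0∞, Measurable F →
      ∫⁻ x, F x = c * ∫⁻ s : ℝ, ∫⁻ t : ℝ, F (s • d₁ + t • d₂) ∧
      ∫⁻ s : ℝ, ∫⁻ t : ℝ, F (s • d₁ + t • d₂) ≤ (c : ℝ≥0∞)⁻¹ * ∫⁻ x, F x := by
  set f : ℝ × ℝ →ₗ[ℝ] Plane := (LinearMap.fst ℝ ℝ ℝ).smulRight d₁ + (LinearMap.snd ℝ ℝ ℝ).smulRight d₂
    with hf
  have hfa : ∀ p : ℝ × ℝ, f p = p.1 • d₁ + p.2 • d₂ := fun p => by simp [hf]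
  have hinj : Function.Injective f := by
    rw [← LinearMap.ker_eq_bot, LinearMap.ker_eq_bot']
    intro p hp
    rw [hfa] at hp
    exact Prod.ext (hd _ _ hp).1 (hd _ _ hp).2
  set L : (ℝ × ℝ) ≃L[ℝ] Plane := (f.linearEquivOfInjective hinj (by simp)).toContinuousLinearEquiv
    with hL
  have hLa : ∀ p : ℝ × ℝ, L p = p.1 • d₁ + p.2 • d₂ := fun p => by
    rw [← hfa]; rfl
  have hhaar : (Measure.map L (volume : Measure (ℝ × ℝ))).IsAddHaarMeasure :=
    L.isAddHaarMeasure_map volume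
  set c := Measure.addHaarScalarFactor (volume : Measure Plane) (Measure.map L volume) with hc
  have hvol : (volume : Measure Plane) = c • Measure.map L volume :=
    Measure.isAddLeftInvariant_eq_smul _ _
  have hc0 : c ≠ 0 := by
    intro h0
    rw [h0, zero_smul] at hvol
    exact (NeZero.ne (volume : Measure Plane)) hvol
  refine ⟨c, hc0, fun F hF => ?_⟩
  have h1 : ∫⁻ x, F x = c * ∫⁻ s : ℝ, ∫⁻ t : ℝ, F (s • d₁ + t • d₂) := by
    conv_lhs => rw [hvol]
    rw [lintegral_smul_measure, lintegral_map hF L.continuous.measurable, Measure.volume_eq_prod,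
      lintegral_prod (fun p => F (L p)) (hF.comp L.continuous.measurable).aemeasurable]
    simp only [hLa]
    rfl
  refine ⟨h1, ?_⟩
  rw [h1, ← mul_assoc, ENNReal.inv_mul_cancel (by simpa using hc0) ENNReal.coe_ne_top, one_mul]

/-- The product argument behind the Gagliardo–Nirenberg inequality in the plane. -/
theorem exists_lintegral_sq_le {d₁ d₂ : Plane}
    (hd : ∀ a b : ℝ, a • d₁ + b • d₂ = 0 → a = 0 ∧ b = 0) :
    ∃ c : ℝ≥0, ∀ F w : Plane → ℝ≥0∞, Measurable F → Measurable w →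
      (∀ x, w x ≤ ∫⁻ s : ℝ, F (x + s • d₁)) → (∀ x, w x ≤ ∫⁻ s : ℝ, F (x + s • d₂)) →
      ∫⁻ x, w x ^ 2 ≤ c * (∫⁻ x, F x) ^ 2 := by
  obtain ⟨c, hc0, hc⟩ := exists_lintegral_oblique hd
  refine ⟨c * (c⁻¹ * c⁻¹), fun F w hF hw h1 h2 => ?_⟩
  rw [(hc _ (hw.pow_const 2)).1]
  have hcc : ((c⁻¹ : ℝ≥0) : ℝ≥0∞) = (c : ℝ≥0∞)⁻¹ := ENNReal.coe_inv hc0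
  push_cast
  rw [hcc, mul_assoc]
  refine mul_le_mul_right ?_ _
  set P : ℝ → ℝ≥0∞ := fun t => ∫⁻ s : ℝ, F (s • d₁ + t • d₂) with hP
  set Q : ℝ → ℝ≥0∞ := fun s => ∫⁻ t : ℝ, F (s • d₁ + t • d₂) with hQ
  have hFm : Measurable fun p : ℝ × ℝ => F (p.1 • d₁ + p.2 • d₂) := hF.comp (by fun_prop)
  have hPm : Measurable P := hFm.lintegral_prod_left'
  have hQm : Measurable Q := hFm.lintegral_prod_right'
  have hQi : ∫⁻ s, Q s ≤ (c : ℝ≥0∞)⁻¹ * ∫⁻ x, F x := (hc F hF).2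
  have hPi : ∫⁻ t, P t ≤ (c : ℝ≥0∞)⁻¹ * ∫⁻ x, F x := by
    refine le_trans (le_of_eq ?_) hQi
    exact (lintegral_lintegral_swap (hFm.aemeasurable
      (μ := (volume : Measure ℝ).prod volume))).symm
  calc ∫⁻ s : ℝ, ∫⁻ t : ℝ, w (s • d₁ + t • d₂) ^ 2
      ≤ ∫⁻ s : ℝ, ∫⁻ t : ℝ, Q s * P t := by
        refine lintegral_mono fun s => lintegral_mono fun t => ?_
        rw [pow_two]
        refine mul_le_mul' ((h2 _).trans (le_of_eq ?_)) ((h1 _).trans (le_of_eq ?_))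
        · rw [hQ]
          dsimp only
          rw [← lintegral_add_left_eq_self (fun t' : ℝ => F (s • d₁ + t' • d₂)) t]
          refine lintegral_congr fun t' => ?_
          congr 1; module
        · rw [hP]
          dsimp only
          rw [← lintegral_add_left_eq_self (fun s' : ℝ => F (s' • d₁ + t • d₂)) s]
          refine lintegral_congr fun t' => ?_
          congr 1; module
    _ = (∫⁻ s, Q s) * ∫⁻ t, P t := by
        simp_rw [lintegral_const_mul _ hPm]
        rw [lintegral_mul_const _ hQm]
    _ ≤ ((c : ℝ≥0∞)⁻¹ * ∫⁻ x, F x) * ((c : ℝ≥0∞)⁻¹ * ∫⁻ x, F x) := mul_le_mul' hQi hPi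
    _ = _ := by ring

/-- On the graph of a Lipschitz function arc length is controlled by the measure of the projection. -/
theorem lintegral_graph_le {G : ℝ → Plane} {K : ℝ≥0} (hG : LipschitzWith K G) {S : Set Plane}
    (hS : S ⊆ range G) (w : Plane → ℝ≥0∞) : ∫⁻ x in S, w x ∂H1 ≤ K * ∫⁻ s, w (G s) := by
  have hle : H1.restrict S ≤ (K : ℝ≥0∞) • Measure.map G volume := by
    refine Measure.le_iff.2 fun A hA => ?_
    rw [Measure.restrict_apply hA, Measure.smul_apply, Measure.map_apply hG.continuous.measurable hA]
    have h1 : A ∩ S ⊆ G '' (G ⁻¹' A) := by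
      rintro x ⟨hx, hxS⟩
      obtain ⟨s, rfl⟩ := hS hxS
      exact ⟨s, hx, rfl⟩
    refine (measure_mono h1).trans ((hG.hausdorffMeasure_image_le zero_le_one _).trans ?_)
    rw [hausdorffMeasure_real, ENNReal.rpow_one, smul_eq_mul]
  refine (lintegral_mono' hle le_rfl).trans ?_
  rw [lintegral_smul_measure, smul_eq_mul]
  exact mul_le_mul_right (lintegral_map_le _ _) _

end Epigraph

/-- Functions that vanish at infinity, are continuous on `E` up to the part `S` of the boundary, and
are differentiable on `E`, with bounded derivative, except on finitely many lines. -/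
structure IsTestFunction (E S : Set Plane) (f : Plane → Plane) : Prop where
  cont : ContinuousOn f (E ∪ S)
  supp : ∃ ρ : ℝ, ∀ x, ρ ≤ ‖x‖ → f x = 0
  bdd : ∃ B : ℝ, ∀ x ∈ E, ‖f x‖ ≤ B
  diff : ∃ 𝓛, IsLineSet 𝓛 ∧ ∃ B : ℝ, ∀ x ∈ E, x ∉ linesUnion 𝓛 →
    DifferentiableAt ℝ f x ∧ ‖fderiv ℝ f x‖ ≤ B

/-- A bound on `E` for the gradient of `‖f‖ ^ r`. -/
noncomputable def gradPow (E : Set Plane) (r : ℝ) (f : Plane → Plane) : Plane → ℝ≥0∞ :=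
  E.indicator fun y => ENNReal.ofReal r * ‖f y‖ₑ ^ (r - 1) * ‖fderiv ℝ f y‖ₑ

section

variable {E S : Set Plane} {f : Plane → Plane} {r : ℝ}

theorem measurable_indicator_of_continuousOn (hE : IsOpen E) (hf : ContinuousOn f E) :
    Measurable (E.indicator f) := by
  classical
  have := hf.measurable_piecewise (continuousOn_const (c := (0 : Plane))) hE.measurableSet
  have h0 : E.piecewise f (fun _ => 0) = E.indicator f := piecewise_eq_indicator
  rwa [h0] at this

theorem measurable_gradPow (hE : IsOpen E) (hf : ContinuousOn f E) :
    Measurable (gradPow E r f) := by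
  have : gradPow E r f = E.indicator fun y =>
      ENNReal.ofReal r * ‖E.indicator f y‖ₑ ^ (r - 1) * ‖fderiv ℝ f y‖ₑ := by
    ext y
    by_cases hy : y ∈ E <;> simp [gradPow, hy]
  rw [this]
  refine Measurable.indicator ?_ hE.measurableSet
  have h1 := measurable_indicator_of_continuousOn hE hf
  have h2 := measurable_fderiv ℝ f
  exact (measurable_const.mul (h1.enorm.pow_const _)).mul h2.enorm

theorem finite_setOf_mem_linesUnion {𝓛 : Set ((Plane →L[ℝ] ℝ) × ℝ)} (h : 𝓛.Finite) {x d : Plane}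
    (hx : ∀ l ∈ 𝓛, l.1 d = 0 → l.1 x ≠ l.2) : {s : ℝ | x + s • d ∈ linesUnion 𝓛}.Finite := by
  have : {s : ℝ | x + s • d ∈ linesUnion 𝓛} ⊆ (fun l => (l.2 - l.1 x) / l.1 d) '' 𝓛 := by
    rintro s ⟨l, hl, hs⟩
    refine ⟨l, hl, ?_⟩
    rw [map_add, map_smul, smul_eq_mul] at hs
    have h0 : l.1 d ≠ 0 := by
      intro h0
      rw [h0, mul_zero, add_zero] at hs
      exact hx l hl h0 hs
    dsimp only
    rw [← hs]; field_simp; ring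
  exact (h.image _).subset this

theorem IsTestFunction.enorm_rpow_le (hr : 1 ≤ r) (hcont : ContinuousOn f (E ∪ S))
    (hsupp : ∃ ρ : ℝ, ∀ x, ρ ≤ ‖x‖ → f x = 0) {𝓛 : Set ((Plane →L[ℝ] ℝ) × ℝ)} (h𝓛 : IsLineSet 𝓛)
    {B : ℝ} (hdiff : ∀ x ∈ E, x ∉ linesUnion 𝓛 → DifferentiableAt ℝ f x ∧ ‖fderiv ℝ f x‖ ≤ B)
    {d : Plane} (hd : d ≠ 0) (hdir : ∀ x ∈ E ∪ S, ∀ s : ℝ, 0 < s → x + s • d ∈ E) {x : Plane}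
    (hxE : x ∈ E ∪ S) (hx : ∀ l ∈ 𝓛, l.1 d = 0 → l.1 x ≠ l.2) :
    ‖f x‖ₑ ^ r ≤ ‖d‖ₑ * ∫⁻ s : ℝ, gradPow E r f (x + s • d) := by
  obtain ⟨ρ, hρ⟩ := hsupp
  have hd0 : 0 < ‖d‖ := norm_pos_iff.2 hd
  set ℓ := (|ρ| + ‖x‖) / ‖d‖ with hℓ
  have hℓ0 : 0 ≤ ℓ := by positivity
  have hend : f (x + ℓ • d) = 0 := by
    refine hρ _ ?_
    have h1 : ‖ℓ • d‖ = |ρ| + ‖x‖ := by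
      rw [norm_smul, Real.norm_of_nonneg hℓ0, hℓ]; field_simp
    have h2 : ‖ℓ • d‖ ≤ ‖x + ℓ • d‖ + ‖x‖ := by
      have : ℓ • d = (x + ℓ • d) - x := by abel
      conv_lhs => rw [this]
      exact norm_sub_le _ _
    linarith [le_abs_self ρ]
  have hmem : ∀ s ∈ Icc 0 ℓ, x + s • d ∈ E ∪ S := by
    intro s hs
    rcases hs.1.eq_or_lt with rfl | h0
    · simpa using hxE
    · exact Or.inl (hdir x hxE s h0)
  have hfin := finite_setOf_mem_linesUnion h𝓛.1 hx
  have key := enorm_rpow_le_lintegral_deriv (f := fun s => f (x + s • d))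
    (f' := fun s => fderiv ℝ f (x + s • d) d) (B := B * ‖d‖) hr hℓ0
    (hcont.comp (by fun_prop) hmem) hend hfin.countable ?_
  · simp only [zero_smul, add_zero] at key
    refine key.trans ?_
    rw [← lintegral_const_mul' _ _ enorm_ne_top]
    refine le_trans (setLIntegral_mono' measurableSet_Ioo fun s hs => ?_) (setLIntegral_le_lintegral _ _)
    have hE : x + s • d ∈ E := hdir x hxE s hs.1
    rw [gradPow, indicator_of_mem hE, mul_comm ‖d‖ₑ, mul_assoc _ _ ‖d‖ₑ]
    refine mul_le_mul_right ?_ _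
    exact ContinuousLinearMap.le_opENorm _ _
  · intro s hs
    have hE : x + s • d ∈ E := hdir x hxE s hs.1.1
    obtain ⟨h1, h2⟩ := hdiff _ hE hs.2
    refine ⟨?_, (ContinuousLinearMap.le_opNorm _ _).trans (by gcongr)⟩
    have h3 : HasDerivAt (fun s : ℝ => x + s • d) d s := by
      simpa using ((hasDerivAt_id s).smul_const d).const_add x
    exact h1.hasFDerivAt.comp_hasDerivAt s h3

variable {φ : Plane ≃ₗᵢ[ℝ] Plane} {K : ℝ≥0} {γ : ℝ → ℝ}

theorem isOpen_epigraph (hγ : LipschitzWith K γ) : IsOpen {y : Plane | γ (φ y 0) < φ y 1} := by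
  refine isOpen_lt ?_ ?_
  · exact hγ.continuous.comp ((EuclideanSpace.proj 0).continuous.comp φ.continuous)
  · exact (EuclideanSpace.proj 1).continuous.comp φ.continuous

theorem coord_add_smul (x : Plane) (s a b : ℝ) (i : Fin 2) :
    φ (x + s • φ.symm (!₂[a, b])) i = φ x i + s * (!₂[a, b] : Plane) i := by
  simp

/-- Epigraphs are invariant under translation in the directions of a cone. -/
theorem add_mem_epigraph (hγ : LipschitzWith K γ) {x : Plane} (hx : γ (φ x 0) ≤ φ x 1) {a b : ℝ}
    (hab : K * |a| < b) {s : ℝ} (hs : 0 < s) :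
    γ (φ (x + s • φ.symm (!₂[a, b])) 0) < φ (x + s • φ.symm (!₂[a, b])) 1 := by
  rw [coord_add_smul, coord_add_smul]
  have h1 := hγ.dist_le_mul (φ x 0 + s * a) (φ x 0)
  rw [Real.dist_eq, Real.dist_eq, add_sub_cancel_left, abs_mul, abs_of_pos hs] at h1
  have h2 := le_abs_self (γ (φ x 0 + s * a) - γ (φ x 0))
  have h3 : s * (K * |a|) < s * b := by gcongr
  simp only [Matrix.cons_val_zero, Matrix.cons_val_one]
  have h4 : (K : ℝ) * (s * |a|) = s * (K * |a|) := by ring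
  rw [h4] at h1
  linarith

theorem exists_epigraph_bounds (hγ : LipschitzWith K γ) :
    ∃ c : ℝ≥0, ∀ S : Set Plane, MeasurableSet S → S ⊆ {y | γ (φ y 0) = φ y 1} →
      ∀ (f : Plane → Plane) (r : ℝ), 1 ≤ r → IsTestFunction {y | γ (φ y 0) < φ y 1} S f →
      (∫⁻ x in {y | γ (φ y 0) < φ y 1}, ‖f x‖ₑ ^ (2 * r)) ≤
          c * (∫⁻ x, gradPow {y | γ (φ y 0) < φ y 1} r f x) ^ 2 ∧
      ∫⁻ x in S, ‖f x‖ₑ ^ r ∂H1 ≤ c * ∫⁻ x, gradPow {y | γ (φ y 0) < φ y 1} r f x := by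
  set E : Set Plane := {y | γ (φ y 0) < φ y 1} with hE
  have hEo : IsOpen E := isOpen_epigraph hγ
  set d₀ : Plane := φ.symm (!₂[1, 0]) with hd₀
  set e : Plane := φ.symm (!₂[0, 1]) with he
  set d : Plane := φ.symm (!₂[1, K + 1]) with hd
  have hv : ∀ a b : ℝ, (!₂[a, b] : Plane) = 0 → a = 0 ∧ b = 0 := by
    intro a b h
    have h0 := congrArg (fun v : Plane => v 0) h
    have h1 := congrArg (fun v : Plane => v 1) h
    simpa using And.intro h0 h1
  have hcomb : ∀ s t a b a' b' : ℝ, s • φ.symm (!₂[a, b]) + t • φ.symm (!₂[a', b']) =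
      φ.symm (!₂[s * a + t * a', s * b + t * b']) := by
    intro s t a b a' b'
    rw [← map_smul, ← map_smul, ← map_add]
    congr 1
    ext i; fin_cases i <;> simp
  have hzero : ∀ v : Plane, φ.symm v = 0 → v = 0 := fun v hv => by simpa using hv
  have hne : ∀ a b : ℝ, b ≠ 0 → φ.symm (!₂[a, b]) ≠ 0 := fun a b hb h =>
    hb (hv a b (hzero _ h)).2
  have ind1 : ∀ a b : ℝ, a • e + b • d = 0 → a = 0 ∧ b = 0 := by
    intro a b h
    rw [hcomb] at h
    obtain ⟨h1, h2⟩ := hv _ _ (hzero _ h)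
    have hb : b = 0 := by linarith
    refine ⟨?_, hb⟩
    rw [hb] at h2; linarith
  have ind2 : ∀ a b : ℝ, a • d₀ + b • e = 0 → a = 0 ∧ b = 0 := by
    intro a b h
    rw [hcomb] at h
    obtain ⟨h1, h2⟩ := hv _ _ (hzero _ h)
    exact ⟨by linarith, by linarith⟩
  obtain ⟨c₁, hc₁⟩ := exists_lintegral_sq_le ind1
  obtain ⟨c₂, hc₂0, hc₂⟩ := exists_lintegral_oblique ind2
  set G : ℝ → Plane := fun s => φ.symm (!₂[s, γ s]) with hG
  have hGeq : ∀ s, G s = s • d₀ + γ s • e := by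
    intro s; rw [hcomb]; simp [hG]
  have hGL : LipschitzWith (1 + K) G := by
    refine LipschitzWith.of_dist_le_mul fun s t => ?_
    have hd₀1 : ‖d₀‖ = 1 := by rw [hd₀, LinearIsometryEquiv.norm_map]; simp [EuclideanSpace.norm_eq]
    have he1 : ‖e‖ = 1 := by rw [he, LinearIsometryEquiv.norm_map]; simp [EuclideanSpace.norm_eq]
    have h1 := hγ.dist_le_mul s t
    rw [Real.dist_eq, Real.dist_eq] at h1
    rw [dist_eq_norm, hGeq, hGeq, show s • d₀ + γ s • e - (t • d₀ + γ t • e) =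
      (s - t) • d₀ + (γ s - γ t) • e by module, Real.dist_eq]
    refine (norm_add_le _ _).trans ?_
    rw [norm_smul, norm_smul, hd₀1, he1, Real.norm_eq_abs, Real.norm_eq_abs]
    push_cast
    linarith
  refine ⟨c₁ * (‖e‖₊ + ‖d‖₊) ^ 2 + (1 + K) * (‖e‖₊ * c₂⁻¹), fun S hSm hS f r hr hf => ?_⟩
  obtain ⟨𝓛, h𝓛, B, hB⟩ := hf.diff
  have hFm : Measurable (gradPow E r f) := measurable_gradPow hEo (hf.cont.mono subset_union_left)
  have hES : ∀ x ∈ E ∪ S, γ (φ x 0) ≤ φ x 1 := by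
    rintro x (hx | hx)
    · exact le_of_lt hx
    · exact le_of_eq (hS hx)
  have hdir_e : ∀ x ∈ E ∪ S, ∀ s : ℝ, 0 < s → x + s • e ∈ E := fun x hx s hs =>
    add_mem_epigraph hγ (hES x hx) (by simp) hs
  have hdir_d : ∀ x ∈ E ∪ S, ∀ s : ℝ, 0 < s → x + s • d ∈ E := fun x hx s hs =>
    add_mem_epigraph hγ (hES x hx) (by simp) hs
  have ray_e := fun x => IsTestFunction.enorm_rpow_le (x := x) hr hf.cont hf.supp h𝓛 hB
    (hne 0 1 one_ne_zero) hdir_e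
  have ray_d := fun x => IsTestFunction.enorm_rpow_le (x := x) hr hf.cont hf.supp h𝓛 hB
    (hne 1 (K + 1) (by positivity)) hdir_d
  constructor
  · set w : Plane → ℝ≥0∞ := (E \ linesUnion 𝓛).indicator fun x => ‖f x‖ₑ ^ r with hw
    have hwm : Measurable w := by
      have : w = (E \ linesUnion 𝓛).indicator fun x => ‖E.indicator f x‖ₑ ^ r := by
        ext x
        by_cases hx : x ∈ E \ linesUnion 𝓛
        · simp [hw, hx, hx.1]
        · simp [hw, hx]
      rw [this]
      exact ((measurable_indicator_of_continuousOn hEo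
        (hf.cont.mono subset_union_left)).enorm.pow_const _).indicator
        (hEo.measurableSet.diff h𝓛.isClosed_linesUnion.measurableSet)
    have hbound : ∀ (v : Plane), (∀ x, x ∈ E ∪ S → (∀ l ∈ 𝓛, l.1 v = 0 → l.1 x ≠ l.2) →
        ‖f x‖ₑ ^ r ≤ ‖v‖ₑ * ∫⁻ s : ℝ, gradPow E r f (x + s • v)) → ‖v‖ₑ ≤ ‖e‖ₑ + ‖d‖ₑ →
        ∀ x, w x ≤ ∫⁻ s : ℝ, (‖e‖ₑ + ‖d‖ₑ) * gradPow E r f (x + s • v) := by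
      intro v hvb hvle x
      by_cases hx : x ∈ E \ linesUnion 𝓛
      · rw [hw, indicator_of_mem hx, lintegral_const_mul' _ _ (by simp)]
        refine (hvb x (Or.inl hx.1) fun l hl _ h => hx.2 ⟨l, hl, h⟩).trans ?_
        exact mul_le_mul_left hvle _
      · rw [hw, indicator_of_notMem hx]; exact zero_le
    have h1 := hc₁ (fun x => (‖e‖ₑ + ‖d‖ₑ) * gradPow E r f x) w (hFm.const_mul _) hwm
      (hbound e ray_e le_self_add) (hbound d ray_d le_add_self)
    rw [lintegral_const_mul' _ _ (by simp)] at h1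
    calc ∫⁻ x in E, ‖f x‖ₑ ^ (2 * r) = ∫⁻ x, w x ^ 2 := by
          rw [← lintegral_indicator hEo.measurableSet]
          refine lintegral_congr_ae ?_
          filter_upwards [measure_eq_zero_iff_ae_notMem.1 h𝓛.volume_eq_zero] with x hx
          by_cases hxE : x ∈ E
          · have : x ∈ E \ linesUnion 𝓛 := ⟨hxE, hx⟩
            rw [hw, indicator_of_mem hxE, indicator_of_mem this, ← ENNReal.rpow_natCast,
              ← ENNReal.rpow_mul]
            congr 1; push_cast; ring
          · have : x ∉ E \ linesUnion 𝓛 := fun h => hxE h.1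
            rw [hw, indicator_of_notMem hxE, indicator_of_notMem this]; simp
      _ ≤ c₁ * ((‖e‖ₑ + ‖d‖ₑ) * ∫⁻ x, gradPow E r f x) ^ 2 := h1
      _ = ((c₁ * (‖e‖₊ + ‖d‖₊) ^ 2 : ℝ≥0) : ℝ≥0∞) * (∫⁻ x, gradPow E r f x) ^ 2 := by
          push_cast
          rw [mul_pow, ← mul_assoc]; rfl
      _ ≤ _ := mul_le_mul_left (by push_cast; exact le_self_add) _
  · have hSG : S ⊆ range G := by
      intro x hx
      refine ⟨φ x 0, ?_⟩
      have h1 : γ (φ x 0) = φ x 1 := hS hx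
      rw [hG]
      dsimp only
      rw [h1, LinearIsometryEquiv.symm_apply_eq]
      ext i; fin_cases i <;> rfl
    set T : Set ℝ := {s | ∃ l ∈ 𝓛, l.1 e = 0 ∧ l.1 (G s) = l.2} with hT
    have hTfin : T.Finite := by
      refine (h𝓛.1.image fun l => l.2 / l.1 d₀).subset ?_
      rintro s ⟨l, hl, h0, hs⟩
      refine ⟨l, hl, ?_⟩
      rw [hGeq, map_add, map_smul, map_smul, h0, smul_zero, add_zero, smul_eq_mul] at hs
      have hl0 : l.1 d₀ ≠ 0 := by
        intro h00
        refine h𝓛.2 l hl (ContinuousLinearMap.ext fun y => ?_)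
        have hy : y = (φ y 0) • d₀ + (φ y 1) • e := by
          rw [hcomb]
          rw [LinearIsometryEquiv.eq_symm_apply]
          ext i; fin_cases i <;> simp
        rw [hy, map_add, map_smul, map_smul, h0, h00]; simp
      dsimp only
      rw [← hs]; field_simp
    calc ∫⁻ x in S, ‖f x‖ₑ ^ r ∂H1 = ∫⁻ x in S, S.indicator (fun x => ‖f x‖ₑ ^ r) x ∂H1 := by
          refine setLIntegral_congr_fun hSm fun x hx => ?_
          rw [indicator_of_mem hx]
      _ ≤ ((1 + K : ℝ≥0) : ℝ≥0∞) * ∫⁻ s, S.indicator (fun x => ‖f x‖ₑ ^ r) (G s) :=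
          lintegral_graph_le hGL hSG _
      _ ≤ ((1 + K : ℝ≥0) : ℝ≥0∞) * ∫⁻ s : ℝ, ‖e‖ₑ * ∫⁻ t : ℝ, gradPow E r f (s • d₀ + t • e) := by
          refine mul_le_mul_right (lintegral_mono_ae ?_) _
          filter_upwards [hTfin.countable.ae_notMem volume] with s hs
          by_cases hsS : G s ∈ S
          · rw [indicator_of_mem hsS]
            refine (ray_e (G s) (Or.inr hsS) fun l hl h0 h1 => hs ⟨l, hl, h0, h1⟩).trans
              (le_of_eq ?_)
            congr 1
            rw [← lintegral_add_left_eq_self (fun t : ℝ => gradPow E r f (s • d₀ + t • e)) (γ s)]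
            refine lintegral_congr fun t => ?_
            rw [hGeq]; congr 1; module
          · rw [indicator_of_notMem hsS]; exact zero_le
      _ ≤ ((1 + K : ℝ≥0) : ℝ≥0∞) * (‖e‖ₑ * ((c₂ : ℝ≥0∞)⁻¹ * ∫⁻ x, gradPow E r f x)) := by
          rw [lintegral_const_mul' _ _ enorm_ne_top]
          gcongr
          exact (hc₂ _ hFm).2
      _ = (((1 + K) * (‖e‖₊ * c₂⁻¹) : ℝ≥0) : ℝ≥0∞) * ∫⁻ x, gradPow E r f x := by
          push_cast [ENNReal.coe_inv hc₂0]
          rw [← mul_assoc, ← mul_assoc, ← mul_assoc]; rfl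
      _ ≤ _ := mul_le_mul_left (by push_cast; exact le_add_self) _

end

theorem exists_eLpNorm_le_eLpNorm {α : Type*} {mα : MeasurableSpace α} {F : Type*}
    [NormedAddCommGroup F] (μ : Measure α)
    [IsFiniteMeasure μ] {p q : ℝ≥0∞} (hpq : p ≤ q) (hp : p ≠ 0) :
    ∃ c : ℝ≥0, ∀ f : α → F, AEStronglyMeasurable f μ → eLpNorm f p μ ≤ c * eLpNorm f q μ := by
  have hexp : 0 ≤ 1 / p.toReal - 1 / q.toReal := by
    rcases eq_or_ne q ⊤ with rfl | hq
    · simp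
    · have hp' : 0 < p.toReal := ENNReal.toReal_pos hp (ne_top_of_le_ne_top hq hpq)
      have := ENNReal.toReal_mono hq hpq
      rw [sub_nonneg]
      gcongr
  have hfin : μ univ ^ (1 / p.toReal - 1 / q.toReal) ≠ ⊤ :=
    ENNReal.rpow_ne_top_of_nonneg hexp (measure_ne_top _ _)
  refine ⟨(μ univ ^ (1 / p.toReal - 1 / q.toReal)).toNNReal, fun f hf => ?_⟩
  rw [ENNReal.coe_toNNReal hfin, mul_comm]
  exact eLpNorm_le_eLpNorm_mul_rpow_measure_univ hpq hf

section

variable {E S : Set Plane} {f : Plane → Plane} {r : ℝ}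

theorem lintegral_gradPow_le (hr : 1 ≤ r) (hE : IsOpen E) (hf : ContinuousOn f E) :
    ∫⁻ x, gradPow E r f x ≤ ENNReal.ofReal r *
      (eLpNorm f (ENNReal.ofReal (2 * r)) (volume.restrict E) ^ (r - 1) *
        eLpNorm (fderiv ℝ f) (ENNReal.ofReal (2 * r / (1 + r))) (volume.restrict E)) := by
  have hfm : AEMeasurable f (volume.restrict E) := hf.aemeasurable hE.measurableSet
  have hgm : Measurable (fderiv ℝ f) := measurable_fderiv ℝ f
  have h0 : ∫⁻ x, gradPow E r f x =
      ENNReal.ofReal r * ∫⁻ x in E, ‖f x‖ₑ ^ (r - 1) * ‖fderiv ℝ f x‖ₑ := by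
    unfold gradPow
    rw [lintegral_indicator hE.measurableSet, ← lintegral_const_mul' _ _ ENNReal.ofReal_ne_top]
    simp_rw [mul_assoc]
  rw [h0]
  refine mul_le_mul_right ?_ _
  rcases hr.eq_or_lt with rfl | hr1
  · norm_num
    rw [eLpNorm_one_eq_lintegral_enorm]
  · have hq : 0 < 2 * r / (1 + r) := by positivity
    have hc : Real.HolderConjugate (2 * r / (r - 1)) (2 * r / (1 + r)) := by
      rw [Real.holderConjugate_iff]
      have : 0 < r - 1 := by linarith
      refine ⟨?_, ?_⟩
      · rw [lt_div_iff₀ this]; linarith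
      · field_simp; ring
    refine (ENNReal.lintegral_mul_le_Lp_mul_Lq _ hc (hfm.enorm.pow_const (r - 1))
      hgm.enorm.aemeasurable).trans (le_of_eq ?_)
    rw [eLpNorm_ofReal_eq (by positivity), eLpNorm_ofReal_eq hq]
    have e1 : ∀ x, (‖f x‖ₑ ^ (r - 1)) ^ (2 * r / (r - 1)) = ‖f x‖ₑ ^ (2 * r) := by
      intro x
      rw [← ENNReal.rpow_mul]
      congr 1
      have : r - 1 ≠ 0 := by linarith
      field_simp
    simp_rw [e1]
    congr 1
    rw [← ENNReal.rpow_mul]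
    congr 1
    field_simp

/-- The Gagliardo–Nirenberg and trace inequalities on the epigraph of a Lipschitz function. -/
theorem exists_epigraph_sobolev {φ : Plane ≃ₗᵢ[ℝ] Plane} {K : ℝ≥0} {γ : ℝ → ℝ}
    (hγ : LipschitzWith K γ) (hr : 1 ≤ r) :
    ∃ C : ℝ≥0, ∀ S : Set Plane, MeasurableSet S → S ⊆ {y | γ (φ y 0) = φ y 1} →
      ∀ f : Plane → Plane, IsTestFunction {y | γ (φ y 0) < φ y 1} S f →
      eLpNorm f (ENNReal.ofReal (2 * r)) (volume.restrict {y | γ (φ y 0) < φ y 1}) ≤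
        C * eLpNorm (fderiv ℝ f) (ENNReal.ofReal (2 * r / (1 + r)))
          (volume.restrict {y | γ (φ y 0) < φ y 1}) ∧
      eLpNorm f (ENNReal.ofReal r) (H1.restrict S) ≤
        C * eLpNorm (fderiv ℝ f) (ENNReal.ofReal (2 * r / (1 + r)))
          (volume.restrict {y | γ (φ y 0) < φ y 1}) := by
  obtain ⟨c, hc⟩ := exists_epigraph_bounds (φ := φ) hγ
  refine ⟨(c + 1) * r.toNNReal, fun S hSm hS f hf => ?_⟩
  obtain ⟨h1, h2⟩ := hc S hSm hS f r hr hf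
  set E : Set Plane := {y | γ (φ y 0) < φ y 1} with hE
  have hEo : IsOpen E := isOpen_epigraph hγ
  have hJ := lintegral_gradPow_le hr hEo (hf.cont.mono subset_union_left)
  set J := ∫⁻ x, gradPow E r f x with hJdef
  set X := eLpNorm f (ENNReal.ofReal (2 * r)) (volume.restrict E) with hX
  set N := eLpNorm (fderiv ℝ f) (ENNReal.ofReal (2 * r / (1 + r))) (volume.restrict E) with hN
  rw [lintegral_rpow_enorm_eq (by positivity), ← hX] at h1
  rw [lintegral_rpow_enorm_eq (by positivity)] at h2
  set Y := eLpNorm f (ENNReal.ofReal r) (H1.restrict S) with hY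
  have hXfin : X ≠ ⊤ := by
    obtain ⟨B, hB⟩ := hf.bdd
    obtain ⟨ρ, hρ⟩ := hf.supp
    have : X ≤ eLpNorm ((Metric.ball (0 : Plane) ρ).indicator fun _ => B)
        (ENNReal.ofReal (2 * r)) volume := by
      refine le_trans (eLpNorm_mono_ae ?_) (eLpNorm_mono_measure _ Measure.restrict_le_self)
      filter_upwards [ae_restrict_mem hEo.measurableSet] with x hx
      by_cases hxb : x ∈ Metric.ball (0 : Plane) ρ
      · rw [indicator_of_mem hxb]
        exact (hB x hx).trans (le_abs_self B)
      · rw [hρ x (by simpa using hxb)]; simp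
    refine ne_top_of_le_ne_top ?_ this
    exact (memLp_indicator_const _ Metric.isOpen_ball.measurableSet B
      (Or.inr Metric.isBounded_ball.measure_lt_top.ne)).eLpNorm_ne_top
  have hA : (((c + 1) * r.toNNReal : ℝ≥0) : ℝ≥0∞) = (c + 1) * ENNReal.ofReal r := by
    push_cast; rfl
  rw [hA]
  set A : ℝ≥0∞ := (c + 1) * ENNReal.ofReal r with hAdef
  have hXA : X ≤ A * N := by
    rcases eq_or_ne X 0 with h0 | h0
    · rw [h0]; exact zero_le
    have h3 : X ^ (2 * r) = X ^ (2 * (r - 1)) * X ^ 2 := by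
      rw [← ENNReal.rpow_natCast, ← ENNReal.rpow_add _ _ h0 hXfin]; congr 1; push_cast; ring
    have h4 : X ^ (2 * (r - 1)) * X ^ 2 ≤ X ^ (2 * (r - 1)) * (A * N) ^ 2 := by
      rw [← h3]
      calc X ^ (2 * r) ≤ c * J ^ 2 := h1
        _ ≤ c * (ENNReal.ofReal r * (X ^ (r - 1) * N)) ^ 2 := by gcongr
        _ = X ^ (2 * (r - 1)) * (c * (ENNReal.ofReal r * N) ^ 2) := by
            rw [mul_comm 2 (r - 1), ENNReal.rpow_mul, ENNReal.rpow_ofNat]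
            ring
        _ ≤ X ^ (2 * (r - 1)) * ((c + 1) ^ 2 * (ENNReal.ofReal r * N) ^ 2) := by
            gcongr
            have : (1 : ℝ≥0∞) ≤ c + 1 := le_add_self
            calc (c : ℝ≥0∞) ≤ (c + 1) * 1 := by rw [mul_one]; exact le_self_add
              _ ≤ (c + 1) * (c + 1) := by gcongr
              _ = _ := by ring
        _ = _ := by rw [hAdef]; ring
    have h5 : X ^ (2 * (r - 1)) ≠ 0 := by
      simp [ENNReal.rpow_eq_zero_iff, h0, hXfin]
    have h6 : X ^ (2 * (r - 1)) ≠ ⊤ := ENNReal.rpow_ne_top_of_nonneg (by linarith) hXfin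
    rw [ENNReal.mul_le_mul_iff_right h5 h6] at h4
    exact (ENNReal.pow_le_pow_left_iff two_ne_zero).1 h4
  refine ⟨hXA, ?_⟩
  have h7 : Y ^ r ≤ (A * N) ^ r := by
    calc Y ^ r ≤ c * J := h2
      _ ≤ c * (ENNReal.ofReal r * (X ^ (r - 1) * N)) := by gcongr
      _ ≤ (c + 1) * (ENNReal.ofReal r * ((A * N) ^ (r - 1) * N)) := by
          gcongr
          exact le_self_add
      _ = (A * N) ^ (r - 1) * (A * N) ^ (1 : ℝ) := by rw [ENNReal.rpow_one, hAdef]; ring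
      _ = _ := by rw [← ENNReal.rpow_add_of_nonneg _ _ (by linarith) zero_le_one]; congr 1; ring
  exact (ENNReal.rpow_le_rpow_iff (by linarith)).1 h7

end

/-- Functions on `Ω` that are piecewise smooth and continuous off the brittle part, up to the loaded
part of the boundary. -/
structure Data.IsTraceFunction (m : Data) (v : Plane → Plane) : Prop where
  cont : ContinuousOn v (m.Ω \ closure m.ΩB ∪ m.bdS)
  meas : AEStronglyMeasurable v m.μΩ
  bdd : ∃ B : ℝ, ∀ x ∈ m.Ω \ closure m.ΩB, ‖v x‖ ≤ B
  diff : ∃ 𝓛, IsLineSet 𝓛 ∧ ∃ B : ℝ, ∀ x ∈ m.Ω, x ∉ linesUnion 𝓛 →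
    DifferentiableAt ℝ v x ∧ ‖fderiv ℝ v x‖ ≤ B

section Cutoff

variable {m : Data} {E : Set Plane} {x₀ : Plane} {ρ : ℝ} {v : Plane → Plane}

theorem fderiv_smul_le_of_cutoff {χ : Plane → ℝ} (hχ : ContDiff ℝ ∞ χ) {L : ℝ}
    (hχ1 : ∀ x, ‖χ x‖ ≤ 1) (hL : ∀ x, ‖fderiv ℝ χ x‖ ≤ L) {x : Plane} (hx : DifferentiableAt ℝ v x) :
    DifferentiableAt ℝ (fun y => χ y • v y) x ∧
      ‖fderiv ℝ (fun y => χ y • v y) x‖ ≤ ‖fderiv ℝ v x‖ + L * ‖v x‖ := by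
  have hχd : DifferentiableAt ℝ χ x := (hχ.differentiable (by simp)).differentiableAt
  refine ⟨hχd.fun_smul hx, ?_⟩
  rw [fderiv_fun_smul hχd hx]
  refine (norm_add_le _ _).trans (add_le_add ?_ ?_)
  · rw [norm_smul]
    exact mul_le_of_le_one_left (norm_nonneg _) (hχ1 x)
  · rw [ContinuousLinearMap.norm_smulRight_apply]
    gcongr
    exact hL x

theorem fderiv_smul_eq_zero_of_cutoff {χ : Plane → ℝ} {x : Plane} (hx : x ∉ tsupport χ) :
    (fun y => χ y • v y) =ᶠ[𝓝 x] 0 := by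
  filter_upwards [notMem_tsupport_iff_eventuallyEq.1 hx] with y hy
  simp [hy]

theorem isTestFunction_cutoff (hv : m.IsTraceFunction v) (hloc : ∀ x ∈ Metric.ball x₀ ρ, x ∈ E ↔ x ∈ m.Ω)
    (hB : ∀ x ∈ Metric.ball x₀ ρ, x ∉ closure m.ΩB) {χ : Plane → ℝ} (hχ : ContDiff ℝ ∞ χ) {L : ℝ}
    (hχ1 : ∀ x, ‖χ x‖ ≤ 1) (hL : ∀ x, ‖fderiv ℝ χ x‖ ≤ L) (hsupp : tsupport χ ⊆ Metric.ball x₀ ρ) :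
    IsTestFunction E (m.bdS ∩ Metric.ball x₀ ρ) (fun y => χ y • v y) := by
  obtain ⟨B, hBd⟩ := hv.bdd
  obtain ⟨𝓛, h𝓛, B', hd⟩ := hv.diff
  have hL0 : 0 ≤ L := (norm_nonneg _).trans (hL x₀)
  refine ⟨fun x hx => ?_, ⟨‖x₀‖ + ρ, fun x hx => ?_⟩, ⟨|B|, fun x hx => ?_⟩, 𝓛, h𝓛,
    |B'| + L * |B|, fun x hx hx𝓛 => ?_⟩
  · by_cases hxb : x ∈ Metric.ball x₀ ρ
    · have hsub : (E ∪ (m.bdS ∩ Metric.ball x₀ ρ)) ∩ Metric.ball x₀ ρ ⊆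
          m.Ω \ closure m.ΩB ∪ m.bdS := by
        rintro y ⟨hy | hy, hyb⟩
        · exact Or.inl ⟨(hloc y hyb).1 hy, hB y hyb⟩
        · exact Or.inr hy.1
      have h1 : ContinuousWithinAt v (E ∪ (m.bdS ∩ Metric.ball x₀ ρ)) x := by
        have := (hv.cont x (hsub ⟨hx, hxb⟩)).mono hsub
        rwa [continuousWithinAt_inter (Metric.isOpen_ball.mem_nhds hxb)] at this
      exact hχ.continuous.continuousWithinAt.smul h1
    · have h2 := fderiv_smul_eq_zero_of_cutoff (v := v) fun h => hxb (hsupp h)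
      exact (continuousAt_const.congr h2.symm).continuousWithinAt
  · have : x ∉ tsupport χ := fun h => by
      have h3 := hsupp h
      rw [mem_ball_iff_norm] at h3
      have := norm_sub_norm_le x x₀
      linarith
    simp [image_eq_zero_of_notMem_tsupport this]
  · by_cases hxs : x ∈ tsupport χ
    · have := hBd x ⟨(hloc x (hsupp hxs)).1 hx, hB x (hsupp hxs)⟩
      rw [norm_smul]
      exact (mul_le_of_le_one_left (norm_nonneg _) (hχ1 x)).trans (this.trans (le_abs_self B))
    · simp [image_eq_zero_of_notMem_tsupport hxs]
  · by_cases hxs : x ∈ tsupport χ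
    · have hxΩ := (hloc x (hsupp hxs)).1 hx
      obtain ⟨h1, h2⟩ := hd x hxΩ hx𝓛
      obtain ⟨h3, h4⟩ := fderiv_smul_le_of_cutoff hχ hχ1 hL h1
      refine ⟨h3, h4.trans ?_⟩
      have := (hBd x ⟨hxΩ, hB x (hsupp hxs)⟩).trans (le_abs_self B)
      have := h2.trans (le_abs_self B')
      gcongr
    · have h2 := fderiv_smul_eq_zero_of_cutoff (v := v) hxs
      refine ⟨(differentiableAt_const (0 : Plane)).congr_of_eventuallyEq h2, ?_⟩
      rw [h2.fderiv_eq]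
      simp only [fderiv_zero, Pi.zero_apply, norm_zero]
      positivity

theorem eLpNorm_fderiv_cutoff_le (hΩ : IsOpen m.Ω) (hv : m.IsTraceFunction v)
    (hloc : ∀ x ∈ Metric.ball x₀ ρ, x ∈ E ↔ x ∈ m.Ω) {χ : Plane → ℝ} (hχ : ContDiff ℝ ∞ χ) {L : ℝ}
    (hχ1 : ∀ x, ‖χ x‖ ≤ 1) (hL : ∀ x, ‖fderiv ℝ χ x‖ ≤ L) (hsupp : tsupport χ ⊆ Metric.ball x₀ ρ)
    {s : ℝ≥0∞} (hs : 1 ≤ s) :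
    eLpNorm (fderiv ℝ fun y => χ y • v y) s (volume.restrict E) ≤ eLpNorm (fderiv ℝ v) s m.μΩ +
      ENNReal.ofReal L * eLpNorm v s (volume.restrict (m.Ω ∩ tsupport χ)) := by
  obtain ⟨𝓛, h𝓛, B', hd⟩ := hv.diff
  have hL0 : 0 ≤ L := (norm_nonneg _).trans (hL x₀)
  have hsm : MeasurableSet (tsupport χ) := (isClosed_tsupport χ).measurableSet
  have hle : volume.restrict (m.Ω ∩ tsupport χ) ≤ m.μΩ := Measure.restrict_mono inter_subset_left le_rfl
  have h1 : eLpNorm (fderiv ℝ fun y => χ y • v y) s (volume.restrict E) =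
      eLpNorm (fderiv ℝ fun y => χ y • v y) s (volume.restrict (m.Ω ∩ tsupport χ)) := by
    have hset : m.Ω ∩ tsupport χ = tsupport χ ∩ E := by
      ext x
      constructor
      · rintro ⟨h, h'⟩; exact ⟨h', (hloc x (hsupp h')).2 h⟩
      · rintro ⟨h', h⟩; exact ⟨(hloc x (hsupp h')).1 h, h'⟩
    rw [hset, ← Measure.restrict_restrict hsm, ← eLpNorm_indicator_eq_eLpNorm_restrict
      (f := fderiv ℝ fun y => χ y • v y) (p := s) (μ := volume.restrict E) hsm]
    congr 1
    ext1 x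
    by_cases hx : x ∈ tsupport χ
    · rw [indicator_of_mem hx]
    · rw [indicator_of_notMem hx, (fderiv_smul_eq_zero_of_cutoff (v := v) hx).fderiv_eq]
      simp
  rw [h1]
  have hvm : AEStronglyMeasurable v (volume.restrict (m.Ω ∩ tsupport χ)) := hv.meas.mono_measure hle
  have hgm : AEStronglyMeasurable (fderiv ℝ v) (volume.restrict (m.Ω ∩ tsupport χ)) :=
    (measurable_fderiv ℝ v).aestronglyMeasurable
  calc eLpNorm (fderiv ℝ fun y => χ y • v y) s (volume.restrict (m.Ω ∩ tsupport χ))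
      ≤ eLpNorm (fun x => ‖fderiv ℝ v x‖ + L * ‖v x‖) s (volume.restrict (m.Ω ∩ tsupport χ)) := by
        refine eLpNorm_mono_ae ?_
        filter_upwards [ae_restrict_mem (hΩ.measurableSet.inter hsm),
          ae_restrict_of_ae (measure_eq_zero_iff_ae_notMem.1 h𝓛.volume_eq_zero)] with x hx hx𝓛
        refine (fderiv_smul_le_of_cutoff hχ hχ1 hL (hd x hx.1 hx𝓛).1).2.trans (le_abs_self _)
    _ ≤ eLpNorm (fun x => ‖fderiv ℝ v x‖) s (volume.restrict (m.Ω ∩ tsupport χ)) +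
          eLpNorm (fun x => L * ‖v x‖) s (volume.restrict (m.Ω ∩ tsupport χ)) :=
        eLpNorm_add_le hgm.norm (hvm.norm.const_mul L) hs
    _ ≤ _ := by
        refine add_le_add ?_ (le_of_eq ?_)
        · rw [eLpNorm_norm]; exact eLpNorm_mono_measure _ hle
        · have : (fun x => L * ‖v x‖) = L • fun x => ‖v x‖ := rfl
          rw [this, eLpNorm_const_smul, eLpNorm_norm, Real.enorm_eq_ofReal hL0]

end Cutoff

section Trace

variable {m : Data}

theorem Data.isFiniteMeasure_μΩ (hm : m.GeometryOK) : IsFiniteMeasure m.μΩ :=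
  ⟨by rw [Data.μΩ, Measure.restrict_apply_univ]; exact hm.bounded_Ω.measure_lt_top⟩

/-- A smooth cutoff function between two concentric balls. -/
theorem exists_cutoff (x₀ : Plane) {ρ₁ ρ₂ : ℝ} (h₁ : 0 < ρ₁) (h₂ : ρ₁ < ρ₂) :
    ∃ (χ : Plane → ℝ) (L : ℝ), ContDiff ℝ ∞ χ ∧ (∀ x, ‖χ x‖ ≤ 1) ∧ (∀ x, ‖fderiv ℝ χ x‖ ≤ L) ∧
      tsupport χ = Metric.closedBall x₀ ρ₂ ∧ ∀ x ∈ Metric.closedBall x₀ ρ₁, χ x = 1 := by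
  let b : ContDiffBump x₀ := ⟨ρ₁, ρ₂, h₁, h₂⟩
  have hc : Continuous (fderiv ℝ b) := b.contDiff.continuous_fderiv (n := 1) (by simp)
  obtain ⟨L, hL⟩ := hc.bounded_above_of_compact_support (b.hasCompactSupport.fderiv ℝ)
  refine ⟨b, L, b.contDiff, fun x => ?_, hL, b.tsupport_eq, fun x hx => b.one_of_mem_closedBall hx⟩
  rw [Real.norm_of_nonneg b.nonneg]
  exact b.le_one

/-- Near a point of the loaded part of the boundary, `Ω` is an epigraph that does not meet the brittle
part. -/
theorem exists_local_epigraph (hm : m.GeometryOK) {x₀ : Plane} (hx₀ : x₀ ∈ m.bdS) :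
    ∃ ρ > 0, ∃ (φ : Plane ≃ₗᵢ[ℝ] Plane) (K : ℝ≥0) (γ : ℝ → ℝ), LipschitzWith K γ ∧
      (∀ x ∈ Metric.ball x₀ ρ, x ∈ {y | γ (φ y 0) < φ y 1} ↔ x ∈ m.Ω) ∧
      ∀ x ∈ Metric.ball x₀ ρ, x ∉ closure m.ΩB := by
  have hxf : x₀ ∈ frontier m.Ω := hm.bdN_sub (hm.bdS_sub hx₀)
  obtain ⟨U, hU, φ, K, γ, hγ, hUE⟩ := hm.lipschitz_Ω x₀ hxf
  have hBc : (closure m.ΩB)ᶜ ∈ 𝓝 x₀ := by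
    refine isClosed_closure.isOpen_compl.mem_nhds fun h => ?_
    have : x₀ ∈ closure m.ΩB ∩ m.bdS := ⟨h, hx₀⟩
    rw [hm.disjoint_ΩB_bdS] at this
    exact this
  obtain ⟨ρ', hρ', hball⟩ := Metric.mem_nhds_iff.1 (inter_mem hU hBc)
  refine ⟨ρ', hρ', φ, K, γ, hγ, fun x hx => ?_, fun x hx => (hball hx).2⟩
  have hxU := (hball hx).1
  constructor
  · intro h
    have : x ∈ m.Ω ∩ U := by rw [hUE]; exact ⟨h, hxU⟩
    exact this.1
  · intro h
    have : x ∈ {y | γ (φ y 0) < φ y 1} ∩ U := by rw [← hUE]; exact ⟨h, hxU⟩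
    exact this.1

theorem exists_local_trace_bound (hm : m.GeometryOK) {p q r : ℝ} (hq : 1 ≤ q) (hr : 1 ≤ r)
    (hpr : 2 * r / (1 + r) ≤ p) {x₀ : Plane} (hx₀ : x₀ ∈ m.bdS) :
    ∃ ρ > 0, ∃ C : ℝ≥0, ∀ v, m.IsTraceFunction v →
      eLpNorm v (ENNReal.ofReal r) (H1.restrict (m.bdS ∩ Metric.ball x₀ ρ)) ≤
        C * (eLpNorm (fderiv ℝ v) (ENNReal.ofReal p) m.μΩ +
          eLpNorm v (ENNReal.ofReal q) m.μΩ) := by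
  obtain ⟨ρ', hρ', φ, K, γ, hγ, hloc, hB⟩ := exists_local_epigraph hm hx₀
  set E : Set Plane := {y | γ (φ y 0) < φ y 1} with hE
  set ρ := ρ' / 4 with hρdef
  have hρ : 0 < ρ := by positivity
  set S := m.bdS ∩ Metric.ball x₀ ρ' with hS
  have hSm : MeasurableSet S := hm.closed_bdS.measurableSet.inter Metric.isOpen_ball.measurableSet
  have hSg : S ⊆ {y | γ (φ y 0) = φ y 1} := by
    rintro y ⟨hyS, hyb⟩
    have hyf := hm.bdN_sub (hm.bdS_sub hyS)
    have h1 : y ∉ E := fun h => by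
      have := hyf.2
      rw [hm.open_Ω.interior_eq] at this
      exact this ((hloc y hyb).1 h)
    refine le_antisymm ?_ (not_lt.1 h1)
    have hc : IsClosed {y : Plane | γ (φ y 0) ≤ φ y 1} := by
      refine isClosed_le ?_ ?_
      · exact hγ.continuous.comp ((EuclideanSpace.proj 0).continuous.comp φ.continuous)
      · exact (EuclideanSpace.proj 1).continuous.comp φ.continuous
    by_contra hlt
    obtain ⟨z, hz1, hz2⟩ := mem_closure_iff.1 hyf.1 ({y : Plane | γ (φ y 0) ≤ φ y 1}ᶜ ∩
      Metric.ball x₀ ρ') (hc.isOpen_compl.inter Metric.isOpen_ball) ⟨hlt, hyb⟩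
    have hzE : γ (φ z 0) < φ z 1 := (hloc z hz1.2).2 hz2
    exact hz1.1 (show γ (φ z 0) ≤ φ z 1 from hzE.le)
  obtain ⟨χ₁, L₁, hχ₁, hχ₁1, hL₁, hs₁, ho₁⟩ := exists_cutoff x₀ hρ (by linarith : ρ < 2 * ρ)
  obtain ⟨χ₂, L₂, hχ₂, hχ₂1, hL₂, hs₂, ho₂⟩ := exists_cutoff x₀ (by linarith : 0 < 2 * ρ)
    (by linarith : 2 * ρ < 3 * ρ)
  have hsub₁ : tsupport χ₁ ⊆ Metric.ball x₀ ρ' := by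
    rw [hs₁]; exact Metric.closedBall_subset_ball (by linarith)
  have hsub₂ : tsupport χ₂ ⊆ Metric.ball x₀ ρ' := by
    rw [hs₂]; exact Metric.closedBall_subset_ball (by linarith)
  obtain ⟨C₁, hC₁⟩ := exists_epigraph_sobolev (φ := φ) hγ hr
  obtain ⟨C₂, hC₂⟩ := exists_epigraph_sobolev (φ := φ) hγ (le_refl (1 : ℝ))
  have hfin := Data.isFiniteMeasure_μΩ hm
  set P := 2 * r / (1 + r) with hP
  have hP1 : 1 ≤ P := by rw [hP, le_div_iff₀ (by linarith)]; linarith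
  have hP2 : P ≤ 2 := by rw [hP, div_le_iff₀ (by linarith)]; linarith
  have h1P : (1 : ℝ≥0∞) ≤ ENNReal.ofReal P := by simpa using hP1
  obtain ⟨k₁, hk₁⟩ := exists_eLpNorm_le_eLpNorm (F := Mat) m.μΩ (ENNReal.ofReal_le_ofReal hpr)
    (by simpa using (by linarith : 0 < P))
  obtain ⟨k₂, hk₂⟩ := exists_eLpNorm_le_eLpNorm (F := Mat) m.μΩ (p := 1)
    (q := ENNReal.ofReal p) (by simpa using hP1.trans hpr) one_ne_zero
  obtain ⟨k₃, hk₃⟩ := exists_eLpNorm_le_eLpNorm (F := Plane) m.μΩ (p := 1)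
    (q := ENNReal.ofReal q) (by simpa using hq) one_ne_zero
  have hfin₂ : IsFiniteMeasure (volume.restrict (m.Ω ∩ tsupport χ₁)) :=
    ⟨by rw [Measure.restrict_apply_univ]
        exact (hm.bounded_Ω.subset inter_subset_left).measure_lt_top⟩
  obtain ⟨k₄, hk₄⟩ := exists_eLpNorm_le_eLpNorm (F := Plane) (volume.restrict (m.Ω ∩ tsupport χ₁))
    (p := ENNReal.ofReal P) (q := ENNReal.ofReal 2) (ENNReal.ofReal_le_ofReal hP2)
    (by simpa using (by linarith : 0 < P))
  refine ⟨ρ, hρ, C₁ * (k₁ + L₁.toNNReal * (k₄ * (C₂ * (k₂ + L₂.toNNReal * k₃)))), fun v hv => ?_⟩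
  set a := eLpNorm (fderiv ℝ v) (ENNReal.ofReal p) m.μΩ with ha
  set b := eLpNorm v (ENNReal.ofReal q) m.μΩ with hb
  have hgm : AEStronglyMeasurable (fderiv ℝ v) m.μΩ := (measurable_fderiv ℝ v).aestronglyMeasurable
  have step2 : eLpNorm (fun y => χ₂ y • v y) (ENNReal.ofReal 2) (volume.restrict E) ≤
      C₂ * (k₂ + L₂.toNNReal * k₃) * (a + b) := by
    have h1 := (hC₂ S hSm hSg _ (isTestFunction_cutoff hv hloc hB hχ₂ hχ₂1 hL₂ hsub₂)).1
    norm_num at h1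
    have h2 := eLpNorm_fderiv_cutoff_le hm.open_Ω hv hloc hχ₂ hχ₂1 hL₂ hsub₂ (s := 1) le_rfl
    have h3 : eLpNorm v 1 (volume.restrict (m.Ω ∩ tsupport χ₂)) ≤ eLpNorm v 1 m.μΩ :=
      eLpNorm_mono_measure _ (Measure.restrict_mono inter_subset_left le_rfl)
    have e2 : (ENNReal.ofReal 2) = 2 := by simp
    rw [e2]
    calc _ ≤ _ := h1
      _ ≤ C₂ * (k₂ * a + ENNReal.ofReal L₂ * (k₃ * b)) := by
          gcongr
          refine h2.trans (add_le_add (hk₂ _ hgm) ?_)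
          gcongr
          exact h3.trans (hk₃ _ hv.meas)
      _ ≤ C₂ * (k₂ * (a + b) + ENNReal.ofReal L₂ * (k₃ * (a + b))) := by
          gcongr
          · exact le_self_add
          · exact le_add_self
      _ = C₂ * (k₂ + ENNReal.ofReal L₂ * k₃) * (a + b) := by ring
      _ = _ := rfl
  have step1 : eLpNorm v (ENNReal.ofReal P) (volume.restrict (m.Ω ∩ tsupport χ₁)) ≤
      k₄ * (C₂ * (k₂ + L₂.toNNReal * k₃) * (a + b)) := by
    refine (hk₄ v (hv.meas.mono_measure (Measure.restrict_mono inter_subset_left le_rfl))).trans ?_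
    refine mul_le_mul_right (le_trans ?_ step2) _
    have hmm : MeasurableSet (m.Ω ∩ tsupport χ₁) :=
      hm.open_Ω.measurableSet.inter (isClosed_tsupport _).measurableSet
    have h4 : eLpNorm v (ENNReal.ofReal 2) (volume.restrict (m.Ω ∩ tsupport χ₁)) =
        eLpNorm (fun y => χ₂ y • v y) (ENNReal.ofReal 2) (volume.restrict (m.Ω ∩ tsupport χ₁)) := by
      refine eLpNorm_congr_ae ?_
      filter_upwards [ae_restrict_mem hmm] with x hx
      rw [ho₂ x (hs₁ ▸ hx.2), one_smul]
    rw [h4]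
    refine eLpNorm_mono_measure _ (Measure.restrict_mono ?_ le_rfl)
    exact fun x hx => (hloc x (hsub₁ hx.2)).2 hx.1
  have h5 := (hC₁ S hSm hSg _ (isTestFunction_cutoff hv hloc hB hχ₁ hχ₁1 hL₁ hsub₁)).2
  have h6 := eLpNorm_fderiv_cutoff_le hm.open_Ω hv hloc hχ₁ hχ₁1 hL₁ hsub₁ h1P
  have hmS : MeasurableSet (m.bdS ∩ Metric.ball x₀ ρ) :=
    hm.closed_bdS.measurableSet.inter Metric.isOpen_ball.measurableSet
  calc eLpNorm v (ENNReal.ofReal r) (H1.restrict (m.bdS ∩ Metric.ball x₀ ρ))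
      = eLpNorm (fun y => χ₁ y • v y) (ENNReal.ofReal r)
          (H1.restrict (m.bdS ∩ Metric.ball x₀ ρ)) := by
        refine eLpNorm_congr_ae ?_
        filter_upwards [ae_restrict_mem hmS] with x hx
        rw [ho₁ x (Metric.ball_subset_closedBall hx.2), one_smul]
    _ ≤ eLpNorm (fun y => χ₁ y • v y) (ENNReal.ofReal r) (H1.restrict S) :=
        eLpNorm_mono_measure _ (Measure.restrict_mono
          (inter_subset_inter_right _ (Metric.ball_subset_ball (by linarith))) le_rfl)
    _ ≤ _ := h5
    _ ≤ C₁ * (k₁ * a + ENNReal.ofReal L₁ * (k₄ * (C₂ * (k₂ + L₂.toNNReal * k₃) * (a + b)))) := by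
        gcongr
        refine h6.trans (add_le_add (hk₁ _ hgm) ?_)
        gcongr
    _ ≤ C₁ * (k₁ * (a + b) +
          ENNReal.ofReal L₁ * (k₄ * (C₂ * (k₂ + L₂.toNNReal * k₃) * (a + b)))) := by
        gcongr
        exact le_self_add
    _ = C₁ * (k₁ + ENNReal.ofReal L₁ * (k₄ * (C₂ * (k₂ + L₂.toNNReal * k₃)))) * (a + b) := by ring
    _ = _ := by push_cast; rfl

theorem eLpNorm_restrict_union_le {μ : Measure Plane} {v : Plane → Plane} {r : ℝ} (hr : 1 ≤ r)
    (s t : Set Plane) : eLpNorm v (ENNReal.ofReal r) (μ.restrict (s ∪ t)) ≤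
      eLpNorm v (ENNReal.ofReal r) (μ.restrict s) + eLpNorm v (ENNReal.ofReal r) (μ.restrict t) := by
  have h0 : 0 < r := by linarith
  rw [eLpNorm_ofReal_eq h0, eLpNorm_ofReal_eq h0, eLpNorm_ofReal_eq h0]
  refine (ENNReal.rpow_le_rpow (lintegral_union_le _ _ _) (by positivity)).trans ?_
  exact ENNReal.rpow_add_le_add_rpow _ _ (by positivity) (by rw [div_le_one h0]; exact hr)

/-- The trace inequality on the loaded part of the boundary. -/
theorem exists_trace_bound (hm : m.GeometryOK) {p q r : ℝ} (hq : 1 ≤ q) (hr : 1 ≤ r)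
    (hpr : 2 * r / (1 + r) ≤ p) :
    ∃ C : ℝ≥0, ∀ v, m.IsTraceFunction v → eLpNorm v (ENNReal.ofReal r) m.μS ≤
        C * (eLpNorm (fderiv ℝ v) (ENNReal.ofReal p) m.μΩ +
          eLpNorm v (ENNReal.ofReal q) m.μΩ) := by
  have hcomp : IsCompact m.bdS := by
    refine Metric.isCompact_of_isClosed_isBounded hm.closed_bdS
      (hm.bounded_Ω.closure.subset ?_)
    exact (hm.bdS_sub.trans hm.bdN_sub).trans frontier_subset_closure
  have key := hcomp.induction_on (p := fun s => ∃ C : ℝ≥0, ∀ v, m.IsTraceFunction v →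
      eLpNorm v (ENNReal.ofReal r) (H1.restrict (m.bdS ∩ s)) ≤
        C * (eLpNorm (fderiv ℝ v) (ENNReal.ofReal p) m.μΩ + eLpNorm v (ENNReal.ofReal q) m.μΩ))
    ⟨0, fun v hv => by simp⟩ ?_ ?_ ?_
  · simpa [Data.μS] using key
  · rintro s t hst ⟨C, hC⟩
    exact ⟨C, fun v hv => (eLpNorm_mono_measure _
      (Measure.restrict_mono (inter_subset_inter_right _ hst) le_rfl)).trans (hC v hv)⟩
  · rintro s t ⟨C, hC⟩ ⟨C', hC'⟩
    refine ⟨C + C', fun v hv => ?_⟩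
    rw [inter_union_distrib_left]
    refine (eLpNorm_restrict_union_le hr _ _).trans ((add_le_add (hC v hv) (hC' v hv)).trans ?_)
    push_cast
    rw [add_mul]
  · intro x hx
    obtain ⟨ρ, hρ, C, hC⟩ := exists_local_trace_bound hm hq hr hpr hx
    exact ⟨Metric.ball x ρ, mem_nhdsWithin_of_mem_nhds (Metric.ball_mem_nhds x hρ), C, hC⟩

theorem Data.ExponentsOK.trace_exponent_le (h : m.ExponentsOK) : 2 * m.r / (1 + m.r) ≤ m.p := by
  have hr : 1 < m.r := h.one_lt_p.trans_le h.p_le_r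
  rw [div_le_iff₀ (by linarith)]
  rcases lt_or_ge m.p 2 with hp | hp
  · have := h.r_le hp
    rw [le_div_iff₀ (by linarith)] at this
    linarith
  · nlinarith

end Trace

/-- The linear part of an affine map of the plane. -/
noncomputable def linPart (L : Plane →ᵃ[ℝ] Plane) : Mat := LinearMap.toContinuousLinearMap L.linear

theorem affine_sub_eq_linPart (L : Plane →ᵃ[ℝ] Plane) (x y : Plane) : L x - L y = linPart L (x - y) := by
  have := L.linearMap_vsub x y
  simpa [linPart] using this.symm

theorem hasFDerivAt_affine (L : Plane →ᵃ[ℝ] Plane) (x : Plane) : HasFDerivAt L (linPart L) x := by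
  have h1 : (L : Plane → Plane) = fun y => linPart L y + L 0 := by
    ext1 y
    have := affine_sub_eq_linPart L y 0
    rw [sub_zero] at this
    rw [← this]; abel
  have h2 : HasFDerivAt (fun y => linPart L y + L 0) (linPart L) x :=
    (linPart L).hasFDerivAt.add_const _
  rwa [← h1] at h2

section Pieces

variable {Ω : Set Plane} {𝒯 : Set (Set Plane)} {u : Plane → Plane}
  {A : Set Plane → Plane →ᵃ[ℝ] Plane}

namespace IsConvexCover

theorem bounded (h : IsConvexCover Ω 𝒯) (hΩ : Bornology.IsBounded Ω) {t : Set Plane} (ht : t ∈ 𝒯) :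
    IsCompact t :=
  Metric.isCompact_of_isClosed_isBounded (h.closed t ht)
    (hΩ.closure.subset (h.subset_closure_domain ht))

theorem exists_value_bound (h : IsConvexCover Ω 𝒯) (hΩ : Bornology.IsBounded Ω)
    (A : Set Plane → Plane →ᵃ[ℝ] Plane) : ∃ B : ℝ, ∀ t ∈ 𝒯, ∀ x ∈ t, ‖A t x‖ ≤ B := by
  have h1 : ∀ t ∈ 𝒯, ∃ B : ℝ, ∀ x ∈ t, ‖A t x‖ ≤ B := by
    intro t ht
    obtain ⟨B, hB⟩ := (h.bounded hΩ ht).bddAbove_image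
      (A t).continuous_of_finiteDimensional.norm.continuousOn
    exact ⟨B, fun x hx => hB ⟨x, hx, rfl⟩⟩
  choose! B hB using h1
  obtain ⟨B', hB'⟩ := (h.finite.image B).bddAbove
  exact ⟨B', fun t ht x hx => (hB t ht x hx).trans (hB' ⟨t, ht, rfl⟩)⟩

theorem exists_linPart_bound (h : IsConvexCover Ω 𝒯) (A : Set Plane → Plane →ᵃ[ℝ] Plane) :
    ∃ Λ : ℝ, 0 ≤ Λ ∧ ∀ t ∈ 𝒯, ‖linPart (A t)‖ ≤ Λ := by
  obtain ⟨Λ, hΛ⟩ := (h.finite.image fun t => ‖linPart (A t)‖).bddAbove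
  exact ⟨|Λ|, abs_nonneg _, fun t ht => (hΛ ⟨t, ht, rfl⟩).trans (le_abs_self _)⟩

theorem hasFDerivAt_of_mem_interior (hu : ∀ t ∈ 𝒯, EqOn u (A t) (interior t)) {t : Set Plane}
    (ht : t ∈ 𝒯) {x : Plane} (hx : x ∈ interior t) : HasFDerivAt u (linPart (A t)) x :=
  (hasFDerivAt_affine (A t) x).congr_of_eventuallyEq
    ((hu t ht).eventuallyEq_of_mem (isOpen_interior.mem_nhds hx))

theorem eqOn_trace (h : IsConvexCover Ω 𝒯) (hL : HasLipschitzBoundary Ω)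
    (hu : ∀ t ∈ 𝒯, EqOn u (A t) (interior t)) {t : Set Plane} (ht : t ∈ 𝒯) :
    EqOn (trace Ω u) (A t) (interior t) := fun _ hx =>
  h.trace_eq hL hu ⟨_, hasApproxLimWithin_of_mem_interior (hu t ht) hx⟩ ht (interior_subset hx)

theorem ae_exists_mem_interior (h : IsConvexCover Ω 𝒯) :
    ∀ᵐ x ∂volume.restrict Ω, x ∈ Ω → ∃ t ∈ 𝒯, x ∈ interior t := by
  obtain ⟨𝓛, h𝓛, hfr⟩ := h.lines
  filter_upwards [ae_restrict_of_ae (measure_eq_zero_iff_ae_notMem.1 h𝓛.volume_eq_zero)]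
    with x hx hxΩ
  exact h.exists_mem_interior hfr (subset_closure hxΩ) hx

theorem aestronglyMeasurable (h : IsConvexCover Ω 𝒯) (hΩ : IsOpen Ω)
    (hu : ∀ t ∈ 𝒯, EqOn u (A t) (interior t)) : AEStronglyMeasurable u (volume.restrict Ω) := by
  have hmono : AEStronglyMeasurable u (volume.restrict (⋃ t ∈ 𝒯, interior t)) := by
    rw [biUnion_eq_iUnion]
    have := h.finite.to_subtype
    refine AEStronglyMeasurable.iUnion fun t => ?_
    refine ((A t).continuous_of_finiteDimensional.aestronglyMeasurable).congr ?_
    filter_upwards [ae_restrict_mem isOpen_interior.measurableSet] with x hx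
      using (hu t t.2 hx).symm
  have hle : (volume.restrict Ω).restrict (⋃ t ∈ 𝒯, interior t) = volume.restrict Ω := by
    refine Measure.restrict_eq_self_of_ae_mem ?_
    filter_upwards [h.ae_exists_mem_interior, ae_restrict_mem hΩ.measurableSet] with x hx hxΩ
    simpa using hx hxΩ
  rw [← hle]
  refine hmono.mono_measure ?_
  rw [Measure.restrict_restrict (isOpen_biUnion fun _ _ => isOpen_interior).measurableSet]
  exact Measure.restrict_mono inter_subset_left le_rfl

theorem trace_ae_eq (h : IsConvexCover Ω 𝒯) (hL : HasLipschitzBoundary Ω) (hΩ : IsOpen Ω)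
    (hu : ∀ t ∈ 𝒯, EqOn u (A t) (interior t)) : trace Ω u =ᵐ[volume.restrict Ω] u := by
  filter_upwards [h.ae_exists_mem_interior, ae_restrict_mem hΩ.measurableSet] with x hx hxΩ
  obtain ⟨t, ht, hxt⟩ := hx hxΩ
  rw [h.eqOn_trace hL hu ht hxt, hu t ht hxt]

theorem fderiv_trace_ae_eq (h : IsConvexCover Ω 𝒯) (hL : HasLipschitzBoundary Ω) (hΩ : IsOpen Ω)
    (hu : ∀ t ∈ 𝒯, EqOn u (A t) (interior t)) :
    fderiv ℝ (trace Ω u) =ᵐ[volume.restrict Ω] fderiv ℝ u := by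
  filter_upwards [h.ae_exists_mem_interior, ae_restrict_mem hΩ.measurableSet] with x hx hxΩ
  obtain ⟨t, ht, hxt⟩ := hx hxΩ
  rw [(hasFDerivAt_of_mem_interior hu ht hxt).fderiv,
    (hasFDerivAt_of_mem_interior (fun t ht => h.eqOn_trace hL hu ht) ht hxt).fderiv]

/-- The trace is continuous on any set of points at which the approximate limit exists. -/
theorem continuousOn_trace (h : IsConvexCover Ω 𝒯) (hL : HasLipschitzBoundary Ω)
    (hu : ∀ t ∈ 𝒯, EqOn u (A t) (interior t)) {G : Set Plane} (hG : G ⊆ closure Ω)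
    (hlim : ∀ x ∈ G, ∃ z, HasApproxLimWithin Ω u x z) : ContinuousOn (trace Ω u) G := by
  intro x hx
  rw [ContinuousWithinAt, Metric.tendsto_nhds]
  intro η hη
  have hev : ∀ᶠ y in 𝓝 x, ∀ t ∈ 𝒯, y ∈ t → x ∈ t ∧ dist (A t y) (A t x) < η := by
    rw [eventually_all_finite h.finite]
    intro t ht
    by_cases hxt : x ∈ t
    · have h1 : Tendsto (A t) (𝓝 x) (𝓝 (A t x)) :=
        (A t).continuous_of_finiteDimensional.continuousAt
      filter_upwards [Metric.tendsto_nhds.1 h1 η hη] with y hy _ using ⟨hxt, hy⟩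
    · filter_upwards [(h.closed t ht).isOpen_compl.mem_nhds hxt] with y hy hyt
      exact absurd hyt hy
  filter_upwards [mem_nhdsWithin_of_mem_nhds hev, self_mem_nhdsWithin] with y hy hyG
  obtain ⟨t, ht, hyt⟩ := h.exists_mem (hG hyG)
  obtain ⟨hxt, hd⟩ := hy t ht hyt
  rw [h.trace_eq hL hu (hlim y hyG) ht hyt, h.trace_eq hL hu (hlim x hx) ht hxt]
  exact hd

end IsConvexCover

variable {m : Data}

/-- At points of the loaded part of the boundary a piecewise affine function that jumps only in the
brittle part has a trace. -/
theorem IsConvexCover.exists_approxLim_of_mem_bdS (hm : m.GeometryOK) (h : IsConvexCover m.Ω 𝒯)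
    (hu : ∀ t ∈ 𝒯, EqOn u (A t) (interior t)) (hj : jumpSet m.Ω u ⊆ closure m.ΩB) {x₀ : Plane}
    (hx₀ : x₀ ∈ m.bdS) : ∃ z, HasApproxLimWithin m.Ω u x₀ z := by
  have hL := hm.lipschitz_Ω
  obtain ⟨ρ', hρ', φ, K, γ, hγ, hloc, hB⟩ := exists_local_epigraph hm hx₀
  obtain ⟨Λ, hΛ0, hΛ⟩ := h.exists_linPart_bound A
  obtain ⟨𝓛, h𝓛, hfr⟩ := h.lines
  set v := trace m.Ω u with hv
  have hgood : ∀ x ∈ m.Ω \ closure m.ΩB, ∃ z, HasApproxLimWithin m.Ω u x z := by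
    intro x hx
    by_contra hne
    exact hx.2 (hj ⟨hx.1, hne⟩)
  have hcont : ContinuousOn v (m.Ω \ closure m.ΩB) :=
    h.continuousOn_trace hL hu (sdiff_subset.trans subset_closure) hgood
  set e : Plane := φ.symm (!₂[0, 1]) with he
  have he1 : ‖e‖ = 1 := by rw [he, LinearIsometryEquiv.norm_map]; simp [EuclideanSpace.norm_eq]
  set C := Λ * (K + 4) with hC
  have hC0 : 0 ≤ C := by positivity
  have claim : ∀ ρ, 0 < ρ → (K + 3) * ρ < ρ' → ∀ t ∈ 𝒯, x₀ ∈ t →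
      ‖A t x₀ - v (x₀ + ((K + 2) * ρ) • e)‖ ≤ C * ρ := by
    intro ρ hρ hρρ t ht hxt
    set z := x₀ + ((K + 2) * ρ) • e with hz
    have hzx : ‖z - x₀‖ = (K + 2) * ρ := by
      rw [hz, add_sub_cancel_left, norm_smul, he1, mul_one, Real.norm_of_nonneg (by positivity)]
    obtain ⟨y, ⟨hyt, hyb⟩, hy𝓛⟩ : ∃ y ∈ interior t ∩ Metric.ball x₀ ρ, y ∉ linesUnion 𝓛 := by
      have hne : (interior t ∩ Metric.ball x₀ ρ).Nonempty := by
        have : x₀ ∈ closure (interior t) := by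
          rw [(h.convex t ht).closure_interior_eq_closure_of_nonempty_interior
            (h.interior_nonempty t ht)]
          exact subset_closure hxt
        obtain ⟨y, hy1, hy2⟩ := mem_closure_iff.1 this _ Metric.isOpen_ball (Metric.mem_ball_self hρ)
        exact ⟨y, hy2, hy1⟩
      by_contra! hsub
      exact (isOpen_interior.inter Metric.isOpen_ball).measure_ne_zero volume hne
        (measure_mono_null hsub h𝓛.volume_eq_zero)
    have hyn : ‖y - x₀‖ < ρ := mem_ball_iff_norm.1 hyb
    have hball : ∀ s ∈ Icc (0 : ℝ) 1, y + s • (z - y) ∈ Metric.ball x₀ ρ' := by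
      intro s hs
      have hK0 : (0 : ℝ) ≤ K := K.2
      refine (convex_ball x₀ ρ').add_smul_sub_mem ?_ ?_ hs
      · exact Metric.ball_subset_ball (by nlinarith) hyb
      · rw [mem_ball_iff_norm, hzx]; nlinarith
    have hyE : γ (φ y 0) < φ y 1 := by
      refine (hloc y ?_).2 (h.interior_subset_domain hL ht hyt)
      simpa using hball 0 (by simp)
    have hmem : ∀ s ∈ Icc (0 : ℝ) 1, y + s • (z - y) ∈ m.Ω \ closure m.ΩB := by
      intro s hs
      refine ⟨(hloc _ (hball s hs)).1 ?_, hB _ (hball s hs)⟩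
      rcases hs.1.eq_or_lt with rfl | hs0
      · simpa using hyE
      have hdec : z - y = φ.symm (!₂[φ (z - y) 0, φ (z - y) 1]) := by
        rw [LinearIsometryEquiv.eq_symm_apply]
        ext i; fin_cases i <;> simp
      have hco : ∀ i, |φ (x₀ - y) i| < ρ := by
        intro i
        have h1 := PiLp.norm_apply_le (φ (x₀ - y)) i
        rw [LinearIsometryEquiv.norm_map, norm_sub_rev] at h1
        exact lt_of_le_of_lt h1 hyn
      have hzy : φ (z - y) = φ (x₀ - y) + ((K + 2) * ρ) • (!₂[0, 1] : Plane) := by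
        rw [hz, show x₀ + ((K + 2) * ρ) • e - y = (x₀ - y) + ((K + 2) * ρ) • e by abel, map_add,
          map_smul, he, LinearIsometryEquiv.apply_symm_apply]
      have e0 : φ (z - y) 0 = φ (x₀ - y) 0 := by rw [hzy]; simp
      have e1 : φ (z - y) 1 = φ (x₀ - y) 1 + (K + 2) * ρ := by rw [hzy]; simp
      rw [hdec]
      refine add_mem_epigraph hγ hyE.le ?_ hs0
      rw [e0, e1]
      have h1 := hco 0
      have h2 := neg_lt_of_abs_lt (hco 1)
      have h3 : (K : ℝ) * |φ (x₀ - y) 0| ≤ K * ρ := by gcongr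
      linarith
    have hzy : ‖z - y‖ ≤ (K + 3) * ρ := by
      have : ‖z - y‖ ≤ ‖z - x₀‖ + ‖y - x₀‖ := by
        rw [show z - y = (z - x₀) - (y - x₀) by abel]; exact norm_sub_le _ _
      linarith
    have hder : ∀ s ∈ Ioo (0 : ℝ) 1 \ {s | y + s • (z - y) ∈ linesUnion 𝓛},
        HasDerivAt (fun s : ℝ => v (y + s • (z - y))) (fderiv ℝ v (y + s • (z - y)) (z - y)) s ∧
        ‖fderiv ℝ v (y + s • (z - y)) (z - y)‖ ≤ Λ * ‖z - y‖ := by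
      intro s hs
      have hsm := hmem s (Ioo_subset_Icc_self hs.1)
      obtain ⟨t', ht', hmt⟩ := h.exists_mem_interior hfr (subset_closure hsm.1) hs.2
      have hfd := hasFDerivAt_of_mem_interior (fun t ht => h.eqOn_trace hL hu ht) ht' hmt
      have h3 : HasDerivAt (fun s : ℝ => y + s • (z - y)) (z - y) s := by
        simpa using ((hasDerivAt_id s).smul_const (z - y)).const_add y
      rw [hfd.fderiv]
      have h4 : HasDerivAt (v ∘ fun s : ℝ => y + s • (z - y)) (linPart (A t') (z - y)) s :=
        hfd.comp_hasDerivAt s h3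
      refine ⟨h4, (ContinuousLinearMap.le_opNorm _ _).trans ?_⟩
      gcongr
      exact hΛ t' ht'
    have hfin := finite_setOf_mem_linesUnion h𝓛.1 (x := y) (d := z - y)
      fun l hl _ h' => hy𝓛 ⟨l, hl, h'⟩
    have key := enorm_sub_le_lintegral_deriv zero_le_one (hcont.comp (by fun_prop) hmem)
      hfin.countable hder
    have key2 : ‖v z - v y‖ ≤ Λ * ‖z - y‖ := by
      have h4 : ∫⁻ s in Ioo (0 : ℝ) 1, ‖fderiv ℝ v (y + s • (z - y)) (z - y)‖ₑ ≤
          ∫⁻ _s in Ioo (0 : ℝ) 1, ENNReal.ofReal (Λ * ‖z - y‖) := by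
        refine lintegral_mono_ae ?_
        filter_upwards [ae_restrict_mem measurableSet_Ioo,
          ae_restrict_of_ae (hfin.countable.ae_notMem volume)] with s h1 h2
        rw [← ofReal_norm]
        exact ENNReal.ofReal_le_ofReal (hder s ⟨h1, h2⟩).2
      have h5 := key.trans h4
      simp only [Function.comp_apply, one_smul, zero_smul, add_zero, add_sub_cancel,
        lintegral_const, Measure.restrict_apply_univ, Real.volume_Ioo, sub_zero,
        ENNReal.ofReal_one, mul_one] at h5
      rw [← ofReal_norm, ENNReal.ofReal_le_ofReal_iff (by positivity)] at h5
      exact h5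
    have hvy : v y = A t y := h.eqOn_trace hL hu ht hyt
    have h6 : ‖A t x₀ - A t y‖ ≤ Λ * ρ := by
      rw [affine_sub_eq_linPart]
      refine (ContinuousLinearMap.le_opNorm _ _).trans ?_
      rw [norm_sub_rev]
      exact mul_le_mul (hΛ t ht) hyn.le (norm_nonneg _) hΛ0
    calc ‖A t x₀ - v z‖ = ‖(A t x₀ - A t y) - (v z - v y)‖ := by rw [hvy]; congr 1; abel
      _ ≤ Λ * ρ + Λ * ((K + 3) * ρ) :=
          (norm_sub_le _ _).trans (add_le_add h6 (key2.trans (by gcongr)))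
      _ = C * ρ := by rw [hC]; ring
  have heq : ∀ t ∈ 𝒯, ∀ t' ∈ 𝒯, x₀ ∈ t → x₀ ∈ t' → A t x₀ = A t' x₀ := by
    intro t ht t' ht' hxt hxt'
    rw [← sub_eq_zero, ← norm_le_zero_iff]
    refine le_of_forall_pos_le_add fun η hη => ?_
    set ρ := min (ρ' / (2 * (K + 3))) (η / (2 * C + 1)) with hρ
    have hK0 : (0 : ℝ) ≤ K := K.2
    have hρ0 : 0 < ρ := lt_min (by positivity) (by positivity)
    have hρ1 : (K + 3) * ρ < ρ' := by
      have h1 : ρ ≤ ρ' / (2 * (K + 3)) := min_le_left _ _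
      rw [le_div_iff₀ (by positivity)] at h1
      linarith
    have hρ2 : 2 * C * ρ ≤ η := by
      have h1 : ρ ≤ η / (2 * C + 1) := min_le_right _ _
      rw [le_div_iff₀ (by positivity)] at h1
      linarith
    have h1 := claim ρ hρ0 hρ1 t ht hxt
    have h2 := claim ρ hρ0 hρ1 t' ht' hxt'
    set w := v (x₀ + ((K + 2) * ρ) • e)
    calc ‖A t x₀ - A t' x₀‖ = ‖(A t x₀ - w) - (A t' x₀ - w)‖ := by congr 1; abel
      _ ≤ C * ρ + C * ρ := (norm_sub_le _ _).trans (add_le_add h1 h2)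
      _ ≤ 0 + η := by linarith
  have hxc : x₀ ∈ closure m.Ω := frontier_subset_closure (hm.bdN_sub (hm.bdS_sub hx₀))
  obtain ⟨t, ht, hxt⟩ := h.exists_mem hxc
  exact ⟨A t x₀, h.hasApproxLimWithin_of_affine_eq hu fun t' ht' hxt' => heq t' ht' t ht hxt' hxt⟩

theorem IsConvexCover.isTraceFunction_trace (hm : m.GeometryOK) (h : IsConvexCover m.Ω 𝒯)
    (hu : ∀ t ∈ 𝒯, EqOn u (A t) (interior t)) (hj : jumpSet m.Ω u ⊆ closure m.ΩB) :
    m.IsTraceFunction (trace m.Ω u) := by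
  have hL := hm.lipschitz_Ω
  have hgood : ∀ x ∈ m.Ω \ closure m.ΩB ∪ m.bdS, ∃ z, HasApproxLimWithin m.Ω u x z := by
    rintro x (hx | hx)
    · by_contra hne
      exact hx.2 (hj ⟨hx.1, hne⟩)
    · exact h.exists_approxLim_of_mem_bdS hm hu hj hx
  have hsub : m.Ω \ closure m.ΩB ∪ m.bdS ⊆ closure m.Ω := by
    rintro x (hx | hx)
    · exact subset_closure hx.1
    · exact frontier_subset_closure (hm.bdN_sub (hm.bdS_sub hx))
  obtain ⟨B, hB⟩ := h.exists_value_bound hm.bounded_Ω A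
  obtain ⟨Λ, hΛ0, hΛ⟩ := h.exists_linPart_bound A
  obtain ⟨𝓛, h𝓛, hfr⟩ := h.lines
  refine ⟨h.continuousOn_trace hL hu hsub hgood, ?_, ⟨B, fun x hx => ?_⟩, 𝓛, h𝓛, Λ, fun x hx hx𝓛 => ?_⟩
  · exact h.aestronglyMeasurable hm.open_Ω fun t ht => h.eqOn_trace hL hu ht
  · obtain ⟨t, ht, hxt⟩ := h.exists_mem (subset_closure hx.1)
    rw [h.trace_eq hL hu (hgood x (Or.inl hx)) ht hxt]
    exact hB t ht x hxt
  · obtain ⟨t, ht, hxt⟩ := h.exists_mem_interior hfr (subset_closure hx) hx𝓛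
    have hfd := hasFDerivAt_of_mem_interior (fun t ht => h.eqOn_trace hL hu ht) ht hxt
    exact ⟨hfd.differentiableAt, by rw [hfd.fderiv]; exact hΛ t ht⟩

theorem Data.IsTraceFunction.sub {v w : Plane → Plane} (hv : m.IsTraceFunction v)
    (hw : m.IsTraceFunction w) : m.IsTraceFunction (v - w) := by
  obtain ⟨B, hB⟩ := hv.bdd
  obtain ⟨B', hB'⟩ := hw.bdd
  obtain ⟨𝓛, h𝓛, Λ, hd⟩ := hv.diff
  obtain ⟨𝓛', h𝓛', Λ', hd'⟩ := hw.diff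
  refine ⟨hv.cont.sub hw.cont, hv.meas.sub hw.meas, ⟨B + B', fun x hx =>
    (norm_sub_le _ _).trans (add_le_add (hB x hx) (hB' x hx))⟩, 𝓛 ∪ 𝓛', h𝓛.union h𝓛', Λ + Λ',
    fun x hx hx𝓛 => ?_⟩
  obtain ⟨h1, h2⟩ := hd x hx fun h => hx𝓛 (linesUnion_mono subset_union_left h)
  obtain ⟨h3, h4⟩ := hd' x hx fun h => hx𝓛 (linesUnion_mono subset_union_right h)
  refine ⟨h1.sub h3, ?_⟩
  rw [fderiv_sub h1 h3]
  exact (norm_sub_le _ _).trans (add_le_add h2 h4)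

end Pieces

section Nodes

theorem Data.IsMesh.isFiniteMeasure_μS {m : Data} {c₁ c₂ ε : ℝ} {R : Set (Set Plane)}
    (h : m.IsMesh c₁ c₂ ε R) : IsFiniteMeasure m.μS := by
  obtain ⟨L, hL, hfin⟩ := h.surface
  have hRf : ∀ s ∈ R, s.Finite := fun s hs =>
    finite_of_ncard_ne_zero (by rw [h.regular.card s hs]; norm_num)
  have hE : (edges R).Finite := by
    refine (h.regular.finite.biUnion fun s hs => (hRf s hs).finite_subsets).subset ?_
    rintro e ⟨-, s, hs, hes⟩
    exact mem_iUnion₂.2 ⟨s, hs, hes⟩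
  have hsub : m.bdS ⊆ symmDiff m.bdS (⋃ e ∈ L, convexHull ℝ e) ∪ ⋃ e ∈ L, convexHull ℝ e := by
    intro x hx
    by_cases hx' : x ∈ ⋃ e ∈ L, convexHull ℝ e
    · exact Or.inr hx'
    · exact Or.inl (Or.inl ⟨hx, hx'⟩)
  have hna : NullSingletonClass H1 := Measure.nullSingletonClass_hausdorff Plane one_pos
  refine ⟨?_⟩
  rw [Data.μS, Measure.restrict_apply_univ]
  refine (measure_mono hsub).trans_lt ((measure_union_le _ _).trans_lt (ENNReal.add_lt_top.2 ⟨?_, ?_⟩))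
  · rw [hfin.measure_zero]; exact ENNReal.zero_lt_top
  · refine measure_biUnion_lt_top (hE.subset hL) fun e he => ?_
    obtain ⟨x, y, -, rfl⟩ := ncard_eq_two.1 (hL he).1
    rw [convexHull_pair, hausdorffMeasure_segment]
    exact edist_lt_top x y

/-- The gradient of an affine function computed from its values at `c` and at two points next to it. -/
noncomputable def nodalGrad (c : Plane) (ρ : ℝ) (v : Plane → Plane) : Mat :=
  ∑ i : Fin 2, (EuclideanSpace.proj i : Plane →L[ℝ] ℝ).smulRight
    (ρ⁻¹ • (v (c + ρ • EuclideanSpace.single i 1) - v c))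

theorem nodalGrad_affine {ρ : ℝ} (hρ : ρ ≠ 0) (c : Plane) (L : Plane →ᵃ[ℝ] Plane) :
    nodalGrad c ρ L = linPart L := by
  ext1 w
  have hw : w = ∑ i : Fin 2, w i • (EuclideanSpace.single i (1 : ℝ) : Plane) := by
    ext j; fin_cases j <;> simp [Fin.sum_univ_two]
  simp only [nodalGrad, affine_sub_eq_linPart, add_sub_cancel_left, map_smul, inv_smul_smul₀ hρ]
  conv_rhs => rw [hw]
  rw [map_sum, Fin.sum_univ_two, Fin.sum_univ_two, map_smul, map_smul]
  rfl

theorem norm_nodalGrad_le {ρ N : ℝ} (hρ : 0 < ρ) {c : Plane} {v : Plane → Plane} (h0 : ‖v c‖ ≤ N)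
    (h1 : ∀ i : Fin 2, ‖v (c + ρ • EuclideanSpace.single i 1)‖ ≤ N) :
    ‖nodalGrad c ρ v‖ ≤ 4 * ρ⁻¹ * N := by
  have h2 : ∀ i : Fin 2, ‖(EuclideanSpace.proj i : Plane →L[ℝ] ℝ).smulRight
      (ρ⁻¹ • (v (c + ρ • EuclideanSpace.single i 1) - v c))‖ ≤ 2 * ρ⁻¹ * N := by
    intro i
    have hp : ‖(EuclideanSpace.proj i : Plane →L[ℝ] ℝ)‖ ≤ 1 :=
      ContinuousLinearMap.opNorm_le_bound _ zero_le_one fun x => by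
        rw [one_mul]; exact PiLp.norm_apply_le x i
    rw [ContinuousLinearMap.norm_smulRight_apply, norm_smul, norm_inv, Real.norm_of_nonneg hρ.le]
    have h3 := (norm_sub_le (v (c + ρ • EuclideanSpace.single i 1)) (v c)).trans (add_le_add (h1 i) h0)
    calc _ ≤ 1 * (ρ⁻¹ * (N + N)) := by gcongr
      _ = _ := by ring
  rw [nodalGrad, Fin.sum_univ_two]
  refine (norm_add_le _ _).trans ((add_le_add (h2 0) (h2 1)).trans (le_of_eq (by ring)))

/-- `c s` is the centre of a ball of radius `2 ρ` contained in the triangle with vertices `s`. -/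
structure IsNodal (R : Set (Set Plane)) (c : Set Plane → Plane) (ρ : ℝ) : Prop where
  pos : 0 < ρ
  ball : ∀ s ∈ R, Metric.ball (c s) (2 * ρ) ⊆ convexHull ℝ s

theorem IsRegularTriangulation.exists_isNodal {c₁ c₂ ε : ℝ} {Ω : Set Plane} {R : Set (Set Plane)}
    (hR : IsRegularTriangulation c₁ c₂ ε Ω R) (hc₁ : 0 < c₁) (hε : 0 < ε) :
    ∃ c ρ, IsNodal R c ρ := by
  choose! c hc using hR.inner_ball
  refine ⟨c, c₁ * ε / 4, by positivity, fun s hs => ?_⟩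
  convert hc s hs using 2
  ring

namespace IsNodal

variable {Ω : Set Plane} {R : Set (Set Plane)} {c : Set Plane → Plane} {ρ : ℝ} {s : Set Plane}
  {v : Plane → Plane}

theorem center_mem (h : IsNodal R c ρ) (hs : s ∈ R) : c s ∈ convexHull ℝ s :=
  h.ball s hs (Metric.mem_ball_self (by linarith [h.pos]))

theorem node_mem (h : IsNodal R c ρ) (hs : s ∈ R) (i : Fin 2) :
    c s + ρ • EuclideanSpace.single i 1 ∈ convexHull ℝ s := by
  refine h.ball s hs ?_
  rw [mem_ball_iff_norm, add_sub_cancel_left, norm_smul, Real.norm_of_nonneg h.pos.le]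
  simp; linarith [h.pos]

theorem nodalGrad_eq (h : IsNodal R c ρ) (hs : s ∈ R) {L : Plane →ᵃ[ℝ] Plane}
    (hL : EqOn v L (convexHull ℝ s)) : nodalGrad (c s) ρ v = linPart L := by
  rw [← nodalGrad_affine h.pos.ne' (c s) L]
  unfold nodalGrad
  refine Finset.sum_congr rfl fun i _ => ?_
  rw [hL (h.center_mem hs), hL (h.node_mem hs i)]

theorem eq_add_nodalGrad (h : IsNodal R c ρ) (hs : s ∈ R) (hv : IsContinuousAffine Ω R v)
    {x : Plane} (hx : x ∈ convexHull ℝ s) : v x = v (c s) + nodalGrad (c s) ρ v (x - c s) := by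
  obtain ⟨L, hL⟩ := hv.2 s hs
  rw [h.nodalGrad_eq hs hL, ← affine_sub_eq_linPart, hL hx, hL (h.center_mem hs)]
  abel

theorem fderiv_eq (h : IsNodal R c ρ) (hs : s ∈ R) (hv : IsContinuousAffine Ω R v)
    {x : Plane} (hx : x ∈ interior (convexHull ℝ s)) : fderiv ℝ v x = nodalGrad (c s) ρ v := by
  obtain ⟨L, hL⟩ := hv.2 s hs
  rw [h.nodalGrad_eq hs hL]
  exact ((hasFDerivAt_affine L x).congr_of_eventuallyEq
    ((hL.mono interior_subset).eventuallyEq_of_mem (isOpen_interior.mem_nhds hx))).fderiv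

/-- An affine function is controlled at the centre of a ball by its integral over the ball. -/
theorem enorm_mul_volume_ball_le (hL : HasLipschitzBoundary Ω) (hsub : convexHull ℝ s ⊆ closure Ω)
    {L : Plane →ᵃ[ℝ] Plane} (hv : EqOn v L (convexHull ℝ s)) {y : Plane}
    (hy : Metric.ball y ρ ⊆ convexHull ℝ s) (hρ : 0 < ρ) :
    ‖v y‖ₑ * volume (Metric.ball (0 : Plane) ρ) ≤ ∫⁻ x in Ω, ‖v x‖ₑ := by
  have hyΩ : Metric.ball y ρ ⊆ Ω :=
    (interior_maximal (hy.trans hsub) Metric.isOpen_ball).trans (interior_closure_subset hL)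
  have hLm : Continuous fun w => ‖L w‖ₑ := L.continuous_of_finiteDimensional.enorm
  have hI : ∀ σ : Plane → Plane, MeasurePreserving σ volume volume →
      (σ ⁻¹' Metric.ball y ρ = Metric.ball 0 ρ) →
      ∫⁻ w in Metric.ball 0 ρ, ‖L (σ w)‖ₑ ≤ ∫⁻ x in Ω, ‖v x‖ₑ := by
    intro σ hσ hpre
    have h1 := (hσ.restrict_preimage Metric.isOpen_ball.measurableSet (s := Metric.ball y ρ))
    rw [hpre] at h1
    rw [h1.lintegral_comp (f := fun w => ‖L w‖ₑ) hLm.measurable]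
    calc ∫⁻ x in Metric.ball y ρ, ‖L x‖ₑ = ∫⁻ x in Metric.ball y ρ, ‖v x‖ₑ :=
          setLIntegral_congr_fun Metric.isOpen_ball.measurableSet fun x hx => by
            rw [hv (hy hx)]
      _ ≤ _ := lintegral_mono' (Measure.restrict_mono hyΩ le_rfl) le_rfl
  have h1 := hI (fun w => y + w) (measurePreserving_add_left volume y) (by
    ext w; simp)
  have h2 := hI (fun w => y - w) (volume.measurePreserving_sub_left y) (by
    ext w; simp)
  have h3 : ∀ w, 2 * ‖v y‖ₑ ≤ ‖L (y + w)‖ₑ + ‖L (y - w)‖ₑ := by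
    intro w
    have e1 : L (y + w) + L (y - w) = (2 : ℝ) • L y := by
      have a1 := affine_sub_eq_linPart L (y + w) y
      have a2 := affine_sub_eq_linPart L (y - w) y
      rw [add_sub_cancel_left] at a1
      rw [sub_sub_cancel_left, map_neg, ← a1] at a2
      have : L (y - w) = L y - (L (y + w) - L y) := by
        rw [sub_eq_iff_eq_add'.1 a2]; abel
      rw [this]; module
    have e2 : ‖(2 : ℝ) • L y‖ₑ = 2 * ‖L y‖ₑ := by
      rw [enorm_smul]; congr 1; simp [Real.enorm_eq_ofReal]
    rw [hv (hy (Metric.mem_ball_self hρ)), ← e2, ← e1]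
    exact enorm_add_le _ _
  have h4 : 2 * (‖v y‖ₑ * volume (Metric.ball (0 : Plane) ρ)) ≤ 2 * ∫⁻ x in Ω, ‖v x‖ₑ := by
    calc _ = ∫⁻ _w in Metric.ball (0 : Plane) ρ, 2 * ‖v y‖ₑ := by
          rw [setLIntegral_const, mul_assoc]
      _ ≤ ∫⁻ w in Metric.ball (0 : Plane) ρ, (‖L (y + w)‖ₑ + ‖L (y - w)‖ₑ) := lintegral_mono h3
      _ = (∫⁻ w in Metric.ball (0 : Plane) ρ, ‖L (y + w)‖ₑ) +
            ∫⁻ w in Metric.ball (0 : Plane) ρ, ‖L (y - w)‖ₑ :=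
          lintegral_add_left (hLm.comp (by fun_prop)).measurable _
      _ ≤ _ := by rw [two_mul]; exact add_le_add h1 h2
  rwa [ENNReal.mul_le_mul_iff_right two_ne_zero ENNReal.ofNat_ne_top] at h4

/-- The inverse inequality: on a fixed mesh, a Lebesgue norm controls values and gradients. -/
theorem exists_inverse_bound {c₁ c₂ ε : ℝ} (hL : HasLipschitzBoundary Ω)
    (hΩ : Bornology.IsBounded Ω) (hR : IsRegularTriangulation c₁ c₂ ε Ω R) (h : IsNodal R c ρ)
    {q : ℝ} (hq : 1 ≤ q) (hmeas : ∀ v, IsContinuousAffine Ω R v →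
      AEStronglyMeasurable v (volume.restrict Ω)) :
    ∃ C : ℝ≥0, ∀ v, IsContinuousAffine Ω R v →
      (∀ x ∈ closure Ω, ‖v x‖ₑ ≤ C * eLpNorm v (ENNReal.ofReal q) (volume.restrict Ω)) ∧
      ∀ s ∈ R, ‖nodalGrad (c s) ρ v‖ₑ ≤ C * eLpNorm v (ENNReal.ofReal q) (volume.restrict Ω) := by
  have hfin : IsFiniteMeasure (volume.restrict Ω) :=
    ⟨by rw [Measure.restrict_apply_univ]; exact hΩ.measure_lt_top⟩
  obtain ⟨k, hk⟩ := exists_eLpNorm_le_eLpNorm (F := Plane) (volume.restrict Ω) (p := 1)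
    (q := ENNReal.ofReal q) (by simpa using hq) one_ne_zero
  obtain ⟨D, hD⟩ := hΩ.closure.subset_closedBall (0 : Plane)
  set V := volume (Metric.ball (0 : Plane) ρ) with hV
  have hV0 : V ≠ 0 := (Metric.measure_ball_pos volume _ h.pos).ne'
  have hVt : V ≠ ⊤ := Metric.isBounded_ball.measure_lt_top.ne
  set k' : ℝ≥0 := V.toNNReal⁻¹ * k with hk'
  have hVn : V.toNNReal ≠ 0 := by simp [ENNReal.toNNReal_eq_zero_iff, hV0, hVt]
  have hρ := h.pos
  set B : ℝ := 1 + 4 * ρ⁻¹ * (1 + 2 * |D|) with hB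
  have hB0 : 0 < B := by positivity
  refine ⟨(k' + 1) * B.toNNReal, fun v hv => ?_⟩
  set Q := eLpNorm v (ENNReal.ofReal q) (volume.restrict Ω) with hQ
  have hsubs : ∀ s ∈ R, convexHull ℝ s ⊆ closure Ω := fun s hs => by
    rw [← hR.cover]; exact subset_biUnion_of_mem (u := fun s => convexHull ℝ s) hs
  by_cases hQt : Q = ⊤
  · have hC : (((k' + 1) * B.toNNReal : ℝ≥0) : ℝ≥0∞) * Q = ⊤ := by
      rw [hQt, ENNReal.mul_top]
      have : (k' + 1) * B.toNNReal ≠ 0 := mul_ne_zero (by positivity) (by simpa using hB0)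
      exact_mod_cast this
    rw [hC]
    exact ⟨fun _ _ => le_top, fun _ _ => le_top⟩
  have hnode : ∀ s ∈ R, ∀ y, Metric.ball y ρ ⊆ convexHull ℝ s → ‖v y‖ₑ ≤ k' * Q := by
    intro s hs y hy
    obtain ⟨L, hLs⟩ := hv.2 s hs
    have h1 := enorm_mul_volume_ball_le hL (hsubs s hs) hLs hy hρ
    have h2 := hk v (hmeas v hv)
    rw [eLpNorm_one_eq_lintegral_enorm] at h2
    have h3 : ‖v y‖ₑ * V ≤ k * Q := h1.trans h2
    rw [hk']
    push_cast
    rw [ENNReal.coe_inv hVn, ENNReal.coe_toNNReal hVt, mul_assoc, mul_comm, ← div_eq_mul_inv,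
      ENNReal.le_div_iff_mul_le (Or.inl hV0) (Or.inl hVt)]
    exact h3
  have hkQ : (k' : ℝ≥0∞) * Q ≠ ⊤ := ENNReal.mul_ne_top ENNReal.coe_ne_top hQt
  set N : ℝ := (k' * Q).toReal with hN
  have hN0 : 0 ≤ N := ENNReal.toReal_nonneg
  have hnode' : ∀ s ∈ R, ∀ y, Metric.ball y ρ ⊆ convexHull ℝ s → ‖v y‖ ≤ N := by
    intro s hs y hy
    rw [← toReal_enorm]
    exact ENNReal.toReal_mono hkQ (hnode s hs y hy)
  have hgrad : ∀ s ∈ R, ‖v (c s)‖ ≤ N ∧ ‖nodalGrad (c s) ρ v‖ ≤ 4 * ρ⁻¹ * N := by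
    intro s hs
    have h1 := hnode' s hs (c s) ((Metric.ball_subset_ball (by linarith)).trans (h.ball s hs))
    refine ⟨h1, norm_nodalGrad_le hρ h1 fun i => hnode' s hs _ (Subset.trans ?_ (h.ball s hs))⟩
    refine Metric.ball_subset_ball' ?_
    rw [dist_eq_norm, add_sub_cancel_left, norm_smul, Real.norm_of_nonneg hρ.le]
    simp; linarith
  have hfinal : ∀ (a : ℝ) , a ≤ B * N →
      ENNReal.ofReal a ≤ (((k' + 1) * B.toNNReal : ℝ≥0) : ℝ≥0∞) * Q := by
    intro a ha
    refine (ENNReal.ofReal_le_ofReal ha).trans ?_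
    rw [ENNReal.ofReal_mul hB0.le, hN, ENNReal.ofReal_toReal hkQ]
    push_cast
    rw [mul_comm (k' + 1 : ℝ≥0∞), mul_assoc]
    refine mul_le_mul_right (mul_le_mul_left le_self_add _) _
  refine ⟨fun x hx => ?_, fun s hs => ?_⟩
  · have : x ∈ ⋃ s ∈ R, convexHull ℝ s := by rw [hR.cover]; exact hx
    obtain ⟨s, hs, hxs⟩ := mem_iUnion₂.1 this
    rw [← ofReal_norm]
    refine hfinal _ ?_
    rw [h.eq_add_nodalGrad hs hv hxs]
    obtain ⟨g1, g2⟩ := hgrad s hs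
    have hd : ‖x - c s‖ ≤ 2 * |D| := by
      have a1 := hD hx
      have a2 := hD (hsubs s hs (h.center_mem hs))
      rw [mem_closedBall_zero_iff] at a1 a2
      exact (norm_sub_le _ _).trans (by linarith [le_abs_self D])
    calc _ ≤ N + 4 * ρ⁻¹ * N * (2 * |D|) := by
          refine (norm_add_le _ _).trans (add_le_add g1 ((ContinuousLinearMap.le_opNorm _ _).trans ?_))
          gcongr
      _ ≤ B * N := by
          rw [hB]
          have : 0 ≤ ρ⁻¹ * N := by positivity
          nlinarith [abs_nonneg D]
  · rw [← ofReal_norm]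
    refine hfinal _ ((hgrad s hs).2.trans ?_)
    rw [hB]
    have : 0 ≤ ρ⁻¹ * N := by positivity
    have h2 : 0 ≤ ρ⁻¹ * N * |D| := by positivity
    nlinarith

end IsNodal

end Nodes

section ContinuousAffine

variable {m : Data} {c₁ c₂ ε : ℝ} {R : Set (Set Plane)} {v w : Plane → Plane}

theorem IsContinuousAffine.exists_pieces {Ω : Set Plane} (hv : IsContinuousAffine Ω R v) :
    ∃ A : Set Plane → Plane →ᵃ[ℝ] Plane, ∀ t ∈ convexHull ℝ '' R, EqOn v (A t) t := by
  have h : ∀ t ∈ convexHull ℝ '' R, ∃ L : Plane →ᵃ[ℝ] Plane, EqOn v L t := by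
    rintro _ ⟨s, hs, rfl⟩
    exact hv.2 s hs
  choose! A hA using h
  exact ⟨A, hA⟩

theorem IsConvexCover.aestronglyMeasurable_of_isContinuousAffine (hm : m.GeometryOK)
    (h : IsConvexCover m.Ω (convexHull ℝ '' R)) (hv : IsContinuousAffine m.Ω R v) :
    AEStronglyMeasurable v m.μΩ := by
  obtain ⟨A, hA⟩ := hv.exists_pieces
  exact h.aestronglyMeasurable hm.open_Ω fun t ht => (hA t ht).mono interior_subset

theorem IsConvexCover.trace_eq_self (hm : m.GeometryOK) (h : IsConvexCover m.Ω (convexHull ℝ '' R))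
    (hv : IsContinuousAffine m.Ω R v) {x : Plane} (hx : x ∈ closure m.Ω) : trace m.Ω v x = v x := by
  obtain ⟨A, hA⟩ := hv.exists_pieces
  exact h.trace_eq_of_hasApproxLimWithin hm.lipschitz_Ω
    (fun t ht => (hA t ht).mono interior_subset) hx
    (hasApproxLimWithin_of_continuous ((hv.1 x hx).mono subset_closure))

theorem IsConvexCover.isTraceFunction (hm : m.GeometryOK) (h : IsConvexCover m.Ω (convexHull ℝ '' R))
    (hv : IsContinuousAffine m.Ω R v) : m.IsTraceFunction v := by
  obtain ⟨A, hA⟩ := hv.exists_pieces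
  have hA' : ∀ t ∈ convexHull ℝ '' R, EqOn v (A t) (interior t) := fun t ht =>
    (hA t ht).mono interior_subset
  obtain ⟨B, hB⟩ := h.exists_value_bound hm.bounded_Ω A
  obtain ⟨Λ, hΛ0, hΛ⟩ := h.exists_linPart_bound A
  obtain ⟨𝓛, h𝓛, hfr⟩ := h.lines
  refine ⟨hv.1.mono ?_, h.aestronglyMeasurable_of_isContinuousAffine hm hv, ⟨B, fun x hx => ?_⟩, 𝓛, h𝓛,
    Λ, fun x hx hx𝓛 => ?_⟩
  · rintro x (hx | hx)
    · exact subset_closure hx.1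
    · exact frontier_subset_closure (hm.bdN_sub (hm.bdS_sub hx))
  · obtain ⟨t, ht, hxt⟩ := h.exists_mem (subset_closure hx.1)
    rw [hA t ht hxt]
    exact hB t ht x hxt
  · obtain ⟨t, ht, hxt⟩ := h.exists_mem_interior hfr (subset_closure hx) hx𝓛
    have hfd := IsConvexCover.hasFDerivAt_of_mem_interior hA' ht hxt
    exact ⟨hfd.differentiableAt, by rw [hfd.fderiv]; exact hΛ t ht⟩

theorem Data.IsTraceFunction.ae_differentiableAt (hm : m.GeometryOK) (hv : m.IsTraceFunction v) :
    ∃ B : ℝ, ∀ᵐ x ∂m.μΩ, DifferentiableAt ℝ v x ∧ ‖fderiv ℝ v x‖ ≤ B := by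
  obtain ⟨𝓛, h𝓛, B, hd⟩ := hv.diff
  refine ⟨B, ?_⟩
  filter_upwards [ae_restrict_of_ae (measure_eq_zero_iff_ae_notMem.1 h𝓛.volume_eq_zero),
    ae_restrict_mem hm.open_Ω.measurableSet] with x hx hxΩ using hd x hxΩ hx

theorem Data.IsTraceFunction.fderiv_sub_ae_eq (hm : m.GeometryOK) (hv : m.IsTraceFunction v)
    (hw : m.IsTraceFunction w) : fderiv ℝ (v - w) =ᵐ[m.μΩ] fderiv ℝ v - fderiv ℝ w := by
  obtain ⟨B, hB⟩ := hv.ae_differentiableAt hm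
  obtain ⟨B', hB'⟩ := hw.ae_differentiableAt hm
  filter_upwards [hB, hB'] with x h1 h2
  rw [fderiv_sub h1.1 h2.1]; rfl

theorem aestronglyMeasurable_fderiv_plane (v : Plane → Plane) (μ : Measure Plane) :
    AEStronglyMeasurable (fderiv ℝ v) μ :=
  (measurable_fderiv ℝ v).aestronglyMeasurable

theorem eLpNorm_ne_top_of_bounded {E : Type*} [NormedAddCommGroup E] {μ : Measure Plane} [IsFiniteMeasure μ]
    {f : Plane → E} {s : ℝ≥0∞} {B : ℝ} (h : ∀ᵐ x ∂μ, ‖f x‖ ≤ B) : eLpNorm f s μ ≠ ⊤ := by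
  refine ne_top_of_le_ne_top ?_ (eLpNorm_le_of_ae_bound h)
  refine ENNReal.mul_ne_top (ENNReal.rpow_ne_top_of_nonneg (by positivity) (measure_ne_top _ _)) ENNReal.ofReal_ne_top

/-- Piecewise affine functions have finite Lebesgue norms. -/
theorem IsConvexCover.eLpNorm_ne_top (hm : m.GeometryOK) {𝒯 : Set (Set Plane)} {u : Plane → Plane}
    {A : Set Plane → Plane →ᵃ[ℝ] Plane} (h : IsConvexCover m.Ω 𝒯)
    (hu : ∀ t ∈ 𝒯, EqOn u (A t) (interior t)) (s : ℝ≥0∞) :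
    eLpNorm u s m.μΩ ≠ ⊤ ∧ eLpNorm (fderiv ℝ u) s m.μΩ ≠ ⊤ := by
  have hfin := Data.isFiniteMeasure_μΩ hm
  obtain ⟨B, hB⟩ := h.exists_value_bound hm.bounded_Ω A
  obtain ⟨Λ, hΛ0, hΛ⟩ := h.exists_linPart_bound A
  have hae : ∀ᵐ x ∂m.μΩ, ∃ t ∈ 𝒯, x ∈ interior t := by
    filter_upwards [h.ae_exists_mem_interior, ae_restrict_mem hm.open_Ω.measurableSet] with x hx hxΩ
      using hx hxΩ
  constructor
  · refine eLpNorm_ne_top_of_bounded (B := B) ?_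
    filter_upwards [hae] with x ⟨t, ht, hx⟩
    rw [hu t ht hx]
    exact hB t ht x (interior_subset hx)
  · refine eLpNorm_ne_top_of_bounded (B := Λ) ?_
    filter_upwards [hae] with x ⟨t, ht, hx⟩
    rw [(hasFDerivAt_of_mem_interior hu ht hx).fderiv]
    exact hΛ t ht

theorem IsConvexCover.sobolevNorm_ne_top (hm : m.GeometryOK) (h : IsConvexCover m.Ω (convexHull ℝ '' R))
    (hv : IsContinuousAffine m.Ω R v) : m.sobolevNorm v (fderiv ℝ v) ≠ ⊤ := by
  obtain ⟨A, hA⟩ := hv.exists_pieces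
  have hA' : ∀ t ∈ convexHull ℝ '' R, EqOn v (A t) (interior t) := fun t ht =>
    (hA t ht).mono interior_subset
  have h1 := h.eLpNorm_ne_top hm hA' (ENNReal.ofReal m.p)
  have h2 := h.eLpNorm_ne_top hm hA' (ENNReal.ofReal m.q)
  exact ENNReal.add_ne_top.2 ⟨ENNReal.add_ne_top.2 ⟨h1.1, h1.2⟩, h2.1⟩

end ContinuousAffine

section SobolevNorm

variable {m : Data} {v w : Plane → Plane} {D E : Plane → Mat}

theorem Data.sobolevNorm_congr {v' : Plane → Plane} {D' : Plane → Mat} (h : v =ᵐ[m.μΩ] v')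
    (hD : D =ᵐ[m.μΩ] D') : m.sobolevNorm v D = m.sobolevNorm v' D' := by
  simp only [Data.sobolevNorm, eLpNorm_congr_ae h, eLpNorm_congr_ae hD]

theorem Data.sobolevNorm_neg : m.sobolevNorm (-v) (-D) = m.sobolevNorm v D := by
  simp only [Data.sobolevNorm, eLpNorm_neg]

theorem Data.ExponentsOK.sobolevNorm_add_le (h : m.ExponentsOK) (hv : AEStronglyMeasurable v m.μΩ)
    (hw : AEStronglyMeasurable w m.μΩ) (hD : AEStronglyMeasurable D m.μΩ)
    (hE : AEStronglyMeasurable E m.μΩ) :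
    m.sobolevNorm (v + w) (D + E) ≤ m.sobolevNorm v D + m.sobolevNorm w E := by
  have hp : 1 ≤ ENNReal.ofReal m.p := by simpa using h.one_lt_p.le
  have hq : 1 ≤ ENNReal.ofReal m.q := by simpa using h.one_lt_q.le
  refine (add_le_add (add_le_add (eLpNorm_add_le hv hw hp) (eLpNorm_add_le hD hE hp))
    (eLpNorm_add_le hv hw hq)).trans (le_of_eq ?_)
  simp only [Data.sobolevNorm]
  abel

theorem Data.eLpNorm_grad_le_sobolevNorm :
    eLpNorm D (ENNReal.ofReal m.p) m.μΩ ≤ m.sobolevNorm v D :=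
  le_add_self.trans le_self_add

theorem Data.eLpNorm_q_le_sobolevNorm : eLpNorm v (ENNReal.ofReal m.q) m.μΩ ≤ m.sobolevNorm v D :=
  le_add_self

/-- Boundedness of the trace operator on differences. -/
theorem exists_trace_sub_bound (hm : m.GeometryOK) (he : m.ExponentsOK) :
    ∃ C : ℝ≥0, ∀ v w, m.IsTraceFunction v → m.IsTraceFunction w →
      eLpNorm (v - w) (ENNReal.ofReal m.r) m.μS ≤
        C * m.sobolevNorm (v - w) (fderiv ℝ v - fderiv ℝ w) := by
  obtain ⟨C, hC⟩ := exists_trace_bound hm he.one_lt_q.le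
    (he.one_lt_p.le.trans he.p_le_r) he.trace_exponent_le
  refine ⟨C, fun v w hv hw => (hC _ (hv.sub hw)).trans (mul_le_mul_right ?_ _)⟩
  rw [eLpNorm_congr_ae (hv.fderiv_sub_ae_eq hm hw)]
  exact add_le_add_left le_add_self _

/-- Minkowski's inequality for the integral over time of a family of functions. -/
theorem eLpNorm_intervalIntegral_le {V : Type*} [NormedAddCommGroup V] [NormedSpace ℝ V]
    {T ρ : ℝ} {μ : Measure Plane} [IsFiniteMeasure μ] (hρ : 1 < ρ) {γ : ℝ → Plane → V}
    (hγ : AEStronglyMeasurable (Function.uncurry γ) ((timeMeasure T).prod μ)) {b : ℝ → ℝ≥0∞}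
    (hb : ∫⁻ τ, b τ ∂timeMeasure T ≠ ⊤) (hbound : ∀ᵐ x ∂μ, ∀ᵐ τ ∂timeMeasure T, ‖γ τ x‖ₑ ≤ b τ)
    {t t' : ℝ} (ht : t ∈ Icc 0 T) (ht' : t' ∈ Icc 0 T) (htt' : t ≤ t') :
    eLpNorm (fun x => ∫ τ in t..t', γ τ x) (ENNReal.ofReal ρ) μ ≤
      ∫⁻ τ in Ioc t t', eLpNorm (γ τ) (ENNReal.ofReal ρ) μ := by
  have hρ0 : 0 < ρ := by linarith
  have hsub : Ioc t t' ⊆ Icc 0 T := fun s hs => ⟨ht.1.trans hs.1.le, hs.2.trans ht'.2⟩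
  have hle : (volume.restrict (Ioc t t')).prod μ ≤ (timeMeasure T).prod μ :=
    Measure.prod_mono (Measure.restrict_mono hsub le_rfl) le_rfl
  have hmeas : AEMeasurable (fun p : ℝ × Plane => ‖γ p.1 p.2‖ₑ) ((volume.restrict (Ioc t t')).prod μ) :=
    (hγ.mono_measure hle).enorm
  simp only [eLpNorm_ofReal_eq hρ0]
  refine le_trans ?_ (lintegral_rpow_lintegral_le hmeas hρ ?_)
  · gcongr with x
    rw [intervalIntegral.integral_of_le htt']
    exact enorm_integral_le_lintegral_enorm _
  · refine ne_top_of_le_ne_top (b := ∫⁻ _x, (∫⁻ τ, b τ ∂timeMeasure T) ^ ρ ∂μ) ?_ ?_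
    · rw [lintegral_const]
      exact ENNReal.mul_ne_top (ENNReal.rpow_ne_top_of_nonneg hρ0.le hb) (measure_ne_top _ _)
    · refine lintegral_mono_ae ?_
      filter_upwards [hbound] with x hx
      refine ENNReal.rpow_le_rpow ?_ hρ0.le
      exact (lintegral_mono' (Measure.restrict_mono hsub le_rfl) le_rfl).trans (lintegral_mono_ae hx)

theorem aemeasurable_eLpNorm {V : Type*} [NormedAddCommGroup V]
    {ρ : ℝ} {ν : Measure ℝ} {μ : Measure Plane} [SFinite μ] [SFinite ν] (hρ : 0 < ρ) {γ : ℝ → Plane → V}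
    (hγ : AEStronglyMeasurable (Function.uncurry γ) (ν.prod μ)) :
    AEMeasurable (fun τ => eLpNorm (γ τ) (ENNReal.ofReal ρ) μ) ν := by
  simp only [eLpNorm_ofReal_eq hρ]
  have h1 : AEMeasurable (fun p : ℝ × Plane => ‖γ p.1 p.2‖ₑ ^ ρ) (ν.prod μ) := hγ.enorm.pow_const ρ
  exact h1.lintegral_prod_right'.pow_const _

theorem Data.ExponentsOK.aemeasurable_sobolevNorm (h : m.ExponentsOK) [SFinite m.μΩ]
    {γ : ℝ → Plane → Plane} {Δ : ℝ → Plane → Mat}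
    (hγ : AEStronglyMeasurable (Function.uncurry γ) ((timeMeasure m.T).prod m.μΩ))
    (hΔ : AEStronglyMeasurable (Function.uncurry Δ) ((timeMeasure m.T).prod m.μΩ)) :
    AEMeasurable (fun τ => m.sobolevNorm (γ τ) (Δ τ)) (timeMeasure m.T) := by
  have hp : 0 < m.p := by linarith [h.one_lt_p]
  have hq : 0 < m.q := by linarith [h.one_lt_q]
  exact ((aemeasurable_eLpNorm hp hγ).add (aemeasurable_eLpNorm hp hΔ)).add (aemeasurable_eLpNorm hq hγ)

end SobolevNorm

section NodalPaths

variable {Ω : Set Plane} {R : Set (Set Plane)} {c : Set Plane → Plane} {ρ : ℝ}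
  {ν : Measure ℝ} {γ : ℝ → Plane → Plane}

theorem aestronglyMeasurable_nodalGrad {x : Plane}
    (h0 : AEStronglyMeasurable (fun t => γ t x) ν)
    (h1 : ∀ i : Fin 2, AEStronglyMeasurable (fun t => γ t (x + ρ • EuclideanSpace.single i 1)) ν) :
    AEStronglyMeasurable (fun t => nodalGrad x ρ (γ t)) ν := by
  unfold nodalGrad
  refine Finset.aestronglyMeasurable_fun_sum _ fun i _ => ?_
  exact (ContinuousLinearMap.smulRightL ℝ Plane Plane
    (EuclideanSpace.proj i : Plane →L[ℝ] ℝ)).continuous.comp_aestronglyMeasurable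
      (((h1 i).sub h0).const_smul ρ⁻¹)

theorem nodalGrad_sub (x : Plane) (v w : Plane → Plane) :
    nodalGrad x ρ (v - w) = nodalGrad x ρ v - nodalGrad x ρ w := by
  unfold nodalGrad
  rw [← Finset.sum_sub_distrib]
  refine Finset.sum_congr rfl fun i _ => ?_
  ext1 y
  simp only [ContinuousLinearMap.smulRight_apply, Pi.sub_apply, sub_apply]
  module

theorem intervalIntegral_nodalGrad {x : Plane} {t t' : ℝ}
    (h0 : IntervalIntegrable (fun t => γ t x) volume t t')
    (h1 : ∀ i : Fin 2, IntervalIntegrable (fun t => γ t (x + ρ • EuclideanSpace.single i 1)) volume t t') :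
    ∫ τ in t..t', nodalGrad x ρ (γ τ) = nodalGrad x ρ fun y => ∫ τ in t..t', γ τ y := by
  have hi : ∀ i : Fin 2, IntervalIntegrable (fun τ =>
      ρ⁻¹ • (γ τ (x + ρ • EuclideanSpace.single i 1) - γ τ x)) volume t t' := fun i =>
    ((h1 i).sub h0).smul ρ⁻¹
  have hT : ∀ (i : Fin 2) (y : Plane), (EuclideanSpace.proj i : Plane →L[ℝ] ℝ).smulRight y =
      ContinuousLinearMap.smulRightL ℝ Plane Plane (EuclideanSpace.proj i : Plane →L[ℝ] ℝ) y :=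
    fun _ _ => rfl
  simp only [nodalGrad, hT]
  rw [intervalIntegral.integral_finsetSum]
  · refine Finset.sum_congr rfl fun i _ => ?_
    rw [ContinuousLinearMap.intervalIntegral_comp_comm _ (hi i), intervalIntegral.integral_smul,
      intervalIntegral.integral_sub (h1 i) h0]
  · intro i _
    exact ⟨ContinuousLinearMap.integrable_comp _ (hi i).1, ContinuousLinearMap.integrable_comp _ (hi i).2⟩

namespace IsNodal

theorem aestronglyMeasurable_nodalGrad (h : IsNodal R c ρ) (hsub : ∀ s ∈ R, convexHull ℝ s ⊆ closure Ω)
    (hmeas : ∀ x ∈ closure Ω, AEStronglyMeasurable (fun t => γ t x) ν) {s : Set Plane} (hs : s ∈ R) :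
    AEStronglyMeasurable (fun t => nodalGrad (c s) ρ (γ t)) ν :=
  CrackGrowth.aestronglyMeasurable_nodalGrad (hmeas _ (hsub s hs (h.center_mem hs)))
    fun i => hmeas _ (hsub s hs (h.node_mem hs i))

variable {μ : Measure Plane}

/-- A path of piecewise affine functions that is measurable pointwise is measurable jointly. -/
theorem aestronglyMeasurable_uncurry (h : IsNodal R c ρ) (hfin : R.Finite)
    (hcov : ⋃ s ∈ R, convexHull ℝ s = closure Ω) (hclosed : ∀ s ∈ R, IsClosed (convexHull ℝ s))
    (hγ : ∀ᵐ t ∂ν, IsContinuousAffine Ω R (γ t))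
    (hmeas : ∀ x ∈ closure Ω, AEStronglyMeasurable (fun t => γ t x) ν)
    (hμ : ∀ᵐ x ∂μ, x ∈ closure Ω) : AEStronglyMeasurable (Function.uncurry γ) (ν.prod μ) := by
  have hsub : ∀ s ∈ R, convexHull ℝ s ⊆ closure Ω := fun s hs => by
    rw [← hcov]; exact subset_biUnion_of_mem (u := fun s => convexHull ℝ s) hs
  have hγ' : ∀ᵐ p ∂ν.prod μ, IsContinuousAffine Ω R (γ p.1) :=
    Measure.quasiMeasurePreserving_fst.ae hγ
  have hμ' : ∀ᵐ p ∂ν.prod μ, p.2 ∈ closure Ω := Measure.quasiMeasurePreserving_snd.ae hμ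
  have hself : (ν.prod μ).restrict (⋃ s ∈ R, (univ : Set ℝ) ×ˢ convexHull ℝ s) = ν.prod μ := by
    refine Measure.restrict_eq_self_of_ae_mem ?_
    filter_upwards [hμ'] with p hp
    rw [← hcov] at hp
    simpa using hp
  rw [← hself, biUnion_eq_iUnion]
  have := hfin.to_subtype
  refine AEStronglyMeasurable.iUnion fun s => ?_
  have hm1 : AEStronglyMeasurable (fun p : ℝ × Plane =>
      γ p.1 (c s) + nodalGrad (c s) ρ (γ p.1) (p.2 - c s)) (ν.prod μ) := by
    refine ((hmeas _ (hsub s s.2 (h.center_mem s.2))).comp_fst).add ?_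
    exact isBoundedBilinearMap_apply.continuous.comp_aestronglyMeasurable
      ((h.aestronglyMeasurable_nodalGrad hsub hmeas s.2).comp_fst.prodMk
        (by fun_prop : Continuous fun p : ℝ × Plane => p.2 - c s).aestronglyMeasurable)
  refine hm1.restrict.congr ?_
  filter_upwards [ae_restrict_of_ae hγ',
    ae_restrict_mem (MeasurableSet.univ.prod (hclosed s s.2).measurableSet)] with p hp hps
  exact (h.eq_add_nodalGrad s.2 hp hps.2).symm

theorem aestronglyMeasurable_uncurry_fderiv (h : IsNodal R c ρ) (hfin : R.Finite)
    (hsub : ∀ s ∈ R, convexHull ℝ s ⊆ closure Ω)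
    (hγ : ∀ᵐ t ∂ν, IsContinuousAffine Ω R (γ t))
    (hmeas : ∀ x ∈ closure Ω, AEStronglyMeasurable (fun t => γ t x) ν)
    (hμ : ∀ᵐ x ∂μ, ∃ s ∈ R, x ∈ interior (convexHull ℝ s)) :
    AEStronglyMeasurable (Function.uncurry (pathGrad γ)) (ν.prod μ) := by
  have hγ' : ∀ᵐ p ∂ν.prod μ, IsContinuousAffine Ω R (γ p.1) :=
    Measure.quasiMeasurePreserving_fst.ae hγ
  have hμ' : ∀ᵐ p ∂ν.prod μ, ∃ s ∈ R, p.2 ∈ interior (convexHull ℝ s) :=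
    Measure.quasiMeasurePreserving_snd.ae hμ
  have hself : (ν.prod μ).restrict (⋃ s ∈ R, (univ : Set ℝ) ×ˢ interior (convexHull ℝ s)) =
      ν.prod μ := by
    refine Measure.restrict_eq_self_of_ae_mem ?_
    filter_upwards [hμ'] with p hp
    simpa using hp
  rw [← hself, biUnion_eq_iUnion]
  have := hfin.to_subtype
  refine AEStronglyMeasurable.iUnion fun s => ?_
  refine ((h.aestronglyMeasurable_nodalGrad hsub hmeas s.2).comp_fst (ν := μ)).restrict.congr ?_
  filter_upwards [ae_restrict_of_ae hγ',
    ae_restrict_mem (MeasurableSet.univ.prod isOpen_interior.measurableSet)] with p hp hps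
  exact (h.fderiv_eq s.2 hp hps.2).symm

end IsNodal

end NodalPaths

/-- The properties of boundary data that the energy estimates use; they do not refer to the mesh. -/
structure Data.IsRegularPath (m : Data) (g gdot : ℝ → Plane → Plane) : Prop where
  traceFunction : ∀ t ∈ Icc 0 m.T, m.IsTraceFunction (g t)
  traceFunction_dot : ∀ᵐ t ∂timeMeasure m.T, m.IsTraceFunction (gdot t)
  trace_dot : ∀ᵐ t ∂timeMeasure m.T, ∀ x ∈ closure m.Ω, trace m.Ω (gdot t) x = gdot t x
  sobolevNorm_ne_top : ∀ t ∈ Icc 0 m.T, m.sobolevNorm (g t) (fderiv ℝ (g t)) ≠ ⊤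
  meas : AEStronglyMeasurable (Function.uncurry g) ((timeMeasure m.T).prod m.μΩ)
  meas_grad : AEStronglyMeasurable (Function.uncurry (pathGrad g)) ((timeMeasure m.T).prod m.μΩ)
  meas_dot : AEStronglyMeasurable (Function.uncurry gdot) ((timeMeasure m.T).prod m.μΩ)
  meas_dot_boundary : AEStronglyMeasurable (Function.uncurry gdot) ((timeMeasure m.T).prod m.μS)
  meas_grad_dot : AEStronglyMeasurable (Function.uncurry (pathGrad gdot))
    ((timeMeasure m.T).prod m.μΩ)
  integrable : ∫⁻ t, m.sobolevNorm (gdot t) (fderiv ℝ (gdot t)) ∂timeMeasure m.T ≠ ⊤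
  bound : ∃ b : ℝ → ℝ≥0∞, ∫⁻ t, b t ∂timeMeasure m.T ≠ ⊤ ∧
    (∀ᵐ t ∂timeMeasure m.T, ∀ x ∈ closure m.Ω, ‖gdot t x‖ₑ ≤ b t) ∧
    (∀ᵐ t ∂timeMeasure m.T, ∀ᵐ x ∂m.μΩ, ‖fderiv ℝ (gdot t) x‖ₑ ≤ b t) ∧
    ∀ᵐ x ∂m.μΩ, ∀ᵐ t ∂timeMeasure m.T, ‖fderiv ℝ (gdot t) x‖ₑ ≤ b t
  sub_eq : ∀ t ∈ Icc 0 m.T, ∀ t' ∈ Icc 0 m.T, ∀ x ∈ closure m.Ω,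
    g t' x - g t x = ∫ τ in t..t', gdot τ x
  grad_sub_eq : ∀ t ∈ Icc 0 m.T, ∀ t' ∈ Icc 0 m.T, ∀ᵐ x ∂m.μΩ,
    fderiv ℝ (g t') x - fderiv ℝ (g t) x = ∫ τ in t..t', fderiv ℝ (gdot τ) x

theorem ae_mem_closure_μΩ {m : Data} (hm : m.GeometryOK) : ∀ᵐ x ∂m.μΩ, x ∈ closure m.Ω := by
  filter_upwards [ae_restrict_mem hm.open_Ω.measurableSet] with x hx using subset_closure hx

theorem ae_mem_closure_μS {m : Data} (hm : m.GeometryOK) : ∀ᵐ x ∂m.μS, x ∈ closure m.Ω := by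
  filter_upwards [ae_restrict_mem hm.closed_bdS.measurableSet] with x hx
    using frontier_subset_closure (hm.bdN_sub (hm.bdS_sub hx))

theorem Data.IsBoundaryDatum.isRegularPath {m : Data} {c₁ c₂ ε : ℝ} {R : Set (Set Plane)}
    {g gdot : ℝ → Plane → Plane} (hm : m.GeometryOK) (he : m.ExponentsOK)
    (hR : m.IsMesh c₁ c₂ ε R) (hc₁ : 0 < c₁) (hε : 0 < ε) (hg : m.IsBoundaryDatum R g gdot) :
    m.IsRegularPath g gdot := by
  have hfinΩ := Data.isFiniteMeasure_μΩ hm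
  have hfinS := hR.isFiniteMeasure_μS
  have hcov := hR.regular.isConvexCover hc₁ hε
  obtain ⟨c, ρ, hN⟩ := hR.regular.exists_isNodal hc₁ hε
  have hsub : ∀ s ∈ R, convexHull ℝ s ⊆ closure m.Ω := fun s hs => by
    rw [← hR.regular.cover]; exact subset_biUnion_of_mem (u := fun s => convexHull ℝ s) hs
  have hclosed : ∀ s ∈ R, IsClosed (convexHull ℝ s) := fun s hs => hcov.closed _ ⟨s, hs, rfl⟩
  have hinter : ∀ᵐ x ∂m.μΩ, ∃ s ∈ R, x ∈ interior (convexHull ℝ s) := by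
    filter_upwards [hcov.ae_exists_mem_interior, ae_restrict_mem hm.open_Ω.measurableSet] with x hx hxΩ
    obtain ⟨_, ⟨s, hs, rfl⟩, hxs⟩ := hx hxΩ
    exact ⟨s, hs, hxs⟩
  obtain ⟨C, hC⟩ := hN.exists_inverse_bound hm.lipschitz_Ω hm.bounded_Ω hR.regular he.one_lt_q.le
    fun v hv => hcov.aestronglyMeasurable_of_isContinuousAffine hm hv
  set b : ℝ → ℝ≥0∞ := fun t => C * m.sobolevNorm (gdot t) (fderiv ℝ (gdot t)) with hbdef
  have hb : ∫⁻ t, b t ∂timeMeasure m.T ≠ ⊤ := by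
    rw [hbdef, lintegral_const_mul' _ _ ENNReal.coe_ne_top]
    exact ENNReal.mul_ne_top ENNReal.coe_ne_top hg.integrable.ne
  have hb1 : ∀ᵐ t ∂timeMeasure m.T, ∀ x ∈ closure m.Ω, ‖gdot t x‖ₑ ≤ b t := by
    filter_upwards [hg.affine_dot] with t ht x hx
    exact ((hC _ ht).1 x hx).trans (mul_le_mul_right Data.eLpNorm_q_le_sobolevNorm _)
  have hb2 : ∀ᵐ t ∂timeMeasure m.T, ∀ s ∈ R, ∀ x ∈ interior (convexHull ℝ s),
      ‖fderiv ℝ (gdot t) x‖ₑ ≤ b t := by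
    filter_upwards [hg.affine_dot] with t ht s hs x hx
    rw [hN.fderiv_eq hs ht hx]
    exact ((hC _ ht).2 s hs).trans (mul_le_mul_right Data.eLpNorm_q_le_sobolevNorm _)
  have hgi : ∀ x ∈ closure m.Ω, Integrable (fun t => gdot t x) (timeMeasure m.T) := by
    intro x hx
    refine ⟨hg.meas x hx, lt_of_le_of_lt (lintegral_mono_ae ?_) (lt_top_iff_ne_top.2 hb)⟩
    filter_upwards [hb1] with t ht using ht x hx
  have hgii : ∀ x ∈ closure m.Ω, ∀ t ∈ Icc 0 m.T, ∀ t' ∈ Icc 0 m.T,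
      IntervalIntegrable (fun t => gdot t x) volume t t' := by
    intro x hx t ht t' ht'
    exact (IntegrableOn.mono_set (hgi x hx) ((convex_Icc 0 m.T).ordConnected.uIcc_subset ht ht')).intervalIntegrable
  have h0 : (0 : ℝ) ∈ Icc 0 m.T := ⟨le_rfl, he.T_pos.le⟩
  have hsubeq : ∀ t ∈ Icc 0 m.T, ∀ t' ∈ Icc 0 m.T, ∀ x ∈ closure m.Ω,
      g t' x - g t x = ∫ τ in t..t', gdot τ x := by
    intro t ht t' ht' x hx
    rw [hg.eq_integral t ht x hx, hg.eq_integral t' ht' x hx, add_sub_add_left_eq_sub,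
      intervalIntegral.integral_interval_sub_left (hgii x hx 0 h0 t' ht') (hgii x hx 0 h0 t ht)]
  have hgmeas : ∀ x ∈ closure m.Ω, AEStronglyMeasurable (fun t => g t x) (timeMeasure m.T) := by
    intro x hx
    have h1 : ContinuousOn (fun t => g 0 x + ∫ s in 0..t, gdot s x) (Icc 0 m.T) := by
      refine continuousOn_const.add ?_
      have := intervalIntegral.continuousOn_primitive_interval' (hgii x hx 0 h0 m.T ⟨he.T_pos.le, le_rfl⟩)
        left_mem_uIcc
      rwa [uIcc_of_le he.T_pos.le] at this
    refine (h1.aestronglyMeasurable measurableSet_Icc).congr ?_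
    filter_upwards [ae_timeMeasure_mem m.T] with t ht using (hg.eq_integral t ht x hx).symm
  have hgaff : ∀ᵐ t ∂timeMeasure m.T, IsContinuousAffine m.Ω R (g t) := by
    filter_upwards [ae_timeMeasure_mem m.T] with t ht using hg.affine t ht
  refine
    { traceFunction := fun t ht => hcov.isTraceFunction hm (hg.affine t ht)
      traceFunction_dot := by
        filter_upwards [hg.affine_dot] with t ht using hcov.isTraceFunction hm ht
      trace_dot := by
        filter_upwards [hg.affine_dot] with t ht x hx using hcov.trace_eq_self hm ht hx
      sobolevNorm_ne_top := fun t ht => hcov.sobolevNorm_ne_top hm (hg.affine t ht)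
      meas := hN.aestronglyMeasurable_uncurry hR.regular.finite hR.regular.cover hclosed hgaff hgmeas
        (ae_mem_closure_μΩ hm)
      meas_grad := hN.aestronglyMeasurable_uncurry_fderiv hR.regular.finite hsub hgaff hgmeas hinter
      meas_dot := hN.aestronglyMeasurable_uncurry hR.regular.finite hR.regular.cover hclosed
        hg.affine_dot hg.meas (ae_mem_closure_μΩ hm)
      meas_dot_boundary := hN.aestronglyMeasurable_uncurry hR.regular.finite hR.regular.cover hclosed
        hg.affine_dot hg.meas (ae_mem_closure_μS hm)
      meas_grad_dot := hN.aestronglyMeasurable_uncurry_fderiv hR.regular.finite hsub hg.affine_dot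
        hg.meas hinter
      integrable := hg.integrable.ne
      bound := ⟨b, hb, hb1, ?_, ?_⟩
      sub_eq := hsubeq
      grad_sub_eq := ?_ }
  · filter_upwards [hb2] with t ht
    filter_upwards [hinter] with x ⟨s, hs, hx⟩ using ht s hs x hx
  · filter_upwards [hinter] with x ⟨s, hs, hx⟩
    filter_upwards [hb2] with t ht using ht s hs x hx
  · intro t ht t' ht'
    filter_upwards [hinter] with x ⟨s, hs, hx⟩
    rw [hN.fderiv_eq hs (hg.affine t ht) hx, hN.fderiv_eq hs (hg.affine t' ht') hx, ← nodalGrad_sub]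
    have h1 : ∫ τ in t..t', fderiv ℝ (gdot τ) x = ∫ τ in t..t', nodalGrad (c s) ρ (gdot τ) := by
      refine intervalIntegral.integral_congr_ae_restrict ?_
      refine ae_mono (Measure.restrict_mono (s' := Icc 0 m.T) ?_ le_rfl) ?_
      · exact uIoc_subset_uIcc.trans ((convex_Icc 0 m.T).ordConnected.uIcc_subset ht ht')
      · filter_upwards [hg.affine_dot] with τ hτ using hN.fderiv_eq hs hτ hx
    have hcs := hsub s hs (hN.center_mem hs)
    have hns := fun i => hsub s hs (hN.node_mem hs i)
    rw [h1, intervalIntegral_nodalGrad (hgii _ hcs t ht t' ht') fun i => hgii _ (hns i) t ht t' ht']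
    unfold nodalGrad
    refine Finset.sum_congr rfl fun i _ => ?_
    simp only [Pi.sub_apply]
    rw [hsubeq t ht t' ht' _ hcs, hsubeq t ht t' ht' _ (hns i)]

namespace Data.IsRegularPath

variable {m : Data} {g gdot g' gdot' : ℝ → Plane → Plane}

theorem aesm_at (h : m.IsRegularPath g gdot) {t : ℝ} (ht : t ∈ Icc 0 m.T) : AEStronglyMeasurable (g t) m.μΩ :=
  (h.traceFunction t ht).meas

/-- The increments of the datum are controlled by the integral of its time derivative. -/
theorem sobolevNorm_sub_le (hm : m.GeometryOK) (he : m.ExponentsOK) (h : m.IsRegularPath g gdot)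
    {t t' : ℝ} (ht : t ∈ Icc 0 m.T) (ht' : t' ∈ Icc 0 m.T) (htt' : t ≤ t') :
    m.sobolevNorm (g t' - g t) (fderiv ℝ (g t') - fderiv ℝ (g t)) ≤
      ∫⁻ τ in Ioc t t', m.sobolevNorm (gdot τ) (fderiv ℝ (gdot τ)) := by
  have hfinΩ := Data.isFiniteMeasure_μΩ hm
  obtain ⟨b, hb, hb1, -, hb3⟩ := h.bound
  have hsub : Ioc t t' ⊆ Icc 0 m.T := fun s hs => ⟨ht.1.trans hs.1.le, hs.2.trans ht'.2⟩
  have hb1' : ∀ᵐ x ∂m.μΩ, ∀ᵐ τ ∂timeMeasure m.T, ‖gdot τ x‖ₑ ≤ b τ := by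
    filter_upwards [ae_mem_closure_μΩ hm] with x hx
    filter_upwards [hb1] with τ hτ using hτ x hx
  have e1 : g t' - g t =ᵐ[m.μΩ] fun x => ∫ τ in t..t', gdot τ x := by
    filter_upwards [ae_mem_closure_μΩ hm] with x hx using h.sub_eq t ht t' ht' x hx
  have e2 : fderiv ℝ (g t') - fderiv ℝ (g t) =ᵐ[m.μΩ] fun x => ∫ τ in t..t', pathGrad gdot τ x :=
    h.grad_sub_eq t ht t' ht'
  rw [Data.sobolevNorm_congr e1 e2]
  have hle : (volume.restrict (Ioc t t')) ≤ timeMeasure m.T := Measure.restrict_mono hsub le_rfl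
  have hle' : (volume.restrict (Ioc t t')).prod m.μΩ ≤ (timeMeasure m.T).prod m.μΩ :=
    Measure.prod_mono hle le_rfl
  have hp := he.one_lt_p
  have hq := he.one_lt_q
  have m1 := aemeasurable_eLpNorm (by linarith : 0 < m.p) (h.meas_dot.mono_measure hle')
  have m2 := aemeasurable_eLpNorm (by linarith : 0 < m.p) (h.meas_grad_dot.mono_measure hle')
  have m3 : AEMeasurable (fun τ => eLpNorm (gdot τ) (ENNReal.ofReal m.p) m.μΩ +
    eLpNorm (pathGrad gdot τ) (ENNReal.ofReal m.p) m.μΩ) (volume.restrict (Ioc t t')) := m1.add m2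
  refine (add_le_add (add_le_add (eLpNorm_intervalIntegral_le hp h.meas_dot hb hb1' ht ht' htt')
    (eLpNorm_intervalIntegral_le hp h.meas_grad_dot hb hb3 ht ht' htt'))
    (eLpNorm_intervalIntegral_le hq h.meas_dot hb hb1' ht ht' htt')).trans (le_of_eq ?_)
  rw [← lintegral_add_left' m1, ← lintegral_add_left' m3]
  rfl

theorem sobolevNorm_sub_le_integral (hm : m.GeometryOK) (he : m.ExponentsOK) (h : m.IsRegularPath g gdot)
    {t t' : ℝ} (ht : t ∈ Icc 0 m.T) (ht' : t' ∈ Icc 0 m.T) :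
    m.sobolevNorm (g t' - g t) (fderiv ℝ (g t') - fderiv ℝ (g t)) ≤
      ∫⁻ τ, m.sobolevNorm (gdot τ) (fderiv ℝ (gdot τ)) ∂timeMeasure m.T := by
  have key : ∀ t ∈ Icc 0 m.T, ∀ t' ∈ Icc 0 m.T, t ≤ t' →
      m.sobolevNorm (g t' - g t) (fderiv ℝ (g t') - fderiv ℝ (g t)) ≤
      ∫⁻ τ, m.sobolevNorm (gdot τ) (fderiv ℝ (gdot τ)) ∂timeMeasure m.T := fun t ht t' ht' htt' =>
    (h.sobolevNorm_sub_le hm he ht ht' htt').trans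
      (lintegral_mono' (Measure.restrict_mono (show Ioc t t' ⊆ Icc 0 m.T from fun s hs =>
        ⟨ht.1.trans hs.1.le, hs.2.trans ht'.2⟩) le_rfl)
        le_rfl)
  rcases le_total t t' with htt' | htt'
  · exact key t ht t' ht' htt'
  · have := key t' ht' t ht htt'
    rwa [← Data.sobolevNorm_neg, neg_sub, neg_sub] at this

/-- A path is bounded uniformly in time by its norm in `W^{1,1}` in time. -/
theorem mul_sobolevNorm_le (hm : m.GeometryOK) (he : m.ExponentsOK) (h : m.IsRegularPath g gdot)
    {t : ℝ} (ht : t ∈ Icc 0 m.T) :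
    ENNReal.ofReal m.T * m.sobolevNorm (g t) (fderiv ℝ (g t)) ≤
      (∫⁻ τ, m.sobolevNorm (g τ) (fderiv ℝ (g τ)) ∂timeMeasure m.T) + ENNReal.ofReal m.T *
        ∫⁻ τ, m.sobolevNorm (gdot τ) (fderiv ℝ (gdot τ)) ∂timeMeasure m.T := by
  set J := ∫⁻ τ, m.sobolevNorm (gdot τ) (fderiv ℝ (gdot τ)) ∂timeMeasure m.T with hJ
  have hvol : timeMeasure m.T univ = ENNReal.ofReal m.T := by simp
  calc ENNReal.ofReal m.T * m.sobolevNorm (g t) (fderiv ℝ (g t))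
      = ∫⁻ _τ, m.sobolevNorm (g t) (fderiv ℝ (g t)) ∂timeMeasure m.T := by
        rw [lintegral_const, hvol, mul_comm]
    _ ≤ ∫⁻ τ, (m.sobolevNorm (g τ) (fderiv ℝ (g τ)) + J) ∂timeMeasure m.T := by
        refine lintegral_mono_ae ?_
        filter_upwards [ae_timeMeasure_mem m.T] with τ hτ
        have h1 := he.sobolevNorm_add_le (h.aesm_at hτ) ((h.aesm_at ht).sub (h.aesm_at hτ))
          (aestronglyMeasurable_fderiv_plane (g τ) m.μΩ)
          ((aestronglyMeasurable_fderiv_plane (g t) m.μΩ).sub (aestronglyMeasurable_fderiv_plane (g τ) m.μΩ))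
        rw [add_sub_cancel, add_sub_cancel] at h1
        exact h1.trans (add_le_add_right (h.sobolevNorm_sub_le_integral hm he hτ ht) _)
    _ = _ := by
        rw [lintegral_add_right _ measurable_const, lintegral_const, hvol, mul_comm J]

end Data.IsRegularPath

section Bounds

variable {T : ℝ} {μ : Measure Plane} {b : ℝ → Plane → ℝ}

/-- A continuous path in a Lebesgue space is bounded. -/
theorem IsContinuousInLp.exists_bound {s : ℝ≥0∞} (hb : IsContinuousInLp T μ s b) (hs : 1 ≤ s) :
    ∃ B : ℝ≥0, ∀ t ∈ Icc 0 T, eLpNorm (b t) s μ ≤ B := by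
  suffices h : ∃ B : ℝ≥0, ∀ t ∈ Icc 0 T, t ∈ Icc 0 T → eLpNorm (b t) s μ ≤ B by
    obtain ⟨B, hB⟩ := h
    exact ⟨B, fun t ht => hB t ht ht⟩
  refine isCompact_Icc.induction_on (p := fun S => ∃ B : ℝ≥0, ∀ t ∈ S, t ∈ Icc 0 T →
    eLpNorm (b t) s μ ≤ B) ⟨0, by simp⟩ ?_ ?_ ?_
  · rintro S S' hSS' ⟨B, hB⟩
    exact ⟨B, fun t ht => hB t (hSS' ht)⟩
  · rintro S S' ⟨B, hB⟩ ⟨B', hB'⟩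
    refine ⟨max B B', fun t ht hT => ?_⟩
    rcases ht with ht | ht
    · exact (hB t ht hT).trans (by exact_mod_cast le_max_left _ _)
    · exact (hB' t ht hT).trans (by exact_mod_cast le_max_right _ _)
  · intro t ht
    refine ⟨{τ | eLpNorm (b τ - b t) s μ ≤ 1}, (hb t ht).2.eventually_le_const zero_lt_one,
      ((1 : ℝ≥0∞) + eLpNorm (b t) s μ).toNNReal, fun τ hτ hτT => ?_⟩
    rw [ENNReal.coe_toNNReal (ENNReal.add_ne_top.2 ⟨ENNReal.one_ne_top, (hb t ht).1.eLpNorm_ne_top⟩)]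
    have h1 := eLpNorm_add_le ((hb τ hτT).1.1.sub (hb t ht).1.1) (hb t ht).1.1 hs
    rw [sub_add_cancel] at h1
    exact h1.trans (add_le_add_left hτ _)

theorem one_le_conjExponent (s : ℝ≥0∞) : 1 ≤ ENNReal.conjExponent s := by
  unfold ENNReal.conjExponent
  exact le_self_add

theorem rpow_le_one_add_rpow {s s' : ℝ} (h0 : 0 ≤ s') (h : s' ≤ s) (x : ℝ≥0∞) :
    x ^ s' ≤ 1 + x ^ s := by
  rcases le_total x 1 with hx | hx
  · exact (ENNReal.rpow_le_one hx h0).trans le_self_add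
  · exact (ENNReal.rpow_le_rpow_of_exponent_le hx h).trans le_add_self

theorem ofReal_growth_le {E : Type*} [NormedAddCommGroup E] {a b x s : ℝ} (hs : 0 ≤ s) {z : E}
    (h : x ≤ a * ‖z‖ ^ s + b) : ENNReal.ofReal x ≤ ‖a‖ₑ * ‖z‖ₑ ^ s + ‖b‖ₑ := by
  rw [← ofReal_norm (x := z), ENNReal.ofReal_rpow_of_nonneg (norm_nonneg _) hs, ← ofReal_norm (x := a),
    ← ENNReal.ofReal_mul (norm_nonneg _), ← ofReal_norm (x := b), ← ENNReal.ofReal_add (by positivity)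
    (norm_nonneg _)]
  refine ENNReal.ofReal_le_ofReal (h.trans ?_)
  have := Real.le_norm_self a
  have := Real.le_norm_self b
  gcongr

theorem exists_growth_bound {E : Type*} [NormedAddCommGroup E] [IsFiniteMeasure μ] {s s' : ℝ}
    (hs' : 0 ≤ s') (hs : s' ≤ s) {a : ℝ → ℝ} (ha : IntegrableOn a (Icc 0 T)) {k : ℝ≥0∞} (hk : 1 ≤ k)
    (hb : IsIntegrableInLp T μ k b) {A : Set Plane} (hA : ∀ᵐ x ∂μ, x ∈ A) {N : ℝ → Plane → E → ℝ}
    (hN : ∀ t ∈ Icc 0 T, ∀ x ∈ A, ∀ z, N t x z ≤ a t * ‖z‖ ^ s' + b t x) :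
    ∃ (a : ℝ → ℝ≥0∞) (b : ℝ × Plane → ℝ≥0∞),
      AEMeasurable a (timeMeasure T) ∧ ∫⁻ t, a t ∂timeMeasure T ≠ ⊤ ∧
      AEMeasurable b ((timeMeasure T).prod μ) ∧ ∫⁻ p, b p ∂((timeMeasure T).prod μ) ≠ ⊤ ∧
      ∀ᵐ x ∂μ, ∀ t ∈ Icc 0 T, ∀ z, ENNReal.ofReal (N t x z) ≤ a t * ‖z‖ₑ ^ s + b (t, x) := by
  have ham : AEMeasurable (fun t => ‖a t‖ₑ) (timeMeasure T) := ha.1.enorm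
  have ham' : AEMeasurable (fun p : ℝ × Plane => ‖a p.1‖ₑ) ((timeMeasure T).prod μ) :=
    ha.1.comp_fst.enorm
  have hbm : AEMeasurable (fun p : ℝ × Plane => ‖b p.1 p.2‖ₑ) ((timeMeasure T).prod μ) := hb.1.enorm
  refine ⟨fun t => ‖a t‖ₑ, fun p => ‖a p.1‖ₑ + ‖b p.1 p.2‖ₑ, ham, ha.2.ne, ham'.add hbm, ?_, ?_⟩
  · rw [lintegral_add_left' ham', lintegral_prod _ ham', lintegral_prod _ hbm]
    simp only [lintegral_const]
    rw [lintegral_mul_const'' _ ham]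
    refine ENNReal.add_ne_top.2 ⟨ENNReal.mul_ne_top ha.2.ne (measure_ne_top _ _), ?_⟩
    obtain ⟨c, hc⟩ := exists_eLpNorm_le_eLpNorm (F := ℝ) μ hk one_ne_zero
    refine ne_top_of_le_ne_top (b := c * ∫⁻ t, eLpNorm (b t) k μ ∂timeMeasure T)
      (ENNReal.mul_ne_top ENNReal.coe_ne_top hb.2.ne) ?_
    rw [← lintegral_const_mul' _ _ ENNReal.coe_ne_top]
    refine lintegral_mono_ae ?_
    filter_upwards [hb.1.prodMk_left] with t ht
    have := hc _ ht
    rwa [eLpNorm_one_eq_lintegral_enorm] at this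
  · filter_upwards [hA] with x hx t ht z
    refine (ofReal_growth_le hs' (hN t ht x hx z)).trans ?_
    calc ‖a t‖ₑ * ‖z‖ₑ ^ s' + ‖b t x‖ₑ ≤ ‖a t‖ₑ * (1 + ‖z‖ₑ ^ s) + ‖b t x‖ₑ := by
          gcongr; exact rpow_le_one_add_rpow hs' hs _
      _ = _ := by ring

theorem exists_derivative_bound {ρ : ℝ} (hρ : 1 < ρ) {a : ℝ}
    (hb : IsContinuousInLp T μ (ENNReal.conjExponent (ENNReal.ofReal ρ)) b) {A : Set Plane}
    (hA : ∀ᵐ x ∂μ, x ∈ A) {Φ : ℝ → Plane → Plane → ℝ}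
    (hΦ : ∀ t ∈ Icc 0 T, ∀ x ∈ A, ∀ z, ‖fderiv ℝ (Φ t x) z‖ ≤ a * ‖z‖ ^ (ρ - 1) + b t x) :
    ∃ (a : ℝ≥0) (b : ℝ → Plane → ℝ≥0∞) (B : ℝ≥0), ∀ t ∈ Icc 0 T,
      AEMeasurable (b t) μ ∧ ∫⁻ x, b t x ^ (ρ / (ρ - 1)) ∂μ ≤ B ∧
        ∀ᵐ x ∂μ, ∀ z, ‖fderiv ℝ (Φ t x) z‖ₑ ≤ a * ‖z‖ₑ ^ (ρ - 1) + b t x := by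
  have hρ' : 0 < ρ / (ρ - 1) := div_pos (by linarith) (by linarith)
  obtain ⟨B, hB⟩ := hb.exists_bound (one_le_conjExponent _)
  refine ⟨‖a‖₊, fun t x => ‖b t x‖ₑ, B ^ (ρ / (ρ - 1)), fun t ht => ⟨(hb t ht).1.1.enorm, ?_, ?_⟩⟩
  · rw [lintegral_rpow_enorm_eq hρ', ← conjExponent_ofReal hρ, ENNReal.coe_rpow_of_nonneg _ hρ'.le]
    exact ENNReal.rpow_le_rpow (hB t ht) hρ'.le
  · filter_upwards [hA] with x hx z
    have := ofReal_growth_le (by linarith) (hΦ t ht x hx z)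
    rwa [ofReal_norm] at this

theorem integrable_of_abs_le {A : Set Plane} (hA : ∀ᵐ x ∂μ, x ∈ A) {f b₀ b₁ : Plane → ℝ}
    (hf : AEStronglyMeasurable f μ) (h₀ : MemLp b₀ 1 μ) (h₁ : MemLp b₁ 1 μ)
    (h : ∀ x ∈ A, - b₀ x ≤ - f x ∧ - f x ≤ b₁ x) : Integrable f μ := by
  rw [memLp_one_iff_integrable] at h₀ h₁
  refine (h₀.norm.add h₁.norm).mono' hf ?_
  filter_upwards [hA] with x hx
  obtain ⟨h2, h3⟩ := h x hx
  rw [Real.norm_eq_abs, abs_le]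
  have h4 := Real.le_norm_self (b₀ x)
  have h5 := Real.le_norm_self (b₁ x)
  have h6 := norm_nonneg (b₀ x)
  have h7 := norm_nonneg (b₁ x)
  simp only [Pi.add_apply]
  constructor <;> linarith

end Bounds

section Potentials

variable {m : Data}

theorem ae_mem_μΩ (hm : m.GeometryOK) : ∀ᵐ x ∂m.μΩ, x ∈ m.Ω :=
  ae_restrict_mem hm.open_Ω.measurableSet

theorem ae_mem_μS (hm : m.GeometryOK) : ∀ᵐ x ∂m.μS, x ∈ m.bdS :=
  ae_restrict_mem hm.closed_bdS.measurableSet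

theorem Data.Admissible.isPotential_body (hm : m.Admissible) :
    IsPotential m.T m.q m.μΩ m.F m.Fdot := by
  have hfin := Data.isFiniteMeasure_μΩ hm.geometry
  have hA := ae_mem_μΩ hm.geometry
  have hF := hm.bodyForces
  have he := hm.exponents
  obtain ⟨a₀, a₁, b₀, b₁, -, -, -, -, hb₀, hb₁, hgr⟩ := hF.growth
  obtain ⟨a₂, b₂, -, -, hb₂, hgr₂⟩ := hF.growth_fderiv
  obtain ⟨a₃, b₃, -, ha₃, -, hb₃, hgr₃⟩ := hF.growth_dot
  obtain ⟨a₄, b₄, -, ha₄, -, hb₄, hgr₄⟩ := hF.growth_fderiv_dot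
  have hq0 : m.q ≠ 0 := by linarith [he.one_lt_q]
  have hqd := he.one_le_qdot
  have hqq := he.qdot_lt
  refine
    { one_lt := he.one_lt_q
      meas := fun z => (hF.potential.meas z).1
      meas_at := fun t ht z => (hF.potential.meas z).2 t ht
      meas_dot := fun z => (hF.potential.meas_dot z).1
      smooth := by filter_upwards [hA] with x hx t ht using hF.potential.smooth t ht x hx
      smooth_dot := by filter_upwards [hA] with x hx t ht using hF.potential.smooth_dot t ht x hx
      eq_integral := hF.potential.eq_integral
      fderiv_eq_integral := hF.potential.fderiv_eq_integral
      integrable_zero := fun t ht => integrable_of_abs_le hA ((hF.potential.meas 0).2 t ht)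
        (hb₀ t ht).1 (hb₁ t ht).1 fun x hx => by simpa [hq0] using hgr t ht x hx 0
      bound_fderiv := exists_derivative_bound he.one_lt_q hb₂ hA hgr₂
      bound_dot := ?_
      bound_fderiv_dot := ?_ }
  · have := exists_growth_bound (by linarith) hqq.le ha₃ le_rfl hb₃ hA hgr₃
    simpa only [← Real.norm_eq_abs, ofReal_norm] using this
  · have := exists_growth_bound (s := m.q - 1) (by linarith) (by linarith) ha₄ (one_le_conjExponent _)
      hb₄ hA hgr₄
    simpa only [ofReal_norm] using this

theorem Data.Admissible.isPotential_surface (hm : m.Admissible) [IsFiniteMeasure m.μS] :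
    IsPotential m.T m.r m.μS m.G m.Gdot := by
  have hA := ae_mem_μS hm.geometry
  have hG := hm.surfaceForces
  have he := hm.exponents
  obtain ⟨a₀, a₁, b₀, b₁, -, -, -, -, -, hb₀, hb₁, hgr⟩ := hG.growth
  obtain ⟨a₂, b₂, -, -, hb₂, hgr₂⟩ := hG.growth_fderiv
  obtain ⟨a₃, b₃, -, ha₃, -, hb₃, hgr₃⟩ := hG.growth_dot
  obtain ⟨a₄, b₄, -, ha₄, -, hb₄, hgr₄⟩ := hG.growth_fderiv_dot
  have hr : 1 < m.r := he.one_lt_p.trans_le he.p_le_r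
  have hr0 : m.r ≠ 0 := by linarith
  refine
    { one_lt := hr
      meas := fun z => (hG.potential.meas z).1
      meas_at := fun t ht z => (hG.potential.meas z).2 t ht
      meas_dot := fun z => (hG.potential.meas_dot z).1
      smooth := by filter_upwards [hA] with x hx t ht using hG.potential.smooth t ht x hx
      smooth_dot := by filter_upwards [hA] with x hx t ht using hG.potential.smooth_dot t ht x hx
      eq_integral := hG.potential.eq_integral
      fderiv_eq_integral := hG.potential.fderiv_eq_integral
      integrable_zero := fun t ht => integrable_of_abs_le hA ((hG.potential.meas 0).2 t ht)
        (hb₀ t ht).1 (hb₁ t ht).1 fun x hx => by simpa [hr0] using hgr t ht x hx 0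
      bound_fderiv := exists_derivative_bound hr hb₂ hA hgr₂
      bound_dot := ?_
      bound_fderiv_dot := ?_ }
  · have := exists_growth_bound (by linarith) le_rfl ha₃ le_rfl hb₃ hA hgr₃
    simpa only [← Real.norm_eq_abs, ofReal_norm] using this
  · have := exists_growth_bound (s := m.r - 1) (by linarith) le_rfl ha₄ (one_le_conjExponent _)
      hb₄ hA hgr₄
    simpa only [ofReal_norm] using this

theorem add_rpow_le_two_rpow {s : ℝ} (hs : 0 ≤ s) (x y : ℝ≥0∞) :
    (x + y) ^ s ≤ 2 ^ s * (x ^ s + y ^ s) := by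
  wlog h : x ≤ y generalizing x y
  · rw [add_comm, add_comm (x ^ s)]; exact this y x (le_of_not_ge h)
  calc (x + y) ^ s ≤ (2 * y) ^ s := by rw [two_mul]; gcongr
    _ = 2 ^ s * y ^ s := ENNReal.mul_rpow_of_nonneg _ _ hs
    _ ≤ _ := by gcongr; exact le_add_self

theorem Data.Admissible.isPotential_bulk (hm : m.Admissible) :
    IsPotential m.T m.p m.μΩ (fun _ => m.W) (fun _ _ _ => 0) := by
  have hfin := Data.isFiniteMeasure_μΩ hm.geometry
  have hA := ae_mem_μΩ hm.geometry
  have hW := hm.bulkDensity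
  obtain ⟨a₀, a₁, b₀, b₁, -, ha₁, hb₀, hb₁, hb₀n, hb₁n, hgr⟩ := hW.growth
  have hp := hm.exponents.one_lt_p
  have hp0 : m.p ≠ 0 := by linarith
  have hz : ∀ z : Mat, ‖fderiv ℝ (fun _ : Mat => (0 : ℝ)) z‖ₑ = 0 := fun z => by
    rw [← ofReal_norm, fderiv_fun_const]
    exact (congrArg ENNReal.ofReal (norm_zero (E := Mat →L[ℝ] ℝ))).trans ENNReal.ofReal_zero
  refine
    { one_lt := hp
      meas := fun z => (hW.meas z).comp_snd
      meas_at := fun t ht z => hW.meas z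
      meas_dot := fun z => aestronglyMeasurable_const
      smooth := by filter_upwards [hA] with x hx t ht using hW.smooth x hx
      smooth_dot := by filter_upwards with x t ht using contDiff_const
      eq_integral := fun t ht z => by filter_upwards with x; simp
      fderiv_eq_integral := fun t ht z => by filter_upwards with x; simp
      integrable_zero := fun t ht => ?_
      bound_fderiv := ?_
      bound_dot := ⟨0, 0, aemeasurable_const, by simp, aemeasurable_const, by simp, by simp⟩
      bound_fderiv_dot := ⟨0, 0, aemeasurable_const, by simp, aemeasurable_const, by simp, by
        filter_upwards with x t ht z
        rw [hz]
        exact zero_le⟩ }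
  · refine hb₁.mono' (hW.meas 0) ?_
    filter_upwards [hA] with x hx
    rw [Real.norm_of_nonneg (hW.nonneg x hx 0)]
    simpa [hp0] using (hgr x hx 0).2
  · set K : ℝ := 2 * (a₁ * 2 ^ m.p + 1) with hK
    have hK0 : 0 ≤ K := by positivity
    have hp1 : 0 ≤ m.p - 1 := by linarith
    have hpp : 0 < m.p / (m.p - 1) := div_pos (by linarith) (by linarith)
    set k : ℝ≥0 := K.toNNReal * 2 ^ (m.p - 1) with hk
    have hkc : (k : ℝ≥0∞) = ENNReal.ofReal K * 2 ^ (m.p - 1) := by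
      rw [hk]; push_cast; rw [ENNReal.coe_rpow_of_nonneg _ hp1]; rfl
    have hbm : AEMeasurable (fun x => ‖b₁ x‖ₑ) m.μΩ := hb₁.1.enorm
    set I : ℝ≥0∞ := (k : ℝ≥0∞) ^ (m.p / (m.p - 1)) * (2 ^ m.p * (m.μΩ univ + ∫⁻ x, ‖b₁ x‖ₑ ∂m.μΩ)) with hI
    have hIt : I ≠ ⊤ := by
      refine ENNReal.mul_ne_top (ENNReal.rpow_ne_top_of_nonneg hpp.le ENNReal.coe_ne_top)
        (ENNReal.mul_ne_top (ENNReal.rpow_ne_top_of_nonneg (by linarith) ENNReal.ofNat_ne_top) ?_)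
      exact ENNReal.add_ne_top.2 ⟨measure_ne_top _ _, hb₁.2.ne⟩
    refine ⟨k, fun _ x => k * (1 + ‖b₁ x‖ₑ ^ (1 / m.p)) ^ (m.p - 1), I.toNNReal, fun t ht => ⟨?_, ?_, ?_⟩⟩
    · exact (((hbm.pow_const _).const_add _).pow_const _).const_mul _
    · rw [ENNReal.coe_toNNReal hIt]
      calc ∫⁻ x, (k * (1 + ‖b₁ x‖ₑ ^ (1 / m.p)) ^ (m.p - 1)) ^ (m.p / (m.p - 1)) ∂m.μΩ
          ≤ ∫⁻ x, (k : ℝ≥0∞) ^ (m.p / (m.p - 1)) * (2 ^ m.p * (1 + ‖b₁ x‖ₑ)) ∂m.μΩ := by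
            refine lintegral_mono fun x => ?_
            rw [ENNReal.mul_rpow_of_nonneg _ _ hpp.le, ← ENNReal.rpow_mul,
              mul_div_cancel₀ _ (by linarith : m.p - 1 ≠ 0)]
            gcongr
            refine (add_rpow_le_two_rpow (by linarith) _ _).trans (le_of_eq ?_)
            rw [ENNReal.one_rpow, ← ENNReal.rpow_mul, one_div, inv_mul_cancel₀ hp0, ENNReal.rpow_one]
        _ = I := by
            rw [lintegral_const_mul'' _ ((hbm.const_add _).const_mul _),
              lintegral_const_mul'' _ (hbm.const_add _), lintegral_add_left measurable_const]
            simp [hI]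
    · filter_upwards [hA] with x hx z
      have h1 := norm_fderiv_le_of_quasiconvex hm.geometry.open_Ω hm.geometry.bounded_Ω ⟨x, hx⟩
        (hW.smooth x hx) (hW.quasiconvex x hx) (hW.nonneg x hx) hp ha₁.le (hb₁n x hx)
        (fun ξ => (hgr x hx ξ).2) z
      rw [← hK] at h1
      rw [← ofReal_norm]
      refine (ENNReal.ofReal_le_ofReal h1).trans ?_
      have hbn := hb₁n x hx
      have e1 : ENNReal.ofReal (‖z‖ + 1 + b₁ x ^ (1 / m.p)) = ‖z‖ₑ + (1 + ‖b₁ x‖ₑ ^ (1 / m.p)) := by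
        rw [ENNReal.ofReal_add (by positivity) (by positivity), ENNReal.ofReal_add (norm_nonneg _) zero_le_one,
          ofReal_norm, ENNReal.ofReal_one, ← ENNReal.ofReal_rpow_of_nonneg hbn (by positivity),
          Real.enorm_of_nonneg hbn, add_assoc]
      rw [ENNReal.ofReal_mul hK0, ← ENNReal.ofReal_rpow_of_nonneg (by positivity) hp1, e1, hkc,
        mul_assoc, mul_assoc, ← mul_add, ← mul_add]
      exact mul_le_mul_right (add_rpow_le_two_rpow hp1 _ _) _

end Potentials

section Configurations

variable {m : Data}

/-- The properties of displacements that the energy estimates use; they do not refer to the mesh. -/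
structure Data.IsConfiguration (m : Data) (u : Plane → Plane) : Prop where
  meas : AEStronglyMeasurable u m.μΩ
  diff : ∀ᵐ x ∂m.μΩ, DifferentiableAt ℝ u x
  grad_ne_top : eLpNorm (fderiv ℝ u) (ENNReal.ofReal m.p) m.μΩ ≠ ⊤
  ne_top : eLpNorm u (ENNReal.ofReal m.q) m.μΩ ≠ ⊤
  traceFunction : m.IsTraceFunction (trace m.Ω u)
  trace_ae : trace m.Ω u =ᵐ[m.μΩ] u
  fderiv_trace_ae : fderiv ℝ (trace m.Ω u) =ᵐ[m.μΩ] fderiv ℝ u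

theorem isConfiguration_of_mem_feSpace (hm : m.GeometryOK) {c₁ c₂ ε a : ℝ} {R : Set (Set Plane)}
    (hR : IsRegularTriangulation c₁ c₂ ε m.Ω R) (ha : 0 < a) {u : Plane → Plane}
    (hu : u ∈ m.feSpace R a) : m.IsConfiguration u := by
  obtain ⟨𝒯, A, h𝒯, hA, -⟩ := Data.exists_cover_of_mem_feSpace hm.open_Ω hR ha hu
  refine ⟨h𝒯.aestronglyMeasurable hm.open_Ω hA, ?_, (h𝒯.eLpNorm_ne_top hm hA _).2,
    (h𝒯.eLpNorm_ne_top hm hA _).1, h𝒯.isTraceFunction_trace hm hA hu.2,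
    h𝒯.trace_ae_eq hm.lipschitz_Ω hm.open_Ω hA, h𝒯.fderiv_trace_ae_eq hm.lipschitz_Ω hm.open_Ω hA⟩
  filter_upwards [h𝒯.ae_exists_mem_interior, ae_mem_μΩ hm] with x hx hxΩ
  obtain ⟨t, ht, hxt⟩ := hx hxΩ
  exact (IsConvexCover.hasFDerivAt_of_mem_interior hA ht hxt).differentiableAt

theorem trace_add_of_mem_feSpace (hm : m.GeometryOK) {c₁ c₂ ε a : ℝ} {R : Set (Set Plane)}
    (hR : IsRegularTriangulation c₁ c₂ ε m.Ω R) (ha : 0 < a) {u h : Plane → Plane}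
    (hu : u ∈ m.feSpace R a) (hh : IsContinuousAffine m.Ω R h) {x : Plane} (hx : x ∈ m.bdS) :
    trace m.Ω (u + h) x = trace m.Ω u x + h x := by
  obtain ⟨𝒯, A, h𝒯, hA, -⟩ := Data.exists_cover_of_mem_feSpace hm.open_Ω hR ha hu
  obtain ⟨𝒯', A', h𝒯', hA', -⟩ :=
    Data.exists_cover_of_mem_feSpace hm.open_Ω hR ha (Data.add_mem_feSpace ha hu hh)
  have hxc : x ∈ closure m.Ω := frontier_subset_closure (hm.bdN_sub (hm.bdS_sub hx))
  have h1 : HasApproxLimWithin m.Ω u x (trace m.Ω u x) :=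
    Classical.epsilon_spec (h𝒯.exists_approxLim_of_mem_bdS hm hA hu.2 hx)
  exact h𝒯'.trace_eq_of_hasApproxLimWithin hm.lipschitz_Ω hA' hxc
    (h1.add_continuous ((hh.1 x hxc).mono subset_closure))

theorem Data.IsTraceFunction.aestronglyMeasurable_boundary (hm : m.GeometryOK) {v : Plane → Plane}
    (hv : m.IsTraceFunction v) : AEStronglyMeasurable v m.μS :=
  (hv.cont.mono subset_union_right).aestronglyMeasurable hm.closed_bdS.measurableSet

theorem exists_configuration_trace_bound (hm : m.GeometryOK) (he : m.ExponentsOK) :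
    ∃ C : ℝ≥0, ∀ u, m.IsConfiguration u → eLpNorm (trace m.Ω u) (ENNReal.ofReal m.r) m.μS ≤
      C * (eLpNorm (fderiv ℝ u) (ENNReal.ofReal m.p) m.μΩ + eLpNorm u (ENNReal.ofReal m.q) m.μΩ) := by
  obtain ⟨C, hC⟩ := exists_trace_bound hm he.one_lt_q.le
    (he.one_lt_p.le.trans he.p_le_r) he.trace_exponent_le
  refine ⟨C, fun u hu => ?_⟩
  have := hC _ hu.traceFunction
  rwa [eLpNorm_congr_ae hu.trace_ae, eLpNorm_congr_ae hu.fderiv_trace_ae] at this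

end Configurations

section Growth

variable {μ : Measure Plane} {E : Type*} [NormedAddCommGroup E]

theorem integral_rpow_norm_eq {ρ : ℝ} (hρ : 1 < ρ) {f : Plane → E} (hf : AEStronglyMeasurable f μ)
    (hfin : eLpNorm f (ENNReal.ofReal ρ) μ ≠ ⊤) : Integrable (fun x => ‖f x‖ ^ ρ) μ ∧
      ∫ x, ‖f x‖ ^ ρ ∂μ = (eLpNorm f (ENNReal.ofReal ρ) μ).toReal ^ ρ := by
  have hρ0 : 0 < ρ := by linarith
  have hmem : MemLp f (ENNReal.ofReal ρ) μ := ⟨hf, lt_top_iff_ne_top.2 hfin⟩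
  have h1 := hmem.integrable_norm_rpow (by simpa using hρ0) ENNReal.ofReal_ne_top
  rw [ENNReal.toReal_ofReal hρ0.le] at h1
  refine ⟨h1, ?_⟩
  rw [integral_eq_lintegral_of_nonneg_ae (by filter_upwards with x; positivity) h1.1,
    ENNReal.toReal_rpow, ← lintegral_rpow_enorm_eq hρ0]
  congr 1
  refine lintegral_congr fun x => ?_
  rw [← ENNReal.ofReal_rpow_of_nonneg (norm_nonneg _) hρ0.le, ofReal_norm]

theorem integral_le_of_growth {ρ : ℝ} (hρ : 1 < ρ) {A : Set Plane} (hA : ∀ᵐ x ∂μ, x ∈ A) {a : ℝ}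
    {b f : Plane → ℝ} {z : Plane → E} (hf : Integrable f μ) (hb : Integrable b μ)
    (hz : AEStronglyMeasurable z μ) (hfin : eLpNorm z (ENNReal.ofReal ρ) μ ≠ ⊤)
    (h : ∀ x ∈ A, f x ≤ a * ‖z x‖ ^ ρ + b x) :
    ∫ x, f x ∂μ ≤ a * (eLpNorm z (ENNReal.ofReal ρ) μ).toReal ^ ρ + ∫ x, b x ∂μ := by
  obtain ⟨h1, h2⟩ := integral_rpow_norm_eq hρ hz hfin
  rw [← h2, ← integral_const_mul, ← integral_add (h1.const_mul a) hb]
  refine integral_mono_ae hf ((h1.const_mul a).add hb) ?_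
  filter_upwards [hA] with x hx using h x hx

theorem le_integral_of_growth {ρ : ℝ} (hρ : 1 < ρ) {A : Set Plane} (hA : ∀ᵐ x ∂μ, x ∈ A) {a : ℝ}
    {b f : Plane → ℝ} {z : Plane → E} (hf : Integrable f μ) (hb : Integrable b μ)
    (hz : AEStronglyMeasurable z μ) (hfin : eLpNorm z (ENNReal.ofReal ρ) μ ≠ ⊤)
    (h : ∀ x ∈ A, a * ‖z x‖ ^ ρ - b x ≤ f x) :
    a * (eLpNorm z (ENNReal.ofReal ρ) μ).toReal ^ ρ - ∫ x, b x ∂μ ≤ ∫ x, f x ∂μ := by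
  have h1 := integral_le_of_growth (a := -a) hρ hA hf.neg hb hz hfin
    fun x hx => by have := h x hx; simp only [Pi.neg_apply]; linarith
  simp only [Pi.neg_apply, integral_neg] at h1
  linarith

theorem abs_integral_le_toReal {b : Plane → ℝ} {B : ℝ≥0} (hB : eLpNorm b 1 μ ≤ B) :
    |∫ x, b x ∂μ| ≤ B := by
  rw [← Real.norm_eq_abs, ← toReal_enorm]
  refine ENNReal.toReal_le_coe_of_le_coe ((enorm_integral_le_lintegral_enorm _).trans ?_)
  rwa [← eLpNorm_one_eq_lintegral_enorm]

/-- Superlinear growth absorbs linear terms. -/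
theorem exists_sub_le_of_superlinear {a L p : ℝ} (ha : 0 < a) (hL : 0 ≤ L) (hp : 1 < p) :
    ∃ D : ℝ, ∀ X : ℝ, 0 ≤ X → X - D ≤ a * X ^ p - L * X := by
  set X₀ := ((L + 1) / a) ^ (1 / (p - 1)) with hX₀
  have hX₀0 : 0 ≤ X₀ := by positivity
  refine ⟨(L + 1) * X₀, fun X hX => ?_⟩
  rcases le_total X X₀ with h | h
  · have h1 : 0 ≤ a * X ^ p := by positivity
    nlinarith
  · have h1 : (L + 1) / a ≤ X ^ (p - 1) := by
      calc (L + 1) / a = X₀ ^ (p - 1) := by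
            rw [hX₀, ← Real.rpow_mul (by positivity), one_div, inv_mul_cancel₀ (by linarith), Real.rpow_one]
        _ ≤ _ := Real.rpow_le_rpow hX₀0 h (by linarith)
    rw [div_le_iff₀ ha] at h1
    have h2 : X ^ p = X ^ (p - 1) * X := by
      rcases hX.eq_or_lt with rfl | hX'
      · rw [mul_zero, Real.zero_rpow (by linarith)]
      · rw [← Real.rpow_add_one hX'.ne']; congr 1; ring
    rw [h2]
    nlinarith [mul_le_mul_of_nonneg_right h1 hX, mul_nonneg (by linarith : 0 ≤ L + 1) hX₀0]

theorem integral_le_toReal_lintegral {f : Plane → ℝ} (hf : Integrable f μ) :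
    ∫ x, f x ∂μ ≤ (∫⁻ x, ENNReal.ofReal (f x) ∂μ).toReal := by
  rw [integral_eq_lintegral_pos_part_sub_lintegral_neg_part hf]
  exact sub_le_self _ ENNReal.toReal_nonneg

end Growth

section APriori

variable {m : Data}

/-- The work of the surface forces is controlled linearly, at all times. -/
theorem exists_surfaceWork_le (hm : m.Admissible) [IsFiniteMeasure m.μS] :
    ∃ A B : ℝ, 0 ≤ A ∧ ∀ t ∈ Icc 0 m.T, ∀ z : Plane → Plane, AEStronglyMeasurable z m.μS →
      eLpNorm z (ENNReal.ofReal m.r) m.μS ≠ ⊤ →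
      ∫ x, m.G t x (z x) ∂m.μS ≤ A * (eLpNorm z (ENNReal.ofReal m.r) m.μS).toReal + B := by
  have hG := hm.isPotential_surface
  have hmem := ae_mem_μS hm.geometry
  have hr := hG.one_lt
  obtain ⟨a₀, a₁, b₀, b₁, -, -, -, -, ⟨ha₀m, A, hA⟩, hb₀, -, hgr⟩ := hm.surfaceForces.growth
  obtain ⟨B, hB⟩ := hb₀.exists_bound le_rfl
  refine ⟨A, B, A.2, fun t ht z hz hzf => ?_⟩
  set Z := eLpNorm z (ENNReal.ofReal m.r) m.μS with hZ
  have hae : ∀ᵐ τ ∂timeMeasure m.T, ∫ x, m.G τ x (z x) ∂m.μS ≤ A * Z.toReal + B := by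
    filter_upwards [hA, ae_timeMeasure_mem m.T, ha₀m.prodMk_left] with τ hτA hτ hτm
    refine (integral_le_toReal_lintegral (hG.integrable_at hτ hz hzf)).trans ?_
    have hle : ∫⁻ x, ENNReal.ofReal (m.G τ x (z x)) ∂m.μS ≤ A * Z + B := by
      calc _ ≤ ∫⁻ x, (‖a₀ τ x‖ₑ * ‖z x‖ₑ + ‖b₀ τ x‖ₑ) ∂m.μS := by
            refine lintegral_mono_ae ?_
            filter_upwards [hmem] with x hx
            have h1 := (hgr τ hτ x hx (z x)).1
            have h2 := ofReal_growth_le (a := a₀ τ x) (b := b₀ τ x) (x := m.G τ x (z x)) (s := 1) (z := z x)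
              zero_le_one (by rw [Real.rpow_one]; linarith)
            rwa [ENNReal.rpow_one] at h2
        _ = (∫⁻ x, ‖a₀ τ x‖ₑ * ‖z x‖ₑ ∂m.μS) + ∫⁻ x, ‖b₀ τ x‖ₑ ∂m.μS :=
            lintegral_add_left' (hτm.enorm.mul hz.enorm) _
        _ ≤ A * Z + B := by
            refine add_le_add ?_ ?_
            · have h1 := ENNReal.lintegral_mul_le_Lp_mul_Lq m.μS
                (Real.HolderConjugate.conjExponent hr).symm hτm.enorm hz.enorm
              refine h1.trans (mul_le_mul' ?_ ?_)
              · have hc : 0 < Real.conjExponent m.r := (Real.HolderConjugate.conjExponent hr).symm.pos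
                rw [conjExponent_ofReal hr] at hτA
                exact (eLpNorm_ofReal_eq hc (a₀ τ)).symm.le.trans hτA
              · rw [hZ, eLpNorm_ofReal_eq (by linarith)]
            · rw [← eLpNorm_one_eq_lintegral_enorm]
              exact hB τ hτ
    have hfin : (A : ℝ≥0∞) * Z ≠ ⊤ := ENNReal.mul_ne_top ENNReal.coe_ne_top hzf
    refine (ENNReal.toReal_mono (ENNReal.add_ne_top.2 ⟨hfin, ENNReal.coe_ne_top⟩) hle).trans (le_of_eq ?_)
    rw [ENNReal.toReal_add hfin ENNReal.coe_ne_top, ENNReal.toReal_mul, ENNReal.coe_toReal, ENNReal.coe_toReal]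
  have hT := hm.exponents.T_pos
  have hcont : ContinuousOn (fun τ => ∫ x, m.G τ x (z x) ∂m.μS) (Icc 0 m.T) := by
    have h0 : (0 : ℝ) ∈ Icc 0 m.T := ⟨le_rfl, hT.le⟩
    have hinter : IntegrableOn (fun τ => ∫ x, m.Gdot τ x (z x) ∂m.μS) (uIcc 0 m.T) := by
      rw [uIcc_of_le hT.le]; exact hG.integrable_work_dot hz hzf
    have h1 := intervalIntegral.continuousOn_primitive_interval hinter
    rw [uIcc_of_le hT.le] at h1
    refine ((continuousOn_const (c := ∫ x, m.G 0 x (z x) ∂m.μS)).add h1).congr fun τ hτ => ?_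
    exact sub_eq_iff_eq_add'.1 (hG.integral_sub_eq h0 hτ hτ.1 hz hzf)
  have heq := Measure.eqOn_Icc_of_ae_eq (μ := volume) hT.ne
    (f := fun τ => ∫ x, m.G τ x (z x) ∂m.μS)
    (g := fun τ => min (∫ x, m.G τ x (z x) ∂m.μS) (A * Z.toReal + B))
    (by filter_upwards [hae] with τ hτ using (min_eq_left hτ).symm) hcont
    (hcont.inf continuousOn_const) ht
  exact min_eq_left_iff.1 heq.symm

/-- Displacements whose energy does not exceed that of a bounded competitor are bounded. -/
theorem exists_apriori_bound (hm : m.Admissible) [IsFiniteMeasure m.μS] (K : ℝ≥0) :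
    ∃ C : ℝ≥0, ∀ t ∈ Icc 0 m.T, ∀ u h, m.IsConfiguration u → m.IsConfiguration h →
      m.sobolevNorm h (fderiv ℝ h) ≤ K → m.elasticEnergy t u ≤ m.elasticEnergy t h →
      eLpNorm (fderiv ℝ u) (ENNReal.ofReal m.p) m.μΩ ≤ C ∧ eLpNorm u (ENNReal.ofReal m.q) m.μΩ ≤ C ∧
        eLpNorm (trace m.Ω u) (ENNReal.ofReal m.r) m.μS ≤ C := by
  have hfin := Data.isFiniteMeasure_μΩ hm.geometry
  have hW := hm.isPotential_bulk
  have hF := hm.isPotential_body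
  have hG := hm.isPotential_surface
  have he := hm.exponents
  have hp := he.one_lt_p
  have hq := he.one_lt_q
  have hr := hG.one_lt
  have hΩ := ae_mem_μΩ hm.geometry
  have hS := ae_mem_μS hm.geometry
  have h0T : (0 : ℝ) ∈ Icc 0 m.T := ⟨le_rfl, he.T_pos.le⟩
  obtain ⟨aW, aW', bW, bW', haW, haW', hbW, hbW', -, -, hgrW⟩ := hm.bulkDensity.growth
  obtain ⟨aF, aF', bF, bF', haF, haF', -, -, hbF, hbF', hgrF⟩ := hm.bodyForces.growth
  obtain ⟨aG, aG', bG, bG', haG', -, -, -, -, -, hbG', hgrG⟩ := hm.surfaceForces.growth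
  obtain ⟨BF, hBF⟩ := hbF.exists_bound le_rfl
  obtain ⟨BF', hBF'⟩ := hbF'.exists_bound le_rfl
  obtain ⟨BG', hBG'⟩ := hbG'.exists_bound le_rfl
  obtain ⟨A, B, hA0, hAB⟩ := exists_surfaceWork_le hm
  obtain ⟨Ct, hCt⟩ := exists_configuration_trace_bound hm.geometry he
  obtain ⟨D₁, hD₁⟩ := exists_sub_le_of_superlinear (L := A * Ct) haW (by positivity) hp
  obtain ⟨D₂, hD₂⟩ := exists_sub_le_of_superlinear (L := A * Ct) haF (by positivity) hq
  set IW : ℝ := ∫ x, bW x ∂m.μΩ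
  set IW' : ℝ := ∫ x, bW' x ∂m.μΩ
  set U : ℝ := aW' * (K : ℝ) ^ m.p + IW' + (aF' * (K : ℝ) ^ m.q + BF') +
    (aG' * (Ct * (K + K) : ℝ) ^ m.r + BG')
  set V : ℝ := U + IW + BF + B + D₁ + D₂
  refine ⟨(1 + Ct) * V.toNNReal, fun t ht u h hu hh hhK hE => ?_⟩
  have hCtT : ∀ v, m.IsConfiguration v →
      eLpNorm (trace m.Ω v) (ENNReal.ofReal m.r) m.μS ≠ ⊤ := fun v hv =>
    ne_top_of_le_ne_top (ENNReal.mul_ne_top ENNReal.coe_ne_top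
      (ENNReal.add_ne_top.2 ⟨hv.grad_ne_top, hv.ne_top⟩)) (hCt v hv)
  set X := (eLpNorm (fderiv ℝ u) (ENNReal.ofReal m.p) m.μΩ).toReal with hX
  set Y := (eLpNorm u (ENNReal.ofReal m.q) m.μΩ).toReal with hY
  have hX0 : 0 ≤ X := ENNReal.toReal_nonneg
  have hY0 : 0 ≤ Y := ENNReal.toReal_nonneg
  have hZ : (eLpNorm (trace m.Ω u) (ENNReal.ofReal m.r) m.μS).toReal ≤ Ct * (X + Y) := by
    have := ENNReal.toReal_mono (ENNReal.mul_ne_top ENNReal.coe_ne_top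
      (ENNReal.add_ne_top.2 ⟨hu.grad_ne_top, hu.ne_top⟩)) (hCt u hu)
    rwa [ENNReal.toReal_mul, ENNReal.toReal_add hu.grad_ne_top hu.ne_top, ENNReal.coe_toReal] at this
  have hmu := hu.traceFunction.aestronglyMeasurable_boundary hm.geometry
  have hmh := hh.traceFunction.aestronglyMeasurable_boundary hm.geometry
  have hK1 : eLpNorm (fderiv ℝ h) (ENNReal.ofReal m.p) m.μΩ ≤ K :=
    Data.eLpNorm_grad_le_sobolevNorm.trans hhK
  have hK2 : eLpNorm h (ENNReal.ofReal m.q) m.μΩ ≤ K := Data.eLpNorm_q_le_sobolevNorm.trans hhK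
  have hK3 : (eLpNorm (trace m.Ω h) (ENNReal.ofReal m.r) m.μS).toReal ≤ Ct * (K + K) := by
    have := (hCt h hh).trans (mul_le_mul_right (add_le_add hK1 hK2) _)
    rw [show (Ct : ℝ≥0∞) * (K + K) = ((Ct * (K + K) : ℝ≥0) : ℝ≥0∞) by push_cast; rfl] at this
    exact_mod_cast ENNReal.toReal_le_coe_of_le_coe this
  have lW : aW * X ^ m.p - IW ≤ m.bulkEnergy u :=
    le_integral_of_growth hp hΩ (hW.integrable_at h0T (aestronglyMeasurable_fderiv_plane u _) hu.grad_ne_top)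
      hbW (aestronglyMeasurable_fderiv_plane u _) hu.grad_ne_top fun x hx => (hgrW x hx _).1
  have uW : m.bulkEnergy h ≤ aW' * (K : ℝ) ^ m.p + IW' := by
    refine (integral_le_of_growth hp hΩ
      (hW.integrable_at h0T (aestronglyMeasurable_fderiv_plane h _) hh.grad_ne_top)
      hbW' (aestronglyMeasurable_fderiv_plane h _) hh.grad_ne_top fun x hx => (hgrW x hx _).2).trans ?_
    gcongr
    exact ENNReal.toReal_le_coe_of_le_coe hK1
  have iF : ∀ v, m.IsConfiguration v → Integrable (fun x => - m.F t x (v x)) m.μΩ := fun v hv =>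
    (hF.integrable_at ht hv.meas hv.ne_top).neg
  have iG : ∀ v, m.IsConfiguration v → Integrable (fun x => - m.G t x (trace m.Ω v x)) m.μS := fun v hv =>
    (hG.integrable_at ht (hv.traceFunction.aestronglyMeasurable_boundary hm.geometry) (hCtT v hv)).neg
  have eF : ∀ v, ∫ x, - m.F t x (v x) ∂m.μΩ = - m.bodyWork t v := fun v => integral_neg _
  have eG : ∀ v, ∫ x, - m.G t x (trace m.Ω v x) ∂m.μS = - m.surfaceWork t v := fun v => integral_neg _
  have lF : aF * Y ^ m.q - BF ≤ - m.bodyWork t u := by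
    have h1 := le_integral_of_growth hq hΩ (iF u hu) (memLp_one_iff_integrable.1 (hbF t ht).1) hu.meas
      hu.ne_top fun x hx => (hgrF t ht x hx _).1
    rw [eF] at h1
    have h2 := (abs_le.1 (abs_integral_le_toReal (hBF t ht))).2
    linarith
  have uF : - m.bodyWork t h ≤ aF' * (K : ℝ) ^ m.q + BF' := by
    have h1 := integral_le_of_growth hq hΩ (iF h hh) (memLp_one_iff_integrable.1 (hbF' t ht).1) hh.meas
      hh.ne_top fun x hx => (hgrF t ht x hx _).2
    rw [eF] at h1
    refine h1.trans (add_le_add ?_ (abs_le.1 (abs_integral_le_toReal (hBF' t ht))).2)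
    gcongr
    exact ENNReal.toReal_le_coe_of_le_coe hK2
  have lG : m.surfaceWork t u ≤ A * (Ct * (X + Y)) + B :=
    (hAB t ht _ hmu (hCtT u hu)).trans (by gcongr)
  have uG : - m.surfaceWork t h ≤ aG' * (Ct * (K + K) : ℝ) ^ m.r + BG' := by
    have h1 := integral_le_of_growth hr hS (iG h hh) (memLp_one_iff_integrable.1 (hbG' t ht).1) hmh
      (hCtT h hh) fun x hx => (hgrG t ht x hx _).2
    rw [eG] at h1
    refine h1.trans (add_le_add ?_ (abs_le.1 (abs_integral_le_toReal (hBG' t ht))).2)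
    gcongr
  have hXY : X + Y ≤ V := by
    have h1 := hD₁ X hX0
    have h2 := hD₂ Y hY0
    simp only [Data.elasticEnergy] at hE
    linarith
  have hle : ∀ z : ℝ≥0∞, z ≠ ⊤ → z.toReal ≤ (1 + Ct) * V →
      z ≤ (((1 + Ct) * V.toNNReal : ℝ≥0) : ℝ≥0∞) := by
    intro z hz hzV
    rw [← ENNReal.ofReal_toReal hz, ENNReal.ofReal_le_coe]
    push_cast
    rwa [Real.coe_toNNReal V (by linarith)]
  have hV0 : 0 ≤ V := by linarith
  have hCt0 : (0 : ℝ) ≤ Ct := Ct.2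
  have hCtV := mul_nonneg hCt0 hV0
  refine ⟨hle _ hu.grad_ne_top (by linarith), hle _ hu.ne_top (by linarith), hle _ (hCtT u hu) ?_⟩
  have := mul_le_mul_of_nonneg_left hXY hCt0
  linarith

end APriori

variable {m : Data} {g gdot g' gdot' : ℝ → Plane → Plane}

/-- The work of the boundary datum and of the forces along the path `U` between two times. -/
noncomputable def Data.work (m : Data) (U gdot : ℝ → Plane → Plane) (t t' : ℝ) : ℝ :=
  (∫ τ in t..t', m.bulkPairing (U τ) (gdot τ)) - (∫ τ in t..t', m.bodyWorkDot τ (U τ))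
    - (∫ τ in t..t', m.bodyPairing τ (U τ) (gdot τ)) - (∫ τ in t..t', m.surfaceWorkDot τ (U τ))
    - ∫ τ in t..t', m.surfacePairing τ (U τ) (gdot τ)

theorem ae_restrict_Ioc_of_timeMeasure {T t t' : ℝ} (ht : t ∈ Icc 0 T) (ht' : t' ∈ Icc 0 T)
    {P : ℝ → Prop} (h : ∀ᵐ τ ∂timeMeasure T, P τ) : ∀ᵐ τ ∂volume.restrict (Ioc t t'), P τ :=
  ae_mono (Measure.restrict_mono (show Ioc t t' ⊆ Icc 0 T from
    fun _ hs => ⟨ht.1.trans hs.1.le, hs.2.trans ht'.2⟩) le_rfl) h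

theorem Data.IsRegularPath.ae_boundary_bound (hm : m.GeometryOK) {b : ℝ → ℝ≥0∞}
    (hb : ∀ᵐ t ∂timeMeasure m.T, ∀ x ∈ closure m.Ω, ‖gdot t x‖ₑ ≤ b t) :
    ∀ᵐ t ∂timeMeasure m.T, ∀ᵐ x ∂m.μS, ‖gdot t x‖ₑ ≤ b t := by
  filter_upwards [hb] with t ht
  filter_upwards [ae_mem_closure_μS hm] with x hx using ht x hx

theorem Data.IsRegularPath.lintegral_boundary_ne_top (hm : m.GeometryOK) [IsFiniteMeasure m.μS]
    (h : m.IsRegularPath g gdot) {ρ : ℝ} :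
    ∫⁻ t, eLpNorm (gdot t) (ENNReal.ofReal ρ) m.μS ∂timeMeasure m.T ≠ ⊤ := by
  obtain ⟨b, hb, hb1, -, -⟩ := h.bound
  set k := m.μS univ ^ (ENNReal.ofReal ρ).toReal⁻¹
  have hk : k ≠ ⊤ := ENNReal.rpow_ne_top_of_nonneg (by positivity) (measure_ne_top _ _)
  refine ne_top_of_le_ne_top (b := k * ∫⁻ t, b t ∂timeMeasure m.T) (ENNReal.mul_ne_top hk hb) ?_
  rw [← lintegral_const_mul' _ _ hk]
  refine lintegral_mono_ae ?_
  filter_upwards [Data.IsRegularPath.ae_boundary_bound hm hb1] with t ht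
  rw [mul_comm]
  exact eLpNorm_le_of_ae_enorm_bound ht

theorem Data.IsRegularPath.surfacePairing_ae_eq (hm : m.GeometryOK) (h : m.IsRegularPath g gdot)
    (u : Plane → Plane) : ∀ᵐ τ ∂timeMeasure m.T, m.surfacePairing τ u (gdot τ) =
      ∫ x, fderiv ℝ (m.G τ x) (trace m.Ω u x) (gdot τ x) ∂m.μS := by
  filter_upwards [h.trace_dot] with τ hτ
  refine integral_congr_ae ?_
  filter_upwards [ae_mem_closure_μS hm] with x hx
  rw [hτ x hx]

/-- Along one time step with fixed displacement, up to the increment of the boundary datum, the change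
of the elastic energy is the work, up to a small error. -/
theorem exists_elastic_step_bound (hm : m.Admissible) [IsFiniteMeasure m.μS] (C : ℝ≥0) :
    ∃ κ : ℝ≥0, ∀ η : ℝ≥0∞, η ≠ 0 → ∃ σ : ℝ, 0 < σ ∧ ∀ t ∈ Icc 0 m.T, ∀ t' ∈ Icc 0 m.T,
      t ≤ t' → t' - t ≤ σ → ∀ (u : Plane → Plane) (g gdot g' gdot' : ℝ → Plane → Plane) (b : ℝ → ℝ≥0∞),
      m.IsConfiguration u → eLpNorm (fderiv ℝ u) (ENNReal.ofReal m.p) m.μΩ ≤ C →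
      eLpNorm u (ENNReal.ofReal m.q) m.μΩ ≤ C → eLpNorm (trace m.Ω u) (ENNReal.ofReal m.r) m.μS ≤ C →
      m.IsRegularPath g gdot → m.IsRegularPath g' gdot' →
      m.sobolevNorm (g t' - g t) (fderiv ℝ (g t') - fderiv ℝ (g t)) ≤ ENNReal.ofReal σ →
      (∀ x ∈ m.bdS, trace m.Ω (u + (g t' - g t)) x = trace m.Ω u x + (g t' - g t) x) →
      (∀ᵐ τ ∂timeMeasure m.T, ∀ x ∈ closure m.Ω, ‖gdot' τ x‖ₑ ≤ b τ) →
      (∀ᵐ τ ∂timeMeasure m.T, ∀ᵐ x ∂m.μΩ, ‖fderiv ℝ (gdot' τ) x‖ₑ ≤ b τ) →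
      ‖m.elasticEnergy t' (u + (g t' - g t)) - m.elasticEnergy t u
          - m.work (fun _ => u) gdot t t'‖ₑ ≤
        ∫⁻ τ in Ioc t t', (κ * m.sobolevNorm (gdot τ - gdot' τ) (pathGrad gdot τ - pathGrad gdot' τ)
          + 3 * η * b τ) := by
  have hfin := Data.isFiniteMeasure_μΩ hm.geometry
  have hge := hm.geometry
  obtain ⟨Ct, hCt⟩ := exists_trace_sub_bound hge hm.exponents
  obtain ⟨κW, hκW⟩ := hm.isPotential_bulk.exists_step_bound C
  obtain ⟨κF, hκF⟩ := hm.isPotential_body.exists_step_bound C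
  obtain ⟨κG, hκG⟩ := hm.isPotential_surface.exists_step_bound C
  refine ⟨κW + κF + κG * Ct, fun η hη => ?_⟩
  obtain ⟨σW, hσW, hW⟩ := hκW η hη
  obtain ⟨σF, hσF, hF⟩ := hκF η hη
  obtain ⟨σG, hσG, hG⟩ := hκG η hη
  have hCt0 : (0 : ℝ) ≤ Ct := Ct.2
  refine ⟨min (min σW σF) (σG / (1 + Ct)), lt_min (lt_min hσW hσF) (by positivity),
    fun t ht t' ht' htt' hσ u g gdot g' gdot' b hu hu1 hu2 hu3 hg hg' hΔ htr hb1 hb2 => ?_⟩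
  set σ := min (min σW σF) (σG / (1 + Ct)) with hσdef
  have h1 : σ ≤ σW := (min_le_left _ _).trans (min_le_left _ _)
  have h2 : σ ≤ σF := (min_le_left _ _).trans (min_le_right _ _)
  have h3 : (1 + Ct) * σ ≤ σG := by
    have : σ ≤ σG / (1 + Ct) := min_le_right _ _
    rw [le_div_iff₀ (by positivity)] at this
    linarith
  have hσ0 : 0 < σ := lt_min (lt_min hσW hσF) (by positivity)
  have h3' : σ ≤ σG := by nlinarith
  have hmt := hg.traceFunction t ht
  have hmt' := hg.traceFunction t' ht'
  have hΔ1 : eLpNorm (fderiv ℝ (g t') - fderiv ℝ (g t)) (ENNReal.ofReal m.p) m.μΩ ≤ ENNReal.ofReal σW :=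
    Data.eLpNorm_grad_le_sobolevNorm.trans (hΔ.trans (ENNReal.ofReal_le_ofReal h1))
  have hΔ2 : eLpNorm (g t' - g t) (ENNReal.ofReal m.q) m.μΩ ≤ ENNReal.ofReal σF :=
    Data.eLpNorm_q_le_sobolevNorm.trans (hΔ.trans (ENNReal.ofReal_le_ofReal h2))
  have hΔ3 : eLpNorm (g t' - g t) (ENNReal.ofReal m.r) m.μS ≤ ENNReal.ofReal σG := by
    refine (hCt _ _ hmt' hmt).trans ((mul_le_mul_right hΔ _).trans ?_)
    rw [← ENNReal.ofReal_coe_nnreal, ← ENNReal.ofReal_mul hCt0]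
    exact ENNReal.ofReal_le_ofReal (by nlinarith)
  have EW := hW t ht t' ht' htt' (hσ.trans h1) (fderiv ℝ u) (fderiv ℝ (g t') - fderiv ℝ (g t))
    (pathGrad gdot) (pathGrad gdot') b (aestronglyMeasurable_fderiv_plane u _) hu1
    ((aestronglyMeasurable_fderiv_plane _ _).sub (aestronglyMeasurable_fderiv_plane _ _)) hΔ1
    hg.meas_grad_dot
    (ne_top_of_le_ne_top hg.integrable (lintegral_mono fun τ => Data.eLpNorm_grad_le_sobolevNorm))
    hg'.meas_grad_dot hb2 (hg.grad_sub_eq t ht t' ht')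
  have EF := hF t ht t' ht' htt' (hσ.trans h2) u (g t' - g t) gdot gdot' b hu.meas hu2
    (hmt'.meas.sub hmt.meas) hΔ2 hg.meas_dot
    (ne_top_of_le_ne_top hg.integrable (lintegral_mono fun τ => Data.eLpNorm_q_le_sobolevNorm))
    hg'.meas_dot
    (by
      filter_upwards [hb1] with τ hτ
      filter_upwards [ae_mem_closure_μΩ hge] with x hx using hτ x hx)
    (by filter_upwards [ae_mem_closure_μΩ hge] with x hx using hg.sub_eq t ht t' ht' x hx)
  have EG := hG t ht t' ht' htt' (hσ.trans h3') (trace m.Ω u) (g t' - g t) gdot gdot' b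
    (hu.traceFunction.aestronglyMeasurable_boundary hge) hu3
    ((hmt'.aestronglyMeasurable_boundary hge).sub (hmt.aestronglyMeasurable_boundary hge)) hΔ3
    hg.meas_dot_boundary (hg.lintegral_boundary_ne_top hge) hg'.meas_dot_boundary
    (Data.IsRegularPath.ae_boundary_bound hge hb1)
    (by filter_upwards [ae_mem_closure_μS hge] with x hx using hg.sub_eq t ht t' ht' x hx)
  have eW : m.bulkEnergy (u + (g t' - g t)) =
      ∫ x, m.W x (fderiv ℝ u x + (fderiv ℝ (g t') - fderiv ℝ (g t)) x) ∂m.μΩ := by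
    obtain ⟨_, hd⟩ := hmt.ae_differentiableAt hge
    obtain ⟨_, hd'⟩ := hmt'.ae_differentiableAt hge
    refine integral_congr_ae ?_
    filter_upwards [hu.diff, hd, hd'] with x h1 h2 h3
    rw [fderiv_add h1 (h3.1.sub h2.1), fderiv_sub h3.1 h2.1]; rfl
  have eG : m.surfaceWork t' (u + (g t' - g t)) =
      ∫ x, m.G t' x (trace m.Ω u x + (g t' - g t) x) ∂m.μS := by
    refine integral_congr_ae ?_
    filter_upwards [ae_mem_μS hge] with x hx
    rw [htr x hx]
  have eGp : ∫ τ in t..t', m.surfacePairing τ u (gdot τ) =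
      ∫ τ in t..t', ∫ x, fderiv ℝ (m.G τ x) (trace m.Ω u x) (gdot τ x) ∂m.μS := by
    rw [intervalIntegral.integral_of_le htt', intervalIntegral.integral_of_le htt']
    exact integral_congr_ae (ae_restrict_Ioc_of_timeMeasure ht ht' (hg.surfacePairing_ae_eq hge u))
  have e0 : ∫ τ in t..t', ∫ _x, (0 : ℝ) ∂m.μΩ = 0 := by simp
  rw [e0] at EW
  set S : ℝ → ℝ≥0∞ := fun τ => m.sobolevNorm (gdot τ - gdot' τ) (pathGrad gdot τ - pathGrad gdot' τ)
  have hS1 : ∀ τ, eLpNorm (pathGrad gdot τ - pathGrad gdot' τ) (ENNReal.ofReal m.p) m.μΩ ≤ S τ :=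
    fun τ => Data.eLpNorm_grad_le_sobolevNorm
  have hS2 : ∀ τ, eLpNorm (gdot τ - gdot' τ) (ENNReal.ofReal m.q) m.μΩ ≤ S τ :=
    fun τ => Data.eLpNorm_q_le_sobolevNorm
  have hS3 : ∀ᵐ τ ∂volume.restrict (Ioc t t'),
      eLpNorm (gdot τ - gdot' τ) (ENNReal.ofReal m.r) m.μS ≤ Ct * S τ := by
    refine ae_restrict_Ioc_of_timeMeasure ht ht' ?_
    filter_upwards [hg.traceFunction_dot, hg'.traceFunction_dot] with τ h1 h2 using hCt _ _ h1 h2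
  have hsplit : m.elasticEnergy t' (u + (g t' - g t)) - m.elasticEnergy t u
      - m.work (fun _ => u) gdot t t' =
      (∫ x, m.W x (fderiv ℝ u x + (fderiv ℝ (g t') - fderiv ℝ (g t)) x) ∂m.μΩ
        - ∫ x, m.W x (fderiv ℝ u x) ∂m.μΩ - 0
        - ∫ τ in t..t', ∫ x, fderiv ℝ (m.W x) (fderiv ℝ u x) (pathGrad gdot τ x) ∂m.μΩ)
      - (∫ x, m.F t' x (u x + (g t' - g t) x) ∂m.μΩ - ∫ x, m.F t x (u x) ∂m.μΩ
          - (∫ τ in t..t', ∫ x, m.Fdot τ x (u x) ∂m.μΩ)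
          - ∫ τ in t..t', ∫ x, fderiv ℝ (m.F τ x) (u x) (gdot τ x) ∂m.μΩ)
      - (∫ x, m.G t' x (trace m.Ω u x + (g t' - g t) x) ∂m.μS - ∫ x, m.G t x (trace m.Ω u x) ∂m.μS
          - (∫ τ in t..t', ∫ x, m.Gdot τ x (trace m.Ω u x) ∂m.μS)
          - ∫ τ in t..t', ∫ x, fderiv ℝ (m.G τ x) (trace m.Ω u x) (gdot τ x) ∂m.μS) := by
    have r1 : m.bulkEnergy u = ∫ x, m.W x (fderiv ℝ u x) ∂m.μΩ := rfl
    have r2 : ∫ τ in t..t', m.bulkPairing u (gdot τ) =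
      ∫ τ in t..t', ∫ x, fderiv ℝ (m.W x) (fderiv ℝ u x) (pathGrad gdot τ x) ∂m.μΩ := rfl
    have r3 : m.bodyWork t' (u + (g t' - g t)) = ∫ x, m.F t' x (u x + (g t' - g t) x) ∂m.μΩ := rfl
    have r4 : m.bodyWork t u = ∫ x, m.F t x (u x) ∂m.μΩ := rfl
    have r5 : ∫ τ in t..t', m.bodyWorkDot τ u = ∫ τ in t..t', ∫ x, m.Fdot τ x (u x) ∂m.μΩ := rfl
    have r6 : ∫ τ in t..t', m.bodyPairing τ u (gdot τ) =
      ∫ τ in t..t', ∫ x, fderiv ℝ (m.F τ x) (u x) (gdot τ x) ∂m.μΩ := rfl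
    have r7 : m.surfaceWork t u = ∫ x, m.G t x (trace m.Ω u x) ∂m.μS := rfl
    have r8 : ∫ τ in t..t', m.surfaceWorkDot τ u =
      ∫ τ in t..t', ∫ x, m.Gdot τ x (trace m.Ω u x) ∂m.μS := rfl
    simp only [Data.elasticEnergy, Data.work]
    rw [eW, eG, eGp, r1, r2, r3, r4, r5, r6, r7, r8]
    ring
  rw [hsplit]
  refine (enorm_sub_le.trans (add_le_add_left enorm_sub_le _)).trans ?_
  refine (add_le_add (add_le_add EW EF) EG).trans ?_
  refine ((add_le_add_left (le_lintegral_add _ _) _).trans (le_lintegral_add _ _)).trans ?_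
  refine lintegral_mono_ae ?_
  filter_upwards [hS3] with τ hτ
  push_cast
  calc _ ≤ (κW * S τ + η * b τ) + (κF * S τ + η * b τ) + (κG * (Ct * S τ) + η * b τ) := by
        gcongr
        · exact hS1 τ
        · exact hS2 τ
    _ = _ := by ring

section Interpolation

variable {m : Data} {δ : ℝ} {w : ℕ → Plane → Plane} {P : ℝ → (Plane → Plane) → ℝ}

theorem integral_interpolation (hT : 0 < m.T) (hδ : 0 < δ) {i : ℕ} (hi : i < m.numSteps δ)
    (hP : Integrable (fun τ => P τ (w i)) (timeMeasure m.T)) :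
    IntervalIntegrable (fun τ => P τ (m.interpolation δ w τ)) volume (m.time δ i) (m.time δ (i + 1)) ∧
      ∫ τ in m.time δ i..m.time δ (i + 1), P τ (m.interpolation δ w τ) =
        ∫ τ in m.time δ i..m.time δ (i + 1), P τ (w i) := by
  have hle := Data.time_le_succ (m := m) hδ i
  have hsub : Ioc (m.time δ i) (m.time δ (i + 1)) ⊆ Icc 0 m.T := fun _ hs =>
    ⟨(Data.time_mem hT hδ i).1.trans hs.1.le, hs.2.trans (Data.time_mem hT hδ _).2⟩
  have hae : (fun τ => P τ (w i)) =ᵐ[volume.restrict (Ioc (m.time δ i) (m.time δ (i + 1)))]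
      fun τ => P τ (m.interpolation δ w τ) := by
    filter_upwards [ae_restrict_mem measurableSet_Ioc,
      ae_restrict_of_ae ((countable_singleton (m.time δ (i + 1))).ae_notMem volume)] with τ h1 h2
    rw [Data.interpolation_eq hδ hi ⟨h1.1.le, lt_of_le_of_ne h1.2 h2⟩]
  constructor
  · rw [intervalIntegrable_iff_integrableOn_Ioc_of_le hle]
    exact (IntegrableOn.mono_set hP hsub).congr hae
  · rw [intervalIntegral.integral_of_le hle, intervalIntegral.integral_of_le hle]
    exact (integral_congr_ae hae).symm

theorem intervalIntegrable_interpolation (hT : 0 < m.T) (hδ : 0 < δ)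
    (hP : ∀ i < m.numSteps δ, Integrable (fun τ => P τ (w i)) (timeMeasure m.T)) {i j : ℕ} (hji : j ≤ i)
    (hi : i ≤ m.numSteps δ) :
    IntervalIntegrable (fun τ => P τ (m.interpolation δ w τ)) volume (m.time δ j) (m.time δ i) := by
  induction i, hji using Nat.le_induction with
  | base => exact IntervalIntegrable.refl
  | succ i hji ih =>
    exact (ih (by omega)).trans (integral_interpolation hT hδ hi (hP i hi)).1

end Interpolation

section Work

variable {m : Data} {g gdot : ℝ → Plane → Plane} {δ : ℝ} {w : ℕ → Plane → Plane}

theorem exists_configuration_trace_ne_top (hm : m.Admissible) {u : Plane → Plane}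
    (hu : m.IsConfiguration u) : eLpNorm (trace m.Ω u) (ENNReal.ofReal m.r) m.μS ≠ ⊤ := by
  obtain ⟨C, hC⟩ := exists_configuration_trace_bound hm.geometry hm.exponents
  exact ne_top_of_le_ne_top (ENNReal.mul_ne_top ENNReal.coe_ne_top
      (ENNReal.add_ne_top.2 ⟨hu.grad_ne_top, hu.ne_top⟩)) (hC u hu)

theorem work_interpolation_succ (hm : m.Admissible) [IsFiniteMeasure m.μS] (hδ : 0 < δ)
    (hg : m.IsRegularPath g gdot) (hw : ∀ i < m.numSteps δ, m.IsConfiguration (w i)) {i j : ℕ}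
    (hji : j ≤ i) (hi : i < m.numSteps δ) :
    m.work (m.interpolation δ w) gdot (m.time δ j) (m.time δ (i + 1)) =
      m.work (m.interpolation δ w) gdot (m.time δ j) (m.time δ i) +
        m.work (fun _ => w i) gdot (m.time δ i) (m.time δ (i + 1)) := by
  have hT := hm.exponents.T_pos
  have hfin := Data.isFiniteMeasure_μΩ hm.geometry
  have key : ∀ P : ℝ → (Plane → Plane) → ℝ,
      (∀ i < m.numSteps δ, Integrable (fun τ => P τ (w i)) (timeMeasure m.T)) →
      ∫ τ in m.time δ j..m.time δ (i + 1), P τ (m.interpolation δ w τ) =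
        (∫ τ in m.time δ j..m.time δ i, P τ (m.interpolation δ w τ)) +
          ∫ τ in m.time δ i..m.time δ (i + 1), P τ (w i) := by
    intro P hP
    obtain ⟨h1, h2⟩ := integral_interpolation hT hδ hi (hP i hi)
    rw [← h2, intervalIntegral.integral_add_adjacent_intervals
      (intervalIntegrable_interpolation hT hδ hP hji hi.le) h1]
  simp only [Data.work]
  rw [key (fun τ v => m.bulkPairing v (gdot τ)) fun i hi =>
      hm.isPotential_bulk.integrable_pairing (aestronglyMeasurable_fderiv_plane _ _)
        (hw i hi).grad_ne_top hg.meas_grad_dot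
        (ne_top_of_le_ne_top hg.integrable (lintegral_mono fun τ => Data.eLpNorm_grad_le_sobolevNorm)),
    key (fun τ v => m.bodyWorkDot τ v) fun i hi =>
      hm.isPotential_body.integrable_work_dot (hw i hi).meas (hw i hi).ne_top,
    key (fun τ v => m.bodyPairing τ v (gdot τ)) fun i hi =>
      hm.isPotential_body.integrable_pairing (hw i hi).meas (hw i hi).ne_top hg.meas_dot
        (ne_top_of_le_ne_top hg.integrable (lintegral_mono fun τ => Data.eLpNorm_q_le_sobolevNorm)),
    key (fun τ v => m.surfaceWorkDot τ v) fun i hi =>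
      hm.isPotential_surface.integrable_work_dot
        ((hw i hi).traceFunction.aestronglyMeasurable_boundary hm.geometry)
        (exists_configuration_trace_ne_top hm (hw i hi)),
    key (fun τ v => m.surfacePairing τ v (gdot τ)) fun i hi =>
      (hm.isPotential_surface.integrable_pairing
        ((hw i hi).traceFunction.aestronglyMeasurable_boundary hm.geometry)
        (exists_configuration_trace_ne_top hm (hw i hi)) hg.meas_dot_boundary
        (hg.lintegral_boundary_ne_top hm.geometry)).congr
        ((hg.surfacePairing_ae_eq hm.geometry (w i)).mono fun _ h => h.symm)]
  ring

end Work

section Defect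

variable {m : Data} {g gdot : ℝ → Plane → Plane} {δ : ℝ} {w : ℕ → Plane → Plane} {Γ₀ : Set Plane}

/-- The energy gained between two steps in excess of the work done. -/
noncomputable def Data.excess (m : Data) (δ : ℝ) (g gdot : ℝ → Plane → Plane) (Γ₀ : Set Plane)
    (w : ℕ → Plane → Plane) (i j : ℕ) : ℝ :=
  m.totalEnergy (m.time δ i) (w i) (m.crack δ g Γ₀ w i)
    - m.totalEnergy (m.time δ j) (w j) (m.crack δ g Γ₀ w j)
    - m.work (m.interpolation δ w) gdot (m.time δ j) (m.time δ i)

/-- The largest excess of a discrete evolution. -/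
noncomputable def Data.maxExcess (m : Data) (δ : ℝ) (g gdot : ℝ → Plane → Plane) (Γ₀ : Set Plane)
    (w : ℕ → Plane → Plane) : ℝ :=
  (Finset.range (m.numSteps δ + 1) ×ˢ Finset.range (m.numSteps δ + 1)).sup'
    ⟨(0, 0), by simp⟩ fun p => if p.2 ≤ p.1 then m.excess δ g gdot Γ₀ w p.1 p.2 else 0

theorem Data.excess_le_maxExcess {i j : ℕ} (hji : j ≤ i) (hi : i ≤ m.numSteps δ) :
    m.excess δ g gdot Γ₀ w i j ≤ m.maxExcess δ g gdot Γ₀ w := by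
  have h := Finset.le_sup' (f := fun p : ℕ × ℕ => if p.2 ≤ p.1 then m.excess δ g gdot Γ₀ w p.1 p.2 else 0)
    (s := Finset.range (m.numSteps δ + 1) ×ˢ Finset.range (m.numSteps δ + 1)) (b := (i, j))
    (by simp only [Finset.mem_product, Finset.mem_range]; omega)
  rwa [if_pos hji] at h

theorem Data.abs_maxExcess_le {B : ℝ}
    (h : ∀ i j, j ≤ i → i ≤ m.numSteps δ → m.excess δ g gdot Γ₀ w i j ≤ B) :
    |m.maxExcess δ g gdot Γ₀ w| ≤ B := by
  have h0 : m.excess δ g gdot Γ₀ w 0 0 = 0 := by simp [Data.excess, Data.work]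
  have hB : 0 ≤ B := h0 ▸ h 0 0 le_rfl (Nat.zero_le _)
  have h1 : 0 ≤ m.maxExcess δ g gdot Γ₀ w := h0 ▸ Data.excess_le_maxExcess le_rfl (Nat.zero_le _)
  rw [abs_of_nonneg h1]
  refine Finset.sup'_le _ _ fun p hp => ?_
  split_ifs with hp'
  · refine h _ _ hp' ?_
    simp only [Finset.mem_product, Finset.mem_range] at hp
    omega
  · exact hB

/-- The excess is bounded if the elastic energy changes along each step as the work predicts. -/
theorem excess_le_of_step {c₁ c₂ ε a : ℝ} {R : Set (Set Plane)} (hm : m.Admissible)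
    [IsFiniteMeasure m.μS] (hδ : 0 < δ) (ha : 0 < a) (hR : IsRegularTriangulation c₁ c₂ ε m.Ω R)
    (hg : ∀ t ∈ Icc 0 m.T, IsContinuousAffine m.Ω R (g t)) (hgr : m.IsRegularPath g gdot)
    (h₀ : m.IsInitialCrack R a Γ₀) (hw : m.IsDiscreteEvolution R a δ g Γ₀ w) {Q : ℝ → ℝ≥0∞}
    (hQ : ∫⁻ τ, Q τ ∂timeMeasure m.T ≠ ⊤)
    (hstep : ∀ i < m.numSteps δ,
      ‖m.elasticEnergy (m.time δ (i + 1)) (w i + (g (m.time δ (i + 1)) - g (m.time δ i)))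
        - m.elasticEnergy (m.time δ i) (w i)
        - m.work (fun _ => w i) gdot (m.time δ i) (m.time δ (i + 1))‖ₑ ≤
        ∫⁻ τ in Ioc (m.time δ i) (m.time δ (i + 1)), Q τ) {i j : ℕ} (hji : j ≤ i)
    (hi : i ≤ m.numSteps δ) :
    m.excess δ g gdot Γ₀ w i j ≤ (∫⁻ τ, Q τ ∂timeMeasure m.T).toReal := by
  have hT := hm.exponents.T_pos
  have hsub : ∀ i j, Ioc (m.time δ j) (m.time δ i) ⊆ Icc 0 m.T := fun i j _ hs =>
    ⟨(Data.time_mem hT hδ j).1.trans hs.1.le, hs.2.trans (Data.time_mem hT hδ i).2⟩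
  have hQt : ∀ i j, ∫⁻ τ in Ioc (m.time δ j) (m.time δ i), Q τ ≠ ⊤ := fun i j =>
    ne_top_of_le_ne_top hQ (lintegral_mono' (Measure.restrict_mono (hsub i j) le_rfl) le_rfl)
  have hmono : Monotone (m.time δ) := monotone_nat_of_le_succ (Data.time_le_succ hδ)
  suffices h : m.excess δ g gdot Γ₀ w i j ≤ (∫⁻ τ in Ioc (m.time δ j) (m.time δ i), Q τ).toReal from
    h.trans (ENNReal.toReal_mono hQ (lintegral_mono' (Measure.restrict_mono (hsub i j) le_rfl) le_rfl))
  induction i, hji using Nat.le_induction with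
  | base => simp [Data.excess, Data.work]
  | succ i hji ih =>
    have h1 := ih (by omega)
    have h2 := Data.totalEnergy_succ_le hm.geometry hm.surfaceDensity hT hR ha hδ hg h₀ hw hi
    have h3 := ENNReal.toReal_mono (hQt (i + 1) i) (hstep i hi)
    rw [toReal_enorm, Real.norm_eq_abs] at h3
    have h4 := (abs_le.1 h3).2
    have h5 := work_interpolation_succ hm hδ hgr (w := w) (fun i hi =>
      isConfiguration_of_mem_feSpace hm.geometry hR ha (hw.mem_feSpace hi.le)) hji hi
    have h6 : (∫⁻ τ in Ioc (m.time δ j) (m.time δ (i + 1)), Q τ).toReal =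
        (∫⁻ τ in Ioc (m.time δ j) (m.time δ i), Q τ).toReal +
          (∫⁻ τ in Ioc (m.time δ i) (m.time δ (i + 1)), Q τ).toReal := by
      rw [← ENNReal.toReal_add (hQt i j) (hQt (i + 1) i),
        ← lintegral_union measurableSet_Ioc (Ioc_disjoint_Ioc_of_le le_rfl),
        Ioc_union_Ioc_eq_Ioc (hmono hji) (hmono (Nat.le_succ i))]
    have h7 : m.totalEnergy (m.time δ i) (w i) (m.crack δ g Γ₀ w i) =
      m.elasticEnergy (m.time δ i) (w i) + (m.surfaceEnergy (m.crack δ g Γ₀ w i)).toReal := rfl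
    rw [h6]
    unfold Data.excess at h1 ⊢
    rw [h5]
    linarith

/-- Evolutions whose boundary data are bounded and do not change too fast have a small excess. -/
theorem exists_excess_bound (hm : m.Admissible) [IsFiniteMeasure m.μS] (K : ℝ≥0) :
    ∃ κ : ℝ≥0, ∀ η : ℝ≥0, η ≠ 0 → ∃ σ : ℝ, 0 < σ ∧ ∀ (c₁ c₂ ε a δ : ℝ) (R : Set (Set Plane))
      (g gdot g' gdot' : ℝ → Plane → Plane) (Γ₀ : Set Plane) (w : ℕ → Plane → Plane) (b : ℝ → ℝ≥0∞),
      0 < δ → δ ≤ σ → 0 < a → IsRegularTriangulation c₁ c₂ ε m.Ω R →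
      (∀ t ∈ Icc 0 m.T, IsContinuousAffine m.Ω R (g t)) → m.IsRegularPath g gdot →
      m.IsInitialCrack R a Γ₀ → m.IsDiscreteEvolution R a δ g Γ₀ w →
      (∀ t ∈ Icc 0 m.T, m.sobolevNorm (g t) (fderiv ℝ (g t)) ≤ K) →
      (∀ t ∈ Icc 0 m.T, ∀ t' ∈ Icc 0 m.T, t ≤ t' → t' - t ≤ δ →
        ∫⁻ τ in Ioc t t', m.sobolevNorm (gdot τ) (fderiv ℝ (gdot τ)) ≤ ENNReal.ofReal σ) →
      m.IsRegularPath g' gdot' → ∫⁻ τ, b τ ∂timeMeasure m.T ≠ ⊤ →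
      (∀ᵐ τ ∂timeMeasure m.T, ∀ x ∈ closure m.Ω, ‖gdot' τ x‖ₑ ≤ b τ) →
      (∀ᵐ τ ∂timeMeasure m.T, ∀ᵐ x ∂m.μΩ, ‖fderiv ℝ (gdot' τ) x‖ₑ ≤ b τ) →
      ∀ θ : ℝ, 0 ≤ θ →
      κ * (∫⁻ τ, m.sobolevNorm (gdot τ - gdot' τ) (pathGrad gdot τ - pathGrad gdot' τ) ∂timeMeasure m.T)
        + 3 * η * ∫⁻ τ, b τ ∂timeMeasure m.T ≤ ENNReal.ofReal θ →
      |m.maxExcess δ g gdot Γ₀ w| ≤ θ := by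
  have hT := hm.exponents.T_pos
  have hfin := Data.isFiniteMeasure_μΩ hm.geometry
  obtain ⟨C, hC⟩ := exists_apriori_bound hm K
  obtain ⟨κ, hκ⟩ := exists_elastic_step_bound hm C
  refine ⟨κ, fun η hη => ?_⟩
  obtain ⟨σ, hσ, hs⟩ := hκ η (by simpa using hη)
  refine ⟨σ, hσ, fun c₁ c₂ ε a δ R g gdot g' gdot' Γ₀ w b hδ hδσ ha hR hg hgr h₀ hw hK hmod hgr' hb hb1 hb2
    θ hθ hle => Data.abs_maxExcess_le fun i j hji hi => ?_⟩
  set Q : ℝ → ℝ≥0∞ := fun τ =>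
    κ * m.sobolevNorm (gdot τ - gdot' τ) (pathGrad gdot τ - pathGrad gdot' τ) + 3 * η * b τ with hQdef
  have hSm : AEMeasurable (fun τ => m.sobolevNorm (gdot τ - gdot' τ) (pathGrad gdot τ - pathGrad gdot' τ))
      (timeMeasure m.T) :=
    hm.exponents.aemeasurable_sobolevNorm (γ := gdot - gdot') (Δ := pathGrad gdot - pathGrad gdot')
      (hgr.meas_dot.sub hgr'.meas_dot) (hgr.meas_grad_dot.sub hgr'.meas_grad_dot)
  have hQ : ∫⁻ τ, Q τ ∂timeMeasure m.T ≤ ENNReal.ofReal θ := by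
    rw [hQdef, lintegral_add_left' (hSm.const_mul _), lintegral_const_mul' _ _ ENNReal.coe_ne_top,
      lintegral_const_mul' _ _ (ENNReal.mul_ne_top (by simp) ENNReal.coe_ne_top)]
    exact hle
  have hQt : ∫⁻ τ, Q τ ∂timeMeasure m.T ≠ ⊤ := ne_top_of_le_ne_top ENNReal.ofReal_ne_top hQ
  refine (excess_le_of_step hm hδ ha hR hg hgr h₀ hw hQt (fun i hi => ?_) hji hi).trans
    (ENNReal.toReal_le_of_le_ofReal hθ hQ)
  have ht := Data.time_mem (m := m) hT hδ i
  have ht' := Data.time_mem (m := m) hT hδ (i + 1)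
  have htt' := Data.time_le_succ (m := m) hδ i
  have hd := Data.time_succ_sub_le (m := m) hδ i
  have hwi := hw.mem_feSpace hi.le
  have hcfg := isConfiguration_of_mem_feSpace hm.geometry hR ha hwi
  have hcfg' := isConfiguration_of_mem_feSpace hm.geometry hR ha
    (Data.mem_feSpace_of_isContinuousAffine ha hwi (hg _ ht))
  obtain ⟨b1, b2, b3⟩ := hC _ ht (w i) (g (m.time δ i)) hcfg hcfg' (hK _ ht)
    (hw.elasticEnergy_le hT ha hδ hg hi.le)
  exact hs _ ht _ ht' htt' (hd.trans hδσ) (w i) g gdot g' gdot' b hcfg b1 b2 b3 hgr hgr'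
    ((hgr.sobolevNorm_sub_le hm.geometry hm.exponents ht ht' htt').trans (hmod _ ht _ ht' htt' hd))
    (fun x hx => trace_add_of_mem_feSpace hm.geometry hR ha hwi ((hg _ ht').sub (hg _ ht)) hx) hb1 hb2

end Defect

section PathDist

variable {m : Data}

/-- Joint measurability of a path, its gradient, and their time derivatives. -/
structure Data.IsMeasurablePath (m : Data) (g gdot : ℝ → Plane → Plane) (D Ddot : ℝ → Plane → Mat) :
    Prop where
  meas : AEStronglyMeasurable (Function.uncurry g) ((timeMeasure m.T).prod m.μΩ)
  meas_grad : AEStronglyMeasurable (Function.uncurry D) ((timeMeasure m.T).prod m.μΩ)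
  meas_dot : AEStronglyMeasurable (Function.uncurry gdot) ((timeMeasure m.T).prod m.μΩ)
  meas_grad_dot : AEStronglyMeasurable (Function.uncurry Ddot) ((timeMeasure m.T).prod m.μΩ)

theorem Data.IsRegularPath.isMeasurablePath {g gdot : ℝ → Plane → Plane} (h : m.IsRegularPath g gdot) :
    m.IsMeasurablePath g gdot (pathGrad g) (pathGrad gdot) :=
  ⟨h.meas, h.meas_grad, h.meas_dot, h.meas_grad_dot⟩

theorem Data.IsSobolevPath.isMeasurablePath {g gdot : ℝ → Plane → Plane} {D Ddot : ℝ → Plane → Mat}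
    (h : m.IsSobolevPath g gdot D Ddot) : m.IsMeasurablePath g gdot D Ddot :=
  ⟨h.meas, h.meas_grad, h.meas_dot, h.meas_grad_dot⟩

theorem isMeasurablePath_zero : m.IsMeasurablePath 0 0 0 0 :=
  ⟨aestronglyMeasurable_const (b := (0 : Plane)), aestronglyMeasurable_const (b := (0 : Mat)),
    aestronglyMeasurable_const (b := (0 : Plane)), aestronglyMeasurable_const (b := (0 : Mat))⟩

theorem lintegral_sobolevNorm_sub_le (he : m.ExponentsOK) [SFinite m.μΩ] {ν : Measure ℝ}
    (hν : ν ≤ timeMeasure m.T) {g h k : ℝ → Plane → Plane} {D E F : ℝ → Plane → Mat}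
    (hg : AEStronglyMeasurable (Function.uncurry g) ((timeMeasure m.T).prod m.μΩ))
    (hD : AEStronglyMeasurable (Function.uncurry D) ((timeMeasure m.T).prod m.μΩ))
    (hh : AEStronglyMeasurable (Function.uncurry h) ((timeMeasure m.T).prod m.μΩ))
    (hE : AEStronglyMeasurable (Function.uncurry E) ((timeMeasure m.T).prod m.μΩ))
    (hk : AEStronglyMeasurable (Function.uncurry k) ((timeMeasure m.T).prod m.μΩ))
    (hF : AEStronglyMeasurable (Function.uncurry F) ((timeMeasure m.T).prod m.μΩ)) :
    ∫⁻ t, m.sobolevNorm (g t - k t) (D t - F t) ∂ν ≤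
      (∫⁻ t, m.sobolevNorm (g t - h t) (D t - E t) ∂ν) +
        ∫⁻ t, m.sobolevNorm (h t - k t) (E t - F t) ∂ν := by
  have h1 : AEMeasurable (fun t => m.sobolevNorm (g t - h t) (D t - E t)) (timeMeasure m.T) :=
    he.aemeasurable_sobolevNorm (γ := g - h) (Δ := D - E) (hg.sub hh) (hD.sub hE)
  rw [← lintegral_add_left' (h1.mono_measure hν)]
  refine lintegral_mono_ae (ae_mono hν ?_)
  filter_upwards [hg.prodMk_left, hh.prodMk_left, hk.prodMk_left, hD.prodMk_left, hE.prodMk_left,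
    hF.prodMk_left] with t a1 a2 a3 a4 a5 a6
  have := he.sobolevNorm_add_le (a1.sub a2) (a2.sub a3) (a4.sub a5) (a5.sub a6)
  rw [sub_add_sub_cancel, sub_add_sub_cancel] at this
  exact this

variable {g gdot h hdot k kdot : ℝ → Plane → Plane} {D Ddot E Edot F Fdot : ℝ → Plane → Mat}

theorem Data.pathDist_comm : m.pathDist g gdot D Ddot h hdot E Edot =
    m.pathDist h hdot E Edot g gdot D Ddot := by
  have key : ∀ (v w : Plane → Plane) (A B : Plane → Mat),
      m.sobolevNorm (v - w) (A - B) = m.sobolevNorm (w - v) (B - A) := fun v w A B => by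
    rw [← Data.sobolevNorm_neg, neg_sub, neg_sub]
  simp only [Data.pathDist]
  congr 1 <;> exact lintegral_congr fun t => key _ _ _ _

theorem Data.IsMeasurablePath.pathDist_triangle (he : m.ExponentsOK) [SFinite m.μΩ]
    (hg : m.IsMeasurablePath g gdot D Ddot) (hh : m.IsMeasurablePath h hdot E Edot)
    (hk : m.IsMeasurablePath k kdot F Fdot) :
    m.pathDist g gdot D Ddot k kdot F Fdot ≤
      m.pathDist g gdot D Ddot h hdot E Edot + m.pathDist h hdot E Edot k kdot F Fdot := by
  refine (add_le_add
    (lintegral_sobolevNorm_sub_le he le_rfl hg.meas hg.meas_grad hh.meas hh.meas_grad hk.meas hk.meas_grad)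
    (lintegral_sobolevNorm_sub_le he le_rfl hg.meas_dot hg.meas_grad_dot hh.meas_dot hh.meas_grad_dot
      hk.meas_dot hk.meas_grad_dot)).trans (le_of_eq ?_)
  simp only [Data.pathDist]
  abel

/-- The norm of a path in `W^{1,1}` in time. -/
noncomputable def Data.pathNorm (m : Data) (g gdot : ℝ → Plane → Plane) : ℝ≥0∞ :=
  m.pathDist g gdot (pathGrad g) (pathGrad gdot) 0 0 0 0

theorem Data.pathNorm_eq : m.pathNorm g gdot =
    (∫⁻ t, m.sobolevNorm (g t) (fderiv ℝ (g t)) ∂timeMeasure m.T) +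
      ∫⁻ t, m.sobolevNorm (gdot t) (fderiv ℝ (gdot t)) ∂timeMeasure m.T := by
  simp only [Data.pathNorm, Data.pathDist, Pi.zero_apply, sub_zero]
  rfl

theorem Data.IsRegularPath.pathNorm_ne_top (hm : m.GeometryOK) (he : m.ExponentsOK)
    (h : m.IsRegularPath g gdot) : m.pathNorm g gdot ≠ ⊤ := by
  have h0 : (0 : ℝ) ∈ Icc 0 m.T := ⟨le_rfl, he.T_pos.le⟩
  rw [Data.pathNorm_eq]
  refine ENNReal.add_ne_top.2 ⟨?_, h.integrable⟩
  refine ne_top_of_le_ne_top (b := ∫⁻ _t, (m.sobolevNorm (g 0) (fderiv ℝ (g 0)) +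
    ∫⁻ τ, m.sobolevNorm (gdot τ) (fderiv ℝ (gdot τ)) ∂timeMeasure m.T) ∂timeMeasure m.T) ?_ ?_
  · rw [lintegral_const]
    exact ENNReal.mul_ne_top (ENNReal.add_ne_top.2 ⟨h.sobolevNorm_ne_top 0 h0, h.integrable⟩)
      (measure_ne_top _ _)
  · refine lintegral_mono_ae ?_
    filter_upwards [ae_timeMeasure_mem m.T] with τ hτ
    have h1 := he.sobolevNorm_add_le (h.aesm_at h0) ((h.aesm_at hτ).sub (h.aesm_at h0))
      (aestronglyMeasurable_fderiv_plane (g 0) m.μΩ)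
      ((aestronglyMeasurable_fderiv_plane (g τ) m.μΩ).sub (aestronglyMeasurable_fderiv_plane (g 0) m.μΩ))
    rw [add_sub_cancel, add_sub_cancel] at h1
    exact h1.trans (add_le_add_right (h.sobolevNorm_sub_le_integral hm he h0 hτ) _)

theorem exists_uniform_bound (hm : m.GeometryOK) (he : m.ExponentsOK) (N : ℝ≥0) :
    ∃ K : ℝ≥0, ∀ g gdot, m.IsRegularPath g gdot → m.pathNorm g gdot ≤ N →
      ∀ t ∈ Icc 0 m.T, m.sobolevNorm (g t) (fderiv ℝ (g t)) ≤ K := by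
  have hT : ENNReal.ofReal m.T ≠ 0 := by simpa using he.T_pos
  set B : ℝ≥0∞ := (N + ENNReal.ofReal m.T * N) / ENNReal.ofReal m.T with hB
  have hBt : B ≠ ⊤ := ENNReal.div_ne_top (ENNReal.add_ne_top.2 ⟨ENNReal.coe_ne_top,
    ENNReal.mul_ne_top ENNReal.ofReal_ne_top ENNReal.coe_ne_top⟩) hT
  refine ⟨B.toNNReal, fun g gdot h hN t ht => ?_⟩
  rw [ENNReal.coe_toNNReal hBt, hB, ENNReal.le_div_iff_mul_le (Or.inl hT) (Or.inl ENNReal.ofReal_ne_top),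
    mul_comm]
  rw [Data.pathNorm_eq] at hN
  refine (h.mul_sobolevNorm_le hm he ht).trans (add_le_add (le_self_add.trans hN) ?_)
  exact mul_le_mul_right (le_add_self.trans hN) _

end PathDist

section Family

/-- A family of discrete evolutions on meshes of different sizes. -/
structure Data.IsFamily (m : Data) (c₁ c₂ : ℝ) (M : Set ℝ) (R : ℝ → Set (Set Plane))
    (g gdot : ℝ → ℝ → Plane → Plane) (Γ₀ : ℝ → ℝ → Set Plane)
    (u : ℝ → ℝ → ℝ → ℕ → Plane → Plane) : Prop where
  pos : 0 < c₁
  sizes : M ⊆ Ioi 0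
  mesh : ∀ ε ∈ M, m.IsMesh c₁ c₂ ε (R ε)
  datum : ∀ ε ∈ M, m.IsBoundaryDatum (R ε) (g ε) (gdot ε)
  crack : ∀ ε ∈ M, ∀ a ∈ Ioo (0 : ℝ) (1 / 2), m.IsInitialCrack (R ε) a (Γ₀ ε a)
  evolution : ∀ δ > 0, ∀ ε ∈ M, ∀ a ∈ Ioo (0 : ℝ) (1 / 2),
    m.IsDiscreteEvolution (R ε) a δ (g ε) (Γ₀ ε a) (u δ ε a)

variable {m : Data} {c₁ c₂ : ℝ} {M : Set ℝ} {R : ℝ → Set (Set Plane)}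
  {g gdot : ℝ → ℝ → Plane → Plane} {Γ₀ : ℝ → ℝ → Set Plane} {u : ℝ → ℝ → ℝ → ℕ → Plane → Plane}

/-- The distance of the boundary data for two mesh sizes. -/
noncomputable def Data.datumDist (m : Data) (g gdot : ℝ → ℝ → Plane → Plane) (ε ε' : ℝ) : ℝ≥0∞ :=
  m.pathDist (g ε) (gdot ε) (pathGrad (g ε)) (pathGrad (gdot ε))
    (g ε') (gdot ε') (pathGrad (g ε')) (pathGrad (gdot ε'))

theorem Data.IsFamily.isRegularPath (hm : m.Admissible) (h : m.IsFamily c₁ c₂ M R g gdot Γ₀ u) {ε : ℝ}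
    (hε : ε ∈ M) : m.IsRegularPath (g ε) (gdot ε) :=
  (h.datum ε hε).isRegularPath hm.geometry hm.exponents (h.mesh ε hε) h.pos (h.sizes hε)

/-- The excess is small if the boundary datum is close enough to a fixed one, and closer to another one
in relation to which the time step is small. -/
theorem Data.IsFamily.exists_maxExcess_le (hm : m.Admissible) [IsFiniteMeasure m.μS]
    (h : m.IsFamily c₁ c₂ M R g gdot Γ₀ u) (N : ℝ≥0) {θ : ℝ} (hθ : 0 < θ) :
    ∃ ρ : ℝ, 0 < ρ ∧ ∀ ε' ∈ M, ∃ σ : ℝ, 0 < σ ∧ ∀ ε'' ∈ M, ∃ δ₀ : ℝ, 0 < δ₀ ∧ ∀ δ ∈ Ioo 0 δ₀, ∀ ε ∈ M,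
      m.pathNorm (g ε) (gdot ε) ≤ N → m.datumDist g gdot ε ε' ≤ ENNReal.ofReal ρ →
      m.datumDist g gdot ε ε'' ≤ ENNReal.ofReal σ → ∀ a ∈ Ioo (0 : ℝ) (1 / 2),
      |m.maxExcess δ (g ε) (gdot ε) (Γ₀ ε a) (u δ ε a)| ≤ θ := by
  have hfin := Data.isFiniteMeasure_μΩ hm.geometry
  obtain ⟨K, hK⟩ := exists_uniform_bound hm.geometry hm.exponents N
  obtain ⟨κ, hκ⟩ := exists_excess_bound hm K
  have hκ0 : (0 : ℝ) ≤ κ := κ.2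
  refine ⟨θ / (2 * (κ + 1)), by positivity, fun ε' hε' => ?_⟩
  have hreg' := h.isRegularPath hm hε'
  obtain ⟨b, hb, hb1, hb2, -⟩ := hreg'.bound
  set β := (∫⁻ τ, b τ ∂timeMeasure m.T).toNNReal with hβ
  have hβc : ∫⁻ τ, b τ ∂timeMeasure m.T = β := (ENNReal.coe_toNNReal hb).symm
  set η : ℝ≥0 := (θ / 2).toNNReal / (3 * (β + 1)) with hη
  have hθ2 : 0 < (θ / 2).toNNReal := by simpa using hθ
  have hη0 : η ≠ 0 := (by positivity : 0 < η).ne'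
  obtain ⟨σ, hσ, hex⟩ := hκ η hη0
  refine ⟨σ / 2, by positivity, fun ε'' hε'' => ?_⟩
  have hreg'' := h.isRegularPath hm hε''
  obtain ⟨d, hd, hdi⟩ := exists_pos_setLIntegral_lt_of_measure_lt hreg''.integrable
    (ε := ENNReal.ofReal (σ / 2)) (by simpa using hσ)
  obtain ⟨r, hr0, hrd⟩ := ENNReal.lt_iff_exists_nnreal_btwn.1 hd
  have hr0' : (0 : ℝ) < r := by exact_mod_cast hr0
  refine ⟨min σ r, lt_min hσ hr0', fun δ hδ ε hε hN h1 h2 a ha => ?_⟩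
  have hreg := h.isRegularPath hm hε
  refine hex c₁ c₂ ε a δ (R ε) (g ε) (gdot ε) (g ε') (gdot ε') (Γ₀ ε a) (u δ ε a) b hδ.1
    (hδ.2.le.trans (min_le_left _ _)) ha.1 (h.mesh ε hε).regular (h.datum ε hε).affine hreg
    (h.crack ε hε a ha) (h.evolution δ hδ.1 ε hε a ha) (hK _ _ hreg hN) ?_ hreg' hb hb1 hb2 θ hθ.le ?_
  · intro t ht t' ht' htt' hd'
    have hsub : Ioc t t' ⊆ Icc 0 m.T := fun s hs => ⟨ht.1.trans hs.1.le, hs.2.trans ht'.2⟩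
    have hν : volume.restrict (Ioc t t') ≤ timeMeasure m.T := Measure.restrict_mono hsub le_rfl
    have hz := isMeasurablePath_zero (m := m)
    have h3 := lintegral_sobolevNorm_sub_le hm.exponents hν hreg.meas_dot hreg.meas_grad_dot
      hreg''.meas_dot hreg''.meas_grad_dot hz.meas_dot hz.meas_grad_dot
    simp only [Pi.zero_apply, sub_zero] at h3
    refine h3.trans ?_
    rw [show σ = σ / 2 + σ / 2 by ring, ENNReal.ofReal_add (by positivity) (by positivity)]
    refine add_le_add ((lintegral_mono' hν le_rfl).trans (le_add_self.trans h2)) ?_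
    have hrr : (timeMeasure m.T).restrict (Ioc t t') = volume.restrict (Ioc t t') := by
      rw [Measure.restrict_restrict measurableSet_Ioc, inter_eq_self_of_subset_left hsub]
    have h4 := hdi (Ioc t t') (by
      refine lt_of_le_of_lt (Measure.restrict_le_self _) (lt_of_le_of_lt ?_ hrd)
      rw [Real.volume_Ioc, ENNReal.ofReal_le_coe]
      exact hd'.trans (hδ.2.le.trans (min_le_right _ _)))
    rw [hrr] at h4
    exact h4.le
  · rw [hβc]
    refine (add_le_add (mul_le_mul_right (le_add_self.trans h1) _) le_rfl).trans ?_
    rw [show θ = θ / 2 + θ / 2 by ring, ENNReal.ofReal_add (by positivity) (by positivity)]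
    refine add_le_add ?_ ?_
    · rw [← ENNReal.ofReal_coe_nnreal, ← ENNReal.ofReal_mul hκ0]
      refine ENNReal.ofReal_le_ofReal ?_
      rw [show θ / 2 + θ / 2 = θ by ring, ← mul_div_assoc, div_le_div_iff₀ (by positivity) (by positivity)]
      nlinarith
    · rw [show ENNReal.ofReal (θ / 2) = ((θ / 2).toNNReal : ℝ≥0∞) from rfl]
      norm_cast
      rw [hη, show 3 * ((θ / 2).toNNReal / (3 * (β + 1))) * β = (θ / 2).toNNReal * (β / (β + 1)) by
        field_simp]
      exact mul_le_of_le_one_right' (div_le_one_of_le₀ (le_self_add) (by positivity))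

theorem exists_pos_le_of_finite {ι : Type*} {J : Set ι} (hJ : J.Finite) {f : ι → ℝ}
    (hf : ∀ x ∈ J, 0 < f x) : ∃ s : ℝ, 0 < s ∧ ∀ x ∈ J, s ≤ f x := by
  have h : ∀ᶠ s in 𝓝[>] (0 : ℝ), ∀ x ∈ J, s ≤ f x := by
    rw [eventually_all_finite hJ]
    intro x hx
    filter_upwards [Ioo_mem_nhdsGT (hf x hx)] with s hs using hs.2.le
  obtain ⟨s, hs, hs0⟩ := (h.and self_mem_nhdsWithin).exists
  exact ⟨s, hs0, hs⟩

theorem Data.IsFamily.maxExcess_le_of_totallyBounded (hm : m.Admissible) [IsFiniteMeasure m.μS]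
    (h : m.IsFamily c₁ c₂ M R g gdot Γ₀ u) {E : Set ℝ} (hE : E ⊆ M)
    (hnet : ∀ η : ℝ≥0∞, 0 < η → ∃ J ⊆ E, J.Finite ∧ ∀ ε ∈ E, ∃ ε' ∈ J, m.datumDist g gdot ε ε' ≤ η)
    {θ : ℝ} (hθ : 0 < θ) : ∃ δ₀ > 0, ∀ δ ∈ Ioo 0 δ₀, ∀ ε ∈ E, ∀ a ∈ Ioo (0 : ℝ) (1 / 2),
      |m.maxExcess δ (g ε) (gdot ε) (Γ₀ ε a) (u δ ε a)| ≤ θ := by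
  have hfin := Data.isFiniteMeasure_μΩ hm.geometry
  have hreg := fun ε (hε : ε ∈ E) => h.isRegularPath hm (hE hε)
  obtain ⟨J, hJE, hJ, hJn⟩ := hnet 1 one_pos
  set N : ℝ≥0 := 1 + ∑ ε ∈ hJ.toFinset, (m.pathNorm (g ε) (gdot ε)).toNNReal with hN
  have hNb : ∀ ε ∈ E, m.pathNorm (g ε) (gdot ε) ≤ N := by
    intro ε hε
    obtain ⟨ε', hε', hd⟩ := hJn ε hε
    have h1 := (hreg ε hε).isMeasurablePath.pathDist_triangle hm.exponents
      (hreg ε' (hJE hε')).isMeasurablePath isMeasurablePath_zero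
    refine h1.trans ?_
    rw [hN]
    push_cast
    refine add_le_add hd ?_
    have h2 := Finset.single_le_sum (f := fun ε => (m.pathNorm (g ε) (gdot ε)).toNNReal)
      (fun _ _ => zero_le) (hJ.mem_toFinset.2 hε')
    have h3 : m.pathNorm (g ε') (gdot ε') = ((m.pathNorm (g ε') (gdot ε')).toNNReal : ℝ≥0∞) :=
      (ENNReal.coe_toNNReal ((hreg ε' (hJE hε')).pathNorm_ne_top hm.geometry hm.exponents)).symm
    exact h3.le.trans (by exact_mod_cast h2)
  obtain ⟨ρ, hρ, hex⟩ := h.exists_maxExcess_le hm N hθ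
  obtain ⟨J', hJE', hJ', hJn'⟩ := hnet (ENNReal.ofReal ρ) (by simpa using hρ)
  choose! σ hσ hex' using hex
  obtain ⟨s, hs, hsσ⟩ := exists_pos_le_of_finite hJ' fun x hx => hσ x (hE (hJE' hx))
  obtain ⟨J'', hJE'', hJ'', hJn''⟩ := hnet (ENNReal.ofReal s) (by simpa using hs)
  choose! d hd hex'' using hex'
  obtain ⟨d₀, hd₀, hdd⟩ := exists_pos_le_of_finite (hJ'.prod hJ'') (f := fun x => d x.1 x.2)
    fun x hx => hd x.1 (hE (hJE' hx.1)) x.2 (hE (hJE'' hx.2))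
  refine ⟨d₀, hd₀, fun δ hδ ε hε a ha => ?_⟩
  obtain ⟨ε', hε', h1⟩ := hJn' ε hε
  obtain ⟨ε'', hε'', h2⟩ := hJn'' ε hε
  exact hex'' ε' (hE (hJE' hε')) ε'' (hE (hJE'' hε'')) δ ⟨hδ.1, hδ.2.trans_le (hdd (ε', ε'') ⟨hε', hε''⟩)⟩
    ε (hE hε) (hNb ε hε) h1 (h2.trans (ENNReal.ofReal_le_ofReal (hsσ ε' hε'))) a ha

theorem Data.IsFamily.maxExcess_le_of_tendsto (hm : m.Admissible) [IsFiniteMeasure m.μS]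
    (h : m.IsFamily c₁ c₂ M R g gdot Γ₀ u) {k kdot : ℝ → Plane → Plane} {D Ddot : ℝ → Plane → Mat}
    (hk : m.IsSobolevPath k kdot D Ddot)
    (hlim : Tendsto (fun ε => m.pathDist (g ε) (gdot ε) (pathGrad (g ε)) (pathGrad (gdot ε))
      k kdot D Ddot) (𝓝[M] 0) (𝓝 0)) {θ : ℝ} (hθ : 0 < θ) :
    ∃ δ₀ > 0, ∃ ε₀ > 0, ∀ δ ∈ Ioo 0 δ₀, ∀ ε ∈ M, ε < ε₀ → ∀ a ∈ Ioo (0 : ℝ) (1 / 2),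
      |m.maxExcess δ (g ε) (gdot ε) (Γ₀ ε a) (u δ ε a)| ≤ θ := by
  have hfin := Data.isFiniteMeasure_μΩ hm.geometry
  by_cases hM : ∃ ε₀ : ℝ, 0 < ε₀ ∧ ∀ ε ∈ M, ε₀ ≤ ε
  · obtain ⟨ε₀, hε₀, hM⟩ := hM
    exact ⟨1, one_pos, ε₀, hε₀, fun δ _ ε hε hlt => absurd hlt (hM ε hε).not_gt⟩
  push Not at hM
  have hclose : ∀ ρ : ℝ≥0∞, 0 < ρ → ∃ ε₀ : ℝ, 0 < ε₀ ∧ ∀ ε ∈ M, ε < ε₀ →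
      m.pathDist (g ε) (gdot ε) (pathGrad (g ε)) (pathGrad (gdot ε)) k kdot D Ddot ≤ ρ := by
    intro ρ hρ
    obtain ⟨ε₀, hε₀, hb⟩ := Metric.mem_nhdsWithin_iff.1 (hlim.eventually_le_const hρ)
    refine ⟨ε₀, hε₀, fun ε hε hlt => hb ⟨?_, hε⟩⟩
    have h0 : 0 < ε := h.sizes hε
    rw [Metric.mem_ball, Real.dist_eq, sub_zero, abs_of_pos h0]
    exact hlt
  have hcauchy : ∀ ρ : ℝ≥0∞, 0 < ρ → ∃ ε₀ : ℝ, 0 < ε₀ ∧ ∀ ε ∈ M, ∀ ε' ∈ M, ε < ε₀ → ε' < ε₀ →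
      m.datumDist g gdot ε ε' ≤ ρ := by
    intro ρ hρ
    obtain ⟨ε₀, hε₀, hb⟩ := hclose (ρ / 2) (ENNReal.half_pos hρ.ne')
    refine ⟨ε₀, hε₀, fun ε hε ε' hε' hlt hlt' => ?_⟩
    have h1 := (h.isRegularPath hm hε).isMeasurablePath.pathDist_triangle hm.exponents
      hk.isMeasurablePath (h.isRegularPath hm hε').isMeasurablePath
    rw [Data.pathDist_comm (g := k)] at h1
    refine h1.trans ((add_le_add (hb ε hε hlt) (hb ε' hε' hlt')).trans (ENNReal.add_halves ρ).le)
  obtain ⟨ε₁, hε₁, hb₁⟩ := hcauchy 1 one_pos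
  obtain ⟨εs, hεs, hεs1⟩ := hM ε₁ hε₁
  have hsN := (h.isRegularPath hm hεs).pathNorm_ne_top hm.geometry hm.exponents
  set N : ℝ≥0 := 1 + (m.pathNorm (g εs) (gdot εs)).toNNReal with hN
  have hNb : ∀ ε ∈ M, ε < ε₁ → m.pathNorm (g ε) (gdot ε) ≤ N := by
    intro ε hε hlt
    have h1 := (h.isRegularPath hm hε).isMeasurablePath.pathDist_triangle hm.exponents
      (h.isRegularPath hm hεs).isMeasurablePath isMeasurablePath_zero
    refine h1.trans ?_
    rw [hN]
    push_cast
    rw [ENNReal.coe_toNNReal hsN]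
    exact add_le_add (hb₁ ε hε εs hεs hlt hεs1) le_rfl
  obtain ⟨ρ, hρ, hex⟩ := h.exists_maxExcess_le hm N hθ
  obtain ⟨ε₂, hε₂, hb₂⟩ := hcauchy (ENNReal.ofReal ρ) (by simpa using hρ)
  obtain ⟨ε', hε', hlt'⟩ := hM ε₂ hε₂
  obtain ⟨σ, hσ, hex'⟩ := hex ε' hε'
  obtain ⟨ε₃, hε₃, hb₃⟩ := hcauchy (ENNReal.ofReal σ) (by simpa using hσ)
  obtain ⟨ε'', hε'', hlt''⟩ := hM ε₃ hε₃
  obtain ⟨δ₀, hδ₀, hex''⟩ := hex' ε'' hε''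
  refine ⟨δ₀, hδ₀, min ε₁ (min ε₂ ε₃), lt_min hε₁ (lt_min hε₂ hε₃), fun δ hδ ε hε hlt => ?_⟩
  obtain ⟨l1, l2⟩ := lt_min_iff.1 hlt
  obtain ⟨l2, l3⟩ := lt_min_iff.1 l2
  exact hex'' δ hδ ε hε (hNb ε hε l1) (hb₂ ε hε ε' hε' l2 hlt') (hb₃ ε hε ε'' hε'' l3 hlt'')

end Family

end CrackGrowth

theorem proposition5p3 (m : CrackGrowth.Data) (hm : m.Admissible)
    (c₁ c₂ : ℝ) (hc₁ : 0 < c₁) (hc₂ : c₁ < c₂)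
    (M : Set ℝ) (hM : M ⊆ Ioi 0)
    (R : ℝ → Set (Set CrackGrowth.Plane)) (hR : ∀ ε ∈ M, m.IsMesh c₁ c₂ ε (R ε))
    (g gdot : ℝ → ℝ → CrackGrowth.Plane → CrackGrowth.Plane)
    (hg : ∀ ε ∈ M, m.IsBoundaryDatum (R ε) (g ε) (gdot ε))
    (Γ₀ : ℝ → ℝ → Set CrackGrowth.Plane)
    (hΓ₀ : ∀ ε ∈ M, ∀ a ∈ Ioo (0 : ℝ) (1 / 2), m.IsInitialCrack (R ε) a (Γ₀ ε a))
    (u : ℝ → ℝ → ℝ → ℕ → CrackGrowth.Plane → CrackGrowth.Plane)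
    (hu : ∀ δ > 0, ∀ ε ∈ M, ∀ a ∈ Ioo (0 : ℝ) (1 / 2),
      m.IsDiscreteEvolution (R ε) a δ (g ε) (Γ₀ ε a) (u δ ε a)) :
    (∀ δ > 0, ∀ ε ∈ M, ∀ a ∈ Ioo (0 : ℝ) (1 / 2), ∀ i ≤ m.numSteps δ,
      m.surfaceEnergy (m.crack δ (g ε) (Γ₀ ε a) (u δ ε a) i) ≠ ⊤) ∧
    ∃ e : ℝ → ℝ → ℝ → ℝ,
      (∀ δ > 0, ∀ ε ∈ M, ∀ a ∈ Ioo (0 : ℝ) (1 / 2), ∀ i j : ℕ, j ≤ i → i ≤ m.numSteps δ →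
        m.totalEnergy (m.time δ i) (u δ ε a i) (m.crack δ (g ε) (Γ₀ ε a) (u δ ε a) i) ≤
          m.totalEnergy (m.time δ j) (u δ ε a j) (m.crack δ (g ε) (Γ₀ ε a) (u δ ε a) j)
          + (∫ τ in m.time δ j..m.time δ i,
              m.bulkPairing (m.interpolation δ (u δ ε a) τ) (gdot ε τ))
          - (∫ τ in m.time δ j..m.time δ i,
              m.bodyWorkDot τ (m.interpolation δ (u δ ε a) τ))
          - (∫ τ in m.time δ j..m.time δ i,
              m.bodyPairing τ (m.interpolation δ (u δ ε a) τ) (gdot ε τ))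
          - (∫ τ in m.time δ j..m.time δ i,
              m.surfaceWorkDot τ (m.interpolation δ (u δ ε a) τ))
          - (∫ τ in m.time δ j..m.time δ i,
              m.surfacePairing τ (m.interpolation δ (u δ ε a) τ) (gdot ε τ))
          + e δ ε a) ∧
      -- uniformity over each set of mesh sizes for which the boundary data are relatively compact
      (∀ E ⊆ M,
        (∀ η : ENNReal, 0 < η → ∃ J ⊆ E, J.Finite ∧ ∀ ε ∈ E, ∃ ε' ∈ J,
          m.pathDist (g ε) (gdot ε) (CrackGrowth.pathGrad (g ε)) (CrackGrowth.pathGrad (gdot ε))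
            (g ε') (gdot ε') (CrackGrowth.pathGrad (g ε')) (CrackGrowth.pathGrad (gdot ε')) ≤ η) →
        ∀ η > 0, ∃ δ₀ > 0, ∀ δ ∈ Ioo 0 δ₀, ∀ ε ∈ E, ∀ a ∈ Ioo (0 : ℝ) (1 / 2),
          |e δ ε a| ≤ η) ∧
      -- uniformity for small mesh sizes if the boundary data converge
      (∀ (h hdot : ℝ → CrackGrowth.Plane → CrackGrowth.Plane)
          (D Ddot : ℝ → CrackGrowth.Plane → CrackGrowth.Mat),
        m.IsSobolevPath h hdot D Ddot →
        Tendsto (fun ε => m.pathDist (g ε) (gdot ε)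
            (CrackGrowth.pathGrad (g ε)) (CrackGrowth.pathGrad (gdot ε)) h hdot D Ddot)
          (𝓝[M] 0) (𝓝 0) →
        ∀ η > 0, ∃ δ₀ > 0, ∃ ε₀ > 0, ∀ δ ∈ Ioo 0 δ₀, ∀ ε ∈ M, ε < ε₀ →
          ∀ a ∈ Ioo (0 : ℝ) (1 / 2), |e δ ε a| ≤ η) := by
  have hF : m.IsFamily c₁ c₂ M R g gdot Γ₀ u := ⟨hc₁, hM, hR, hg, hΓ₀, hu⟩
  refine ⟨fun δ hδ ε hε a ha i hi => CrackGrowth.Data.surfaceEnergy_crack_ne_top hm.geometry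
      hm.surfaceDensity hm.exponents.T_pos (hR ε hε).regular ha.1 hδ (hg ε hε).affine (hΓ₀ ε hε a ha)
      (hu δ hδ ε hε a ha) hi,
    fun δ ε a => m.maxExcess δ (g ε) (gdot ε) (Γ₀ ε a) (u δ ε a), fun δ _ ε _ a _ i j hji hi => ?_,
    fun E hE hnet θ hθ => ?_, fun h hdot D Ddot hh hlim θ hθ => ?_⟩
  · have h1 := CrackGrowth.Data.excess_le_maxExcess (m := m) (δ := δ) (g := g ε) (gdot := gdot ε)
      (Γ₀ := Γ₀ ε a) (w := u δ ε a) hji hi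
    simp only [CrackGrowth.Data.excess, CrackGrowth.Data.work] at h1
    linarith
  · rcases E.eq_empty_or_nonempty with rfl | ⟨ε, hε⟩
    · exact ⟨1, one_pos, by simp⟩
    · have := (hR ε (hE hε)).isFiniteMeasure_μS
      exact hF.maxExcess_le_of_totallyBounded hm hE hnet hθ
  · rcases M.eq_empty_or_nonempty with rfl | ⟨ε, hε⟩
    · exact ⟨1, one_pos, 1, one_pos, by simp⟩
    · have := (hR ε hε).isFiniteMeasure_μS
      exact hF.maxExcess_le_of_tendsto hm hh hlim hθ
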